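/- **Setting.** Let $\mathcal T$ be one of the set theories $\mathbf{CZF}$, $\mathbf{IZF}$, $\mathbf{ZF}$, formulated in a language with terms $x$, $\emptyset$, $\omega$, $\{a,b\}$, $\bigcup a$, $\mathcal P(a)$, $\{x\in a\mid\varphi\}$ ($x$ not free in $a$) and formulas built from $\bot$, $a=b$, $a\in b$ by $\wedge,\vee,\to,\forall,\exists$ (for $\mathbf{CZF}$: no $\mathcal P(a)$, and $\{x\in a\mid\varphi\}$ only for $\Delta_0$-formulas $\varphi$). Write $0=\emptyset$, $\{a\}=\{a,a\}$, $1=\{\emptyset\}$, $(a,b)=\{\{a\},\{a,b\}\}$, $a\cup b=\bigcup\{a,b\}$, $p_1(a)=\bigcup\{x\in\bigcup a\mid\forall y(y\in a\to x\in y)\}$, $p_2(a)=\bigcup\{x\in\bigcup a\mid x=p_1(a)\to a=\{\{p_1(a)\}\}\}$, $\ell(a)=\{x\in\omega\mid\exists y(y\in\bigcup\bigcup a\wedge(x,y)\in a)\}$. **The type theory $\mathbf{emTT}_{\mathcal T}$.** Let $\mathbf{emTT}$ be the extensional level of the Minimalist Foundation (Maietti, 2009), with judgements $A\,type\,[\Gamma]$,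 $A=B\,type\,[\Gamma]$ ($type$ being $col$, $set$, $prop$ or $prop_s$: collections, sets, propositions, small propositions), $a\in A\,[\Gamma]$, $a=b\in A\,[\Gamma]$. Its pre-syntax, extended for $\mathbf{emTT}_{\mathcal T}$, is: * pre-collections $\mathsf N_0$, $\mathsf N_1$, $\mathsf{List}(A)$, $A+B$, $(\Sigma x\in A)B$, $(\Pi x\in A)B$, $A/(x,y)\varphi$, $\mathcal P(1)$, $A\to\mathcal P(1)$, $\{x\mid\varphi\}$, $\varphi$, $\mathbf V$; * pre-terms $x$, $\mathsf{emp}_0(a)$, $\star$, $\mathsf{El}_{\mathsf N_1}(a,b)$, $\epsilon$, $\mathsf{cons}(a,b)$, $\mathsf{El}^A_{\mathsf{List}}(a,b,(x,y,z)c)$, $\mathsf{inl}(a)$, $\mathsf{inr}(a)$, $\mathsf{El}_+(a,(x)b,(y)c)$, $\langle a,b\rangle$, $\mathsf{El}_\Sigma(a,(x,y)b)$, $\lambda x^A.b$, $\mathsf{Ap}(a,b)$, $[a]_{A,(x,y)\varphi}$, $\mathsf{El}_{A/(x,y)\varphi}(a,(x)b)$, $\mathsf{true}$, $[\varphi]$,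 $\lceil A\rceil$, $\emptyset$, $\{a,b\}$, $\bigcup a$, $\mathcal P(a)$, $\{x\,\varepsilon\,a\mid\varphi\}$, $\omega$; * pre-propositions $\bot$, $a\,\varepsilon\,b$, $a\,\varepsilon\,A$, $a=_Ab$, $\varphi\to\psi$, $\varphi\wedge\psi$, $\varphi\vee\psi$, $(\exists x\in A)\varphi$, $(\forall x\in A)\varphi$. $\mathbf{emTT}_{\mathcal T}$ consists of the rules of $\mathbf{emTT}$ together with the following ones. 1. *Collections as definable classes.* $\mathbf V\,col$; if $a\in A$ then $a\in\mathbf V$; if $a=b\in A$ then $a=b\in\mathbf V$; if $a,b\in A$ and $a=b\in\mathbf V$ then $a=b\in A$; if $a\in A$, $b\in\mathbf V$ and $a=b\in\mathbf V$ then $b\in A$. For $a,b\in\mathbf V$: $a=_{\mathbf V}b\ prop_s$ and $a\,\varepsilon\,b\ prop_s$; for $a\in\mathbf V$ and $A\,col$: $a\,\varepsilon\,A\ prop$; both $\varepsilon$'s respect definitional equality; $\mathsf{true}\in a\,\varepsilon\,A$ if and only if $a\in A$. If $\varphi\,prop\,[x\in\mathbf V]$, then $\{x\mid\varphi\}\,col$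 and $\mathsf{true}\in\varphi[a/x]\leftrightarrow a\,\varepsilon\,\{x\mid\varphi\}$ for $a\in\mathbf V$. If $\mathsf{true}\in(\forall x\in\mathbf V)(x\,\varepsilon\,A\leftrightarrow x\,\varepsilon\,B)$, then $A=B\,col$. If $\varphi\,prop\,[x\in A]$, then $x\,\varepsilon\,A\wedge\varphi\ prop\,[x\in\mathbf V]$ and $x\,\varepsilon\,A\to\varphi\ prop\,[x\in\mathbf V]$, and $\mathsf{true}\in(\exists x\in A)\varphi\leftrightarrow(\exists x\in\mathbf V)(x\,\varepsilon\,A\wedge\varphi)$, $\mathsf{true}\in(\forall x\in A)\varphi\leftrightarrow(\forall x\in\mathbf V)(x\,\varepsilon\,A\to\varphi)$. 2. *Sets as definable sets.* If $A\,col$ and $\mathsf{true}\in(\exists y\in\mathbf V)(\forall x\in\mathbf V)(x\,\varepsilon\,A\leftrightarrow x\,\varepsilon\,y)$, then $A\,set$. If $A\,set$, then $\lceil A\rceil\in\mathbf V$ and $\mathsf{true}\in(\forall x\in\mathbf V)(x\,\varepsilon\,A\leftrightarrow x\,\varepsilon\,\lceil A\rceil)$. If $A=B\,col$, $A\,type$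 and $B\,type$, then $A=B\,type$. 3. *Axioms of set theory*, read in $\mathbf V$ with quantifiers $(\forall x\in\mathbf V)$, $(\exists x\in\mathbf V)$ and with membership $\varepsilon$: extensionality, and the formation in $\mathbf V$ and characterisation of the elements of $\emptyset$, $\{a,b\}$, $\bigcup a$; $\omega$ is the least set containing $\emptyset$ and closed under $z\mapsto\bigcup\{z,\{z\}\}$; $\varepsilon$-induction for all $\varphi\,prop\,[x\in\mathbf V]$. For $\mathbf{IZF}$ and $\mathbf{ZF}$: $\mathcal P(a)$; $\{x\,\varepsilon\,a\mid\varphi\}$ for $\varphi\,prop\,[x\in\mathbf V]$; collection for propositions. For $\mathbf{ZF}$: $\varphi\vee\neg\varphi$ for every proposition. For $\mathbf{CZF}$: $\{x\,\varepsilon\,a\mid\varphi\}$ for $\varphi\,prop_s\,[x\in\mathbf V]$; strong collection and subset collection for propositions; and quantification bounded by an element of $\mathbf V$ is small: if $a\in\mathbf V$ and $\varphi\,prop_s\,[x\in\mathbf V]$, then $(\forall x\in\mathbf V)(x\,\varepsilon\,a\to\varphi)\ prop_s$ and $(\exists x\in\mathbf V)(x\,\varepsilon\,a\wedge\varphi)\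 prop_s$. 4. *Interpretation of canonical elements*, for well-formed data: $\star=\emptyset\in\mathsf N_1$; $\langle a,b\rangle=(a,b)\in(\Sigma x\in A)B$; $\lambda x^A.b=\{z\,\varepsilon\,\lceil(\Sigma x\in A)B\rceil\mid(\exists x\in A)(z=_{\mathbf V}(x,b))\}\in(\Pi x\in A)B$; $\mathsf{inl}(a)=(\emptyset,a)$ and $\mathsf{inr}(b)=(\{\emptyset\},b)$ in $A+B$; $\epsilon=\emptyset$ and $\mathsf{cons}(a,b)=\bigcup\{a,\{(\ell(a),b)\}\}$ in $\mathsf{List}(A)$, where here $\ell(a)$ is $\mathsf{El}^A_{\mathsf{List}}(a,\emptyset,(x,y,z)\bigcup\{z,\{z\}\})$; $[a]_{A,(x,y)R}=\{x\,\varepsilon\,\lceil A\rceil\mid(\exists y\in A)(y=_{\mathbf V}x\wedge R(y,a))\}\in A/(x,y)R$; $[\varphi]=\{x\,\varepsilon\,\{\emptyset\}\mid x=_{\mathbf V}\emptyset\wedge\varphi\}\in\mathcal P(1)$; $\lambda x^A.b=\lceil\{z\mid(\exists x\in A)(z=_{\mathbf V}(x,b))\}\rceil\in A\to\mathcal P(1)$;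 $\mathsf{true}=\emptyset\in\varphi$ whenever $\mathsf{true}\in\varphi$. **The translation $\mathcal T\to\mathbf{emTT}_{\mathcal T}$.** Terms $a$ and formulas $\varphi$ of $\mathcal T$ are sent to pre-terms $\widetilde a$ and pre-propositions $\widetilde\varphi$: all term constructors, $\bot$ and the connectives are preserved, $\widetilde{\{x\in a\mid\varphi\}}=\{x\,\varepsilon\,\widetilde a\mid\widetilde\varphi\}$, $\widetilde{a=b}$ is $\widetilde a=_{\mathbf V}\widetilde b$, $\widetilde{a\in b}$ is $\widetilde a\,\varepsilon\,\widetilde b$, and quantifiers become quantifiers over $\mathbf V$. **The translation $\mathbf{emTT}_{\mathcal T}\to\mathcal T$.** With a special variable $u$ and all other auxiliary variables fresh, pre-propositions $\varphi$, pre-collections $A$ and pre-terms $a$ are sent to formulas $\widehat\varphi$, $\eta_A$, $\delta_a$ of $\mathcal T$: * $\widehat\bot$ is $\bot$; $\widehat{a\,\varepsilon\,b}$ is $\exists u\exists v(\delta_a\wedge\delta_b[v/u]\wedge u\in v)$; $\widehat{a\,\varepsilon\,A}$ is $\exists u(\delta_a\wedge\eta_A)$; $\widehat{a=_Ab}$ is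 $\exists u(\delta_a\wedge\delta_b\wedge\eta_A)$; connectives are preserved; $\widehat{(\forall x\in A)\varphi}$ is $\forall x(\eta_A[x/u]\to\widehat\varphi)$; $\widehat{(\exists x\in A)\varphi}$ is $\exists x(\eta_A[x/u]\wedge\widehat\varphi)$. * $\eta_\varphi$ is $u=0\wedge\widehat\varphi$; $\eta_{\mathsf N_0}$ is $\bot$; $\eta_{\mathsf N_1}$ is $u=0$; $\eta_{\mathbf V}$ is $u=u$; $\eta_{\{x\mid\varphi\}}$ is $\widehat\varphi[u/x]$; $\eta_{\mathcal P(1)}$ is $u\subseteq\{0\}$; $\eta_{(\Sigma x\in A)B}$ is $\exists v\exists w(\eta_A[v/u]\wedge\eta_B[v/x,w/u]\wedge u=(v,w))$; $\eta_{(\Pi x\in A)B}$ is $\forall v(v\in u\to\exists w\exists w'(v=(w,w')\wedge\eta_A[w/u]\wedge\eta_B[w/x,w'/u]))\wedge\mathrm{Svl}(u)\wedge\forall w(\eta_A[w/u]\to\exists w'((w,w')\in u))$, where $\mathrm{Svl}(t)$ is $\forall w\forall w'\forall w''((w,w')\in t\wedge(w,w'')\in t\to w'=w'')$; $\eta_{A\to\mathcal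 P(1)}$ is $\eta_{(\Pi x\in A)\mathcal P(1)}$; $\eta_{A+B}$ is $\exists v(\eta_A[v/u]\wedge u=(0,v))\vee\exists w(\eta_B[w/u]\wedge u=(1,w))$; $\eta_{\mathsf{List}(A)}$ is $\exists n(n\in\omega\wedge\forall v(v\in u\to\exists w\exists w'(w\in n\wedge\eta_A[w'/u]\wedge v=(w,w')))\wedge\mathrm{Svl}(u)\wedge\forall w(w\in n\to\exists w'((w,w')\in u)))$; $\eta_{A/(x,y)\varphi}$ is $\exists w(\eta_A[w/u]\wedge\forall v(v\in u\leftrightarrow\eta_A[v/u]\wedge\widehat\varphi[w/x,v/y]))$. * $\delta_x$ is $u=x$; $\delta_{\mathsf{true}}$, $\delta_{\mathsf{emp}_0(a)}$, $\delta_\star$, $\delta_\epsilon$, $\delta_\emptyset$ are $u=0$; $\delta_\omega$ is $u=\omega$; $\delta_{\mathsf{El}_{\mathsf N_1}(a,b)}$ is $\delta_b$; $\delta_{\langle a,b\rangle}$ is $\exists v\exists w(\delta_a[v/u]\wedge\delta_b[w/u]\wedge u=(v,w))$; $\delta_{\mathsf{El}_\Sigma(a,(x,y)b)}$ is $\exists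 v(\delta_a[v/u]\wedge\delta_b[p_1(v)/x,p_2(v)/y])$; $\delta_{\lambda x^A.b}$ is $\forall v(v\in u\leftrightarrow\exists w\exists w'(\eta_A[w/u]\wedge\delta_b[w/x,w'/u]\wedge v=(w,w')))$; $\delta_{\mathsf{Ap}(a,b)}$ is $\exists v\exists w(\delta_a[v/u]\wedge\delta_b[w/u]\wedge u=p_2(\bigcup\{z\in v\mid p_1(z)=w\}))$; $\delta_{\mathsf{inl}(a)}$ is $\exists v(\delta_a[v/u]\wedge u=(0,v))$; $\delta_{\mathsf{inr}(a)}$ is $\exists v(\delta_a[v/u]\wedge u=(1,v))$; $\delta_{\mathsf{El}_+(a,(x)b,(y)c)}$ is $\exists v(\delta_a[v/u]\wedge((p_1(v)=0\wedge\delta_b[p_2(v)/x])\vee(p_1(v)=1\wedge\delta_c[p_2(v)/y])))$; $\delta_{\mathsf{cons}(a,b)}$ is $\exists v\exists w(\delta_a[v/u]\wedge\delta_b[w/u]\wedge u=v\cup\{(\ell(v),w)\})$; $\delta_{\mathsf{El}^A_{\mathsf{List}}(a,b,(x,y,z)c)}$ is $$\begin{aligned}\exists f\big(&\forall w(w\in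 f\to\exists w_1\exists w_2(\eta_{\mathsf{List}(A)}[w_1/u]\wedge w=(w_1,w_2)))\wedge\mathrm{Svl}(f)\wedge\forall w_1(\eta_{\mathsf{List}(A)}[w_1/u]\to\exists w_2((w_1,w_2)\in f))\\&\wedge\exists v(\delta_b[v/u]\wedge(0,v)\in f)\\&\wedge\forall w_1\forall w_2\forall w_3\forall v((w_1,w_3)\in f\wedge\eta_A[w_2/u]\wedge\delta_c[w_1/x,w_2/y,w_3/z,v/u]\to(w_1\cup\{(\ell(w_1),w_2)\},v)\in f)\\&\wedge\exists w'(\delta_a[w'/u]\wedge(w',u)\in f)\big);\end{aligned}$$ $\delta_{[a]_{A,(x,y)\varphi}}$ is $\exists w(\delta_a[w/u]\wedge\forall v(v\in u\leftrightarrow\eta_A[v/u]\wedge\widehat\varphi[w/x,v/y]))$; $\delta_{\mathsf{El}_{A/(x,y)\varphi}(a,(x)b)}$ is $\exists v(\delta_a[v/u]\wedge\exists w(w\in v)\wedge\forall w(w\in v\to\delta_b[w/x]))$; $\delta_{[\varphi]}$ is $\forall v(v\in u\leftrightarrow v=0\wedge\widehat\varphi)$; $\delta_{\lceil A\rceil}$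 is $\forall v(v\in u\leftrightarrow\eta_A[v/u])$; $\delta_{\{a,b\}}$ is $\exists v\exists w(\delta_a[v/u]\wedge\delta_b[w/u]\wedge u=\{v,w\})$; $\delta_{\bigcup a}$ is $\exists v(\delta_a[v/u]\wedge u=\bigcup v)$; $\delta_{\mathcal P(a)}$ is $\exists v(\delta_a[v/u]\wedge\forall w(w\in u\leftrightarrow w\subseteq v))$; $\delta_{\{x\,\varepsilon\,a\mid\varphi\}}$ is $\exists v(\delta_a[v/u]\wedge\forall x(x\in u\leftrightarrow x\in v\wedge\widehat\varphi))$. **Proposition.** Let $\mathcal T$ be $\mathbf{CZF}$, $\mathbf{IZF}$ or $\mathbf{ZF}$, let $\Gamma$ be a pre-context, and let $A$ be a pre-collection, $a$ a pre-term and $\varphi$ a pre-proposition of $\mathbf{emTT}_{\mathcal T}$. With $z$ a fresh variable: 1. if $\mathbf{emTT}_{\mathcal T}\vdash A\,col\,[\Gamma]$, then $\mathbf{emTT}_{\mathcal T}\vdash A=\{z\mid\widetilde{\eta_A[z/u]}\}\,col\,[\Gamma]$; 2. if $\mathbf{emTT}_{\mathcal T}\vdash a\in A\,[\Gamma]$,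 then $\mathbf{emTT}_{\mathcal T}\vdash\mathsf{true}\in(\forall z\in\mathbf V)(\widetilde{\delta_a[z/u]}\leftrightarrow z=_{\mathbf V}a)\,[\Gamma]$; 3. if $\mathbf{emTT}_{\mathcal T}\vdash\varphi\,prop\,[\Gamma]$, then $\mathbf{emTT}_{\mathcal T}\vdash\mathsf{true}\in\varphi\leftrightarrow\widetilde{\widehat\varphi}\,[\Gamma]$. -/

import Mathlib

/-!
Syntax is represented with de Bruijn indices: variable `0` is the one bound last.  In a constructor
whose argument binds `x, y, z` (in this order) the argument sees `z` as `0`, `y` as `1`, `x` as `2`,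
and the variable `i` of the surrounding context as `i + 3`.
-/

namespace EmTT

/-- The three axiomatic set theories. -/
inductive SetTheory
  | CZF
  | IZF
  | ZF

/-! ## The language of set theory -/

mutual
/-- Terms of set theory; `sep a φ` is `{x ∈ a | φ}`, which binds `x` in `φ` only.
(Terms of CZF are those without `power` in which `sep` is applied to `Δ₀`-formulas only.) -/
inductive STm : Type
  | var (i : ℕ)
  | empty
  | omega
  | upair (a b : STm)
  | union (a : STm)
  | power (a : STm)
  | sep (a : STm) (φ : SFm)
/-- Formulas of set theory. -/
inductive SFm : Type
  | bot
  | eq (a b : STm)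
  | mem (a b : STm)
  | and (φ ψ : SFm)
  | or (φ ψ : SFm)
  | imp (φ ψ : SFm)
  | all (φ : SFm)
  | ex (φ : SFm)
end

/-- Lifting of a renaming under a binder. -/
def upRen (ρ : ℕ → ℕ) : ℕ → ℕ
  | 0 => 0
  | i + 1 => ρ i + 1

mutual
def STm.ren (ρ : ℕ → ℕ) : STm → STm
  | .var i => .var (ρ i)
  | .empty => .empty
  | .omega => .omega
  | .upair a b => .upair (a.ren ρ) (b.ren ρ)
  | .union a => .union (a.ren ρ)
  | .power a => .power (a.ren ρ)
  | .sep a φ => .sep (a.ren ρ) (φ.ren (upRen ρ))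
def SFm.ren (ρ : ℕ → ℕ) : SFm → SFm
  | .bot => .bot
  | .eq a b => .eq (a.ren ρ) (b.ren ρ)
  | .mem a b => .mem (a.ren ρ) (b.ren ρ)
  | .and φ ψ => .and (φ.ren ρ) (ψ.ren ρ)
  | .or φ ψ => .or (φ.ren ρ) (ψ.ren ρ)
  | .imp φ ψ => .imp (φ.ren ρ) (ψ.ren ρ)
  | .all φ => .all (φ.ren (upRen ρ))
  | .ex φ => .ex (φ.ren (upRen ρ))
end

/-- Lifting of a substitution under a binder. -/
def STm.up (σ : ℕ → STm) : ℕ → STm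
  | 0 => .var 0
  | i + 1 => (σ i).ren Nat.succ

mutual
/-- Simultaneous capture-avoiding substitution. -/
def STm.subst (σ : ℕ → STm) : STm → STm
  | .var i => σ i
  | .empty => .empty
  | .omega => .omega
  | .upair a b => .upair (a.subst σ) (b.subst σ)
  | .union a => .union (a.subst σ)
  | .power a => .power (a.subst σ)
  | .sep a φ => .sep (a.subst σ) (φ.subst (STm.up σ))
def SFm.subst (σ : ℕ → STm) : SFm → SFm
  | .bot => .bot
  | .eq a b => .eq (a.subst σ) (b.subst σ)
  | .mem a b => .mem (a.subst σ) (b.subst σ)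
  | .and φ ψ => .and (φ.subst σ) (ψ.subst σ)
  | .or φ ψ => .or (φ.subst σ) (ψ.subst σ)
  | .imp φ ψ => .imp (φ.subst σ) (ψ.subst σ)
  | .all φ => .all (φ.subst (STm.up σ))
  | .ex φ => .ex (φ.subst (STm.up σ))
end

/-- `STm.sb [t₀, …, tₖ₋₁] m` sends the variable `j < k` to `tⱼ` and the variable `k + i` to the
variable `i + m`. -/
def STm.sb : List STm → ℕ → ℕ → STm
  | [], m, i => .var (i + m)
  | t :: _, _, 0 => t
  | _ :: l, m, i + 1 => STm.sb l m i

/-- `a.inst l m` is `a` with its first `l.length` variables replaced by the terms of `l`, the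
remaining ones being weakened by `m`; `a.inst [] m` is weakening by `m` variables. -/
def STm.inst (a : STm) (l : List STm) (m : ℕ) : STm := a.subst (STm.sb l m)
/-- See `STm.inst`. -/
def SFm.inst (φ : SFm) (l : List STm) (m : ℕ) : SFm := φ.subst (STm.sb l m)

def SFm.iff (φ ψ : SFm) : SFm := .and (.imp φ ψ) (.imp ψ φ)

/-- `{a}` -/
def STm.sing (a : STm) : STm := .upair a a
/-- `1 = {∅}` -/
def STm.one : STm := .sing .empty
/-- The ordered pair `(a, b) = {{a}, {a, b}}`. -/
def STm.pair (a b : STm) : STm := .upair (.sing a) (.upair a b)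
/-- `a ∪ b` -/
def STm.cup (a b : STm) : STm := .union (.upair a b)
/-- `a ⊆ b` -/
def STm.sub (a b : STm) : SFm :=
  .all (.imp (.mem (.var 0) (a.inst [] 1)) (.mem (.var 0) (b.inst [] 1)))
/-- `p₁(a) = ⋃ {x ∈ ⋃ a | ∀ y (y ∈ a → x ∈ y)}` -/
def STm.fst (a : STm) : STm :=
  .union (.sep (.union a) (.all (.imp (.mem (.var 0) (a.inst [] 2)) (.mem (.var 1) (.var 0)))))
/-- `p₂(a) = ⋃ {x ∈ ⋃ a | x = p₁(a) → a = {{p₁(a)}}}` -/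
def STm.snd (a : STm) : STm :=
  .union (.sep (.union a)
    (.imp (.eq (.var 0) (STm.fst (a.inst [] 1)))
      (.eq (a.inst [] 1) (.sing (.sing (STm.fst (a.inst [] 1)))))))
/-- The length `ℓ(a) = {x ∈ ω | ∃ y (y ∈ ⋃ ⋃ a ∧ (x, y) ∈ a)}` of a list `a`. The bound on `y` is
redundant, and makes this a term of CZF as well. -/
def STm.len (a : STm) : STm :=
  .sep .omega (.ex (.and (.mem (.var 0) (.union (.union (a.inst [] 2))))
    (.mem (.pair (.var 1) (.var 0)) (a.inst [] 2))))

/-! ## The pre-syntax of the type theory -/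

mutual
/-- Pre-collections. -/
inductive PCol : Type
  | N0
  | N1
  | list (A : PCol)
  | sum (A B : PCol)
  /-- `(Σ x ∈ A) B` -/
  | sigma (A B : PCol)
  /-- `(Π x ∈ A) B` -/
  | pi (A B : PCol)
  /-- `A / (x, y) φ` -/
  | quot (A : PCol) (φ : PProp)
  /-- `𝒫(1)` -/
  | pow1
  /-- `A → 𝒫(1)` -/
  | funPow1 (A : PCol)
  /-- `{x | φ}` -/
  | compr (φ : PProp)
  /-- a proposition, seen as a collection -/
  | ofProp (φ : PProp)
  /-- the universal collection -/
  | V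
/-- Pre-terms. -/
inductive PTm : Type
  | var (i : ℕ)
  | emp0 (a : PTm)
  | star
  | elN1 (a b : PTm)
  | nil
  /-- `cons(a, b)`: the list `a` extended by the element `b` -/
  | cons (a b : PTm)
  /-- `El_List^A(a, b, (x, y, z) c)` -/
  | elList (A : PCol) (a b c : PTm)
  | inl (a : PTm)
  | inr (a : PTm)
  /-- `El_+(a, (x) b, (y) c)` -/
  | elSum (a b c : PTm)
  | pair (a b : PTm)
  /-- `El_Σ(a, (x, y) b)` -/
  | elSigma (a b : PTm)
  /-- `λ x^A. b` -/
  | lam (A : PCol) (b : PTm)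
  | app (a b : PTm)
  /-- the class `[a]` annotated with `A, (x, y) φ` -/
  | cls (A : PCol) (φ : PProp) (a : PTm)
  /-- `El_{A/(x, y) φ}(a, (x) b)` -/
  | elQuot (A : PCol) (φ : PProp) (a b : PTm)
  /-- the canonical proof-term `true` -/
  | tt
  /-- `[φ]`, an element of `𝒫(1)` -/
  | code (φ : PProp)
  /-- `⌈A⌉` -/
  | name (A : PCol)
  | empty
  | upair (a b : PTm)
  | union (a : PTm)
  | power (a : PTm)
  /-- `{x ε a | φ}`, binding `x` in `φ` only -/
  | sep (a : PTm) (φ : PProp)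
  | omega
/-- Pre-propositions. -/
inductive PProp : Type
  | bot
  /-- `a ε b` for terms `a`, `b` -/
  | mem (a b : PTm)
  /-- `a ε A` for a term `a` and a collection `A` -/
  | memCol (a : PTm) (A : PCol)
  /-- `a =_A b` -/
  | eq (A : PCol) (a b : PTm)
  | imp (φ ψ : PProp)
  | and (φ ψ : PProp)
  | or (φ ψ : PProp)
  /-- `(∃ x ∈ A) φ` -/
  | ex (A : PCol) (φ : PProp)
  /-- `(∀ x ∈ A) φ` -/
  | all (A : PCol) (φ : PProp)
end

mutual
def PCol.ren (ρ : ℕ → ℕ) : PCol → PCol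
  | .N0 => .N0
  | .N1 => .N1
  | .list A => .list (A.ren ρ)
  | .sum A B => .sum (A.ren ρ) (B.ren ρ)
  | .sigma A B => .sigma (A.ren ρ) (B.ren (upRen ρ))
  | .pi A B => .pi (A.ren ρ) (B.ren (upRen ρ))
  | .quot A φ => .quot (A.ren ρ) (φ.ren (upRen (upRen ρ)))
  | .pow1 => .pow1
  | .funPow1 A => .funPow1 (A.ren ρ)
  | .compr φ => .compr (φ.ren (upRen ρ))
  | .ofProp φ => .ofProp (φ.ren ρ)
  | .V => .V
def PTm.ren (ρ : ℕ → ℕ) : PTm → PTm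
  | .var i => .var (ρ i)
  | .emp0 a => .emp0 (a.ren ρ)
  | .star => .star
  | .elN1 a b => .elN1 (a.ren ρ) (b.ren ρ)
  | .nil => .nil
  | .cons a b => .cons (a.ren ρ) (b.ren ρ)
  | .elList A a b c =>
      .elList (A.ren ρ) (a.ren ρ) (b.ren ρ) (c.ren (upRen (upRen (upRen ρ))))
  | .inl a => .inl (a.ren ρ)
  | .inr a => .inr (a.ren ρ)
  | .elSum a b c => .elSum (a.ren ρ) (b.ren (upRen ρ)) (c.ren (upRen ρ))
  | .pair a b => .pair (a.ren ρ) (b.ren ρ)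
  | .elSigma a b => .elSigma (a.ren ρ) (b.ren (upRen (upRen ρ)))
  | .lam A b => .lam (A.ren ρ) (b.ren (upRen ρ))
  | .app a b => .app (a.ren ρ) (b.ren ρ)
  | .cls A φ a => .cls (A.ren ρ) (φ.ren (upRen (upRen ρ))) (a.ren ρ)
  | .elQuot A φ a b =>
      .elQuot (A.ren ρ) (φ.ren (upRen (upRen ρ))) (a.ren ρ) (b.ren (upRen ρ))
  | .tt => .tt
  | .code φ => .code (φ.ren ρ)
  | .name A => .name (A.ren ρ)
  | .empty => .empty
  | .upair a b => .upair (a.ren ρ) (b.ren ρ)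
  | .union a => .union (a.ren ρ)
  | .power a => .power (a.ren ρ)
  | .sep a φ => .sep (a.ren ρ) (φ.ren (upRen ρ))
  | .omega => .omega
def PProp.ren (ρ : ℕ → ℕ) : PProp → PProp
  | .bot => .bot
  | .mem a b => .mem (a.ren ρ) (b.ren ρ)
  | .memCol a A => .memCol (a.ren ρ) (A.ren ρ)
  | .eq A a b => .eq (A.ren ρ) (a.ren ρ) (b.ren ρ)
  | .imp φ ψ => .imp (φ.ren ρ) (ψ.ren ρ)
  | .and φ ψ => .and (φ.ren ρ) (ψ.ren ρ)
  | .or φ ψ => .or (φ.ren ρ) (ψ.ren ρ)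
  | .ex A φ => .ex (A.ren ρ) (φ.ren (upRen ρ))
  | .all A φ => .all (A.ren ρ) (φ.ren (upRen ρ))
end

/-- Lifting of a substitution under a binder. -/
def PTm.up (σ : ℕ → PTm) : ℕ → PTm
  | 0 => .var 0
  | i + 1 => (σ i).ren Nat.succ

mutual
/-- Simultaneous capture-avoiding substitution. -/
def PCol.subst (σ : ℕ → PTm) : PCol → PCol
  | .N0 => .N0
  | .N1 => .N1
  | .list A => .list (A.subst σ)
  | .sum A B => .sum (A.subst σ) (B.subst σ)
  | .sigma A B => .sigma (A.subst σ) (B.subst (PTm.up σ))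
  | .pi A B => .pi (A.subst σ) (B.subst (PTm.up σ))
  | .quot A φ => .quot (A.subst σ) (φ.subst (PTm.up (PTm.up σ)))
  | .pow1 => .pow1
  | .funPow1 A => .funPow1 (A.subst σ)
  | .compr φ => .compr (φ.subst (PTm.up σ))
  | .ofProp φ => .ofProp (φ.subst σ)
  | .V => .V
def PTm.subst (σ : ℕ → PTm) : PTm → PTm
  | .var i => σ i
  | .emp0 a => .emp0 (a.subst σ)
  | .star => .star
  | .elN1 a b => .elN1 (a.subst σ) (b.subst σ)
  | .nil => .nil
  | .cons a b => .cons (a.subst σ) (b.subst σ)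
  | .elList A a b c =>
      .elList (A.subst σ) (a.subst σ) (b.subst σ) (c.subst (PTm.up (PTm.up (PTm.up σ))))
  | .inl a => .inl (a.subst σ)
  | .inr a => .inr (a.subst σ)
  | .elSum a b c => .elSum (a.subst σ) (b.subst (PTm.up σ)) (c.subst (PTm.up σ))
  | .pair a b => .pair (a.subst σ) (b.subst σ)
  | .elSigma a b => .elSigma (a.subst σ) (b.subst (PTm.up (PTm.up σ)))
  | .lam A b => .lam (A.subst σ) (b.subst (PTm.up σ))
  | .app a b => .app (a.subst σ) (b.subst σ)
  | .cls A φ a => .cls (A.subst σ) (φ.subst (PTm.up (PTm.up σ))) (a.subst σ)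
  | .elQuot A φ a b =>
      .elQuot (A.subst σ) (φ.subst (PTm.up (PTm.up σ))) (a.subst σ) (b.subst (PTm.up σ))
  | .tt => .tt
  | .code φ => .code (φ.subst σ)
  | .name A => .name (A.subst σ)
  | .empty => .empty
  | .upair a b => .upair (a.subst σ) (b.subst σ)
  | .union a => .union (a.subst σ)
  | .power a => .power (a.subst σ)
  | .sep a φ => .sep (a.subst σ) (φ.subst (PTm.up σ))
  | .omega => .omega
def PProp.subst (σ : ℕ → PTm) : PProp → PProp
  | .bot => .bot
  | .mem a b => .mem (a.subst σ) (b.subst σ)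
  | .memCol a A => .memCol (a.subst σ) (A.subst σ)
  | .eq A a b => .eq (A.subst σ) (a.subst σ) (b.subst σ)
  | .imp φ ψ => .imp (φ.subst σ) (ψ.subst σ)
  | .and φ ψ => .and (φ.subst σ) (ψ.subst σ)
  | .or φ ψ => .or (φ.subst σ) (ψ.subst σ)
  | .ex A φ => .ex (A.subst σ) (φ.subst (PTm.up σ))
  | .all A φ => .all (A.subst σ) (φ.subst (PTm.up σ))
end

/-- `PTm.sb [t₀, …, tₖ₋₁] m` sends the variable `j < k` to `tⱼ` and the variable `k + i` to the
variable `i + m`. -/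
def PTm.sb : List PTm → ℕ → ℕ → PTm
  | [], m, i => .var (i + m)
  | t :: _, _, 0 => t
  | _ :: l, m, i + 1 => PTm.sb l m i

/-- `A.inst l m` is `A` with its first `l.length` variables replaced by the terms of `l`, the
remaining ones being weakened by `m`; `A.inst [] m` is weakening by `m` variables, and
`A.inst [a] 0` is `A[a/x]` for the last variable `x`. -/
def PCol.inst (A : PCol) (l : List PTm) (m : ℕ) : PCol := A.subst (PTm.sb l m)
/-- See `PCol.inst`. -/
def PTm.inst (a : PTm) (l : List PTm) (m : ℕ) : PTm := a.subst (PTm.sb l m)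
/-- See `PCol.inst`. -/
def PProp.inst (φ : PProp) (l : List PTm) (m : ℕ) : PProp := φ.subst (PTm.sb l m)

def PProp.neg (φ : PProp) : PProp := .imp φ .bot
def PProp.iff (φ ψ : PProp) : PProp := .and (.imp φ ψ) (.imp ψ φ)
def PProp.top : PProp := .imp .bot .bot

/-- `{a}` -/
def PTm.sing (a : PTm) : PTm := .upair a a
/-- The set-theoretic ordered pair `(a, b) = {{a}, {a, b}}`. -/
def PTm.kpair (a b : PTm) : PTm := .upair (.sing a) (.upair a b)
/-- `⋃ {a, {a}}` -/
def PTm.succ (a : PTm) : PTm := .union (.upair a (.sing a))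
/-- `ℓ(a) = El_List^A(a, ∅, (x, y, z) ⋃ {z, {z}})` -/
def PTm.len (A : PCol) (a : PTm) : PTm := .elList A a .empty (.succ (.var 0))

/-- `Trans(y)`: `∅ ε y ∧ (∀ z ∈ V)(z ε y → ⋃ {z, {z}} ε y)` -/
def PTm.trans (y : PTm) : PProp :=
  .and (.mem .empty y)
    (.all .V (.imp (.mem (.var 0) (y.inst [] 1)) (.mem (.succ (.var 0)) (y.inst [] 1))))

/-! ## The two translations -/

mutual
/-- The translation `a ↦ ã` of terms of set theory. -/
def STm.tilde : STm → PTm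
  | .var i => .var i
  | .empty => .empty
  | .omega => .omega
  | .upair a b => .upair a.tilde b.tilde
  | .union a => .union a.tilde
  | .power a => .power a.tilde
  | .sep a φ => .sep a.tilde φ.tilde
/-- The translation `φ ↦ φ̃` of formulas of set theory. -/
def SFm.tilde : SFm → PProp
  | .bot => .bot
  | .eq a b => .eq .V a.tilde b.tilde
  | .mem a b => .mem a.tilde b.tilde
  | .and φ ψ => .and φ.tilde ψ.tilde
  | .or φ ψ => .or φ.tilde ψ.tilde
  | .imp φ ψ => .imp φ.tilde ψ.tilde
  | .all φ => .all .V φ.tilde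
  | .ex φ => .ex .V φ.tilde
end

/-- `∀ w ∀ w' ∀ w'' ((w, w') ∈ f ∧ (w, w'') ∈ f → w' = w'')` -/
def svl (f : STm) : SFm :=
  .all (.all (.all (.imp
    (.and (.mem (.pair (.var 2) (.var 1)) (f.inst [] 3))
      (.mem (.pair (.var 2) (.var 0)) (f.inst [] 3)))
    (.eq (.var 1) (.var 0)))))

/-- `η_{(Π x ∈ A) B}` from `η_A` and `η_B`:
`∀ v (v ∈ u → ∃ w ∃ w' (v = (w, w') ∧ η_A[w/u] ∧ η_B[w/x, w'/u]))`, `u` is single-valued, and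
`∀ w (η_A[w/u] → ∃ w' ((w, w') ∈ u))`. -/
def etaPi (α β : SFm) : SFm :=
  .and (.all (.imp (.mem (.var 0) (.var 1))
      (.ex (.ex (.and (.eq (.var 2) (.pair (.var 1) (.var 0)))
        (.and (α.inst [.var 1] 4) (β.inst [.var 0, .var 1] 4)))))))
  (.and (svl (.var 0))
    (.all (.imp (α.inst [.var 0] 2) (.ex (.mem (.pair (.var 1) (.var 0)) (.var 2))))))

/-- `η_{𝒫(1)}`: `u ⊆ {0}` -/
def etaPow1 : SFm := STm.sub (.var 0) (.sing .empty)

/-- `η_{List(A)}` from `η_A`: there is `n ∈ ω` such that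
`∀ v (v ∈ u → ∃ w ∃ w' (w ∈ n ∧ η_A[w'/u] ∧ v = (w, w')))`, `u` is single-valued, and
`∀ w (w ∈ n → ∃ w' ((w, w') ∈ u))`. -/
def etaList (α : SFm) : SFm :=
  .ex (.and (.mem (.var 0) .omega)
  (.and (.all (.imp (.mem (.var 0) (.var 2))
      (.ex (.ex (.and (.mem (.var 1) (.var 3))
        (.and (α.inst [.var 0] 5) (.eq (.var 2) (.pair (.var 1) (.var 0)))))))))
  (.and (svl (.var 1))
    (.all (.imp (.mem (.var 0) (.var 1)) (.ex (.mem (.pair (.var 1) (.var 0)) (.var 3))))))))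

/-- `∃ w (γ[w/u] ∧ ∀ v (v ∈ u ↔ η_A[v/u] ∧ R[w/x, v/y]))`, for `α = η_A`, `ρ = R`; this is
`η_{A/R}` for `γ = η_A`, and `δ_{[a]}` for `γ = δ_a`. -/
def classOf (γ α ρ : SFm) : SFm :=
  .ex (.and (γ.inst [.var 0] 2)
    (.all (SFm.iff (.mem (.var 0) (.var 2))
      (.and (α.inst [.var 0] 3) (ρ.inst [.var 0, .var 1] 3)))))

mutual
/-- The formula `η_A`. Its variable `0` is the special variable `u`, and the variable `i` of `A` is
the variable `i + 1` of `η_A`. -/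
def PCol.eta : PCol → SFm
  | .N0 => .bot
  | .N1 => .eq (.var 0) .empty
  | .list A => etaList A.eta
  -- `∃ v (η_A[v/u] ∧ u = (0, v)) ∨ ∃ w (η_B[w/u] ∧ u = (1, w))`
  | .sum A B =>
      .or (.ex (.and (A.eta.inst [.var 0] 2) (.eq (.var 1) (.pair .empty (.var 0)))))
        (.ex (.and (B.eta.inst [.var 0] 2) (.eq (.var 1) (.pair .one (.var 0)))))
  -- `∃ v ∃ w (η_A[v/u] ∧ η_B[v/x, w/u] ∧ u = (v, w))`
  | .sigma A B =>
      .ex (.ex (.and (A.eta.inst [.var 1] 3) (.and (B.eta.inst [.var 0, .var 1] 3)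
        (.eq (.var 2) (.pair (.var 1) (.var 0))))))
  | .pi A B => etaPi A.eta B.eta
  | .quot A φ => classOf A.eta A.eta φ.hat
  | .pow1 => etaPow1
  | .funPow1 A => etaPi A.eta etaPow1
  -- `φ̂[u/x]`
  | .compr φ => φ.hat
  -- `u = 0 ∧ φ̂`
  | .ofProp φ => .and (.eq (.var 0) .empty) (φ.hat.inst [] 1)
  | .V => .eq (.var 0) (.var 0)
/-- The formula `δ_a`. Its variable `0` is the special variable `u`, and the variable `i` of `a` is
the variable `i + 1` of `δ_a`. -/
def PTm.delta : PTm → SFm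
  | .var i => .eq (.var 0) (.var (i + 1))
  | .emp0 _ => .eq (.var 0) .empty
  | .star => .eq (.var 0) .empty
  | .elN1 _ b => b.delta
  | .nil => .eq (.var 0) .empty
  -- `∃ v ∃ w (δ_a[v/u] ∧ δ_b[w/u] ∧ u = v ∪ {(ℓ(v), w)})`
  | .cons a b =>
      .ex (.ex (.and (a.delta.inst [.var 1] 3) (.and (b.delta.inst [.var 0] 3)
        (.eq (.var 2)
          (.cup (.var 1) (.sing (.pair (.len (.var 1)) (.var 0))))))))
  -- there is a function `f` on `List(A)` with `f(0) = b`, with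
  -- `f(w₁ ∪ {(ℓ(w₁), w₂)}) = c(w₁, w₂, f(w₁))` for `w₁` in `List(A)` and `w₂` in `A`, and with
  -- `f(a) = u`
  | .elList A a b c =>
      .ex (.and
        (.all (.imp (.mem (.var 0) (.var 1))
          (.ex (.ex (.and ((etaList A.eta).inst [.var 1] 5)
            (.eq (.var 2) (.pair (.var 1) (.var 0))))))))
      (.and (svl (.var 0))
      (.and
        (.all (.imp ((etaList A.eta).inst [.var 0] 3)
          (.ex (.mem (.pair (.var 1) (.var 0)) (.var 2)))))
      (.and
        (.ex (.and (b.delta.inst [.var 0] 3) (.mem (.pair .empty (.var 0)) (.var 1))))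
      (.and
        (.all (.all (.all (.all (.imp
          (.and (.mem (.pair (.var 3) (.var 1)) (.var 4))
            (.and (A.eta.inst [.var 2] 6)
              (c.delta.inst [.var 0, .var 1, .var 2, .var 3] 6)))
          (.mem (.pair (.cup (.var 3) (.sing (.pair (.len (.var 3)) (.var 2)))) (.var 0))
            (.var 4)))))))
        (.ex (.and (a.delta.inst [.var 0] 3) (.mem (.pair (.var 0) (.var 2)) (.var 1)))))))))
  -- `∃ v (δ_a[v/u] ∧ u = (0, v))`
  | .inl a => .ex (.and (a.delta.inst [.var 0] 2) (.eq (.var 1) (.pair .empty (.var 0))))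
  -- `∃ v (δ_a[v/u] ∧ u = (1, v))`
  | .inr a => .ex (.and (a.delta.inst [.var 0] 2) (.eq (.var 1) (.pair .one (.var 0))))
  -- `∃ v (δ_a[v/u] ∧ ((p₁(v) = 0 ∧ δ_b[p₂(v)/x]) ∨ (p₁(v) = 1 ∧ δ_c[p₂(v)/y])))`
  | .elSum a b c =>
      .ex (.and (a.delta.inst [.var 0] 2)
        (.or (.and (.eq (.fst (.var 0)) .empty) (b.delta.inst [.var 1, .snd (.var 0)] 2))
          (.and (.eq (.fst (.var 0)) .one) (c.delta.inst [.var 1, .snd (.var 0)] 2))))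
  -- `∃ v ∃ w (δ_a[v/u] ∧ δ_b[w/u] ∧ u = (v, w))`
  | .pair a b =>
      .ex (.ex (.and (a.delta.inst [.var 1] 3) (.and (b.delta.inst [.var 0] 3)
        (.eq (.var 2) (.pair (.var 1) (.var 0))))))
  -- `∃ v (δ_a[v/u] ∧ δ_b[p₁(v)/x, p₂(v)/y])`
  | .elSigma a b =>
      .ex (.and (a.delta.inst [.var 0] 2)
        (b.delta.inst [.var 1, .snd (.var 0), .fst (.var 0)] 2))
  -- `∀ v (v ∈ u ↔ ∃ w ∃ w' (η_A[w/u] ∧ δ_b[w/x, w'/u] ∧ v = (w, w')))`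
  | .lam A b =>
      .all (SFm.iff (.mem (.var 0) (.var 1))
        (.ex (.ex (.and (A.eta.inst [.var 1] 4) (.and (b.delta.inst [.var 0, .var 1] 4)
          (.eq (.var 2) (.pair (.var 1) (.var 0))))))))
  -- `∃ v ∃ w (δ_a[v/u] ∧ δ_b[w/u] ∧ u = p₂(⋃ {z ∈ v | p₁(z) = w}))`
  | .app a b =>
      .ex (.ex (.and (a.delta.inst [.var 1] 3) (.and (b.delta.inst [.var 0] 3)
        (.eq (.var 2) (.snd (.union (.sep (.var 1) (.eq (.fst (.var 0)) (.var 1)))))))))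
  | .cls A φ a => classOf a.delta A.eta φ.hat
  -- `∃ v (δ_a[v/u] ∧ ∃ w (w ∈ v) ∧ ∀ w (w ∈ v → δ_b[w/x]))`
  | .elQuot _ _ a b =>
      .ex (.and (a.delta.inst [.var 0] 2)
        (.and (.ex (.mem (.var 0) (.var 1)))
          (.all (.imp (.mem (.var 0) (.var 1)) (b.delta.inst [.var 2, .var 0] 3)))))
  | .tt => .eq (.var 0) .empty
  -- `∀ v (v ∈ u ↔ v = 0 ∧ φ̂)`
  | .code φ =>
      .all (SFm.iff (.mem (.var 0) (.var 1))
        (.and (.eq (.var 0) .empty) (φ.hat.inst [] 2)))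
  -- `∀ v (v ∈ u ↔ η_A[v/u])`
  | .name A => .all (SFm.iff (.mem (.var 0) (.var 1)) (A.eta.inst [.var 0] 2))
  | .empty => .eq (.var 0) .empty
  -- `∃ v ∃ w (δ_a[v/u] ∧ δ_b[w/u] ∧ u = {v, w})`
  | .upair a b =>
      .ex (.ex (.and (a.delta.inst [.var 1] 3) (.and (b.delta.inst [.var 0] 3)
        (.eq (.var 2) (.upair (.var 1) (.var 0))))))
  -- `∃ v (δ_a[v/u] ∧ u = ⋃ v)`
  | .union a => .ex (.and (a.delta.inst [.var 0] 2) (.eq (.var 1) (.union (.var 0))))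
  -- `∃ v (δ_a[v/u] ∧ ∀ w (w ∈ u ↔ w ⊆ v))`
  | .power a =>
      .ex (.and (a.delta.inst [.var 0] 2)
        (.all (SFm.iff (.mem (.var 0) (.var 2)) (STm.sub (.var 0) (.var 1)))))
  -- `∃ v (δ_a[v/u] ∧ ∀ x (x ∈ u ↔ x ∈ v ∧ φ̂))`
  | .sep a φ =>
      .ex (.and (a.delta.inst [.var 0] 2)
        (.all (SFm.iff (.mem (.var 0) (.var 2))
          (.and (.mem (.var 0) (.var 1)) (φ.hat.inst [.var 0] 3)))))
  | .omega => .eq (.var 0) .omega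
/-- The formula `φ̂`, with the same variables as `φ`. -/
def PProp.hat : PProp → SFm
  | .bot => .bot
  -- `∃ u ∃ v (δ_a ∧ δ_b[v/u] ∧ u ∈ v)`
  | .mem a b =>
      .ex (.ex (.and (a.delta.inst [.var 1] 2) (.and (b.delta.inst [.var 0] 2)
        (.mem (.var 1) (.var 0)))))
  -- `∃ u (δ_a ∧ η_A)`
  | .memCol a A => .ex (.and a.delta A.eta)
  -- `∃ u (δ_a ∧ δ_b ∧ η_A)`
  | .eq A a b => .ex (.and a.delta (.and b.delta A.eta))
  | .imp φ ψ => .imp φ.hat ψ.hat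
  | .and φ ψ => .and φ.hat ψ.hat
  | .or φ ψ => .or φ.hat ψ.hat
  -- `∃ x (η_A[x/u] ∧ φ̂)`
  | .ex A φ => .ex (.and A.eta φ.hat)
  -- `∀ x (η_A[x/u] → φ̂)`
  | .all A φ => .all (.imp A.eta φ.hat)
end

/-! ## Judgements and derivability -/

/-- The four kinds of types. -/
inductive Kind
  | col
  | set
  | prop
  | props

/-- Used to state at once a formation rule for collections or propositions (`large`) and the
analogous one for sets or small propositions (`small`). -/
inductive Size
  | large
  | small

def Size.dom : Size → Kind
  | .large => .col
  | .small => .set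
def Size.logic : Size → Kind
  | .large => .prop
  | .small => .props

/-- Judgements (without their context): context formation, `A k`, `A = B k`, `a ∈ A`,
`a = b ∈ A`. -/
inductive Jdg : Type
  | wf
  | ty (k : Kind) (A : PCol)
  | tyEq (k : Kind) (A B : PCol)
  | tm (a : PTm) (A : PCol)
  | tmEq (a b : PTm) (A : PCol)

def Jdg.subst (σ : ℕ → PTm) : Jdg → Jdg
  | .wf => .wf
  | .ty k A => .ty k (A.subst σ)
  | .tyEq k A B => .tyEq k (A.subst σ) (B.subst σ)
  | .tm a A => .tm (a.subst σ) (A.subst σ)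
  | .tmEq a b A => .tmEq (a.subst σ) (b.subst σ) (A.subst σ)

/-- `φ prop` -/
abbrev Jdg.prop (φ : PProp) : Jdg := .ty .prop (.ofProp φ)
/-- `φ prop_s` -/
abbrev Jdg.props (φ : PProp) : Jdg := .ty .props (.ofProp φ)
/-- `true ∈ φ` -/
abbrev Jdg.holds (φ : PProp) : Jdg := .tm .tt (.ofProp φ)

/-- Pre-contexts; the head of the list is the last declaration, and the variables of an entry refer
to the entries after it in the list. -/
abbrev Ctx := List PCol

/-- `Γ.Has i A`: the variable `i` is declared in `Γ` with type `A` (weakened to the whole of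
`Γ`). -/
inductive Ctx.Has : Ctx → ℕ → PCol → Prop
  | zero {Γ : Ctx} {A : PCol} : Ctx.Has (A :: Γ) 0 (A.inst [] 1)
  | succ {Γ : Ctx} {A B : PCol} {i : ℕ} : Ctx.Has Γ i A → Ctx.Has (B :: Γ) (i + 1) (A.inst [] 1)

/-- `Der T Γ J`: the judgement `J [Γ]` is derivable in `emTT_T`. The premises which form the types
and propositions occurring in a rule are always made explicit. -/
inductive Der (T : SetTheory) : Ctx → Jdg → Prop
  /- Contexts, variables, substitution. -/
  | nil : Der T [] .wf
  | cons {Γ A} : Der T Γ (.ty .col A) → Der T (A :: Γ) .wf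
  | var {Γ i A} : Der T Γ .wf → Ctx.Has Γ i A → Der T Γ (.tm (.var i) A)
  | subst {Γ Δ J} {σ : ℕ → PTm} : Der T Γ J → Der T Δ .wf →
      (∀ i A, Ctx.Has Γ i A → Der T Δ (.tm (σ i) (A.subst σ))) → Der T Δ (J.subst σ)
  | substEqTy {Γ Δ k A} {σ τ : ℕ → PTm} : Der T Γ (.ty k A) → Der T Δ .wf →
      (∀ i B, Ctx.Has Γ i B → Der T Δ (.tm (σ i) (B.subst σ))) →
      (∀ i B, Ctx.Has Γ i B → Der T Δ (.tm (τ i) (B.subst τ))) →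
      (∀ i B, Ctx.Has Γ i B → Der T Δ (.tmEq (σ i) (τ i) (B.subst σ))) →
      Der T Δ (.tyEq k (A.subst σ) (A.subst τ))
  | substEqTm {Γ Δ a A} {σ τ : ℕ → PTm} : Der T Γ (.tm a A) → Der T Δ .wf →
      (∀ i B, Ctx.Has Γ i B → Der T Δ (.tm (σ i) (B.subst σ))) →
      (∀ i B, Ctx.Has Γ i B → Der T Δ (.tm (τ i) (B.subst τ))) →
      (∀ i B, Ctx.Has Γ i B → Der T Δ (.tmEq (σ i) (τ i) (B.subst σ))) →
      Der T Δ (.tmEq (a.subst σ) (a.subst τ) (A.subst σ))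
  /- Inclusions between the kinds of types. -/
  | setCol {Γ A} : Der T Γ (.ty .set A) → Der T Γ (.ty .col A)
  | propCol {Γ A} : Der T Γ (.ty .prop A) → Der T Γ (.ty .col A)
  | propsSet {Γ A} : Der T Γ (.ty .props A) → Der T Γ (.ty .set A)
  | propsProp {Γ A} : Der T Γ (.ty .props A) → Der T Γ (.ty .prop A)
  | setColEq {Γ A B} : Der T Γ (.tyEq .set A B) → Der T Γ (.tyEq .col A B)
  | propColEq {Γ A B} : Der T Γ (.tyEq .prop A B) → Der T Γ (.tyEq .col A B)
  | propsSetEq {Γ A B} : Der T Γ (.tyEq .props A B) → Der T Γ (.tyEq .set A B)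
  | propsPropEq {Γ A B} : Der T Γ (.tyEq .props A B) → Der T Γ (.tyEq .prop A B)
  /- Equality. -/
  | tyRefl {Γ k A} : Der T Γ (.ty k A) → Der T Γ (.tyEq k A A)
  | tySymm {Γ k A B} : Der T Γ (.tyEq k A B) → Der T Γ (.tyEq k B A)
  | tyTrans {Γ k A B C} : Der T Γ (.tyEq k A B) → Der T Γ (.tyEq k B C) →
      Der T Γ (.tyEq k A C)
  | tmRefl {Γ a A} : Der T Γ (.tm a A) → Der T Γ (.tmEq a a A)
  | tmSymm {Γ a b A} : Der T Γ (.tmEq a b A) → Der T Γ (.tmEq b a A)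
  | tmTrans {Γ a b c A} : Der T Γ (.tmEq a b A) → Der T Γ (.tmEq b c A) →
      Der T Γ (.tmEq a c A)
  | conv {Γ a A B} : Der T Γ (.tm a A) → Der T Γ (.tyEq .col A B) → Der T Γ (.tm a B)
  | convEq {Γ a b A B} : Der T Γ (.tmEq a b A) → Der T Γ (.tyEq .col A B) →
      Der T Γ (.tmEq a b B)
  /- The empty set. -/
  | n0F {Γ} : Der T Γ .wf → Der T Γ (.ty .set .N0)
  | n0E {Γ a M} : Der T (.N0 :: Γ) (.ty .col M) → Der T Γ (.tm a .N0) →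
      Der T Γ (.tm (.emp0 a) (M.inst [a] 0))
  /- The singleton set. -/
  | n1F {Γ} : Der T Γ .wf → Der T Γ (.ty .set .N1)
  | n1I {Γ} : Der T Γ .wf → Der T Γ (.tm .star .N1)
  | n1E {Γ a b M} : Der T (.N1 :: Γ) (.ty .col M) → Der T Γ (.tm a .N1) →
      Der T Γ (.tm b (M.inst [.star] 0)) → Der T Γ (.tm (.elN1 a b) (M.inst [a] 0))
  | n1C {Γ b M} : Der T (.N1 :: Γ) (.ty .col M) → Der T Γ (.tm b (M.inst [.star] 0)) →
      Der T Γ (.tmEq (.elN1 .star b) b (M.inst [.star] 0))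
  /- Strong indexed sums of collections and of sets. -/
  | sigmaF {Γ A B} (s : Size) : Der T Γ (.ty s.dom A) → Der T (A :: Γ) (.ty s.dom B) →
      Der T Γ (.ty s.dom (.sigma A B))
  | sigmaFEq {Γ A A' B B'} (s : Size) : Der T Γ (.tyEq s.dom A A') →
      Der T (A :: Γ) (.tyEq s.dom B B') → Der T Γ (.ty s.dom (.sigma A B)) →
      Der T Γ (.ty s.dom (.sigma A' B')) →
      Der T Γ (.tyEq s.dom (.sigma A B) (.sigma A' B'))
  | sigmaI {Γ A B a b} : Der T Γ (.ty .col A) → Der T (A :: Γ) (.ty .col B) →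
      Der T Γ (.tm a A) → Der T Γ (.tm b (B.inst [a] 0)) →
      Der T Γ (.tm (.pair a b) (.sigma A B))
  | sigmaE {Γ A B M d m} : Der T Γ (.ty .col A) → Der T (A :: Γ) (.ty .col B) →
      Der T (.sigma A B :: Γ) (.ty .col M) → Der T Γ (.tm d (.sigma A B)) →
      Der T (B :: A :: Γ) (.tm m (M.inst [.pair (.var 1) (.var 0)] 2)) →
      Der T Γ (.tm (.elSigma d m) (M.inst [d] 0))
  | sigmaEEq {Γ A B M d d' m m'} : Der T Γ (.ty .col A) → Der T (A :: Γ) (.ty .col B) →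
      Der T (.sigma A B :: Γ) (.ty .col M) → Der T Γ (.tmEq d d' (.sigma A B)) →
      Der T (B :: A :: Γ) (.tmEq m m' (M.inst [.pair (.var 1) (.var 0)] 2)) →
      Der T Γ (.tm (.elSigma d m) (M.inst [d] 0)) →
      Der T Γ (.tm (.elSigma d' m') (M.inst [d'] 0)) →
      Der T Γ (.tmEq (.elSigma d m) (.elSigma d' m') (M.inst [d] 0))
  | sigmaC {Γ A B M a b m} : Der T Γ (.ty .col A) → Der T (A :: Γ) (.ty .col B) →
      Der T (.sigma A B :: Γ) (.ty .col M) → Der T Γ (.tm a A) →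
      Der T Γ (.tm b (B.inst [a] 0)) →
      Der T (B :: A :: Γ) (.tm m (M.inst [.pair (.var 1) (.var 0)] 2)) →
      Der T Γ (.tmEq (.elSigma (.pair a b) m) (m.inst [b, a] 0) (M.inst [.pair a b] 0))
  /- Dependent products of sets. -/
  | piF {Γ A B} : Der T Γ (.ty .set A) → Der T (A :: Γ) (.ty .set B) →
      Der T Γ (.ty .set (.pi A B))
  | piFEq {Γ A A' B B'} : Der T Γ (.tyEq .set A A') → Der T (A :: Γ) (.tyEq .set B B') →
      Der T Γ (.ty .set (.pi A B)) → Der T Γ (.ty .set (.pi A' B')) →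
      Der T Γ (.tyEq .set (.pi A B) (.pi A' B'))
  | piI {Γ A B b} : Der T Γ (.ty .set A) → Der T (A :: Γ) (.ty .set B) →
      Der T (A :: Γ) (.tm b B) → Der T Γ (.tm (.lam A b) (.pi A B))
  | piIEq {Γ A A' B b b'} : Der T Γ (.tyEq .set A A') → Der T (A :: Γ) (.tmEq b b' B) →
      Der T Γ (.tm (.lam A b) (.pi A B)) → Der T Γ (.tm (.lam A' b') (.pi A B)) →
      Der T Γ (.tmEq (.lam A b) (.lam A' b') (.pi A B))
  | piE {Γ A B f a} : Der T Γ (.ty .set A) → Der T (A :: Γ) (.ty .set B) →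
      Der T Γ (.tm f (.pi A B)) → Der T Γ (.tm a A) → Der T Γ (.tm (.app f a) (B.inst [a] 0))
  | piC {Γ A B b a} : Der T Γ (.ty .set A) → Der T (A :: Γ) (.ty .set B) →
      Der T (A :: Γ) (.tm b B) → Der T Γ (.tm a A) →
      Der T Γ (.tmEq (.app (.lam A b) a) (b.inst [a] 0) (B.inst [a] 0))
  | piEta {Γ A B f} : Der T Γ (.ty .set A) → Der T (A :: Γ) (.ty .set B) →
      Der T Γ (.tm f (.pi A B)) →
      Der T Γ (.tmEq f (.lam A (.app (f.inst [] 1) (.var 0))) (.pi A B))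
  /- Disjoint sums of sets. -/
  | sumF {Γ A B} : Der T Γ (.ty .set A) → Der T Γ (.ty .set B) → Der T Γ (.ty .set (.sum A B))
  | sumFEq {Γ A A' B B'} : Der T Γ (.tyEq .set A A') → Der T Γ (.tyEq .set B B') →
      Der T Γ (.ty .set (.sum A B)) → Der T Γ (.ty .set (.sum A' B')) →
      Der T Γ (.tyEq .set (.sum A B) (.sum A' B'))
  | sumI1 {Γ A B a} : Der T Γ (.ty .set A) → Der T Γ (.ty .set B) → Der T Γ (.tm a A) →
      Der T Γ (.tm (.inl a) (.sum A B))
  | sumI2 {Γ A B b} : Der T Γ (.ty .set A) → Der T Γ (.ty .set B) → Der T Γ (.tm b B) →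
      Der T Γ (.tm (.inr b) (.sum A B))
  | sumE {Γ A B M d m n} : Der T Γ (.ty .set A) → Der T Γ (.ty .set B) →
      Der T (.sum A B :: Γ) (.ty .col M) → Der T Γ (.tm d (.sum A B)) →
      Der T (A :: Γ) (.tm m (M.inst [.inl (.var 0)] 1)) →
      Der T (B :: Γ) (.tm n (M.inst [.inr (.var 0)] 1)) →
      Der T Γ (.tm (.elSum d m n) (M.inst [d] 0))
  | sumEEq {Γ A B M d d' m m' n n'} : Der T Γ (.ty .set A) → Der T Γ (.ty .set B) →
      Der T (.sum A B :: Γ) (.ty .col M) → Der T Γ (.tmEq d d' (.sum A B)) →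
      Der T (A :: Γ) (.tmEq m m' (M.inst [.inl (.var 0)] 1)) →
      Der T (B :: Γ) (.tmEq n n' (M.inst [.inr (.var 0)] 1)) →
      Der T Γ (.tm (.elSum d m n) (M.inst [d] 0)) →
      Der T Γ (.tm (.elSum d' m' n') (M.inst [d'] 0)) →
      Der T Γ (.tmEq (.elSum d m n) (.elSum d' m' n') (M.inst [d] 0))
  | sumC1 {Γ A B M a m n} : Der T Γ (.ty .set A) → Der T Γ (.ty .set B) →
      Der T (.sum A B :: Γ) (.ty .col M) → Der T Γ (.tm a A) →
      Der T (A :: Γ) (.tm m (M.inst [.inl (.var 0)] 1)) →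
      Der T (B :: Γ) (.tm n (M.inst [.inr (.var 0)] 1)) →
      Der T Γ (.tmEq (.elSum (.inl a) m n) (m.inst [a] 0) (M.inst [.inl a] 0))
  | sumC2 {Γ A B M b m n} : Der T Γ (.ty .set A) → Der T Γ (.ty .set B) →
      Der T (.sum A B :: Γ) (.ty .col M) → Der T Γ (.tm b B) →
      Der T (A :: Γ) (.tm m (M.inst [.inl (.var 0)] 1)) →
      Der T (B :: Γ) (.tm n (M.inst [.inr (.var 0)] 1)) →
      Der T Γ (.tmEq (.elSum (.inr b) m n) (n.inst [b] 0) (M.inst [.inr b] 0))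
  /- Lists over a set. -/
  | listF {Γ A} : Der T Γ (.ty .set A) → Der T Γ (.ty .set (.list A))
  | listFEq {Γ A A'} : Der T Γ (.tyEq .set A A') → Der T Γ (.ty .set (.list A)) →
      Der T Γ (.ty .set (.list A')) → Der T Γ (.tyEq .set (.list A) (.list A'))
  | listI1 {Γ A} : Der T Γ (.ty .set A) → Der T Γ (.tm .nil (.list A))
  | listI2 {Γ A a b} : Der T Γ (.ty .set A) → Der T Γ (.tm a (.list A)) → Der T Γ (.tm b A) →
      Der T Γ (.tm (.cons a b) (.list A))
  | listE {Γ A M a b c} : Der T Γ (.ty .set A) → Der T (.list A :: Γ) (.ty .col M) →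
      Der T Γ (.tm a (.list A)) → Der T Γ (.tm b (M.inst [.nil] 0)) →
      Der T (M.inst [.var 1] 2 :: A.inst [] 1 :: .list A :: Γ)
        (.tm c (M.inst [.cons (.var 2) (.var 1)] 3)) →
      Der T Γ (.tm (.elList A a b c) (M.inst [a] 0))
  | listEEq {Γ A A' M a a' b b' c c'} : Der T Γ (.tyEq .set A A') →
      Der T (.list A :: Γ) (.ty .col M) →
      Der T Γ (.tmEq a a' (.list A)) → Der T Γ (.tmEq b b' (M.inst [.nil] 0)) →
      Der T (M.inst [.var 1] 2 :: A.inst [] 1 :: .list A :: Γ)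
        (.tmEq c c' (M.inst [.cons (.var 2) (.var 1)] 3)) →
      Der T Γ (.tm (.elList A a b c) (M.inst [a] 0)) →
      Der T Γ (.tm (.elList A' a' b' c') (M.inst [a'] 0)) →
      Der T Γ (.tmEq (.elList A a b c) (.elList A' a' b' c') (M.inst [a] 0))
  | listC1 {Γ A M b c} : Der T Γ (.ty .set A) → Der T (.list A :: Γ) (.ty .col M) →
      Der T Γ (.tm b (M.inst [.nil] 0)) →
      Der T (M.inst [.var 1] 2 :: A.inst [] 1 :: .list A :: Γ)
        (.tm c (M.inst [.cons (.var 2) (.var 1)] 3)) →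
      Der T Γ (.tmEq (.elList A .nil b c) b (M.inst [.nil] 0))
  | listC2 {Γ A M a d b c} : Der T Γ (.ty .set A) → Der T (.list A :: Γ) (.ty .col M) →
      Der T Γ (.tm a (.list A)) → Der T Γ (.tm d A) → Der T Γ (.tm b (M.inst [.nil] 0)) →
      Der T (M.inst [.var 1] 2 :: A.inst [] 1 :: .list A :: Γ)
        (.tm c (M.inst [.cons (.var 2) (.var 1)] 3)) →
      Der T Γ (.tmEq (.elList A (.cons a d) b c) (c.inst [.elList A a b c, d, a] 0)
        (M.inst [.cons a d] 0))
  /- Quotients of sets by small equivalence relations: `R(x, y)` is `R` in the context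
  `x ∈ A, y ∈ A`. -/
  | quotF {Γ A R} : Der T Γ (.ty .set A) → Der T (A.inst [] 1 :: A :: Γ) (.props R) →
      Der T (A :: Γ) (.holds (R.inst [.var 0, .var 0] 1)) →
      Der T (.ofProp R :: A.inst [] 1 :: A :: Γ) (.holds (R.inst [.var 2, .var 1] 3)) →
      Der T (.ofProp (R.inst [.var 1, .var 2] 4) :: .ofProp (R.inst [.var 1, .var 2] 3) ::
        A.inst [] 2 :: A.inst [] 1 :: A :: Γ) (.holds (R.inst [.var 2, .var 4] 5)) →
      Der T Γ (.ty .set (.quot A R))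
  | quotFEq {Γ A A' R R'} : Der T Γ (.tyEq .set A A') →
      Der T (A.inst [] 1 :: A :: Γ) (.tyEq .props (.ofProp R) (.ofProp R')) →
      Der T Γ (.ty .set (.quot A R)) → Der T Γ (.ty .set (.quot A' R')) →
      Der T Γ (.tyEq .set (.quot A R) (.quot A' R'))
  | quotI {Γ A R a} : Der T Γ (.ty .set A) → Der T (A.inst [] 1 :: A :: Γ) (.props R) →
      Der T Γ (.ty .set (.quot A R)) → Der T Γ (.tm a A) →
      Der T Γ (.tm (.cls A R a) (.quot A R))
  | quotIEq {Γ A A' R R' a a'} : Der T Γ (.tyEq .set A A') →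
      Der T (A.inst [] 1 :: A :: Γ) (.tyEq .props (.ofProp R) (.ofProp R')) →
      Der T Γ (.tmEq a a' A) → Der T Γ (.tm (.cls A R a) (.quot A R)) →
      Der T Γ (.tm (.cls A' R' a') (.quot A R)) →
      Der T Γ (.tmEq (.cls A R a) (.cls A' R' a') (.quot A R))
  | quotEq {Γ A R a b} : Der T Γ (.ty .set A) → Der T (A.inst [] 1 :: A :: Γ) (.props R) →
      Der T Γ (.ty .set (.quot A R)) → Der T Γ (.tm a A) → Der T Γ (.tm b A) →
      Der T Γ (.holds (R.inst [b, a] 0)) →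
      Der T Γ (.tmEq (.cls A R a) (.cls A R b) (.quot A R))
  | quotEff {Γ A R a b} : Der T Γ (.ty .set A) → Der T (A.inst [] 1 :: A :: Γ) (.props R) →
      Der T Γ (.ty .set (.quot A R)) → Der T Γ (.tm a A) → Der T Γ (.tm b A) →
      Der T Γ (.tmEq (.cls A R a) (.cls A R b) (.quot A R)) →
      Der T Γ (.holds (R.inst [b, a] 0))
  | quotE {Γ A R M d m} : Der T Γ (.ty .set A) → Der T (A.inst [] 1 :: A :: Γ) (.props R) →
      Der T Γ (.ty .set (.quot A R)) → Der T (.quot A R :: Γ) (.ty .col M) →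
      Der T Γ (.tm d (.quot A R)) →
      Der T (A :: Γ) (.tm m (M.inst [.cls (A.inst [] 1) (R.inst [.var 0, .var 1] 3) (.var 0)] 1)) →
      Der T (.ofProp R :: A.inst [] 1 :: A :: Γ) (.tmEq (m.inst [.var 2] 3) (m.inst [.var 1] 3)
        (M.inst [.cls (A.inst [] 3) (R.inst [.var 0, .var 1] 5) (.var 2)] 3)) →
      Der T Γ (.tm (.elQuot A R d m) (M.inst [d] 0))
  | quotEEq {Γ A A' R R' M d d' m m'} : Der T Γ (.tyEq .set A A') →
      Der T (A.inst [] 1 :: A :: Γ) (.tyEq .props (.ofProp R) (.ofProp R')) →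
      Der T (.quot A R :: Γ) (.ty .col M) → Der T Γ (.tmEq d d' (.quot A R)) →
      Der T (A :: Γ)
        (.tmEq m m' (M.inst [.cls (A.inst [] 1) (R.inst [.var 0, .var 1] 3) (.var 0)] 1)) →
      Der T Γ (.tm (.elQuot A R d m) (M.inst [d] 0)) →
      Der T Γ (.tm (.elQuot A' R' d' m') (M.inst [d'] 0)) →
      Der T Γ (.tmEq (.elQuot A R d m) (.elQuot A' R' d' m') (M.inst [d] 0))
  | quotC {Γ A R M a m} : Der T Γ (.ty .set A) → Der T (A.inst [] 1 :: A :: Γ) (.props R) →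
      Der T Γ (.ty .set (.quot A R)) → Der T (.quot A R :: Γ) (.ty .col M) →
      Der T Γ (.tm a A) →
      Der T (A :: Γ) (.tm m (M.inst [.cls (A.inst [] 1) (R.inst [.var 0, .var 1] 3) (.var 0)] 1)) →
      Der T (.ofProp R :: A.inst [] 1 :: A :: Γ) (.tmEq (m.inst [.var 2] 3) (m.inst [.var 1] 3)
        (M.inst [.cls (A.inst [] 3) (R.inst [.var 0, .var 1] 5) (.var 2)] 3)) →
      Der T Γ (.tmEq (.elQuot A R (.cls A R a) m) (m.inst [a] 0) (M.inst [.cls A R a] 0))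
  /- The power-collection of the singleton. -/
  | powF {Γ} : Der T Γ .wf → Der T Γ (.ty .col .pow1)
  | powI {Γ φ} : Der T Γ (.props φ) → Der T Γ (.tm (.code φ) .pow1)
  | powEq {Γ φ ψ} : Der T Γ (.props φ) → Der T Γ (.props ψ) → Der T Γ (.holds (.iff φ ψ)) →
      Der T Γ (.tmEq (.code φ) (.code ψ) .pow1)
  | powEff {Γ φ ψ} : Der T Γ (.props φ) → Der T Γ (.props ψ) →
      Der T Γ (.tmEq (.code φ) (.code ψ) .pow1) → Der T Γ (.holds (.iff φ ψ))
  | powEqF {Γ a b} : Der T Γ (.tm a .pow1) → Der T Γ (.tm b .pow1) →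
      Der T Γ (.props (.eq .pow1 a b))
  | powEta {Γ a} : Der T Γ (.tm a .pow1) →
      Der T Γ (.tmEq a (.code (.eq .pow1 a (.code .top))) .pow1)
  /- The collection of functions from a set to the power-collection of the singleton. -/
  | funF {Γ A} : Der T Γ (.ty .set A) → Der T Γ (.ty .col (.funPow1 A))
  | funFEq {Γ A A'} : Der T Γ (.tyEq .set A A') → Der T Γ (.ty .col (.funPow1 A)) →
      Der T Γ (.ty .col (.funPow1 A')) → Der T Γ (.tyEq .col (.funPow1 A) (.funPow1 A'))
  | funI {Γ A b} : Der T Γ (.ty .set A) → Der T (A :: Γ) (.tm b .pow1) →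
      Der T Γ (.tm (.lam A b) (.funPow1 A))
  | funIEq {Γ A A' b b'} : Der T Γ (.tyEq .set A A') → Der T (A :: Γ) (.tmEq b b' .pow1) →
      Der T Γ (.tm (.lam A b) (.funPow1 A)) → Der T Γ (.tm (.lam A' b') (.funPow1 A)) →
      Der T Γ (.tmEq (.lam A b) (.lam A' b') (.funPow1 A))
  | funE {Γ A f a} : Der T Γ (.ty .set A) → Der T Γ (.tm f (.funPow1 A)) → Der T Γ (.tm a A) →
      Der T Γ (.tm (.app f a) .pow1)
  | funC {Γ A b a} : Der T Γ (.ty .set A) → Der T (A :: Γ) (.tm b .pow1) → Der T Γ (.tm a A) →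
      Der T Γ (.tmEq (.app (.lam A b) a) (b.inst [a] 0) .pow1)
  | funEta {Γ A f} : Der T Γ (.ty .set A) → Der T Γ (.tm f (.funPow1 A)) →
      Der T Γ (.tmEq f (.lam A (.app (f.inst [] 1) (.var 0))) (.funPow1 A))
  /- Propositions. An introduction rule asks that the proposition introduced be well formed; for
  conjunctions and implications this does not always mean that both components are (see
  `andRelF` and `impRelF`). -/
  | propMono {Γ A a b} : Der T Γ (.ty .prop A) → Der T Γ (.tm a A) → Der T Γ (.tm b A) →
      Der T Γ (.tmEq a b A)
  | propTrue {Γ A a} : Der T Γ (.ty .prop A) → Der T Γ (.tm a A) → Der T Γ (.tm .tt A)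
  | botF {Γ} : Der T Γ .wf → Der T Γ (.props .bot)
  | botE {Γ φ} : Der T Γ (.prop φ) → Der T Γ (.holds .bot) → Der T Γ (.holds φ)
  | eqF {Γ A a b} (s : Size) : Der T Γ (.ty s.dom A) → Der T Γ (.tm a A) → Der T Γ (.tm b A) →
      Der T Γ (.ty s.logic (.ofProp (.eq A a b)))
  | eqFEq {Γ A A' a a' b b'} (s : Size) : Der T Γ (.tyEq s.dom A A') →
      Der T Γ (.tmEq a a' A) → Der T Γ (.tmEq b b' A) →
      Der T Γ (.ty s.logic (.ofProp (.eq A a b))) →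
      Der T Γ (.ty s.logic (.ofProp (.eq A' a' b'))) →
      Der T Γ (.tyEq s.logic (.ofProp (.eq A a b)) (.ofProp (.eq A' a' b')))
  | eqI {Γ A a} : Der T Γ (.ty .col A) → Der T Γ (.tm a A) → Der T Γ (.holds (.eq A a a))
  | eqE {Γ A a b} : Der T Γ (.ty .col A) → Der T Γ (.tm a A) → Der T Γ (.tm b A) →
      Der T Γ (.holds (.eq A a b)) → Der T Γ (.tmEq a b A)
  | andF {Γ φ ψ} (s : Size) : Der T Γ (.ty s.logic (.ofProp φ)) →
      Der T Γ (.ty s.logic (.ofProp ψ)) → Der T Γ (.ty s.logic (.ofProp (.and φ ψ)))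
  | andFEq {Γ φ φ' ψ ψ'} (s : Size) : Der T Γ (.tyEq s.logic (.ofProp φ) (.ofProp φ')) →
      Der T Γ (.tyEq s.logic (.ofProp ψ) (.ofProp ψ')) →
      Der T Γ (.tyEq s.logic (.ofProp (.and φ ψ)) (.ofProp (.and φ' ψ')))
  | andI {Γ φ ψ} : Der T Γ (.prop (.and φ ψ)) → Der T Γ (.holds φ) → Der T Γ (.holds ψ) →
      Der T Γ (.holds (.and φ ψ))
  | andE1 {Γ φ ψ} : Der T Γ (.prop φ) → Der T Γ (.holds (.and φ ψ)) → Der T Γ (.holds φ)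
  | andE2 {Γ φ ψ} : Der T Γ (.prop ψ) → Der T Γ (.holds (.and φ ψ)) → Der T Γ (.holds ψ)
  | orF {Γ φ ψ} (s : Size) : Der T Γ (.ty s.logic (.ofProp φ)) →
      Der T Γ (.ty s.logic (.ofProp ψ)) → Der T Γ (.ty s.logic (.ofProp (.or φ ψ)))
  | orFEq {Γ φ φ' ψ ψ'} (s : Size) : Der T Γ (.tyEq s.logic (.ofProp φ) (.ofProp φ')) →
      Der T Γ (.tyEq s.logic (.ofProp ψ) (.ofProp ψ')) →
      Der T Γ (.tyEq s.logic (.ofProp (.or φ ψ)) (.ofProp (.or φ' ψ')))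
  | orI1 {Γ φ ψ} : Der T Γ (.prop φ) → Der T Γ (.prop ψ) → Der T Γ (.holds φ) →
      Der T Γ (.holds (.or φ ψ))
  | orI2 {Γ φ ψ} : Der T Γ (.prop φ) → Der T Γ (.prop ψ) → Der T Γ (.holds ψ) →
      Der T Γ (.holds (.or φ ψ))
  | orE {Γ φ ψ χ} : Der T Γ (.prop φ) → Der T Γ (.prop ψ) → Der T Γ (.prop χ) →
      Der T Γ (.holds (.or φ ψ)) → Der T (.ofProp φ :: Γ) (.holds (χ.inst [] 1)) →
      Der T (.ofProp ψ :: Γ) (.holds (χ.inst [] 1)) → Der T Γ (.holds χ)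
  | impF {Γ φ ψ} (s : Size) : Der T Γ (.ty s.logic (.ofProp φ)) →
      Der T Γ (.ty s.logic (.ofProp ψ)) → Der T Γ (.ty s.logic (.ofProp (.imp φ ψ)))
  | impFEq {Γ φ φ' ψ ψ'} (s : Size) : Der T Γ (.tyEq s.logic (.ofProp φ) (.ofProp φ')) →
      Der T Γ (.tyEq s.logic (.ofProp ψ) (.ofProp ψ')) →
      Der T Γ (.tyEq s.logic (.ofProp (.imp φ ψ)) (.ofProp (.imp φ' ψ')))
  | impI {Γ φ ψ} : Der T Γ (.prop (.imp φ ψ)) →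
      Der T (.ofProp φ :: Γ) (.holds (ψ.inst [] 1)) → Der T Γ (.holds (.imp φ ψ))
  | impE {Γ φ ψ} : Der T Γ (.prop ψ) → Der T Γ (.holds (.imp φ ψ)) → Der T Γ (.holds φ) →
      Der T Γ (.holds ψ)
  | exF {Γ A φ} (s : Size) : Der T Γ (.ty s.dom A) → Der T (A :: Γ) (.ty s.logic (.ofProp φ)) →
      Der T Γ (.ty s.logic (.ofProp (.ex A φ)))
  | exFEq {Γ A A' φ φ'} (s : Size) : Der T Γ (.tyEq s.dom A A') →
      Der T (A :: Γ) (.tyEq s.logic (.ofProp φ) (.ofProp φ')) →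
      Der T Γ (.ty s.logic (.ofProp (.ex A φ))) →
      Der T Γ (.ty s.logic (.ofProp (.ex A' φ'))) →
      Der T Γ (.tyEq s.logic (.ofProp (.ex A φ)) (.ofProp (.ex A' φ')))
  | exI {Γ A φ a} : Der T Γ (.ty .col A) → Der T (A :: Γ) (.prop φ) → Der T Γ (.tm a A) →
      Der T Γ (.holds (φ.inst [a] 0)) → Der T Γ (.holds (.ex A φ))
  | exE {Γ A φ χ} : Der T Γ (.ty .col A) → Der T (A :: Γ) (.prop φ) → Der T Γ (.prop χ) →
      Der T Γ (.holds (.ex A φ)) → Der T (.ofProp φ :: A :: Γ) (.holds (χ.inst [] 2)) →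
      Der T Γ (.holds χ)
  | allF {Γ A φ} (s : Size) : Der T Γ (.ty s.dom A) →
      Der T (A :: Γ) (.ty s.logic (.ofProp φ)) → Der T Γ (.ty s.logic (.ofProp (.all A φ)))
  | allFEq {Γ A A' φ φ'} (s : Size) : Der T Γ (.tyEq s.dom A A') →
      Der T (A :: Γ) (.tyEq s.logic (.ofProp φ) (.ofProp φ')) →
      Der T Γ (.ty s.logic (.ofProp (.all A φ))) →
      Der T Γ (.ty s.logic (.ofProp (.all A' φ'))) →
      Der T Γ (.tyEq s.logic (.ofProp (.all A φ)) (.ofProp (.all A' φ')))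
  | allI {Γ A φ} : Der T Γ (.ty .col A) → Der T (A :: Γ) (.prop φ) → Der T (A :: Γ) (.holds φ) →
      Der T Γ (.holds (.all A φ))
  | allE {Γ A φ a} : Der T Γ (.ty .col A) → Der T (A :: Γ) (.prop φ) →
      Der T Γ (.holds (.all A φ)) → Der T Γ (.tm a A) → Der T Γ (.holds (φ.inst [a] 0))
  /- Collections as definable classes. -/
  | vF {Γ} : Der T Γ .wf → Der T Γ (.ty .col .V)
  | toV {Γ a A} : Der T Γ (.tm a A) → Der T Γ (.tm a .V)
  | toVEq {Γ a b A} : Der T Γ (.tmEq a b A) → Der T Γ (.tmEq a b .V)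
  | ofVEq {Γ a b A} : Der T Γ (.tm a A) → Der T Γ (.tm b A) → Der T Γ (.tmEq a b .V) →
      Der T Γ (.tmEq a b A)
  | ofV {Γ a b A} : Der T Γ (.tm a A) → Der T Γ (.tm b .V) → Der T Γ (.tmEq a b .V) →
      Der T Γ (.tm b A)
  | eqVF {Γ a b} : Der T Γ (.tm a .V) → Der T Γ (.tm b .V) → Der T Γ (.props (.eq .V a b))
  | memF {Γ a b} : Der T Γ (.tm a .V) → Der T Γ (.tm b .V) → Der T Γ (.props (.mem a b))
  | memColF {Γ a A} : Der T Γ (.tm a .V) → Der T Γ (.ty .col A) → Der T Γ (.prop (.memCol a A))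
  | memColI {Γ a A} : Der T Γ (.ty .col A) → Der T Γ (.tm a A) → Der T Γ (.holds (.memCol a A))
  | memColE {Γ a A} : Der T Γ (.ty .col A) → Der T Γ (.tm a .V) →
      Der T Γ (.holds (.memCol a A)) → Der T Γ (.tm a A)
  | memFEq {Γ a a' b b'} : Der T Γ (.tmEq a a' .V) → Der T Γ (.tmEq b b' .V) →
      Der T Γ (.tyEq .props (.ofProp (.mem a b)) (.ofProp (.mem a' b')))
  | memColFEq {Γ a a' A A'} : Der T Γ (.tmEq a a' .V) → Der T Γ (.tyEq .col A A') →
      Der T Γ (.tyEq .prop (.ofProp (.memCol a A)) (.ofProp (.memCol a' A')))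
  | comprF {Γ φ} : Der T (.V :: Γ) (.prop φ) → Der T Γ (.ty .col (.compr φ))
  | comprMem {Γ φ a} : Der T (.V :: Γ) (.prop φ) → Der T Γ (.tm a .V) →
      Der T Γ (.holds (.iff (φ.inst [a] 0) (.memCol a (.compr φ))))
  | colExt {Γ A B} : Der T Γ (.ty .col A) → Der T Γ (.ty .col B) →
      Der T Γ (.holds (.all .V
        (.iff (.memCol (.var 0) (A.inst [] 1)) (.memCol (.var 0) (B.inst [] 1))))) →
      Der T Γ (.tyEq .col A B)
  | andRelF {Γ A φ} : Der T Γ (.ty .col A) → Der T (A :: Γ) (.prop φ) →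
      Der T (.V :: Γ) (.prop (.and (.memCol (.var 0) (A.inst [] 1)) φ))
  | exRel {Γ A φ} : Der T Γ (.ty .col A) → Der T (A :: Γ) (.prop φ) →
      Der T Γ (.holds (.iff (.ex A φ)
        (.ex .V (.and (.memCol (.var 0) (A.inst [] 1)) φ))))
  | impRelF {Γ A φ} : Der T Γ (.ty .col A) → Der T (A :: Γ) (.prop φ) →
      Der T (.V :: Γ) (.prop (.imp (.memCol (.var 0) (A.inst [] 1)) φ))
  | allRel {Γ A φ} : Der T Γ (.ty .col A) → Der T (A :: Γ) (.prop φ) →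
      Der T Γ (.holds (.iff (.all A φ)
        (.all .V (.imp (.memCol (.var 0) (A.inst [] 1)) φ))))
  /- Sets as definable sets. -/
  | setI {Γ A} : Der T Γ (.ty .col A) →
      Der T Γ (.holds (.ex .V (.all .V
        (.iff (.memCol (.var 0) (A.inst [] 2)) (.mem (.var 0) (.var 1)))))) →
      Der T Γ (.ty .set A)
  | nameI {Γ A} : Der T Γ (.ty .set A) → Der T Γ (.tm (.name A) .V)
  | nameMem {Γ A} : Der T Γ (.ty .set A) →
      Der T Γ (.holds (.all .V
        (.iff (.memCol (.var 0) (A.inst [] 1)) (.mem (.var 0) (.name (A.inst [] 1))))))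
  | collapse {Γ A B} (k : Kind) : Der T Γ (.tyEq .col A B) → Der T Γ (.ty k A) →
      Der T Γ (.ty k B) → Der T Γ (.tyEq k A B)
  /- Axiomatic set theory: rules common to the three theories. -/
  | setExt {Γ a b} : Der T Γ (.tm a .V) → Der T Γ (.tm b .V) →
      Der T Γ (.holds (.imp
        (.all .V (.iff (.mem (.var 0) (a.inst [] 1)) (.mem (.var 0) (b.inst [] 1))))
        (.eq .V a b)))
  | emptyI {Γ} : Der T Γ .wf → Der T Γ (.tm .empty .V)
  | emptyMem {Γ a} : Der T Γ (.tm a .V) → Der T Γ (.holds (.neg (.mem a .empty)))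
  | upairI {Γ a b} : Der T Γ (.tm a .V) → Der T Γ (.tm b .V) → Der T Γ (.tm (.upair a b) .V)
  | upairMem {Γ a b c} : Der T Γ (.tm a .V) → Der T Γ (.tm b .V) → Der T Γ (.tm c .V) →
      Der T Γ (.holds (.iff (.mem c (.upair a b)) (.or (.eq .V c a) (.eq .V c b))))
  | unionI {Γ a} : Der T Γ (.tm a .V) → Der T Γ (.tm (.union a) .V)
  | unionMem {Γ a b} : Der T Γ (.tm a .V) → Der T Γ (.tm b .V) →
      Der T Γ (.holds (.iff (.mem b (.union a))
        (.ex .V (.and (.mem (b.inst [] 1) (.var 0)) (.mem (.var 0) (a.inst [] 1))))))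
  | omegaI {Γ} : Der T Γ .wf → Der T Γ (.tm .omega .V)
  | omegaTrans {Γ} : Der T Γ .wf → Der T Γ (.holds (PTm.trans .omega))
  | omegaMin {Γ a} : Der T Γ (.tm a .V) →
      Der T Γ (.holds (.imp (.mem a .omega)
        (.all .V (.imp (PTm.trans (.var 0)) (.mem (a.inst [] 1) (.var 0))))))
  | memInd {Γ a φ} : Der T Γ (.tm a .V) → Der T (.V :: Γ) (.prop φ) →
      Der T Γ (.holds (.imp
        (.all .V (.imp
          (.all .V (.imp (.mem (.var 0) (.var 1)) (φ.inst [.var 0] 2)))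
          φ))
        (φ.inst [a] 0)))
  /- Rules specific to IZF and ZF. -/
  | powerI {Γ a} (hT : T ≠ .CZF) : Der T Γ (.tm a .V) → Der T Γ (.tm (.power a) .V)
  | powerMem {Γ a b} (hT : T ≠ .CZF) : Der T Γ (.tm a .V) → Der T Γ (.tm b .V) →
      Der T Γ (.holds (.iff (.mem b (.power a))
        (.all .V (.imp (.mem (.var 0) (b.inst [] 1)) (.mem (.var 0) (a.inst [] 1))))))
  | sepI {Γ a φ} (hT : T ≠ .CZF) : Der T Γ (.tm a .V) → Der T (.V :: Γ) (.prop φ) →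
      Der T Γ (.tm (.sep a φ) .V)
  | sepMem {Γ a φ b} (hT : T ≠ .CZF) : Der T Γ (.tm a .V) → Der T (.V :: Γ) (.prop φ) →
      Der T Γ (.tm b .V) →
      Der T Γ (.holds (.iff (.mem b (.sep a φ)) (.and (.mem b a) (φ.inst [b] 0))))
  | collection {Γ a φ} (hT : T ≠ .CZF) : Der T Γ (.tm a .V) →
      Der T (.V :: .V :: Γ) (.prop φ) →
      Der T Γ (.holds (.all .V (.imp (.mem (.var 0) (a.inst [] 1)) (.ex .V φ)))) →
      Der T Γ (.holds (.ex .V (.all .V (.imp (.mem (.var 0) (a.inst [] 2))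
        (.ex .V (.and (.mem (.var 0) (.var 2)) (φ.inst [.var 0, .var 1] 3)))))))
  /- The rule specific to ZF. -/
  | lem {Γ φ} (hT : T = .ZF) : Der T Γ (.prop φ) → Der T Γ (.holds (.or φ (.neg φ)))
  /- Rules specific to CZF. By the first two, bounded quantification over an element of `V`
  preserves small propositions, so that `Δ₀`-formulas denote small propositions. -/
  | bddAllF {Γ a φ} (hT : T = .CZF) : Der T Γ (.tm a .V) → Der T (.V :: Γ) (.props φ) →
      Der T Γ (.props (.all .V (.imp (.mem (.var 0) (a.inst [] 1)) φ)))
  | bddExF {Γ a φ} (hT : T = .CZF) : Der T Γ (.tm a .V) → Der T (.V :: Γ) (.props φ) →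
      Der T Γ (.props (.ex .V (.and (.mem (.var 0) (a.inst [] 1)) φ)))
  | sepIs {Γ a φ} (hT : T = .CZF) : Der T Γ (.tm a .V) → Der T (.V :: Γ) (.props φ) →
      Der T Γ (.tm (.sep a φ) .V)
  | sepMems {Γ a φ b} (hT : T = .CZF) : Der T Γ (.tm a .V) → Der T (.V :: Γ) (.props φ) →
      Der T Γ (.tm b .V) →
      Der T Γ (.holds (.iff (.mem b (.sep a φ)) (.and (.mem b a) (φ.inst [b] 0))))
  -- strong collection, for `φ` in the context `z, x, y`
  | strongColl {Γ φ} (hT : T = .CZF) : Der T (.V :: .V :: .V :: Γ) (.prop φ) →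
      Der T (.V :: Γ) (.holds (.imp
        (.all .V (.imp (.mem (.var 0) (.var 1)) (.ex .V φ)))
        (.ex .V (.and
          (.all .V (.imp (.mem (.var 0) (.var 2))
            (.ex .V (.and (.mem (.var 0) (.var 2)) (φ.inst [.var 0, .var 1, .var 3] 4)))))
          (.all .V (.imp (.mem (.var 0) (.var 1))
            (.ex .V (.and (.mem (.var 0) (.var 3)) (φ.inst [.var 1, .var 0, .var 3] 4)))))))))
  -- subset collection, for `φ` in the context `v, w, u, x, y`
  | subsetColl {Γ φ} (hT : T = .CZF) : Der T (.V :: .V :: .V :: .V :: .V :: Γ) (.prop φ) →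
      Der T Γ (.holds (.all .V (.all .V (.ex .V (.all .V (.imp
        (.all .V (.imp (.mem (.var 0) (.var 4))
          (.ex .V (.and (.mem (.var 0) (.var 4))
            (φ.inst [.var 0, .var 1, .var 2, .var 4, .var 5] 6)))))
        (.ex .V (.and (.mem (.var 0) (.var 2)) (.and
          (.all .V (.imp (.mem (.var 0) (.var 5))
            (.ex .V (.and (.mem (.var 0) (.var 2))
              (φ.inst [.var 0, .var 1, .var 3, .var 5, .var 6] 7)))))
          (.all .V (.imp (.mem (.var 0) (.var 1))
            (.ex .V (.and (.mem (.var 0) (.var 6))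
              (φ.inst [.var 1, .var 0, .var 3, .var 5, .var 6] 7))))))))))))))
  /- The set-theoretic interpretation of the canonical elements. -/
  | starEq {Γ} : Der T Γ .wf → Der T Γ (.tmEq .star .empty .N1)
  | pairEq {Γ A B a b} : Der T Γ (.ty .col A) → Der T (A :: Γ) (.ty .col B) →
      Der T Γ (.tm a A) → Der T Γ (.tm b (B.inst [a] 0)) →
      Der T Γ (.tmEq (.pair a b) (.kpair a b) (.sigma A B))
  | lamEq {Γ A B b} : Der T Γ (.ty .set A) → Der T (A :: Γ) (.ty .set B) →
      Der T (A :: Γ) (.tm b B) →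
      Der T Γ (.tmEq (.lam A b)
        (.sep (.name (.sigma A B))
          (.ex (A.inst [] 1) (.eq .V (.var 1) (.kpair (.var 0) (b.inst [.var 0] 2)))))
        (.pi A B))
  | inlEq {Γ A B a} : Der T Γ (.ty .set A) → Der T Γ (.ty .set B) → Der T Γ (.tm a A) →
      Der T Γ (.tmEq (.inl a) (.kpair .empty a) (.sum A B))
  | inrEq {Γ A B b} : Der T Γ (.ty .set A) → Der T Γ (.ty .set B) → Der T Γ (.tm b B) →
      Der T Γ (.tmEq (.inr b) (.kpair (.sing .empty) b) (.sum A B))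
  | nilEq {Γ A} : Der T Γ (.ty .set A) → Der T Γ (.tmEq .nil .empty (.list A))
  | consEq {Γ A a b} : Der T Γ (.ty .set A) → Der T Γ (.tm a (.list A)) → Der T Γ (.tm b A) →
      Der T Γ (.tmEq (.cons a b) (.union (.upair a (.sing (.kpair (.len A a) b)))) (.list A))
  -- `[a] = {x ε ⌈A⌉ | (∃ y ∈ A)(y =_V x ∧ R(y, a))}`
  | clsEq {Γ A R a} : Der T Γ (.ty .set A) → Der T (A.inst [] 1 :: A :: Γ) (.props R) →
      Der T Γ (.ty .set (.quot A R)) → Der T Γ (.tm a A) →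
      Der T Γ (.tmEq (.cls A R a)
        (.sep (.name A) (.ex (A.inst [] 1)
          (.and (.eq .V (.var 0) (.var 1)) (R.inst [a.inst [] 2, .var 0] 2))))
        (.quot A R))
  | codeEq {Γ φ} : Der T Γ (.props φ) →
      Der T Γ (.tmEq (.code φ)
        (.sep (.sing .empty) (.and (.eq .V (.var 0) .empty) (φ.inst [] 1))) .pow1)
  | lamPowEq {Γ A b} : Der T Γ (.ty .set A) → Der T (A :: Γ) (.tm b .pow1) →
      Der T Γ (.tmEq (.lam A b)
        (.name (.compr
          (.ex (A.inst [] 1) (.eq .V (.var 1) (.kpair (.var 0) (b.inst [.var 0] 2))))))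
        (.funPow1 A))
  | trueEq {Γ φ} : Der T Γ (.prop φ) → Der T Γ (.holds φ) →
      Der T Γ (.tmEq .tt .empty (.ofProp φ))

end EmTT

namespace EmTT

/-! ## Renaming and substitution -/

theorem PTm.up_var : PTm.up PTm.var = PTm.var := by
  funext i; cases i <;> rfl

theorem PTm.up_varRen (ρ : ℕ → ℕ) :
    PTm.up (fun i => .var (ρ i)) = fun i => .var (upRen ρ i) := by
  funext i; cases i <;> rfl

theorem PTm.up_comp_upRen (σ : ℕ → PTm) (ρ : ℕ → ℕ) :
    (fun i => PTm.up σ (upRen ρ i)) = PTm.up (fun i => σ (ρ i)) := by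
  funext i; cases i <;> rfl

mutual
theorem PCol.ren_eq_subst (ρ : ℕ → ℕ) (A : PCol) : A.ren ρ = A.subst (fun i => .var (ρ i)) := by
  cases A <;> simp [PCol.ren, PCol.subst, PTm.up_varRen, PCol.ren_eq_subst, PProp.ren_eq_subst]
theorem PTm.ren_eq_subst (ρ : ℕ → ℕ) (a : PTm) : a.ren ρ = a.subst (fun i => .var (ρ i)) := by
  cases a <;> simp [PTm.ren, PTm.subst, PTm.up_varRen, PCol.ren_eq_subst, PProp.ren_eq_subst,
    PTm.ren_eq_subst]
theorem PProp.ren_eq_subst (ρ : ℕ → ℕ) (φ : PProp) :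
    φ.ren ρ = φ.subst (fun i => .var (ρ i)) := by
  cases φ <;> simp [PProp.ren, PProp.subst, PTm.up_varRen, PCol.ren_eq_subst, PProp.ren_eq_subst,
    PTm.ren_eq_subst]
end

mutual
theorem PCol.subst_var (A : PCol) : A.subst .var = A := by
  cases A <;> simp [PCol.subst, PTm.up_var, PCol.subst_var, PProp.subst_var]
theorem PTm.subst_var (a : PTm) : a.subst .var = a := by
  cases a <;> simp [PTm.subst, PTm.up_var, PCol.subst_var, PProp.subst_var, PTm.subst_var]
theorem PProp.subst_var (φ : PProp) : φ.subst .var = φ := by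
  cases φ <;> simp [PProp.subst, PTm.up_var, PCol.subst_var, PProp.subst_var, PTm.subst_var]
end

mutual
theorem PCol.ren_subst (ρ : ℕ → ℕ) (σ : ℕ → PTm) (A : PCol) :
    (A.ren ρ).subst σ = A.subst (fun i => σ (ρ i)) := by
  cases A <;> simp [PCol.ren, PCol.subst, PTm.up_comp_upRen, PCol.ren_subst, PProp.ren_subst]
theorem PTm.ren_subst (ρ : ℕ → ℕ) (σ : ℕ → PTm) (a : PTm) :
    (a.ren ρ).subst σ = a.subst (fun i => σ (ρ i)) := by
  cases a <;> simp [PTm.ren, PTm.subst, PTm.up_comp_upRen, PCol.ren_subst, PProp.ren_subst,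
    PTm.ren_subst]
theorem PProp.ren_subst (ρ : ℕ → ℕ) (σ : ℕ → PTm) (φ : PProp) :
    (φ.ren ρ).subst σ = φ.subst (fun i => σ (ρ i)) := by
  cases φ <;> simp [PProp.ren, PProp.subst, PTm.up_comp_upRen, PCol.ren_subst, PProp.ren_subst,
    PTm.ren_subst]
end

theorem PTm.ren_ren (ρ ρ' : ℕ → ℕ) (a : PTm) : (a.ren ρ).ren ρ' = a.ren (fun i => ρ' (ρ i)) := by
  rw [PTm.ren_eq_subst ρ', PTm.ren_subst, PTm.ren_eq_subst]
theorem PProp.ren_ren (ρ ρ' : ℕ → ℕ) (a : PProp) :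
    (a.ren ρ).ren ρ' = a.ren (fun i => ρ' (ρ i)) := by
  rw [PProp.ren_eq_subst ρ', PProp.ren_subst, PProp.ren_eq_subst]

theorem PTm.up_ren_upRen (σ : ℕ → PTm) (ρ : ℕ → ℕ) :
    (fun i => (PTm.up σ i).ren (upRen ρ)) = PTm.up (fun i => (σ i).ren ρ) := by
  funext i; cases i
  · rfl
  · simp [PTm.up, PTm.ren_ren, upRen]

mutual
theorem PCol.subst_ren (σ : ℕ → PTm) (ρ : ℕ → ℕ) (A : PCol) :
    (A.subst σ).ren ρ = A.subst (fun i => (σ i).ren ρ) := by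
  cases A <;> simp [PCol.ren, PCol.subst, PTm.up_ren_upRen, PCol.subst_ren, PProp.subst_ren]
theorem PTm.subst_ren (σ : ℕ → PTm) (ρ : ℕ → ℕ) (a : PTm) :
    (a.subst σ).ren ρ = a.subst (fun i => (σ i).ren ρ) := by
  cases a <;> simp [PTm.ren, PTm.subst, PTm.up_ren_upRen, PCol.subst_ren, PProp.subst_ren,
    PTm.subst_ren]
theorem PProp.subst_ren (σ : ℕ → PTm) (ρ : ℕ → ℕ) (φ : PProp) :
    (φ.subst σ).ren ρ = φ.subst (fun i => (σ i).ren ρ) := by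
  cases φ <;> simp [PProp.ren, PProp.subst, PTm.up_ren_upRen, PCol.subst_ren, PProp.subst_ren,
    PTm.subst_ren]
end

theorem PTm.up_subst_up (σ τ : ℕ → PTm) :
    (fun i => (PTm.up σ i).subst (PTm.up τ)) = PTm.up (fun i => (σ i).subst τ) := by
  funext i; cases i
  · rfl
  · simp [PTm.up, PTm.ren_subst, PTm.subst_ren]

mutual
theorem PCol.subst_subst (σ τ : ℕ → PTm) (A : PCol) :
    (A.subst σ).subst τ = A.subst (fun i => (σ i).subst τ) := by
  cases A <;> simp [PCol.subst, PTm.up_subst_up, PCol.subst_subst, PProp.subst_subst]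
theorem PTm.subst_subst (σ τ : ℕ → PTm) (a : PTm) :
    (a.subst σ).subst τ = a.subst (fun i => (σ i).subst τ) := by
  cases a <;> simp [PTm.subst, PTm.up_subst_up, PCol.subst_subst, PProp.subst_subst,
    PTm.subst_subst]
theorem PProp.subst_subst (σ τ : ℕ → PTm) (φ : PProp) :
    (φ.subst σ).subst τ = φ.subst (fun i => (σ i).subst τ) := by
  cases φ <;> simp [PProp.subst, PTm.up_subst_up, PCol.subst_subst, PProp.subst_subst,
    PTm.subst_subst]
end

/-! The same for the language of set theory. -/

theorem STm.up_varRen (ρ : ℕ → ℕ) :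
    STm.up (fun i => .var (ρ i)) = fun i => .var (upRen ρ i) := by
  funext i; cases i <;> rfl

theorem STm.up_comp_upRen (σ : ℕ → STm) (ρ : ℕ → ℕ) :
    (fun i => STm.up σ (upRen ρ i)) = STm.up (fun i => σ (ρ i)) := by
  funext i; cases i <;> rfl

mutual
theorem STm.ren_eq_subst (ρ : ℕ → ℕ) (a : STm) : a.ren ρ = a.subst (fun i => .var (ρ i)) := by
  cases a <;> simp [STm.ren, STm.subst, STm.up_varRen, STm.ren_eq_subst, SFm.ren_eq_subst]
theorem SFm.ren_eq_subst (ρ : ℕ → ℕ) (φ : SFm) : φ.ren ρ = φ.subst (fun i => .var (ρ i)) := by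
  cases φ <;> simp [SFm.ren, SFm.subst, STm.up_varRen, STm.ren_eq_subst, SFm.ren_eq_subst]
end

mutual
theorem STm.ren_subst (ρ : ℕ → ℕ) (σ : ℕ → STm) (a : STm) :
    (a.ren ρ).subst σ = a.subst (fun i => σ (ρ i)) := by
  cases a <;> simp [STm.ren, STm.subst, STm.up_comp_upRen, STm.ren_subst, SFm.ren_subst]
theorem SFm.ren_subst (ρ : ℕ → ℕ) (σ : ℕ → STm) (φ : SFm) :
    (φ.ren ρ).subst σ = φ.subst (fun i => σ (ρ i)) := by
  cases φ <;> simp [SFm.ren, SFm.subst, STm.up_comp_upRen, STm.ren_subst, SFm.ren_subst]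
end

theorem STm.ren_ren (ρ ρ' : ℕ → ℕ) (a : STm) : (a.ren ρ).ren ρ' = a.ren (fun i => ρ' (ρ i)) := by
  rw [STm.ren_eq_subst ρ', STm.ren_subst, STm.ren_eq_subst]

theorem STm.up_ren_upRen (σ : ℕ → STm) (ρ : ℕ → ℕ) :
    (fun i => (STm.up σ i).ren (upRen ρ)) = STm.up (fun i => (σ i).ren ρ) := by
  funext i; cases i
  · rfl
  · simp [STm.up, STm.ren_ren, upRen]

mutual
theorem STm.subst_ren (σ : ℕ → STm) (ρ : ℕ → ℕ) (a : STm) :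
    (a.subst σ).ren ρ = a.subst (fun i => (σ i).ren ρ) := by
  cases a <;> simp [STm.ren, STm.subst, STm.up_ren_upRen, STm.subst_ren, SFm.subst_ren]
theorem SFm.subst_ren (σ : ℕ → STm) (ρ : ℕ → ℕ) (φ : SFm) :
    (φ.subst σ).ren ρ = φ.subst (fun i => (σ i).ren ρ) := by
  cases φ <;> simp [SFm.ren, SFm.subst, STm.up_ren_upRen, STm.subst_ren, SFm.subst_ren]
end

theorem STm.up_subst_up (σ τ : ℕ → STm) :
    (fun i => (STm.up σ i).subst (STm.up τ)) = STm.up (fun i => (σ i).subst τ) := by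
  funext i; cases i
  · rfl
  · simp [STm.up, STm.ren_subst, STm.subst_ren]

mutual
theorem STm.subst_subst (σ τ : ℕ → STm) (a : STm) :
    (a.subst σ).subst τ = a.subst (fun i => (σ i).subst τ) := by
  cases a <;> simp [STm.subst, STm.up_subst_up, STm.subst_subst, SFm.subst_subst]
theorem SFm.subst_subst (σ τ : ℕ → STm) (φ : SFm) :
    (φ.subst σ).subst τ = φ.subst (fun i => (σ i).subst τ) := by
  cases φ <;> simp [SFm.subst, STm.up_subst_up, STm.subst_subst, SFm.subst_subst]
end

theorem STm.up_tilde (σ : ℕ → STm) :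
    (∀ a : STm, ∀ ρ, (a.ren ρ).tilde = a.tilde.ren ρ) →
    (fun i => (STm.up σ i).tilde) = PTm.up (fun i => (σ i).tilde) := by
  intro h; funext i; cases i
  · rfl
  · simp [STm.up, PTm.up, h]

mutual
theorem STm.tilde_ren (ρ : ℕ → ℕ) (a : STm) : (a.ren ρ).tilde = a.tilde.ren ρ := by
  cases a <;> simp [STm.ren, STm.tilde, PTm.ren, STm.tilde_ren, SFm.tilde_ren]
theorem SFm.tilde_ren (ρ : ℕ → ℕ) (φ : SFm) : (φ.ren ρ).tilde = φ.tilde.ren ρ := by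
  cases φ <;> simp [SFm.ren, SFm.tilde, PProp.ren, PCol.ren, STm.tilde_ren, SFm.tilde_ren]
end

mutual
theorem STm.tilde_subst (σ : ℕ → STm) (a : STm) :
    (a.subst σ).tilde = a.tilde.subst (fun i => (σ i).tilde) := by
  have := STm.up_tilde σ fun a ρ => STm.tilde_ren ρ a
  cases a <;> simp [STm.subst, STm.tilde, PTm.subst, STm.tilde_subst, SFm.tilde_subst, this]
theorem SFm.tilde_subst (σ : ℕ → STm) (φ : SFm) :
    (φ.subst σ).tilde = φ.tilde.subst (fun i => (σ i).tilde) := by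
  have := STm.up_tilde σ fun a ρ => STm.tilde_ren ρ a
  cases φ <;> simp [SFm.subst, SFm.tilde, PProp.subst, PCol.subst, STm.tilde_subst,
    SFm.tilde_subst, this]
end

end EmTT

namespace EmTT

set_option linter.unusedSimpArgs false

/-! ## Iterated lifting -/

/-- Lifting of a renaming under `n` binders. -/
def upn : ℕ → (ℕ → ℕ) → ℕ → ℕ
  | 0, ρ => ρ
  | n + 1, ρ => upRen (upn n ρ)

theorem upn_zero (ρ : ℕ → ℕ) : upn 0 ρ = ρ := rfl

theorem upRen_eq_upn (ρ : ℕ → ℕ) : upRen ρ = upn 1 ρ := rfl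

theorem upn_upn (m n : ℕ) (ρ : ℕ → ℕ) : upn m (upn n ρ) = upn (m + n) ρ := by
  induction m with
  | zero => simp [upn]
  | succ m ih => rw [show m + 1 + n = (m + n) + 1 by omega]; simp [upn, ih]

theorem upn_add (n i : ℕ) (ρ : ℕ → ℕ) : upn n ρ (i + n) = ρ i + n := by
  induction n with
  | zero => rfl
  | succ n ih => show upRen (upn n ρ) ((i + n) + 1) = _; simp [upRen, ih]; omega

theorem upn_lt {n i : ℕ} (ρ : ℕ → ℕ) (h : i < n) : upn n ρ i = i := by
  induction n generalizing i with
  | zero => omega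
  | succ n ih => cases i with
    | zero => rfl
    | succ i => show upn n ρ i + 1 = _; rw [ih (by omega)]

/-- Lifting of a substitution under `n` binders. -/
def ups : ℕ → (ℕ → PTm) → ℕ → PTm
  | 0, σ => σ
  | n + 1, σ => PTm.up (ups n σ)

theorem ups_zero (σ : ℕ → PTm) : ups 0 σ = σ := rfl

theorem up_eq_ups (σ : ℕ → PTm) : PTm.up σ = ups 1 σ := rfl

theorem ups_ups (m n : ℕ) (σ : ℕ → PTm) : ups m (ups n σ) = ups (m + n) σ := by
  induction m with
  | zero => simp [ups]
  | succ m ih => rw [show m + 1 + n = (m + n) + 1 by omega]; simp [ups, ih]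

theorem ups_add (n i : ℕ) (σ : ℕ → PTm) : ups n σ (i + n) = (σ i).ren (· + n) := by
  induction n with
  | zero =>
    simp only [ups, Nat.add_zero, PTm.ren_eq_subst]
    exact ((σ i).subst_var).symm
  | succ n ih =>
    show (ups n σ (i + n)).ren Nat.succ = _
    rw [ih, PTm.ren_ren]; rfl

theorem ups_lt {n i : ℕ} (σ : ℕ → PTm) (h : i < n) : ups n σ i = .var i := by
  induction n generalizing i with
  | zero => omega
  | succ n ih => cases i with
    | zero => rfl
    | succ i => show (ups n σ i).ren Nat.succ = _; rw [ih (by omega)]; rfl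

theorem STm.sb_add (l : List STm) (m i : ℕ) : STm.sb l m (i + l.length) = .var (i + m) := by
  induction l with
  | nil => rfl
  | cons t l ih => exact ih

theorem STm.sb_lt (l : List STm) (m : ℕ) {i : ℕ} (h : i < l.length) : STm.sb l m i = l[i] := by
  induction l generalizing i with
  | nil => simp at h
  | cons t l ih => cases i with
    | zero => rfl
    | succ i => exact ih (by simpa using h)

theorem PTm.sb_add (l : List PTm) (m i : ℕ) : PTm.sb l m (i + l.length) = .var (i + m) := by
  induction l with
  | nil => rfl
  | cons t l ih => exact ih

theorem PTm.sb_lt (l : List PTm) (m : ℕ) {i : ℕ} (h : i < l.length) : PTm.sb l m i = l[i] := by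
  induction l generalizing i with
  | nil => simp at h
  | cons t l ih => cases i with
    | zero => rfl
    | succ i => exact ih (by simpa using h)

theorem STm.sb_ren (l : List STm) {m n : ℕ} (h : m ≤ n) (ρ : ℕ → ℕ) :
    (fun i => (STm.sb l m i).ren (upn n ρ)) =
      fun i => STm.sb (l.map (·.ren (upn n ρ))) m (upn (l.length + (n - m)) ρ i) := by
  obtain ⟨d, rfl⟩ := Nat.exists_eq_add_of_le h
  funext i
  rw [Nat.add_sub_cancel_left, ← upn_upn l.length]
  rcases lt_or_ge i l.length with hi | hi
  · rw [upn_lt _ hi, STm.sb_lt _ _ hi, STm.sb_lt _ _ (by simpa using hi)]; simp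
  · obtain ⟨j, rfl⟩ := Nat.exists_eq_add_of_le' hi
    have h2 := STm.sb_add (l.map (·.ren (upn (m + d) ρ))) m (upn d ρ j)
    rw [List.length_map] at h2
    rw [upn_add, STm.sb_add, h2, ← upn_upn, STm.ren, upn_add]

theorem PTm.sb_ren (l : List PTm) {m n : ℕ} (h : m ≤ n) (ρ : ℕ → ℕ) :
    (fun i => (PTm.sb l m i).ren (upn n ρ)) =
      fun i => PTm.sb (l.map (·.ren (upn n ρ))) m (upn (l.length + (n - m)) ρ i) := by
  obtain ⟨d, rfl⟩ := Nat.exists_eq_add_of_le h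
  funext i
  rw [Nat.add_sub_cancel_left, ← upn_upn l.length]
  rcases lt_or_ge i l.length with hi | hi
  · rw [upn_lt _ hi, PTm.sb_lt _ _ hi, PTm.sb_lt _ _ (by simpa using hi)]; simp
  · obtain ⟨j, rfl⟩ := Nat.exists_eq_add_of_le' hi
    have h2 := PTm.sb_add (l.map (·.ren (upn (m + d) ρ))) m (upn d ρ j)
    rw [List.length_map] at h2
    rw [upn_add, PTm.sb_add, h2, ← upn_upn, PTm.ren, upn_add]

theorem PTm.sb_subst (l : List PTm) {m n : ℕ} (h : m ≤ n) (σ : ℕ → PTm) :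
    (fun i => (PTm.sb l m i).subst (ups n σ)) =
      fun i => (ups (l.length + (n - m)) σ i).subst (PTm.sb (l.map (·.subst (ups n σ))) m) := by
  obtain ⟨d, rfl⟩ := Nat.exists_eq_add_of_le h
  funext i
  rw [Nat.add_sub_cancel_left, ← ups_ups l.length]
  rcases lt_or_ge i l.length with hi | hi
  · rw [ups_lt _ hi, PTm.sb_lt _ _ hi, PTm.subst, PTm.sb_lt _ _ (by simpa using hi)]; simp
  · obtain ⟨j, rfl⟩ := Nat.exists_eq_add_of_le' hi
    rw [ups_add, PTm.sb_add, ← ups_ups, PTm.subst, ups_add, PTm.ren_subst, PTm.ren_eq_subst]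
    congr 1; funext k
    have h2 := PTm.sb_add (l.map (·.subst (ups m (ups d σ)))) m k
    rw [List.length_map] at h2
    rw [h2]

theorem SFm.inst_ren (φ : SFm) (l : List STm) {m n : ℕ} (h : m ≤ n) (ρ : ℕ → ℕ) :
    (φ.inst l m).ren (upn n ρ) =
      (φ.ren (upn (l.length + (n - m)) ρ)).inst (l.map (·.ren (upn n ρ))) m := by
  rw [SFm.inst, SFm.subst_ren, STm.sb_ren l h, SFm.inst, SFm.ren_subst]

theorem STm.inst_ren (φ : STm) (l : List STm) {m n : ℕ} (h : m ≤ n) (ρ : ℕ → ℕ) :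
    (φ.inst l m).ren (upn n ρ) =
      (φ.ren (upn (l.length + (n - m)) ρ)).inst (l.map (·.ren (upn n ρ))) m := by
  rw [STm.inst, STm.subst_ren, STm.sb_ren l h, STm.inst, STm.ren_subst]

theorem PCol.inst_ren (φ : PCol) (l : List PTm) {m n : ℕ} (h : m ≤ n) (ρ : ℕ → ℕ) :
    (φ.inst l m).ren (upn n ρ) =
      (φ.ren (upn (l.length + (n - m)) ρ)).inst (l.map (·.ren (upn n ρ))) m := by
  rw [PCol.inst, PCol.subst_ren, PTm.sb_ren l h, PCol.inst, PCol.ren_subst]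

theorem PTm.inst_ren (φ : PTm) (l : List PTm) {m n : ℕ} (h : m ≤ n) (ρ : ℕ → ℕ) :
    (φ.inst l m).ren (upn n ρ) =
      (φ.ren (upn (l.length + (n - m)) ρ)).inst (l.map (·.ren (upn n ρ))) m := by
  rw [PTm.inst, PTm.subst_ren, PTm.sb_ren l h, PTm.inst, PTm.ren_subst]

theorem PProp.inst_ren (φ : PProp) (l : List PTm) {m n : ℕ} (h : m ≤ n) (ρ : ℕ → ℕ) :
    (φ.inst l m).ren (upn n ρ) =
      (φ.ren (upn (l.length + (n - m)) ρ)).inst (l.map (·.ren (upn n ρ))) m := by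
  rw [PProp.inst, PProp.subst_ren, PTm.sb_ren l h, PProp.inst, PProp.ren_subst]

theorem PCol.inst_subst (φ : PCol) (l : List PTm) {m n : ℕ} (h : m ≤ n) (σ : ℕ → PTm) :
    (φ.inst l m).subst (ups n σ) =
      (φ.subst (ups (l.length + (n - m)) σ)).inst (l.map (·.subst (ups n σ))) m := by
  rw [PCol.inst, PCol.subst_subst, PTm.sb_subst l h, PCol.inst, PCol.subst_subst]

theorem PTm.inst_subst (φ : PTm) (l : List PTm) {m n : ℕ} (h : m ≤ n) (σ : ℕ → PTm) :
    (φ.inst l m).subst (ups n σ) =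
      (φ.subst (ups (l.length + (n - m)) σ)).inst (l.map (·.subst (ups n σ))) m := by
  rw [PTm.inst, PTm.subst_subst, PTm.sb_subst l h, PTm.inst, PTm.subst_subst]

theorem PProp.inst_subst (φ : PProp) (l : List PTm) {m n : ℕ} (h : m ≤ n) (σ : ℕ → PTm) :
    (φ.inst l m).subst (ups n σ) =
      (φ.subst (ups (l.length + (n - m)) σ)).inst (l.map (·.subst (ups n σ))) m := by
  rw [PProp.inst, PProp.subst_subst, PTm.sb_subst l h, PProp.inst, PProp.subst_subst]

/-! ## The translations commute with renaming -/

theorem STm.fst_ren (ρ : ℕ → ℕ) (a : STm) : a.fst.ren ρ = (a.ren ρ).fst := by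
  simp [STm.fst, STm.ren, SFm.ren, upRen_eq_upn, upn_upn, STm.inst_ren, upn_lt, upn_zero]

theorem STm.snd_ren (ρ : ℕ → ℕ) (a : STm) : a.snd.ren ρ = (a.ren ρ).snd := by
  simp [STm.snd, STm.ren, SFm.ren, STm.sing, STm.fst_ren, upRen_eq_upn, upn_upn, STm.inst_ren,
    upn_lt, upn_zero]

theorem STm.len_ren (ρ : ℕ → ℕ) (a : STm) : a.len.ren ρ = (a.ren ρ).len := by
  simp [STm.len, STm.ren, SFm.ren, STm.pair, STm.sing, upRen_eq_upn, upn_upn, STm.inst_ren,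
    upn_lt, upn_zero]

theorem svl_ren (ρ : ℕ → ℕ) (f : STm) : (svl f).ren ρ = svl (f.ren ρ) := by
  simp [svl, STm.ren, SFm.ren, STm.pair, STm.sing, upRen_eq_upn, upn_upn, STm.inst_ren,
    upn_lt, upn_zero]

theorem etaPi_ren (ρ : ℕ → ℕ) (α β : SFm) :
    (etaPi α β).ren (upRen ρ) = etaPi (α.ren (upRen ρ)) (β.ren (upRen (upRen ρ))) := by
  simp [etaPi, svl_ren, STm.ren, SFm.ren, STm.pair, STm.sing, upRen_eq_upn, upn_upn,
    SFm.inst_ren, upn_lt, upn_zero]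

theorem etaPow1_ren (ρ : ℕ → ℕ) : etaPow1.ren (upRen ρ) = etaPow1 := by
  simp [etaPow1, STm.sub, STm.ren, SFm.ren, STm.sing, upRen_eq_upn, upn_upn,
    STm.inst_ren, upn_lt, upn_zero]

theorem etaList_ren (ρ : ℕ → ℕ) (α : SFm) :
    (etaList α).ren (upRen ρ) = etaList (α.ren (upRen ρ)) := by
  simp [etaList, svl_ren, STm.ren, SFm.ren, STm.pair, STm.sing, upRen_eq_upn, upn_upn,
    SFm.inst_ren, upn_lt, upn_zero]

theorem classOf_ren (ρ : ℕ → ℕ) (γ α R : SFm) :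
    (classOf γ α R).ren (upRen ρ) =
      classOf (γ.ren (upRen ρ)) (α.ren (upRen ρ)) (R.ren (upRen (upRen ρ))) := by
  simp [classOf, STm.ren, SFm.ren, SFm.iff, upRen_eq_upn, upn_upn,
    SFm.inst_ren, upn_lt, upn_zero]

theorem etaList_upn (ρ : ℕ → ℕ) (α : SFm) :
    (etaList α).ren (upn 1 ρ) = etaList (α.ren (upn 1 ρ)) := etaList_ren ρ α

mutual
theorem PCol.eta_ren (ρ : ℕ → ℕ) (A : PCol) : (A.ren ρ).eta = A.eta.ren (upRen ρ) := by
  cases A <;> simp only [PCol.ren, PCol.eta, PCol.eta_ren, PProp.hat_ren, etaList_ren, etaPi_ren,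
    etaPow1_ren, classOf_ren] <;>
  simp [STm.ren, SFm.ren, STm.pair, STm.sing, STm.one, upRen_eq_upn, upn_upn,
    SFm.inst_ren, upn_lt, upn_zero]
theorem PTm.delta_ren (ρ : ℕ → ℕ) (a : PTm) : (a.ren ρ).delta = a.delta.ren (upRen ρ) := by
  cases a <;> simp only [PTm.ren, PTm.delta, PCol.eta_ren, PTm.delta_ren, PProp.hat_ren, etaList_ren,
    etaPi_ren, etaPow1_ren, classOf_ren] <;>
  simp [STm.ren, SFm.ren, SFm.iff, STm.pair, STm.sing, STm.one, STm.cup, STm.fst_ren, STm.snd_ren,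
    STm.len_ren, svl_ren, STm.sub, upRen_eq_upn, upn_upn, etaList_upn, STm.inst_ren,
    SFm.inst_ren, upn_lt, upn_zero]
  all_goals rfl
theorem PProp.hat_ren (ρ : ℕ → ℕ) (φ : PProp) : (φ.ren ρ).hat = φ.hat.ren ρ := by
  cases φ <;> simp only [PProp.ren, PProp.hat, PCol.eta_ren, PTm.delta_ren, PProp.hat_ren] <;>
  simp [STm.ren, SFm.ren, upRen_eq_upn, upn_upn, SFm.inst_ren, upn_lt, upn_zero]
end

end EmTT

namespace EmTT

variable {T : SetTheory}

/-! ## Basic properties of derivations -/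

/-- Every initial segment of a context is well formed. -/
def Ctx.Ok (T : SetTheory) : Ctx → Prop
  | [] => True
  | A :: Γ => Der T Γ (.ty .col A) ∧ Der T Γ .wf ∧ Ctx.Ok T Γ

theorem Der.wf_ok {Γ : Ctx} {J : Jdg} (h : Der T Γ J) : Der T Γ .wf ∧ Ctx.Ok T Γ := by
  induction h
  case nil => exact ⟨.nil, trivial⟩
  case cons h ih => exact ⟨.cons h, h, ih.1, ih.2⟩
  case andRelF h _ ih _ => exact ⟨.cons (.vF ih.1), .vF ih.1, ih⟩
  case impRelF h _ ih _ => exact ⟨.cons (.vF ih.1), .vF ih.1, ih⟩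
  all_goals first
    | assumption
    | (rename_i ih; exact ⟨ih.2.2.1, ih.2.2.2⟩)
    | (rename_i ih; exact ⟨ih.2.2.2.2.1, ih.2.2.2.2.2⟩)
    | (rename_i ih; exact ⟨ih.2.2.2.2.2.2.2.2.2.2.1, ih.2.2.2.2.2.2.2.2.2.2.2⟩)

theorem Der.wf {Γ : Ctx} {J : Jdg} (h : Der T Γ J) : Der T Γ .wf := h.wf_ok.1

theorem Der.head {Γ : Ctx} {A : PCol} {J : Jdg} (h : Der T (A :: Γ) J) : Der T Γ (.ty .col A) :=
  h.wf_ok.2.1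

theorem Der.tail {Γ : Ctx} {A : PCol} {J : Jdg} (h : Der T (A :: Γ) J) : Der T Γ .wf :=
  h.wf_ok.2.2.1

theorem Ctx.Has.lt {Γ : Ctx} {i : ℕ} {A : PCol} (h : Γ.Has i A) : i < Γ.length := by
  induction h <;> simp_all

theorem Ctx.exists_has {Γ : Ctx} {i : ℕ} (h : i < Γ.length) : ∃ A, Γ.Has i A := by
  induction Γ generalizing i with
  | nil => simp at h
  | cons A Γ ih => cases i with
    | zero => exact ⟨_, .zero⟩
    | succ i =>
      obtain ⟨B, hB⟩ := ih (by simpa using h)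
      exact ⟨_, .succ hB⟩

theorem Ctx.Has.unique {Γ : Ctx} {i : ℕ} {A B : PCol} (h : Γ.Has i A) (h' : Γ.Has i B) :
    A = B := by
  induction h generalizing B with
  | zero => cases h'; rfl
  | succ _ ih => cases h' with | succ h' => rw [ih h']

/-! Derivable judgements only contain variables that are declared. -/

def Jdg.ren (ρ : ℕ → ℕ) : Jdg → Jdg
  | .wf => .wf
  | .ty k A => .ty k (A.ren ρ)
  | .tyEq k A B => .tyEq k (A.ren ρ) (B.ren ρ)
  | .tm a A => .tm (a.ren ρ) (A.ren ρ)
  | .tmEq a b A => .tmEq (a.ren ρ) (b.ren ρ) (A.ren ρ)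

/-- `ρ` is the identity below `n`. -/
def Fixes (n : ℕ) (ρ : ℕ → ℕ) : Prop := ∀ i < n, ρ i = i

theorem fixes_upn {n k : ℕ} {ρ : ℕ → ℕ} : Fixes (n + k) (upn k ρ) ↔ Fixes n ρ := by
  constructor
  · intro h i hi
    have := h (i + k) (by omega)
    rw [upn_add] at this; omega
  · intro h i hi
    rcases lt_or_ge i k with hk | hk
    · exact upn_lt _ hk
    · obtain ⟨j, rfl⟩ := Nat.exists_eq_add_of_le' hk
      rw [upn_add, h j (by omega)]

theorem fixes_upn1 {n : ℕ} {ρ : ℕ → ℕ} : Fixes (n + 1) (upn 1 ρ) ↔ Fixes n ρ := fixes_upn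
theorem fixes_upn2 {n : ℕ} {ρ : ℕ → ℕ} : Fixes (n + 1 + 1) (upn 2 ρ) ↔ Fixes n ρ :=
  fixes_upn (k := 2)
theorem fixes_upn3 {n : ℕ} {ρ : ℕ → ℕ} : Fixes (n + 1 + 1 + 1) (upn 3 ρ) ↔ Fixes n ρ :=
  fixes_upn (k := 3)
theorem fixes_upn5 {n : ℕ} {ρ : ℕ → ℕ} :
    Fixes (n + 1 + 1 + 1 + 1 + 1) (upn 5 ρ) ↔ Fixes n ρ := fixes_upn (k := 5)

theorem PCol.inst_ren_zero (A : PCol) (l : List PTm) (ρ : ℕ → ℕ) :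
    (A.inst l 0).ren ρ = (A.ren (upn l.length ρ)).inst (l.map (·.ren ρ)) 0 :=
  PCol.inst_ren (n := 0) A l le_rfl ρ
theorem PTm.inst_ren_zero (A : PTm) (l : List PTm) (ρ : ℕ → ℕ) :
    (A.inst l 0).ren ρ = (A.ren (upn l.length ρ)).inst (l.map (·.ren ρ)) 0 :=
  PTm.inst_ren (n := 0) A l le_rfl ρ
theorem PProp.inst_ren_zero (A : PProp) (l : List PTm) (ρ : ℕ → ℕ) :
    (A.inst l 0).ren ρ = (A.ren (upn l.length ρ)).inst (l.map (·.ren ρ)) 0 :=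
  PProp.inst_ren (n := 0) A l le_rfl ρ

def Ctx.Closed : Ctx → Prop
  | [] => True
  | A :: Γ => (∀ ρ, Fixes Γ.length ρ → A.ren ρ = A) ∧ Closed Γ

theorem PCol.wk_ren (A : PCol) (n : ℕ) (h : ∀ ρ, Fixes n ρ → A.ren ρ = A) (ρ : ℕ → ℕ)
    (hρ : Fixes (n + 1) ρ) : (A.inst [] 1).ren ρ = A.inst [] 1 := by
  have h1 : A = A.ren (fun i => if i < n then i else ρ (i + 1) - 1) :=
    (h _ fun i hi => by simp [hi]).symm
  by_cases hz : ∀ i, ρ (i + 1) ≠ 0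
  · conv_rhs => rw [h1]
    rw [PCol.inst, PCol.subst_ren, PCol.inst, PCol.ren_subst]
    congr 1; funext i
    simp only [PTm.sb, PTm.ren]
    split
    · rw [hρ _ (by omega)]
    · rw [Nat.sub_add_cancel (by have := hz i; omega)]
  · let ρ' : ℕ → ℕ := fun i => if i < n then i else n
    have h2 : A = A.ren ρ' := (h _ fun i hi => by simp [ρ', hi]).symm
    let ρ'' : ℕ → ℕ := fun i => if i < n then i else n + 1
    have h3 : A = A.ren ρ'' := (h _ fun i hi => by simp [ρ'', hi]).symm
    let τ : ℕ → PTm := fun i => if i < n then .var (i + 1) else if i = n then .var (ρ (n + 1))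
      else .var (n + 2)
    have e1 : (A.inst [] 1).ren ρ = A.subst τ := by
      conv_lhs => rw [h2]
      conv_rhs => rw [h2]
      rw [PCol.inst, PCol.subst_ren, PCol.ren_subst, PCol.ren_subst]
      congr 1; funext i
      simp only [PTm.sb, PTm.ren, ρ', τ]
      by_cases hi : i < n
      · simp [hi, hρ (i + 1) (by omega)]
      · simp [hi]
    have e2 : A.inst [] 1 = A.subst τ := by
      conv_lhs => rw [h3]
      conv_rhs => rw [h3]
      rw [PCol.inst, PCol.ren_subst, PCol.ren_subst]
      congr 1; funext i
      simp only [PTm.sb, ρ'', τ]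
      by_cases hi : i < n
      · simp [hi]
      · simp [hi]
    rw [e1, e2]

theorem Ctx.Closed.has {Γ : Ctx} (h : Γ.Closed) {i : ℕ} {A : PCol} (hA : Γ.Has i A) :
    ∀ ρ, Fixes Γ.length ρ → A.ren ρ = A := by
  induction hA with
  | zero => exact PCol.wk_ren _ _ h.1
  | succ _ ih => exact PCol.wk_ren _ _ (ih h.2)

/-- The two substitutions agree below `n`. -/
theorem Jdg.subst_congr_of_ren_le {J : Jdg} {n : ℕ}
    (h : ∀ ρ, Fixes n ρ → (∀ i, n ≤ i → n ≤ ρ i) → J.ren ρ = J)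
    {σ τ : ℕ → PTm} (hσ : ∀ i < n, σ i = τ i) : J.subst σ = J.subst τ := by
  let ρ : ℕ → ℕ := fun i => if i < n then i else n + 2 * (i - n)
  let ρ' : ℕ → ℕ := fun i => if i < n then i else n + 2 * (i - n) + 1
  let μ : ℕ → PTm := fun i => if i < n then σ i else
    if (i - n) % 2 = 0 then σ (n + (i - n) / 2) else τ (n + (i - n) / 2)
  have hr : ∀ (J : Jdg) (ρ : ℕ → ℕ) (σ : ℕ → PTm),
      (J.ren ρ).subst σ = J.subst (fun i => σ (ρ i)) := by
    intro J ρ σ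
    cases J <;> simp [Jdg.ren, Jdg.subst, PCol.ren_subst, PTm.ren_subst]
  have e1 : (fun i => μ (ρ i)) = σ := by
    funext i
    by_cases hi : i < n
    · simp [μ, ρ, hi]
    · simp [μ, ρ, hi, show n + (i - n) = i by omega]
  have e2 : (fun i => μ (ρ' i)) = τ := by
    funext i
    by_cases hi : i < n
    · simp [μ, ρ', hi, hσ]
    · have h1 : ¬ (n + 2 * (i - n) + 1 < n) := by omega
      have h2 : (n + 2 * (i - n) + 1 - n) % 2 ≠ 0 := by omega
      have h3 : n + (n + 2 * (i - n) + 1 - n) / 2 = i := by omega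
      simp only [μ, ρ', hi, h1, h2, h3, if_false]
  rw [← e1, ← e2, ← hr, ← hr, h ρ (fun i hi => by simp [ρ, hi]) fun i hi => by
      simp only [ρ]; split <;> omega,
    h ρ' (fun i hi => by simp [ρ', hi]) fun i hi => by simp only [ρ']; split <;> omega]

theorem Jdg.subst_congr_of_ren {J : Jdg} {n : ℕ} (h : ∀ ρ, Fixes n ρ → J.ren ρ = J)
    {σ τ : ℕ → PTm} (hσ : ∀ i < n, σ i = τ i) : J.subst σ = J.subst τ :=
  subst_congr_of_ren_le (fun ρ hρ _ => h ρ hρ) hσ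

theorem Jdg.subst_ren (J : Jdg) (σ : ℕ → PTm) (ρ : ℕ → ℕ) :
    (J.subst σ).ren ρ = J.subst (fun i => (σ i).ren ρ) := by
  cases J <;> simp [Jdg.ren, Jdg.subst, PCol.subst_ren, PTm.subst_ren]

set_option maxHeartbeats 4000000 in
theorem Der.closed {Γ : Ctx} {J : Jdg} (h : Der T Γ J) :
    (∀ ρ, Fixes Γ.length ρ → J.ren ρ = J) ∧ Γ.Closed := by
  induction h
  case nil => exact ⟨fun _ _ => rfl, trivial⟩
  case cons h ih => exact ⟨fun _ _ => rfl, fun ρ hρ => by simpa [Jdg.ren] using ih.1 ρ hρ, ih.2⟩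
  case var i A h hA ih =>
    exact ⟨fun ρ hρ => by simp [Jdg.ren, PTm.ren, hρ i hA.lt, ih.2.has hA ρ hρ], ih.2⟩
  case subst Γ Δ J σ h _ _ ih1 ih2 ih3 =>
    refine ⟨fun ρ hρ => ?_, ih2.2⟩
    rw [Jdg.subst_ren]
    refine Jdg.subst_congr_of_ren ih1.1 fun i hi => ?_
    obtain ⟨A, hA⟩ := Ctx.exists_has hi
    have := (ih3 i A hA).1 ρ hρ
    simp only [Jdg.ren, Jdg.tm.injEq] at this
    exact this.1
  case substEqTy Γ Δ k A σ τ h _ _ _ _ ih1 ih2 ih3 ih4 _ =>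
    refine ⟨fun ρ hρ => ?_, ih2.2⟩
    have e1 := Jdg.subst_congr_of_ren (σ := fun i => (σ i).ren ρ) (τ := σ) ih1.1 fun i hi => by
      obtain ⟨A, hA⟩ := Ctx.exists_has hi
      have := (ih3 i A hA).1 ρ hρ
      simp only [Jdg.ren, Jdg.tm.injEq] at this
      exact this.1
    have e2 := Jdg.subst_congr_of_ren (σ := fun i => (τ i).ren ρ) (τ := τ) ih1.1 fun i hi => by
      obtain ⟨A, hA⟩ := Ctx.exists_has hi
      have := (ih4 i A hA).1 ρ hρ
      simp only [Jdg.ren, Jdg.tm.injEq] at this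
      exact this.1
    simp only [Jdg.subst, Jdg.ty.injEq, true_and] at e1 e2
    simp [Jdg.ren, PCol.subst_ren, e1, e2]
  case substEqTm Γ Δ a A σ τ h _ _ _ _ ih1 ih2 ih3 ih4 _ =>
    refine ⟨fun ρ hρ => ?_, ih2.2⟩
    have e1 := Jdg.subst_congr_of_ren (σ := fun i => (σ i).ren ρ) (τ := σ) ih1.1 fun i hi => by
      obtain ⟨A, hA⟩ := Ctx.exists_has hi
      have := (ih3 i A hA).1 ρ hρ
      simp only [Jdg.ren, Jdg.tm.injEq] at this
      exact this.1
    have e2 := Jdg.subst_congr_of_ren (σ := fun i => (τ i).ren ρ) (τ := τ) ih1.1 fun i hi => by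
      obtain ⟨A, hA⟩ := Ctx.exists_has hi
      have := (ih4 i A hA).1 ρ hρ
      simp only [Jdg.ren, Jdg.tm.injEq] at this
      exact this.1
    simp only [Jdg.subst, Jdg.tm.injEq] at e1 e2
    simp [Jdg.ren, PCol.subst_ren, PTm.subst_ren, e1, e2]
  case andRelF A φ _ _ ih1 ih2 =>
    refine ⟨fun ρ hρ => ?_, by simp [PCol.ren], ih1.2⟩
    have h1 := ih2.1 ρ hρ
    simp only [Jdg.ren, PCol.ren, Jdg.ty.injEq, PCol.ofProp.injEq, true_and] at h1
    simp only [Jdg.ren, PCol.ren, PProp.ren, PTm.ren, h1, hρ 0 (by simp),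
      PCol.wk_ren A _ (fun ρ h => by simpa [Jdg.ren] using ih1.1 ρ h) ρ hρ]
  case impRelF A φ _ _ ih1 ih2 =>
    refine ⟨fun ρ hρ => ?_, by simp [PCol.ren], ih1.2⟩
    have h1 := ih2.1 ρ hρ
    simp only [Jdg.ren, PCol.ren, Jdg.ty.injEq, PCol.ofProp.injEq, true_and] at h1
    simp only [Jdg.ren, PCol.ren, PProp.ren, PTm.ren, h1, hρ 0 (by simp),
      PCol.wk_ren A _ (fun ρ h => by simpa [Jdg.ren] using ih1.1 ρ h) ρ hρ]
  case strongColl Γ φ hT _ ih =>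
    refine ⟨fun ρ hρ => ?_, ih.2.2.2⟩
    have key : ∀ l : List PTm, l.length = 3 → l.map (·.ren (upn 3 ρ)) = l →
        (φ.inst l 4).ren (upn 3 ρ) = φ.inst l 4 := by
      intro l hl hl'
      have := Jdg.subst_congr_of_ren (σ := fun i => (PTm.sb l 4 i).ren (upn 3 ρ))
        (τ := PTm.sb l 4) ih.1 fun i hi => by
          rcases lt_or_ge i 3 with h3 | h3
          · rw [PTm.sb_lt _ _ (by omega)]
            have h9 : (l.map (·.ren (upn 3 ρ)))[i]'(by simp; omega) = l[i]'(by omega) := by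
              simp only [hl']
            rwa [List.getElem_map] at h9
          · obtain ⟨j, rfl⟩ := Nat.exists_eq_add_of_le' h3
            rw [← hl, PTm.sb_add, hl, PTm.ren, show j + 4 = (j + 1) + 3 by omega, upn_add,
              hρ _ (by simp at hi ⊢; omega)]
      simp only [Jdg.subst, PCol.subst, Jdg.ty.injEq, PCol.ofProp.injEq, true_and] at this
      rw [PProp.inst, PProp.subst_ren, this]
    have h0 : ρ 0 = 0 := hρ 0 (by simp)
    have h1 := key [.var 0, .var 1, .var 3] rfl (by simp [PTm.ren, upn, upRen, h0])
    have h2 := key [.var 1, .var 0, .var 3] rfl (by simp [PTm.ren, upn, upRen, h0])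
    have h3 := ih.1 (upn 2 ρ) (fixes_upn2.2 hρ)
    simp only [Jdg.ren, PCol.ren, Jdg.ty.injEq, PCol.ofProp.injEq, true_and] at h3
    simp only [upn] at h1 h2 h3
    simp [h3, Jdg.ren, PCol.ren, PTm.ren, PProp.ren, h1, h2, upRen, h0]
  all_goals
    refine ⟨fun ρ hρ => ?_, by
      first
      | (rename_i ih; exact ih.2)
      | (rename_i ih _; exact ih.2)
      | (rename_i ih _ _; exact ih.2)
      | (rename_i ih; exact ih.2.2)
      | (rename_i ih; exact ih.2.2.2.2.2.2)⟩
    simp_all [Jdg.ren, PCol.ren, PTm.ren, PProp.ren, upRen_eq_upn, upn_upn, upn_lt, upn_zero,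
      PCol.inst_ren, PTm.inst_ren, PProp.inst_ren, PCol.inst_ren_zero, PTm.inst_ren_zero,
      PProp.inst_ren_zero, fixes_upn1, fixes_upn2, fixes_upn3, fixes_upn5, PProp.iff, PProp.neg,
      PTm.trans, PTm.succ, PTm.sing, PTm.kpair, PTm.len, PProp.top, Ctx.Closed]

end EmTT

namespace EmTT

variable {T : SetTheory}

/-! ## Typed substitutions -/

/-- Extension of a substitution by a value for the last variable. -/
def scons (a : PTm) (σ : ℕ → PTm) : ℕ → PTm
  | 0 => a
  | i + 1 => σ i

theorem PTm.sb_cons (a : PTm) (l : List PTm) (m : ℕ) : PTm.sb (a :: l) m = scons a (PTm.sb l m) := by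
  funext i; cases i <;> rfl

theorem PTm.sb_nil (m : ℕ) : PTm.sb [] m = fun i => .var (i + m) := rfl

theorem scons_subst (a : PTm) (σ τ : ℕ → PTm) :
    (fun i => (scons a σ i).subst τ) = scons (a.subst τ) (fun i => (σ i).subst τ) := by
  funext i; cases i <;> rfl

theorem scons_ren (a : PTm) (σ : ℕ → PTm) (ρ : ℕ → ℕ) :
    (fun i => (scons a σ i).ren ρ) = scons (a.ren ρ) (fun i => (σ i).ren ρ) := by
  funext i; cases i <;> rfl

theorem up_eq_scons (σ : ℕ → PTm) : PTm.up σ = scons (.var 0) (fun i => (σ i).ren Nat.succ) := by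
  funext i; cases i <;> rfl

theorem up_subst_scons (σ : ℕ → PTm) (a : PTm) (τ : ℕ → PTm) :
    (fun i => (PTm.up σ i).subst (scons a τ)) = scons a (fun i => (σ i).subst τ) := by
  funext i; cases i
  · rfl
  · exact PTm.ren_subst _ _ _

theorem scons_upRen (a : PTm) (σ : ℕ → PTm) (ρ : ℕ → ℕ) :
    (fun i => scons a σ (upRen ρ i)) = scons a (fun i => σ (ρ i)) := by
  funext i; cases i <;> rfl

theorem PCol.wk_eq (A : PCol) : A.inst [] 1 = A.ren Nat.succ := by
  rw [PCol.ren_eq_subst]; rfl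
theorem PTm.wk_eq (A : PTm) : A.inst [] 1 = A.ren Nat.succ := by
  rw [PTm.ren_eq_subst]; rfl
theorem PProp.wk_eq (A : PProp) : A.inst [] 1 = A.ren Nat.succ := by
  rw [PProp.ren_eq_subst]; rfl

theorem Jdg.subst_var (J : Jdg) : J.subst .var = J := by
  cases J <;> simp [Jdg.subst, PCol.subst_var, PTm.subst_var]

theorem Jdg.subst_subst (J : Jdg) (σ τ : ℕ → PTm) :
    (J.subst σ).subst τ = J.subst (fun i => (σ i).subst τ) := by
  cases J <;> simp [Jdg.subst, PCol.subst_subst, PTm.subst_subst]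

theorem Jdg.ren_eq_subst (J : Jdg) (ρ : ℕ → ℕ) : J.ren ρ = J.subst (fun i => .var (ρ i)) := by
  cases J <;> simp [Jdg.subst, Jdg.ren, PCol.ren_eq_subst, PTm.ren_eq_subst]

/-- `σ` is a typed substitution from `Δ` to `Γ`. -/
def SubTy (T : SetTheory) (Δ : Ctx) (σ : ℕ → PTm) (Γ : Ctx) : Prop :=
  Der T Δ .wf ∧ ∀ i A, Γ.Has i A → Der T Δ (.tm (σ i) (A.subst σ))

theorem Der.sub {Γ Δ : Ctx} {J : Jdg} {σ : ℕ → PTm} (h : Der T Γ J) (hσ : SubTy T Δ σ Γ) :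
    Der T Δ (J.subst σ) := .subst h hσ.1 hσ.2

theorem SubTy.cons {Γ Δ : Ctx} {A : PCol} {a : PTm} {σ : ℕ → PTm} (h : SubTy T Δ σ Γ)
    (ha : Der T Δ (.tm a (A.subst σ))) : SubTy T Δ (scons a σ) (A :: Γ) := by
  refine ⟨h.1, fun i B hB => ?_⟩
  cases hB with
  | zero => rw [PCol.wk_eq, PCol.ren_subst]; exact ha
  | succ hB => rw [PCol.wk_eq, PCol.ren_subst]; exact h.2 _ _ hB

theorem SubTy.wk {Γ : Ctx} {A : PCol} (hA : Der T Γ (.ty .col A)) :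
    SubTy T (A :: Γ) (fun i => .var (i + 1)) Γ :=
  ⟨.cons hA, fun _ _ hB => .var (.cons hA) (.succ hB)⟩

theorem Der.wk {Γ : Ctx} {A : PCol} {J : Jdg} (h : Der T Γ J) (hA : Der T Γ (.ty .col A)) :
    Der T (A :: Γ) (J.subst (fun i => .var (i + 1))) := h.sub (.wk hA)

theorem SubTy.comp {Γ Δ Θ : Ctx} {σ τ : ℕ → PTm} (h : SubTy T Δ σ Γ) (h' : SubTy T Θ τ Δ) :
    SubTy T Θ (fun i => (σ i).subst τ) Γ := by
  refine ⟨h'.1, fun i A hA => ?_⟩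
  have := (h.2 i A hA).sub h'
  rwa [Jdg.subst, PCol.subst_subst] at this

theorem SubTy.up {Γ Δ : Ctx} {A : PCol} {σ : ℕ → PTm} (h : SubTy T Δ σ Γ)
    (hA : Der T Γ (.ty .col A)) : SubTy T (A.subst σ :: Δ) (PTm.up σ) (A :: Γ) := by
  have hA' : Der T Δ (.ty .col (A.subst σ)) := hA.sub h
  have h1 := h.comp (SubTy.wk hA')
  have e : PTm.up σ = scons (.var 0) fun i => (σ i).subst fun i => .var (i + 1) := by
    rw [up_eq_scons]; simp only [PTm.ren_eq_subst]
  rw [e]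
  refine h1.cons ?_
  rw [← PCol.subst_subst]
  exact .var (.cons hA') .zero

theorem SubTy.id {Γ : Ctx} (h : Der T Γ .wf) : SubTy T Γ .var Γ :=
  ⟨h, fun i A hA => by rw [PCol.subst_var]; exact .var h hA⟩

theorem Der.sub1 {Γ Δ : Ctx} {A : PCol} {J : Jdg} {σ : ℕ → PTm} (h : Der T (A :: Γ) J)
    (hσ : SubTy T Δ σ Γ) : Der T (A.subst σ :: Δ) (J.subst (PTm.up σ)) := h.sub (hσ.up h.head)

theorem Der.sub2 {Γ Δ : Ctx} {A B : PCol} {J : Jdg} {σ : ℕ → PTm} (h : Der T (B :: A :: Γ) J)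
    (hσ : SubTy T Δ σ Γ) :
    Der T (B.subst (PTm.up σ) :: A.subst σ :: Δ) (J.subst (PTm.up (PTm.up σ))) :=
  h.sub ((hσ.up h.tail.head).up h.head)

theorem Der.sub3 {Γ Δ : Ctx} {A B C : PCol} {J : Jdg} {σ : ℕ → PTm}
    (h : Der T (C :: B :: A :: Γ) J) (hσ : SubTy T Δ σ Γ) :
    Der T (C.subst (PTm.up (PTm.up σ)) :: B.subst (PTm.up σ) :: A.subst σ :: Δ)
      (J.subst (PTm.up (PTm.up (PTm.up σ)))) :=
  h.sub (((hσ.up h.tail.tail.head).up h.tail.head).up h.head)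

/-- Instantiation of the last variable. -/
theorem Der.inst1 {Γ : Ctx} {A : PCol} {J : Jdg} {a : PTm} (h : Der T (A :: Γ) J)
    (ha : Der T Γ (.tm a A)) : Der T Γ (J.subst (scons a .var)) :=
  h.sub ((SubTy.id ha.wf).cons (by rwa [PCol.subst_var]))

theorem Der.eq_inst1 {Γ : Ctx} {A B : PCol} {t a b : PTm} (h : Der T (A :: Γ) (.tm t B))
    (ha : Der T Γ (.tm a A)) (hb : Der T Γ (.tm b A)) (hab : Der T Γ (.tmEq a b A)) :
    Der T Γ (.tmEq (t.subst (scons a .var)) (t.subst (scons b .var)) (B.subst (scons a .var))) := by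
  have h1 := (SubTy.id ha.wf).cons (a := a) (A := A) (by rwa [PCol.subst_var])
  have h2 := (SubTy.id ha.wf).cons (a := b) (A := A) (by rwa [PCol.subst_var])
  refine .substEqTm h ha.wf h1.2 h2.2 fun i C hC => ?_
  cases hC with
  | zero => rw [PCol.wk_eq, PCol.ren_subst]; simpa [scons, PCol.subst_var] using hab
  | succ hC =>
    rw [PCol.wk_eq, PCol.ren_subst]; simpa [scons, PCol.subst_var] using .tmRefl (.var ha.wf hC)

/-! ### Inclusion of contexts -/

/-- All declarations of `Γ` are available in `Δ`, under the same names. -/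
def Ctx.Sub (T : SetTheory) (Γ Δ : Ctx) : Prop := SubTy T Δ .var Γ

theorem Der.mono {Γ Δ : Ctx} {J : Jdg} (h : Der T Γ J) (hs : Γ.Sub T Δ) : Der T Δ J := by
  have := h.sub hs
  rwa [Jdg.subst_var] at this

theorem Ctx.Sub.trans {Γ Δ Θ : Ctx} (h : Γ.Sub T Δ) (h' : Δ.Sub T Θ) : Γ.Sub T Θ :=
  ⟨h'.1, fun i A hA => by simpa using (h.2 i A hA).mono h'⟩

theorem Ctx.Sub.cons {Γ Δ : Ctx} {A : PCol} (h : Γ.Sub T Δ) (hA : Der T Γ (.ty .col A)) :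
    Ctx.Sub T (A :: Γ) (A :: Δ) := by
  have := SubTy.up h hA
  rwa [PCol.subst_var, PTm.up_var] at this

theorem Der.mono1 {Γ Δ : Ctx} {A : PCol} {J : Jdg} (h : Der T (A :: Γ) J) (hs : Γ.Sub T Δ) :
    Der T (A :: Δ) J := h.mono (hs.cons h.head)

theorem Der.mono2 {Γ Δ : Ctx} {A B : PCol} {J : Jdg} (h : Der T (B :: A :: Γ) J)
    (hs : Γ.Sub T Δ) : Der T (B :: A :: Δ) J := h.mono ((hs.cons h.tail.head).cons h.head)

/-! ### Proofs -/

theorem Der.tt_eq {Γ : Ctx} (h : Der T Γ .wf) : Der T Γ (.tmEq .tt .empty .V) := by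
  have h1 : Der T Γ (.holds (.eq .V .empty .empty)) := .eqI (.vF h) (.emptyI h)
  exact .toVEq (.trueEq (.propsProp (.eqVF (.emptyI h) (.emptyI h))) h1)

theorem Der.tt_V {Γ : Ctx} (h : Der T Γ .wf) : Der T Γ (.tm .tt .V) :=
  .ofV (.emptyI h) (.toV (.eqI (.vF h) (.emptyI h))) (.tmSymm h.tt_eq)

/-- Any proof of a proposition is a proof of any true proposition. -/
theorem Der.proof {Γ : Ctx} {φ ψ : PProp} {a : PTm} (hφ : Der T Γ (.prop φ))
    (ha : Der T Γ (.tm a (.ofProp φ))) (hψ : Der T Γ (.holds ψ)) :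
    Der T Γ (.tm a (.ofProp ψ)) :=
  .ofV hψ (.toV ha) (.toVEq (.propMono hφ (.propTrue hφ ha) ha))

theorem Der.hyp {Γ : Ctx} {φ : PProp} (h : Der T Γ (.prop φ)) :
    Der T (.ofProp φ :: Γ) (.holds (φ.inst [] 1)) :=
  .propTrue (h.wk (.propCol h)) (.var (.cons (.propCol h)) .zero)

theorem Der.top_prop {Γ : Ctx} (h : Der T Γ .wf) : Der T Γ (.prop .top) :=
  .impF .large (.propsProp (.botF h)) (.propsProp (.botF h))

theorem Der.top_holds {Γ : Ctx} (h : Der T Γ .wf) : Der T Γ (.holds .top) := by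
  have hb : Der T Γ (.prop .bot) := .propsProp (.botF h)
  exact .impI h.top_prop (Der.hyp hb)

end EmTT

namespace EmTT

variable {T : SetTheory}

/-! ## Supports -/

/-- All variables of `φ` are in `L`. -/
def PProp.Supp (L : Set ℕ) (φ : PProp) : Prop :=
  ∀ σ τ : ℕ → PTm, (∀ i ∈ L, σ i = τ i) → φ.subst σ = φ.subst τ
/-- All variables of `a` are in `L`. -/
def PTm.Supp (L : Set ℕ) (a : PTm) : Prop :=
  ∀ σ τ : ℕ → PTm, (∀ i ∈ L, σ i = τ i) → a.subst σ = a.subst τ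
/-- All variables of `A` are in `L`. -/
def PCol.Supp (L : Set ℕ) (A : PCol) : Prop :=
  ∀ σ τ : ℕ → PTm, (∀ i ∈ L, σ i = τ i) → A.subst σ = A.subst τ

theorem PProp.Supp.mono {L L' : Set ℕ} {φ : PProp} (h : φ.Supp L) (hL : L ⊆ L') : φ.Supp L' :=
  fun σ τ hs => h σ τ fun i hi => hs i (hL hi)
theorem PTm.Supp.mono {L L' : Set ℕ} {φ : PTm} (h : φ.Supp L) (hL : L ⊆ L') : φ.Supp L' :=
  fun σ τ hs => h σ τ fun i hi => hs i (hL hi)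

theorem PTm.supp_var {L : Set ℕ} {i : ℕ} (h : i ∈ L) : (PTm.var i).Supp L :=
  fun _ _ hs => hs i h

theorem PProp.supp_subst {L : Set ℕ} {φ : PProp} {σ : ℕ → PTm} (h : ∀ i, (σ i).Supp L) :
    (φ.subst σ).Supp L := fun σ' τ' hs => by
  rw [PProp.subst_subst, PProp.subst_subst]
  congr 1; funext i; exact h i _ _ hs
theorem PTm.supp_subst {L : Set ℕ} {φ : PTm} {σ : ℕ → PTm} (h : ∀ i, (σ i).Supp L) :
    (φ.subst σ).Supp L := fun σ' τ' hs => by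
  rw [PTm.subst_subst, PTm.subst_subst]
  congr 1; funext i; exact h i _ _ hs

theorem PProp.Supp.and {L : Set ℕ} {φ ψ : PProp} (h : φ.Supp L) (h' : ψ.Supp L) :
    (PProp.and φ ψ).Supp L := fun σ τ hs => by simp [PProp.subst, h σ τ hs, h' σ τ hs]

theorem PProp.supp_top {L : Set ℕ} : PProp.top.Supp L := fun _ _ _ => rfl

/-- The value of a body under a binder only depends on the substitution on the support. -/
theorem PProp.subst_scons_congr {L : Set ℕ} {φ : PProp} (h : (PProp.ex .V φ).Supp L) (b : PTm)
    {σ τ : ℕ → PTm} (hs : ∀ i ∈ L, σ i = τ i) : φ.subst (scons b σ) = φ.subst (scons b τ) := by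
  have h1 := h σ τ hs
  simp only [PProp.subst, PCol.subst, PProp.ex.injEq, true_and] at h1
  have h2 := congrArg (fun φ => PProp.subst (scons b .var) φ) h1
  simpa [PProp.subst_subst, up_subst_scons, PTm.subst_var] using h2

theorem Der.supp_prop {Γ : Ctx} {k : Kind} {φ : PProp} (h : Der T Γ (.ty k (.ofProp φ))) :
    φ.Supp {i | i < Γ.length} := fun σ τ hs => by
  have := Jdg.subst_congr_of_ren h.closed.1 hs
  simpa [Jdg.subst, PCol.subst] using this

/-! ## Stages -/

/-- Propositions over an unlimited supply of names `1, 2, …` for elements of `V`. -/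
def UProp (T : SetTheory) (n : ℕ) (ψ : PProp) : Prop :=
  Der T (List.replicate n .V) (.prop (ψ.ren Nat.pred))

/-- The context with `n` elements of `V`, named `1, …, n`, and the hypothesis `ψ`. -/
def stg (n : ℕ) (ψ : PProp) : Ctx := .ofProp (ψ.ren Nat.pred) :: List.replicate n .V

def posNames : Set ℕ := {i | 1 ≤ i}

theorem replicate_has {n i : ℕ} {A : PCol} :
    Ctx.Has (List.replicate n .V) i A ↔ i < n ∧ A = .V := by
  constructor
  · intro h
    refine ⟨by simpa using h.lt, ?_⟩
    induction n generalizing i A with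
    | zero => cases h
    | succ n ih => cases h with
      | zero => rfl
      | succ h => rw [ih h]; rfl
  · rintro ⟨h, rfl⟩
    induction n generalizing i with
    | zero => omega
    | succ n ih => cases i with
      | zero => exact .zero (A := .V)
      | succ i => exact .succ (A := .V) (ih (by omega))

theorem replicate_wf (n : ℕ) : Der T (List.replicate n .V) .wf := by
  induction n with
  | zero => exact .nil
  | succ n ih => exact .cons (.vF ih)

theorem replicate_sub {n m : ℕ} (h : n ≤ m) :
    Ctx.Sub T (List.replicate n .V) (List.replicate m .V) :=
  ⟨replicate_wf m, fun i A hA => by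
    obtain ⟨hi, rfl⟩ := replicate_has.1 hA
    exact .var (replicate_wf m) (replicate_has.2 ⟨by omega, rfl⟩)⟩

theorem UProp.mono {n m : ℕ} {ψ : PProp} (h : UProp T n ψ) (hn : n ≤ m) : UProp T m ψ :=
  Der.mono h (replicate_sub hn)

theorem UProp.stg_wf {n : ℕ} {ψ : PProp} (h : UProp T n ψ) : Der T (stg n ψ) .wf :=
  .cons (.propCol h)

theorem PProp.pred_wk {ψ : PProp} (h : ψ.Supp posNames) : (ψ.ren Nat.pred).ren Nat.succ = ψ := by
  rw [PProp.ren_ren, PProp.ren_eq_subst]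
  conv_rhs => rw [← PProp.subst_var ψ]
  exact h _ _ fun i hi => by
    have : 1 ≤ i := hi
    simp; omega

theorem stg_has_zero {n : ℕ} {ψ : PProp} (h : ψ.Supp posNames) :
    Ctx.Has (stg n ψ) 0 (.ofProp ψ) := by
  have : PCol.ofProp ψ = (PCol.ofProp (ψ.ren Nat.pred)).inst [] 1 := by
    rw [PCol.wk_eq, PCol.ren, PProp.pred_wk h]
  rw [this]; exact .zero

theorem stg_has_succ {n i : ℕ} {ψ : PProp} {A : PCol} :
    Ctx.Has (stg n ψ) (i + 1) A ↔ i < n ∧ A = .V := by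
  constructor
  · intro h
    cases h with
    | succ h =>
      obtain ⟨h1, rfl⟩ := replicate_has.1 h
      exact ⟨h1, rfl⟩
  · rintro ⟨h, rfl⟩
    exact .succ (A := .V) (replicate_has.2 ⟨h, rfl⟩)

theorem UProp.stg_prop {n : ℕ} {ψ : PProp} (h : UProp T n ψ) (hs : ψ.Supp posNames) :
    Der T (stg n ψ) (.prop ψ) := by
  have := h.wk (.propCol h)
  rwa [Jdg.subst, PCol.subst, ← PProp.ren_eq_subst, PProp.pred_wk hs] at this

theorem UProp.stg_holds {n : ℕ} {ψ : PProp} (h : UProp T n ψ) (hs : ψ.Supp posNames) :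
    Der T (stg n ψ) (.holds ψ) :=
  .propTrue (h.stg_prop hs) (.var h.stg_wf (stg_has_zero hs))

/-- Unlimited propositions are propositions in all large stages. -/
theorem UProp.in_stg {n m : ℕ} {φ ψ : PProp} (h : UProp T n φ) (hs : φ.Supp posNames)
    (hψ : UProp T m ψ) (hnm : n ≤ m) : Der T (stg m ψ) (.prop φ) := by
  have := (h.mono hnm).wk (.propCol hψ)
  rwa [Jdg.subst, PCol.subst, ← PProp.ren_eq_subst, PProp.pred_wk hs] at this

theorem UProp.and {n : ℕ} {φ ψ : PProp} (h : UProp T n φ) (h' : UProp T n ψ) :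
    UProp T n (.and φ ψ) := .andF .large h h'

theorem stg_sub {n m : ℕ} {ψ ψ' : PProp} (hs : ψ.Supp posNames) (hs' : ψ'.Supp posNames)
    (hnm : n ≤ m) (hψ' : UProp T m ψ') (h : Der T (stg m ψ') (.holds ψ)) :
    Ctx.Sub T (stg n ψ) (stg m ψ') := by
  refine ⟨hψ'.stg_wf, fun i A hA => ?_⟩
  rw [PCol.subst_var]
  cases i with
  | zero =>
    rw [hA.unique (stg_has_zero hs)]
    exact Der.proof (hψ'.stg_prop hs') (.var hψ'.stg_wf (stg_has_zero hs')) h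
  | succ i =>
    obtain ⟨hi, rfl⟩ := stg_has_succ.1 hA
    exact .var hψ'.stg_wf (stg_has_succ.2 ⟨by omega, rfl⟩)

/-! ## Theories -/

/-- The names of rank less than `r`. -/
def names (r : ℕ) : Set ℕ := {i | 1 ≤ i ∧ (Nat.unpair (i - 1)).1 < r}

theorem names_pos (r : ℕ) : names r ⊆ posNames := fun _ h => h.1

theorem names_mono {r s : ℕ} (h : r ≤ s) : names r ⊆ names s := fun _ hi => ⟨hi.1, hi.2.trans_le h⟩

/-- Deductively closed sets of propositions with names of rank less than `rank`. -/
structure Thy (T : SetTheory) where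
  rank : ℕ
  F : Set PProp
  supp : ∀ ψ ∈ F, ψ.Supp (names rank)
  uprop : ∀ ψ ∈ F, ∃ n, UProp T n ψ
  top_mem : PProp.top ∈ F
  and_mem : ∀ φ ∈ F, ∀ ψ ∈ F, PProp.and φ ψ ∈ F
  closed : ∀ n, ∀ ψ ∈ F, ∀ φ, φ.Supp (names rank) → (∃ n, UProp T n φ) →
    Der T (stg n ψ) (.holds φ) → φ ∈ F

namespace Thy

variable (𝓕 : Thy T)

theorem posSupp {ψ : PProp} (h : ψ ∈ 𝓕.F) : ψ.Supp posNames := (𝓕.supp ψ h).mono (names_pos _)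

/-- The stages of `𝓕` extended by the proposition `θ`. -/
def stages (θ : PProp) : Set Ctx :=
  {Δ | ∃ n, ∃ ψ ∈ 𝓕.F, UProp T n ψ ∧ UProp T n θ ∧ Δ = stg n (.and ψ θ)}

/-- `J` is derivable from `𝓕` and `θ`. -/
def Ent (θ : PProp) (J : Jdg) : Prop := ∃ Δ ∈ 𝓕.stages θ, Der T Δ J

variable {𝓕}

theorem stages_wf {θ : PProp} {Δ : Ctx} (h : Δ ∈ 𝓕.stages θ) : Der T Δ .wf := by
  obtain ⟨n, ψ, hψ, hu, hθ, rfl⟩ := h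
  exact (hu.and hθ).stg_wf

theorem stages_mem {ψ θ : PProp} (hs : θ.Supp posNames) (hψ : ψ ∈ 𝓕.F) {n : ℕ}
    (hθ : UProp T n θ) (k : ℕ) :
    ∃ Δ ∈ 𝓕.stages θ, ∃ N ≥ k, Δ = stg N (.and ψ θ) ∧ UProp T N ψ ∧ UProp T N θ ∧
      Der T Δ (.holds ψ) ∧ Der T Δ (.holds θ) := by
  obtain ⟨m, hm⟩ := 𝓕.uprop _ hψ
  have h1 : UProp T (k + n + m) ψ := hm.mono (by omega)
  have h2 : UProp T (k + n + m) θ := hθ.mono (by omega)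
  have hsψ := 𝓕.posSupp hψ
  have h3 := (h1.and h2).stg_holds (hsψ.and hs)
  refine ⟨_, ⟨_, ψ, hψ, h1, h2, rfl⟩, _, by omega, rfl, h1, h2, ?_, ?_⟩
  · exact .andE1 (h1.in_stg hsψ (h1.and h2) le_rfl) h3
  · exact .andE2 (h2.in_stg hs (h1.and h2) le_rfl) h3

theorem stages_directed {θ : PProp} (hs : θ.Supp posNames) {Δ Δ' : Ctx}
    (h : Δ ∈ 𝓕.stages θ) (h' : Δ' ∈ 𝓕.stages θ) :
    ∃ Θ ∈ 𝓕.stages θ, Δ.Sub T Θ ∧ Δ'.Sub T Θ := by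
  obtain ⟨n, ψ, hψ, hu, hθ, rfl⟩ := h
  obtain ⟨n', ψ', hψ', hu', hθ', rfl⟩ := h'
  obtain ⟨Θ, hΘ, N, hN, rfl, h1, h2, h3, h4⟩ :=
    stages_mem hs (𝓕.and_mem _ hψ _ hψ') hθ (n + n')
  have s1 := 𝓕.posSupp hψ
  have s2 := 𝓕.posSupp hψ'
  have p1 := hu.in_stg s1 (h1.and h2) (by omega)
  have p2 := hu'.in_stg s2 (h1.and h2) (by omega)
  have p3 := hθ.in_stg hs (h1.and h2) (by omega)
  refine ⟨_, hΘ, ?_, ?_⟩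
  · exact stg_sub (s1.and hs) ((s1.and s2).and hs) (by omega) (h1.and h2)
      (.andI (.andF .large p1 p3) (.andE1 p1 h3) h4)
  · exact stg_sub (s2.and hs) ((s1.and s2).and hs) (by omega) (h1.and h2)
      (.andI (.andF .large p2 p3) (.andE2 p2 h3) h4)

theorem Ent.combine {θ : PProp} (hs : θ.Supp posNames) {Δ : Ctx} {J : Jdg}
    (h : Δ ∈ 𝓕.stages θ) (h' : 𝓕.Ent θ J) : ∃ Θ ∈ 𝓕.stages θ, Δ.Sub T Θ ∧ Der T Θ J := by
  obtain ⟨Δ', hΔ', hJ⟩ := h'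
  obtain ⟨Θ, h1, h2, h3⟩ := stages_directed hs h hΔ'
  exact ⟨Θ, h1, h2, hJ.mono h3⟩

theorem Ent.uprop {θ : PProp} {J : Jdg} (h : 𝓕.Ent θ J) : ∃ n, UProp T n θ := by
  obtain ⟨Δ, ⟨n, ψ, _, _, h, _⟩, _⟩ := h
  exact ⟨n, h⟩

theorem Ent.self {θ : PProp} (hs : θ.Supp posNames) {n : ℕ} (hθ : UProp T n θ) :
    𝓕.Ent θ (.holds θ) := by
  obtain ⟨Δ, h, _, _, _, _, _, _, h'⟩ := stages_mem hs 𝓕.top_mem hθ 0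
  exact ⟨Δ, h, h'⟩

theorem Ent.of_mem {θ ψ : PProp} (hs : θ.Supp posNames) {n : ℕ} (hθ : UProp T n θ)
    (hψ : ψ ∈ 𝓕.F) : 𝓕.Ent θ (.holds ψ) := by
  obtain ⟨Δ, h, _, _, _, _, _, h', _⟩ := stages_mem hs hψ hθ 0
  exact ⟨Δ, h, h'⟩

/-- If `θ'` implies `θ`, then it implies all consequences of `θ`. -/
theorem Ent.cut {θ θ' : PProp} {J : Jdg} (hs : θ.Supp posNames) (hs' : θ'.Supp posNames)
    (h : 𝓕.Ent θ' (.holds θ)) (hJ : 𝓕.Ent θ J) : 𝓕.Ent θ' J := by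
  obtain ⟨Δ, ⟨n, ψ, hψ, hu, hθ, rfl⟩, hJ⟩ := hJ
  obtain ⟨k, hθ'⟩ := h.uprop
  obtain ⟨Δ', hΔ', N, hN, rfl, h1, h2, h3, h4⟩ := stages_mem hs' hψ hθ' n
  obtain ⟨Θ, hΘ, hsub, h5⟩ := h.combine hs' hΔ'
  obtain ⟨M, χ, hχ, hu', hθ'', rfl⟩ := hΘ
  set M' := M + n
  have s1 := 𝓕.posSupp hψ
  have s2 := 𝓕.posSupp hχ
  have hw := (hu'.mono (show M ≤ M' by omega)).and (hθ''.mono (show M ≤ M' by omega))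
  have hb : Ctx.Sub T (stg M (.and χ θ')) (stg M' (.and χ θ')) :=
    stg_sub (s2.and hs') (s2.and hs') (by omega) hw (hw.stg_holds (s2.and hs'))
  have p1 := hu.in_stg s1 hw (by omega)
  have p2 := hθ.in_stg hs hw (by omega)
  refine ⟨_, ⟨M', χ, hχ, hu'.mono (by omega), hθ''.mono (by omega), rfl⟩, hJ.mono ?_⟩
  exact stg_sub (s1.and hs) (s2.and hs') (by omega) hw
    (.andI (.andF .large p1 p2) (h3.mono (hsub.trans hb)) (h5.mono hb))

/-- The stages of `𝓕` and `θ`, directed by inclusion. -/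
def fil (𝓕 : Thy T) (θ : PProp) : Filter Ctx :=
  ⨅ Δ ∈ 𝓕.stages θ, Filter.principal {Θ | Θ ∈ 𝓕.stages θ ∧ Δ.Sub T Θ}

theorem fil_basis {θ : PProp} (hs : θ.Supp posNames) {n : ℕ} (hθ : UProp T n θ) :
    (𝓕.fil θ).HasBasis (fun Δ => Δ ∈ 𝓕.stages θ) fun Δ => {Θ | Θ ∈ 𝓕.stages θ ∧ Δ.Sub T Θ} := by
  refine Filter.hasBasis_biInf_principal ?_ ?_
  · intro Δ h Δ' h'
    obtain ⟨Θ, h1, h2, h3⟩ := stages_directed hs h h'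
    exact ⟨Θ, h1, fun Ξ hΞ => ⟨hΞ.1, h2.trans hΞ.2⟩, fun Ξ hΞ => ⟨hΞ.1, h3.trans hΞ.2⟩⟩
  · obtain ⟨Δ, h, _⟩ := stages_mem hs 𝓕.top_mem hθ 0
    exact ⟨Δ, h⟩

theorem Ent.iff_eventually {θ : PProp} (hs : θ.Supp posNames) {n : ℕ} (hθ : UProp T n θ)
    {J : Jdg} : 𝓕.Ent θ J ↔ ∀ᶠ Δ in 𝓕.fil θ, Der T Δ J := by
  rw [(fil_basis hs hθ).eventually_iff]
  constructor
  · rintro ⟨Δ, h, hJ⟩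
    exact ⟨Δ, h, fun Θ hΘ => hJ.mono hΘ.2⟩
  · rintro ⟨Δ, h, hJ⟩
    exact ⟨Δ, h, hJ ⟨h, SubTy.id (stages_wf h)⟩⟩

end Thy

/-! ### Adjoining names -/

theorem ren_name_eq (φ : PProp) (c : ℕ) (τ : ℕ → PTm) :
    (φ.inst [.var c] 0).subst τ = φ.subst (scons (τ c) τ) := by
  rw [PProp.inst, PProp.subst_subst, PTm.sb_cons, scons_subst, PTm.sb_nil]; rfl

theorem stg_subTy {n : ℕ} {χ : PProp} (hχ : χ.Supp posNames) {Δ : Ctx} {τ : ℕ → PTm}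
    (h0 : Der T Δ (.tm (τ 0) (.ofProp (χ.subst τ)))) (hτ : ∀ i, 1 ≤ i → i ≤ n → Der T Δ (.tm (τ i) .V)) :
    SubTy T Δ τ (stg n χ) := by
  refine ⟨h0.wf, fun i A hA => ?_⟩
  cases i with
  | zero => rw [hA.unique (stg_has_zero hχ)]; exact h0
  | succ i =>
    obtain ⟨hi, rfl⟩ := stg_has_succ.1 hA
    exact hτ _ (by omega) (by omega)

/-- The substitution that sends the name `c` to the variable `k`, and weakens all other names. -/
def freshSub (c k m : ℕ) : ℕ → PTm := fun i => if i = 0 then .tt else if i = c then .var k else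
  .var (i + m)

theorem freshSub_eq {c : ℕ} (k m : ℕ) : ∀ i ∈ {i | 1 ≤ i ∧ i ≠ c}, freshSub c k m i = .var (i + m) := by
  rintro i ⟨h1, h2⟩
  simp only [freshSub]; rw [if_neg (by omega), if_neg h2]

theorem notName_pos (c : ℕ) : ({i | 1 ≤ i ∧ i ≠ c} : Set ℕ) ⊆ posNames := fun _ hi => hi.1

/-- Elimination of a fresh name from a hypothesis. -/
theorem fresh_ex {ψ φ : PProp} {J : Jdg} {n m c : ℕ} (hc : 1 ≤ c)
    (hψ : ψ.Supp {i | 1 ≤ i ∧ i ≠ c})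
    (hφ : (PProp.ex .V φ).Supp {i | 1 ≤ i ∧ i ≠ c}) (hu : UProp T m ψ) (hnm : n ≤ m)
    (hp : Der T (.V :: stg m ψ) (.prop φ)) (hcs : (φ.inst [.var c] 0).Supp posNames)
    (h : Der T (stg n (.and ψ (φ.inst [.var c] 0))) J) :
    Der T (.ofProp φ :: .V :: stg m ψ) (J.subst (freshSub c 1 2)) := by
  have hwf : Der T (.ofProp φ :: .V :: stg m ψ) .wf := .cons (.propCol hp)
  have hsψ : ψ.subst (freshSub c 1 2) = ψ.subst fun i => .var (i + 2) := hψ _ _ (freshSub_eq 1 2)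
  have hsφ : (φ.inst [.var c] 0).subst (freshSub c 1 2) = φ.inst [] 1 := by
    rw [ren_name_eq, PProp.subst_scons_congr hφ _ (freshSub_eq 1 2), PProp.inst, PTm.sb_nil]
    have : freshSub c 1 2 c = .var 1 := by
      simp only [freshSub]; rw [if_neg (by omega)]; simp
    rw [this]; congr 1; funext i; cases i <;> rfl
  have key : Der T (.ofProp φ :: .V :: stg m ψ)
      (.holds ((PProp.and ψ (φ.inst [.var c] 0)).subst (freshSub c 1 2))) := by
    have d1 := ((hu.stg_holds (hψ.mono (notName_pos c))).wk (.vF hu.stg_wf)).wk (.propCol hp)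
    have q1 := ((hu.stg_prop (hψ.mono (notName_pos c))).wk (.vF hu.stg_wf)).wk (.propCol hp)
    have d2 := Der.hyp hp
    have q2 := hp.wk (.propCol hp)
    simp only [Jdg.subst, PCol.subst, PTm.subst, PProp.subst_subst] at d1 q1 q2
    rw [PProp.subst, hsψ, hsφ]
    exact .andI (.andF .large q1 q2) d1 d2
  refine h.sub (stg_subTy ((hψ.mono (notName_pos c)).and hcs) key fun i h1 h2 => ?_)
  simp only [freshSub]
  rw [if_neg (by omega)]
  split
  · exact .var (A := .V) hwf (.succ (A := .V) .zero)
  · obtain ⟨j, rfl⟩ := Nat.exists_eq_add_of_le' h1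
    exact .var (A := .V) hwf (.succ (A := .V) (.succ (A := .V) (stg_has_succ.2 ⟨by omega, rfl⟩)))

/-- Generalization over a fresh name. -/
theorem fresh_all {ψ : PProp} {J : Jdg} {n m c : ℕ} 
    (hψ : ψ.Supp {i | 1 ≤ i ∧ i ≠ c}) (hu : UProp T m ψ) (hnm : n ≤ m)
    (h : Der T (stg n ψ) J) : Der T (.V :: stg m ψ) (J.subst (freshSub c 0 1)) := by
  have hwf : Der T (.V :: stg m ψ) .wf := .cons (.vF hu.stg_wf)
  have hsψ : ψ.subst (freshSub c 0 1) = ψ.subst fun i => .var (i + 1) := hψ _ _ (freshSub_eq 0 1)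
  refine h.sub (stg_subTy (hψ.mono (notName_pos c)) ?_ fun i h1 h2 => ?_)
  · rw [hsψ]
    exact (hu.stg_holds (hψ.mono (notName_pos c))).wk (.vF hu.stg_wf)
  · simp only [freshSub]
    rw [if_neg (by omega)]
    split
    · exact .var (A := .V) hwf .zero
    · obtain ⟨j, rfl⟩ := Nat.exists_eq_add_of_le' h1
      exact .var (A := .V) hwf (.succ (A := .V) (stg_has_succ.2 ⟨by omega, rfl⟩))

theorem UProp.supp {n : ℕ} {φ : PProp} (h : UProp T n φ) (hs : φ.Supp posNames) :
    φ.Supp {i | i ≤ n} := fun σ τ hst => by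
  have h1 := Der.supp_prop h
  have key : ∀ σ : ℕ → PTm, φ.subst σ = (φ.ren Nat.pred).subst fun i => σ (i + 1) := fun σ => by
    conv_lhs => rw [← PProp.pred_wk hs, PProp.ren_subst]
  rw [key, key]
  refine h1 _ _ fun i hi => hst _ ?_
  have : i < n := by simpa using hi
  exact this

theorem PProp.Supp.inter {L L' : Set ℕ} {φ : PProp} (h : φ.Supp L) (h' : φ.Supp L') :
    φ.Supp (L ∩ L') := fun σ τ hst => by
  classical
  rw [h σ (fun i => if i ∈ L then σ i else τ i) fun i hi => by simp [hi]]
  refine h' _ _ fun i hi => ?_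
  by_cases hL : i ∈ L
  · simp [hL, hst i ⟨hL, hi⟩]
  · simp [hL]

/-- There are unboundedly many names of rank `r`. -/
theorem exists_fresh (r k : ℕ) : ∃ c ∈ names (r + 1), c ∉ names r ∧ k < c := by
  refine ⟨Nat.pair r k + 1, ⟨by omega, by simp⟩, fun h => ?_, ?_⟩
  · have := h.2
    simp at this
  · have := Nat.right_le_pair r k
    omega

theorem supp_fresh {r c : ℕ} {φ : PProp} (h : φ.Supp (names r)) (hc : c ∉ names r) :
    φ.Supp {i | 1 ≤ i ∧ i ≠ c} :=
  h.mono fun _ hi => ⟨hi.1, fun e => hc (e ▸ hi)⟩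

theorem supp_fresh' {n c : ℕ} {φ : PProp} (h : φ.Supp posNames) (h' : φ.Supp {i | i ≤ n}) (hc : n < c) :
    φ.Supp {i | 1 ≤ i ∧ i ≠ c} :=
  (h.inter h').mono fun i hi => ⟨hi.1, fun e => by have : i ≤ n := hi.2; omega⟩

theorem supp_inst {L L' : Set ℕ} {φ : PProp} {c : ℕ} (h : (PProp.ex .V φ).Supp L) (hL : L ⊆ L')
    (hc : c ∈ L') : (φ.inst [.var c] 0).Supp L' := fun σ τ hst => by
  rw [ren_name_eq, ren_name_eq, hst c hc]
  exact PProp.subst_scons_congr h _ fun i hi => hst i (hL hi)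

theorem PProp.Supp.of_or {L : Set ℕ} {φ ψ : PProp} (h : (PProp.or φ ψ).Supp L) :
    φ.Supp L ∧ ψ.Supp L := by
  constructor <;> intro σ τ hst <;> have := h σ τ hst <;>
  simp only [PProp.subst, PProp.or.injEq] at this
  exacts [this.1, this.2]

end EmTT

namespace EmTT

variable {T : SetTheory}

/-! ## Prime saturated extensions -/

/-- `φ` is a proposition depending on one more element of `V`. -/
def UProp1 (T : SetTheory) (n : ℕ) (φ : PProp) : Prop :=
  Der T (.V :: List.replicate n .V) (.prop (φ.ren (upRen Nat.pred)))

theorem UProp1.mono {n m : ℕ} {φ : PProp} (h : UProp1 T n φ) (hnm : n ≤ m) : UProp1 T m φ :=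
  Der.mono1 h (replicate_sub hnm)

theorem UProp1.inst {n m c : ℕ} {φ : PProp} (h : UProp1 T n φ) (hc : 1 ≤ c) (hn : n ≤ m)
    (hm : c ≤ m) : UProp T m (φ.inst [.var c] 0) := by
  have h1 := (h.mono hn).inst1 (a := .var (c - 1))
    (.var (replicate_wf m) (replicate_has.2 ⟨by omega, rfl⟩))
  rw [Jdg.subst, PCol.subst, PProp.ren_subst, scons_upRen] at h1
  rw [UProp, PProp.ren_eq_subst, ren_name_eq]
  exact h1

theorem UProp1.in_stg {n m : ℕ} {φ ψ : PProp} (h : UProp1 T n φ)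
    (hs : (PProp.ex .V φ).Supp posNames) (hψ : UProp T m ψ) (hnm : n ≤ m) :
    Der T (.V :: stg m ψ) (.prop φ) := by
  have h1 := Der.sub1 (h.mono hnm) (SubTy.wk (.propCol hψ))
  have e : (PProp.ex .V (φ.ren (upRen Nat.pred))).subst (fun i => .var (i + 1)) = .ex .V φ := by
    have := PProp.pred_wk hs
    simpa [PProp.ren, PProp.ren_eq_subst, PCol.ren] using this
  simp only [PProp.subst, PCol.subst, PProp.ex.injEq, true_and] at e
  rw [Jdg.subst, PCol.subst, e] at h1
  exact h1

namespace Thy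

variable {𝓕 : Thy T}

theorem eventually_of {θ : PProp} (hs : θ.Supp posNames) {Δ : Ctx} (h : Δ ∈ 𝓕.stages θ)
    {P : Ctx → Prop} (hP : ∀ Δ', Δ.Sub T Δ' → P Δ') : ∀ᶠ Δ in 𝓕.fil θ, P Δ := by
  obtain ⟨n, ψ, hψ, hu, hθ, rfl⟩ := h
  rw [(fil_basis hs hθ).eventually_iff]
  exact ⟨_, ⟨n, ψ, hψ, hu, hθ, rfl⟩, fun Θ hΘ => hP _ hΘ.2⟩

theorem Ent.eventually {θ : PProp} (hs : θ.Supp posNames) {J : Jdg} (h : 𝓕.Ent θ J) :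
    ∀ᶠ Δ in 𝓕.fil θ, Der T Δ J := by
  obtain ⟨Δ, hΔ, hJ⟩ := h
  exact eventually_of hs hΔ fun _ => hJ.mono

theorem eventually_wf {θ : PProp} (hs : θ.Supp posNames) {n : ℕ} (hθ : UProp T n θ) :
    ∀ᶠ Δ in 𝓕.fil θ, Der T Δ .wf := by
  obtain ⟨Δ, h, _⟩ := stages_mem (𝓕 := 𝓕) hs 𝓕.top_mem hθ 0
  exact eventually_of hs h fun _ h => h.1

theorem eventually_prop {θ φ : PProp} (hs : θ.Supp posNames) {n m : ℕ} (hθ : UProp T n θ)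
    (hφ : UProp T m φ) (hs' : φ.Supp posNames) : ∀ᶠ Δ in 𝓕.fil θ, Der T Δ (.prop φ) := by
  obtain ⟨Δ, h, N, hN, rfl, h1, h2, _⟩ := stages_mem (𝓕 := 𝓕) hs 𝓕.top_mem hθ m
  exact eventually_of hs h fun _ => (hφ.in_stg hs' (h1.and h2) hN).mono

theorem eventually_prop1 {θ φ : PProp} (hs : θ.Supp posNames) {n m : ℕ} (hθ : UProp T n θ)
    (hφ : UProp1 T m φ) (hs' : (PProp.ex .V φ).Supp posNames) :
    ∀ᶠ Δ in 𝓕.fil θ, Der T (.V :: Δ) (.prop φ) := by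
  obtain ⟨Δ, h, N, hN, rfl, h1, h2, _⟩ := stages_mem (𝓕 := 𝓕) hs 𝓕.top_mem hθ m
  exact eventually_of hs h fun _ => (hφ.in_stg hs' (h1.and h2) hN).mono1

/-- The deduction theorem. -/
theorem Ent.deduce {θ φ : PProp} {J : Jdg} (hs : θ.Supp posNames) (hs' : φ.Supp posNames)
    {n m : ℕ} (hθ : UProp T n θ) (hφ : UProp T m φ)
    (h : 𝓕.Ent (.and θ φ) J) :
    ∀ᶠ Δ in 𝓕.fil θ, Der T (.ofProp φ :: Δ) (J.subst fun i => .var (i + 1)) := by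
  obtain ⟨Δ, ⟨k, ψ, hψ, hu, hu', rfl⟩, hJ⟩ := h
  obtain ⟨Θ, hΘ, N, hN, rfl, h1, h2, h3, h4⟩ := stages_mem (𝓕 := 𝓕) hs hψ hθ (k + m)
  refine eventually_of hs hΘ fun Δ hΔ => Der.mono1 ?_ hΔ
  have s1 := 𝓕.posSupp hψ
  have p := hφ.in_stg hs' (h1.and h2) (by omega)
  have w : Der T (.ofProp φ :: stg N (ψ.and θ)) .wf := .cons (.propCol p)
  have q0 := ((h1.and h2).stg_prop (s1.and hs)).wk (.propCol p)
  have q1 := (h1.in_stg s1 (h1.and h2) le_rfl).wk (.propCol p)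
  have q2 := (h2.in_stg hs (h1.and h2) le_rfl).wk (.propCol p)
  have q3 := p.wk (.propCol p)
  have r1 := h3.wk (.propCol p)
  have r2 := h4.wk (.propCol p)
  have r3 := Der.hyp p
  have v1 : Der T (.ofProp φ :: stg N (ψ.and θ))
      (.tm (.var 1) (.ofProp ((ψ.and θ).inst [] 1))) :=
    .var w (.succ (A := .ofProp (ψ.and θ)) (stg_has_zero (s1.and hs)))
  simp only [Jdg.subst, PCol.subst, PTm.subst] at q0 q1 q2 q3 r1 r2
  refine hJ.sub (stg_subTy (s1.and (hs.and hs')) ?_ fun i hi hik => ?_)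
  · refine Der.proof q0 v1 ?_
    exact .andI (.andF .large q1 (.andF .large q2 q3)) r1
      (.andI (.andF .large q2 q3) r2 r3)
  · obtain ⟨j, rfl⟩ := Nat.exists_eq_add_of_le' hi
    exact .var (A := .V) w (.succ (A := .V) (stg_has_succ.2 ⟨by omega, rfl⟩))

theorem Ent.supp {θ χ : PProp} {k : Kind} (h : 𝓕.Ent θ (.ty k (.ofProp χ))) : ∃ n, χ.Supp {i | i ≤ n} := by
  obtain ⟨Δ, ⟨n, ψ, hψ, hu, hu', rfl⟩, hJ⟩ := h
  refine ⟨n, (Der.supp_prop hJ).mono fun i hi => ?_⟩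
  have : i < n + 1 := by simpa [stg] using hi
  exact Nat.lt_succ_iff.1 this

theorem Ent.of_eventually {θ : PProp} (hs : θ.Supp posNames) {n : ℕ} (hθ : UProp T n θ) {J : Jdg}
    (h : ∀ᶠ Δ in 𝓕.fil θ, Der T Δ J) : 𝓕.Ent θ J := (Ent.iff_eventually hs hθ).2 h

theorem not_ent_or {θ φ ψ χ : PProp} (hs : θ.Supp posNames) (hs1 : φ.Supp posNames)
    (hs2 : ψ.Supp posNames) {n m k : ℕ} (hθ : UProp T n θ) (hφ : UProp T m φ) (hψ : UProp T k ψ)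
    (hχ : 𝓕.Ent θ (.prop χ)) (h : 𝓕.Ent θ (.holds (.or φ ψ))) (hn : ¬ 𝓕.Ent θ (.holds χ)) :
    ¬ 𝓕.Ent (.and θ φ) (.holds χ) ∨ ¬ 𝓕.Ent (.and θ ψ) (.holds χ) := by
  by_contra hc
  push Not at hc
  refine hn (Ent.of_eventually hs hθ ?_)
  filter_upwards [hc.1.deduce hs hs1 hθ hφ, hc.2.deduce hs hs2 hθ hψ, hχ.eventually hs,
    h.eventually hs, eventually_prop hs hθ hφ hs1, eventually_prop hs hθ hψ hs2]
    with Δ h1 h2 h3 h4 h5 h6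
  exact .orE h5 h6 h3 h4 h1 h2

theorem not_ent_ex {θ φ χ : PProp} {c : ℕ} (hc : 1 ≤ c) (hs : θ.Supp posNames)
    (hsφ : (PProp.ex .V φ).Supp {i | 1 ≤ i ∧ i ≠ c}) (hsθ : θ.Supp {i | 1 ≤ i ∧ i ≠ c})
    (hsχ : χ.Supp {i | 1 ≤ i ∧ i ≠ c})
    (hsF : ∀ ψ ∈ 𝓕.F, ψ.Supp {i | 1 ≤ i ∧ i ≠ c}) {n m : ℕ} (hθ : UProp T n θ)
    (hφ : UProp1 T m φ) (hχ : 𝓕.Ent θ (.prop χ)) (h : 𝓕.Ent θ (.holds (.ex .V φ)))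
    (hn : ¬ 𝓕.Ent θ (.holds χ)) : ¬ 𝓕.Ent (.and θ (φ.inst [.var c] 0)) (.holds χ) := by
  rintro ⟨Δ, ⟨k, ψ, hψ, hu, hu', rfl⟩, hJ⟩
  have hcs : (φ.inst [.var c] 0).Supp posNames := supp_inst hsφ (notName_pos c) hc
  have hm : UProp T (m + c) (φ.inst [.var c] 0) := hφ.inst hc (by omega) (by omega)
  have hJ' : ∃ k', ∃ ψ' ∈ 𝓕.F, UProp T k' ψ' ∧ UProp T k' θ ∧
      Der T (stg k' (.and (.and ψ' θ) (φ.inst [.var c] 0))) (.holds χ) := by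
    set N := k + n + m + c
    have u1 := hu.mono (show k ≤ N by omega)
    have u2 := hθ.mono (show n ≤ N by omega)
    have u3 := hm.mono (show m + c ≤ N by omega)
    have s1 := 𝓕.posSupp hψ
    have w := (u1.and u2).and u3
    have ws := (s1.and hs).and hcs
    have p1 := u1.in_stg s1 w le_rfl
    have p2 := u2.in_stg hs w le_rfl
    have p3 := u3.in_stg hcs w le_rfl
    have d := w.stg_holds ws
    have d1 := Der.andE1 (.andF .large p1 p2) d
    refine ⟨N, ψ, hψ, u1, u2, hJ.mono (stg_sub (s1.and (hs.and hcs)) ws (by omega) w ?_)⟩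
    exact .andI (.andF .large p1 (.andF .large p2 p3)) (.andE1 p1 d1)
      (.andI (.andF .large p2 p3) (.andE2 p2 d1) (.andE2 p3 d))
  obtain ⟨k', ψ', hψ', u1, u2, hJ'⟩ := hJ'
  obtain ⟨Θ, hΘ, N, hN, rfl, h1, h2, h3, h4⟩ := stages_mem (𝓕 := 𝓕) hs hψ' hθ (k' + m)
  have hx := fresh_ex hc ((hsF _ hψ').and hsθ) hsφ (h1.and h2) (n := k') (by omega)
    (hφ.in_stg (hsφ.mono (notName_pos c)) (h1.and h2) (by omega)) hcs hJ'
  refine hn (Ent.of_eventually hs hθ ?_)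
  filter_upwards [hχ.eventually hs, h.eventually hs, eventually_wf hs hθ,
    eventually_prop1 hs hθ hφ (hsφ.mono (notName_pos c)),
    eventually_of hs hΘ fun _ => hx.mono2] with Δ g1 g2 g3 g4 g5
  refine .exE (.vF g3) g4 g1 g2 ?_
  simp only [Jdg.subst, PCol.subst, PTm.subst] at g5
  rw [hsχ _ _ (freshSub_eq 1 2)] at g5
  exact g5

end Thy

end EmTT

namespace EmTT

variable {T : SetTheory}

deriving instance Countable for PProp

namespace Thy

variable {𝓕 : Thy T}

theorem Ent.of_stg {θ ψ : PProp} {J : Jdg} {n k : ℕ} (hs : θ.Supp posNames) (hsψ : ψ.Supp posNames)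
    (hψ : UProp T k ψ) (h : 𝓕.Ent θ (.holds ψ)) (hJ : Der T (stg n ψ) J) : 𝓕.Ent θ J := by
  refine Ent.cut hsψ hs h ?_
  have u1 := hψ.mono (show k ≤ n + k by omega)
  have u0 : UProp T (n + k) .top := Der.top_prop (replicate_wf _)
  have s0 : PProp.top.Supp posNames := PProp.supp_top
  have w := u0.and u1
  refine ⟨_, ⟨n + k, .top, 𝓕.top_mem, u0, u1, rfl⟩, hJ.mono ?_⟩
  exact stg_sub hsψ (s0.and hsψ) (by omega) w
    (.andE2 (u1.in_stg hsψ w le_rfl) (w.stg_holds (s0.and hsψ)))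

/-- The propositions `θ` considered in the construction of a prime saturated extension of `𝓕` that
does not prove `χ`. -/
structure Avoids (𝓕 : Thy T) (χ θ : PProp) : Prop where
  supp : θ.Supp (names (𝓕.rank + 1))
  uprop : ∃ n, UProp T n θ
  prop : 𝓕.Ent θ (.prop χ)
  avoids : ¬ 𝓕.Ent θ (.holds χ)

variable {χ θ : PProp}

theorem Avoids.pos (h : 𝓕.Avoids χ θ) : θ.Supp posNames := h.supp.mono (names_pos _)

theorem Avoids.and (h : 𝓕.Avoids χ θ) {φ : PProp} (hs : φ.Supp (names (𝓕.rank + 1)))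
    {n : ℕ} (hφ : UProp T n φ) (h' : ¬ 𝓕.Ent (.and θ φ) (.holds χ)) :
    𝓕.Avoids χ (.and θ φ) ∧ 𝓕.Ent (.and θ φ) (.holds θ) ∧ 𝓕.Ent (.and θ φ) (.holds φ) := by
  obtain ⟨m, hm⟩ := h.uprop
  have u1 := hm.mono (show m ≤ n + m by omega)
  have u2 := hφ.mono (show n ≤ n + m by omega)
  have s := h.pos.and (hs.mono (names_pos _))
  have e : ∀ᶠ Δ in 𝓕.fil (.and θ φ), Der T Δ (.holds θ) ∧ Der T Δ (.holds φ) := by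
    filter_upwards [(Ent.self (𝓕 := 𝓕) s (u1.and u2)).eventually s,
      eventually_prop s (u1.and u2) u1 h.pos,
      eventually_prop s (u1.and u2) u2 (hs.mono (names_pos _))] with Δ h1 h2 h3
    exact ⟨.andE1 h2 h1, .andE2 h3 h1⟩
  have e1 := Ent.of_eventually s (u1.and u2) (e.mono fun _ h => h.1)
  have e2 := Ent.of_eventually s (u1.and u2) (e.mono fun _ h => h.2)
  exact ⟨⟨h.supp.and hs, ⟨_, u1.and u2⟩, Ent.cut h.pos s e1 h.prop, h'⟩, e1, e2⟩

theorem Avoids.step (hχ : χ.Supp posNames) (h : 𝓕.Avoids χ θ) (α : PProp) :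
    ∃ θ', 𝓕.Avoids χ θ' ∧ 𝓕.Ent θ' (.holds θ) ∧
      (𝓕.Ent θ (.holds α) → α.Supp (names (𝓕.rank + 1)) →
        (∀ φ ψ, α = .or φ ψ → (∃ n, UProp T n φ) → (∃ n, UProp T n ψ) →
          𝓕.Ent θ' (.holds φ) ∨ 𝓕.Ent θ' (.holds ψ)) ∧
        (∀ φ, α = .ex .V φ → (∃ n, UProp1 T n φ) →
          ∃ c ∈ names (𝓕.rank + 1), 𝓕.Ent θ' (.holds (φ.inst [.var c] 0)))) := by
  obtain ⟨N, hθ⟩ := h.uprop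
  have triv : 𝓕.Avoids χ θ ∧ 𝓕.Ent θ (.holds θ) := ⟨h, Ent.self h.pos hθ⟩
  by_cases hα : 𝓕.Ent θ (.holds α) ∧ α.Supp (names (𝓕.rank + 1))
  swap
  · exact ⟨θ, triv.1, triv.2, fun h1 h2 => absurd ⟨h1, h2⟩ hα⟩
  obtain ⟨hα, hsα⟩ := hα
  by_cases hor : ∃ φ ψ, α = .or φ ψ ∧ (∃ n, UProp T n φ) ∧ (∃ n, UProp T n ψ)
  · obtain ⟨φ, ψ, rfl, ⟨n, hφ⟩, m, hψ⟩ := hor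
    obtain ⟨s1, s2⟩ := hsα.of_or
    rcases not_ent_or h.pos (s1.mono (names_pos _)) (s2.mono (names_pos _)) hθ hφ hψ h.prop hα
      h.avoids with h' | h'
    · obtain ⟨a, b, c⟩ := h.and s1 hφ h'
      refine ⟨_, a, b, fun _ _ => ⟨?_, (fun _ e => nomatch e)⟩⟩
      rintro _ _ ⟨⟩ _ _
      exact .inl c
    · obtain ⟨a, b, c⟩ := h.and s2 hψ h'
      refine ⟨_, a, b, fun _ _ => ⟨?_, (fun _ e => nomatch e)⟩⟩
      rintro _ _ ⟨⟩ _ _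
      exact .inr c
  by_cases hex : ∃ φ, α = .ex .V φ ∧ ∃ n, UProp1 T n φ
  · obtain ⟨φ, rfl, n, hφ⟩ := hex
    have hsα' := hsα.mono (names_pos _)
    have hu : UProp T n (.ex .V φ) := .exF .large (.vF (replicate_wf n)) hφ
    obtain ⟨k, hk⟩ := h.prop.supp
    obtain ⟨c, hc, hc', hlt⟩ := exists_fresh 𝓕.rank (k + n + N)
    have h' := not_ent_ex hc.1 h.pos
      (supp_fresh' hsα' (hu.supp hsα') (by omega))
      (supp_fresh' h.pos (hθ.supp h.pos) (by omega)) (supp_fresh' hχ hk (by omega))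
      (fun ψ hψ => supp_fresh (𝓕.supp ψ hψ) hc') hθ hφ h.prop hα h.avoids
    obtain ⟨a, b, d⟩ := h.and (supp_inst hsα (le_refl _) hc)
      (hφ.inst hc.1 (Nat.le_add_right n c) (by omega)) h'
    refine ⟨_, a, b, fun _ _ => ⟨(fun _ _ e => nomatch e), ?_⟩⟩
    rintro _ ⟨⟩ _
    exact ⟨c, hc, d⟩
  refine ⟨θ, triv.1, triv.2, fun _ _ => ⟨fun φ ψ e h1 h2 => ?_, fun φ e h1 => ?_⟩⟩
  · exact absurd ⟨φ, ψ, e, h1, h2⟩ hor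
  · exact absurd ⟨φ, e, h1⟩ hex

end Thy

/-- Consistent, prime and saturated theories. -/
structure World (T : SetTheory) extends Thy T where
  bot_notMem : PProp.bot ∉ F
  prime : ∀ φ ψ, (∃ n, UProp T n φ) → (∃ n, UProp T n ψ) → PProp.or φ ψ ∈ F → φ ∈ F ∨ ψ ∈ F
  witness : ∀ φ, (∃ n, UProp1 T n φ) → PProp.ex .V φ ∈ F →
    ∃ c ∈ names rank, φ.inst [.var c] 0 ∈ F

namespace Thy

variable {𝓕 : Thy T} {χ θ : PProp}

/-- Prime saturated extensions. -/
theorem exists_world (hχ : χ.Supp posNames) (h : 𝓕.Avoids χ θ) :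
    ∃ w : World T, w.rank = 𝓕.rank + 1 ∧ 𝓕.F ⊆ w.F ∧ θ ∈ w.F ∧ ¬ w.Ent .top (.holds χ) := by
  have : Nonempty PProp := ⟨.bot⟩
  obtain ⟨f, hf⟩ := exists_surjective_nat PProp
  choose! next hn1 hn2 hn3 using fun θ (h : 𝓕.Avoids χ θ) α => h.step hχ α
  let g : ℕ → PProp := fun n => n.rec θ fun n θ => next θ (f n.unpair.1)
  have hg : ∀ n, 𝓕.Avoids χ (g n) := fun n => by
    induction n with
    | zero => exact h
    | succ n ih => exact hn1 _ ih _
  have hcut : ∀ {n m}, n ≤ m → ∀ {J}, 𝓕.Ent (g n) J → 𝓕.Ent (g m) J := fun {n m} hnm J hJ => by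
    induction m, hnm using Nat.le_induction with
    | base => exact hJ
    | succ m _ ih => exact Ent.cut (hg m).pos (hg (m + 1)).pos (hn2 _ (hg m) _) ih
  have hvis : ∀ α n, ∃ m, n ≤ m ∧ f (Nat.unpair m).1 = α := fun α n => by
    obtain ⟨k, hk⟩ := hf α
    exact ⟨Nat.pair k n, Nat.right_le_pair k n, by simpa using hk⟩
  let F : Set PProp := {φ | (∃ n, UProp T n φ) ∧ φ.Supp (names (𝓕.rank + 1)) ∧
    ∃ n, 𝓕.Ent (g n) (.holds φ)}
  have hclosed : ∀ n, ∀ ψ ∈ F, ∀ J, Der T (stg n ψ) J → ∃ m, 𝓕.Ent (g m) J := by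
    rintro n ψ ⟨⟨k, hk⟩, h1, m, h2⟩ J hJ
    exact ⟨m, Ent.of_stg (hg m).pos (h1.mono (names_pos _)) hk h2 hJ⟩
  obtain ⟨N, hθ⟩ := h.uprop
  have hmem : 𝓕.F ⊆ F := fun φ hφ => ⟨𝓕.uprop φ hφ,
    (𝓕.supp φ hφ).mono (names_mono (by omega)), 0, Ent.of_mem h.pos hθ hφ⟩
  let 𝓖 : Thy T :=
    { rank := 𝓕.rank + 1
      F := F
      supp := fun ψ hψ => hψ.2.1
      uprop := fun ψ hψ => hψ.1
      top_mem := hmem 𝓕.top_mem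
      and_mem := by
        rintro φ ⟨⟨n, h1⟩, h2, m, h3⟩ ψ ⟨⟨n', h1'⟩, h2', m', h3'⟩
        refine ⟨⟨n + n', (h1.mono (by omega)).and (h1'.mono (by omega))⟩, h2.and h2', m + m', ?_⟩
        have s := (hg (m + m')).pos
        obtain ⟨N, hN⟩ := (hg (m + m')).uprop
        refine Ent.of_eventually s hN ?_
        filter_upwards [(hcut (show m ≤ m + m' by omega) h3).eventually s,
          (hcut (show m' ≤ m + m' by omega) h3').eventually s,
          eventually_prop s hN h1 (h2.mono (names_pos _)),
          eventually_prop s hN h1' (h2'.mono (names_pos _))] with Δ a b c d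
        exact .andI (.andF .large c d) a b
      closed := fun n ψ hψ φ h1 h2 h3 => ⟨h2, h1, hclosed n ψ hψ _ h3⟩ }
  have hprop : ∀ m, ¬ 𝓕.Ent (g m) (.holds .bot) := fun m hm => (hg m).avoids <| by
    have s := (hg m).pos
    obtain ⟨N, hN⟩ := (hg m).uprop
    refine Ent.of_eventually s hN ?_
    filter_upwards [hm.eventually s, (hg m).prop.eventually s] with Δ a b
    exact .botE b a
  let w : World T :=
    { 𝓖 with
      bot_notMem := fun h => (hprop _) h.2.2.choose_spec
      prime := by
        rintro φ ψ hφ hψ ⟨_, h2, m, h3⟩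
        obtain ⟨k, hk, e⟩ := hvis (.or φ ψ) m
        have := (hn3 _ (hg k) (f k.unpair.1) (e ▸ hcut hk h3) (e ▸ h2)).1 φ ψ e hφ hψ
        obtain ⟨s1, s2⟩ := h2.of_or
        rcases this with h | h
        · exact .inl ⟨hφ, s1, k + 1, h⟩
        · exact .inr ⟨hψ, s2, k + 1, h⟩
      witness := by
        rintro φ hφ ⟨_, h2, m, h3⟩
        obtain ⟨k, hk, e⟩ := hvis (.ex .V φ) m
        obtain ⟨c, hc, h⟩ := (hn3 _ (hg k) (f k.unpair.1) (e ▸ hcut hk h3) (e ▸ h2)).2 φ e hφ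
        obtain ⟨n, hφ⟩ := hφ
        exact ⟨c, hc, ⟨n + c, hφ.inst hc.1 (by omega) (by omega)⟩, supp_inst h2 le_rfl hc,
          k + 1, h⟩ }
  refine ⟨w, rfl, hmem, ⟨⟨N, hθ⟩, h.supp, 0, Ent.self h.pos hθ⟩, ?_⟩
  rintro ⟨Δ, ⟨n, ψ, hψ, hu, hu', rfl⟩, hJ⟩
  obtain ⟨m, hm⟩ := hclosed _ _ (𝓖.and_mem _ hψ _ 𝓖.top_mem) _ hJ
  exact (hg m).avoids hm

end Thy

end EmTT

namespace EmTT

variable {T : SetTheory}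

/-! ## Truth in a world -/

theorem Ctx.Sub.append {Γ Δ : Ctx} (h : Γ.Sub T Δ) (Θ : Ctx) (hΘ : Der T (Θ ++ Γ) .wf) :
    Ctx.Sub T (Θ ++ Γ) (Θ ++ Δ) := by
  induction Θ with
  | nil => exact h
  | cons A Θ ih =>
    rw [List.cons_append] at hΘ
    exact (ih hΘ.tail).cons hΘ.head

theorem Der.mono_append {Γ Δ Θ : Ctx} {J : Jdg} (hJ : Der T (Θ ++ Γ) J) (h : Γ.Sub T Δ) :
    Der T (Θ ++ Δ) J := hJ.mono (h.append Θ hJ.wf)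

theorem uprop_top (n : ℕ) : UProp T n .top := Der.top_prop (replicate_wf _)

/-- `φ`, for a proposition `φ` which depends on a proof of `ψ`. -/
def guard (ψ φ : PProp) : PProp := .ex (.ofProp ψ) (φ.ren Nat.succ)

theorem PProp.wk_inst (φ : PProp) (a : PTm) : (φ.ren Nat.succ).inst [a] 0 = φ := by
  rw [PProp.inst, PTm.sb_cons, PProp.ren_subst]
  exact PProp.subst_var φ

theorem Der.inst_one {Γ : Ctx} {A B : PCol} {a t : PTm} (h : Der T (A :: Γ) (.tm t B))
    (ha : Der T Γ (.tm a A)) : Der T Γ (.tm (t.inst [a] 0) (B.inst [a] 0)) := by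
  have := h.inst1 ha
  rw [PTm.inst, PCol.inst, PTm.sb_cons]; exact this

theorem Der.inst_one_ty {Γ : Ctx} {A B : PCol} {a : PTm} {k : Kind} (h : Der T (A :: Γ) (.ty k B))
    (ha : Der T Γ (.tm a A)) : Der T Γ (.ty k (B.inst [a] 0)) := by
  have := h.inst1 ha
  rw [PCol.inst, PTm.sb_cons]; exact this

theorem Der.wk_prop {Γ : Ctx} {A : PCol} {k : Kind} {φ : PProp} (h : Der T Γ (.ty k (.ofProp φ)))
    (hA : Der T Γ (.ty .col A)) : Der T (A :: Γ) (.ty k (.ofProp (φ.ren Nat.succ))) := by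
  have := h.wk hA
  rwa [Jdg.subst, PCol.subst, ← PProp.ren_eq_subst] at this

theorem Der.wk_holds {Γ : Ctx} {A : PCol} {φ : PProp} (h : Der T Γ (.holds φ))
    (hA : Der T Γ (.ty .col A)) : Der T (A :: Γ) (.holds (φ.ren Nat.succ)) := by
  have := h.wk hA
  rwa [Jdg.subst, PCol.subst, ← PProp.ren_eq_subst] at this

theorem Der.hyp' {Γ : Ctx} {φ : PProp} (h : Der T Γ (.prop φ)) :
    Der T (.ofProp φ :: Γ) (.holds (φ.ren Nat.succ)) := by
  have := Der.hyp h
  rwa [PProp.wk_eq] at this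

theorem guard_prop {Δ : Ctx} {ψ φ : PProp} (hψ : Der T Δ (.prop ψ)) (hφ : Der T Δ (.prop φ)) :
    Der T Δ (.prop (guard ψ φ)) :=
  .exF .large (.propCol hψ) (hφ.wk_prop (.propCol hψ))

theorem guard_iff {Δ : Ctx} {ψ φ : PProp} (hψ : Der T Δ (.prop ψ)) (h : Der T Δ (.holds ψ))
    (hφ : Der T Δ (.prop φ)) : Der T Δ (.holds (guard ψ φ)) ↔ Der T Δ (.holds φ) := by
  have h1 := hφ.wk_prop (.propCol hψ)
  constructor
  · intro hg
    refine .exE (.propCol hψ) h1 hφ hg ?_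
    have := Der.hyp h1
    rw [PProp.wk_eq, PProp.ren_ren] at this
    rw [PProp.inst, PTm.sb_nil, ← PProp.ren_eq_subst]
    exact this
  · intro hp
    refine .exI (.propCol hψ) h1 h ?_
    rwa [PProp.wk_inst]

theorem guard_inst (ψ φ : PProp) (a : PTm) :
    (guard (ψ.ren Nat.succ) φ).inst [a] 0 = guard ψ (φ.inst [a] 0) := by
  have h1 := PProp.wk_inst ψ a
  simp only [PProp.inst, PTm.sb_cons] at h1 ⊢
  simp only [guard, PProp.subst, PCol.subst, h1, PProp.ren_subst, PProp.subst_ren,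
    up_eq_scons]
  congr 2

theorem supp_ex {L : Set ℕ} {φ : PProp}
    (h : ∀ σ τ : ℕ → PTm, (∀ i ∈ L, σ i = τ i) → φ.subst (PTm.up σ) = φ.subst (PTm.up τ)) :
    (PProp.ex .V φ).Supp L := fun σ τ hs => by
  simp only [PProp.subst, PCol.subst, h σ τ hs]

namespace PProp.Supp

variable {L : Set ℕ} {φ ψ : PProp}

theorem guard (hψ : ψ.Supp L) (hφ : φ.Supp L) : (guard ψ φ).Supp L := fun σ τ hs => by
  simp only [EmTT.guard, PProp.subst, PCol.subst, hψ σ τ hs, PProp.ren_subst]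
  congr 1
  refine hφ _ _ fun i hi => ?_
  simp [PTm.up, hs i hi]

theorem guard1 (hψ : ψ.Supp L) (hφ : (PProp.ex .V φ).Supp L) :
    (PProp.ex .V (EmTT.guard (ψ.ren Nat.succ) φ)).Supp L := supp_ex fun σ τ hs => by
  simp only [EmTT.guard, PProp.subst, PCol.subst, PProp.ren_subst]
  congr 1
  · congr 1
    refine hψ _ _ fun i hi => ?_
    simp [PTm.up, hs i hi]
  · simp only [up_eq_scons]
    have : ∀ σ : ℕ → PTm, (fun i => (scons (.var 0) (fun i => (σ i).ren Nat.succ) i).ren Nat.succ) =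
      scons (.var 1) fun i => (σ i).ren fun i => i + 2 := fun σ => by
        rw [scons_ren]; simp [PTm.ren_ren, PTm.ren]
    erw [this, this]
    exact PProp.subst_scons_congr hφ _ fun i hi => by rw [hs i hi]

end PProp.Supp

theorem stg_guard {n : ℕ} {ψ φ : PProp} (hψ : UProp T n ψ) (hs : φ.Supp posNames)
    (hφ : Der T (stg n ψ) (.prop φ)) : UProp T n (guard ψ φ) := by
  refine .exF .large (.propCol hψ) ?_
  have e : (φ.ren Nat.succ).ren (upRen Nat.pred) = φ := by
    conv_rhs => rw [← PProp.subst_var φ]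
    rw [PProp.ren_ren, PProp.ren_eq_subst]
    refine hs _ _ fun i hi => ?_
    have : 1 ≤ i := hi
    obtain ⟨j, rfl⟩ := Nat.exists_eq_add_of_le' this
    rfl
  change Der T _ (.prop ((φ.ren Nat.succ).ren (upRen Nat.pred)))
  rw [e]; exact hφ

theorem stg_guard1 {n : ℕ} {ψ φ : PProp} (hψ : UProp T n ψ) (hsψ : ψ.Supp posNames)
    (hs : (PProp.ex .V φ).Supp posNames)
    (hφ : Der T (.V :: stg n ψ) (.prop φ)) : UProp1 T n (guard (ψ.ren Nat.succ) φ) := by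
  have hv : Der T (List.replicate n .V) (.ty .col .V) := .vF (replicate_wf n)
  have e1 : (ψ.ren Nat.succ).ren (upRen Nat.pred) = (ψ.ren Nat.pred).ren Nat.succ := by
    rw [PProp.ren_ren, PProp.ren_ren]; rfl
  have p1 : Der T (.V :: List.replicate n .V) (.prop ((ψ.ren Nat.succ).ren (upRen Nat.pred))) := by
    rw [e1]; exact Der.wk_prop hψ hv
  refine .exF .large (.propCol p1) ?_
  have hw := p1.propCol.cons
  have hsub : SubTy T (.ofProp ((ψ.ren Nat.succ).ren (upRen Nat.pred)) :: .V :: List.replicate n .V)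
      (scons (.var 1) (scons (.var 0) fun i => .var (i + 2))) (.V :: stg n ψ) := by
    refine SubTy.cons ?_ (.var (A := .V) hw (.succ (A := .V) .zero))
    refine stg_subTy hsψ ?_ fun i h1 h2 => ?_
    · have := Der.var (i := 0) hw .zero
      have e : ψ.subst (scons (.var 0) fun i => .var (i + 2)) =
          ((ψ.ren Nat.succ).ren (upRen Nat.pred)).ren Nat.succ := by
        rw [PProp.ren_ren, PProp.ren_ren, PProp.ren_eq_subst]
        refine hsψ _ _ fun i hi => ?_
        have : 1 ≤ i := hi
        obtain ⟨j, rfl⟩ := Nat.exists_eq_add_of_le' this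
        rfl
      rw [PCol.wk_eq, PCol.ren] at this
      rw [e]
      exact this
    · obtain ⟨j, rfl⟩ := Nat.exists_eq_add_of_le' h1
      exact .var (A := .V) hw (.succ (A := .V) (.succ (A := .V) (replicate_has.2 ⟨by omega, rfl⟩)))
  have := hφ.sub hsub
  rw [Jdg.subst, PCol.subst] at this
  change Der T _ (.prop ((φ.ren Nat.succ).ren (upRen (upRen Nat.pred))))
  have e : (fun i => PTm.var (upRen (upRen Nat.pred) (Nat.succ i))) =
      scons (.var 1) fun i => .var (Nat.pred i + 2) := by
    funext i; cases i <;> rfl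
  rw [PProp.ren_ren _ _ φ, PProp.ren_eq_subst _ φ, e]
  rwa [PProp.subst_scons_congr hs (.var 1) (τ := scons (.var 0) fun i => .var (i + 2))]
  intro i hi
  have : 1 ≤ i := hi
  obtain ⟨j, rfl⟩ := Nat.exists_eq_add_of_le' this
  rfl

namespace World

instance : Preorder (World T) where
  le w w' := w.rank ≤ w'.rank ∧ w.F ⊆ w'.F
  le_refl w := ⟨le_rfl, subset_rfl⟩
  le_trans _ _ _ h h' := ⟨h.1.trans h'.1, h.2.trans h'.2⟩

/-- The judgement `J` is derivable over `w`, in the context `Θ`. -/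
def Tr (w : World T) (Θ : Ctx) (J : Jdg) : Prop := ∀ᶠ Δ in w.fil .top, Der T (Θ ++ Δ) J

variable {w w' : World T} {Θ : Ctx} {J : Jdg} {φ ψ θ : PProp}

theorem tr_iff : w.Tr Θ J ↔ ∃ n, ∃ ψ ∈ w.F, UProp T n ψ ∧ Der T (Θ ++ stg n ψ) J := by
  constructor
  · intro h
    obtain ⟨Δ, h1, h2⟩ := (Thy.fil_basis (PProp.supp_top) (uprop_top 0)).eventually_iff.1 h
    have h3 := h2 ⟨h1, SubTy.id (Thy.stages_wf h1)⟩
    obtain ⟨n, ψ, hψ, hu, hu', rfl⟩ := h1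
    exact ⟨n, _, w.and_mem _ hψ _ w.top_mem, hu.and hu', h3⟩
  · rintro ⟨n, ψ, hψ, hu, hJ⟩
    have s := w.posSupp hψ
    have s0 : PProp.top.Supp posNames := PProp.supp_top
    have hw := hu.and (uprop_top n)
    refine Thy.eventually_of PProp.supp_top ⟨n, ψ, hψ, hu, uprop_top n, rfl⟩
      fun Δ hΔ => hJ.mono_append (Ctx.Sub.trans ?_ hΔ)
    exact stg_sub s (s.and s0) le_rfl hw
      (.andE1 (hu.in_stg s hw le_rfl) (hw.stg_holds (s.and s0)))

theorem Tr.fil (h : w.Tr Θ J) (hs : θ.Supp posNames) {n : ℕ} (hθ : UProp T n θ) :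
    ∀ᶠ Δ in w.fil θ, Der T (Θ ++ Δ) J := by
  obtain ⟨m, ψ, hψ, hu, hJ⟩ := tr_iff.1 h
  have s := w.posSupp hψ
  have hw := (hu.mono (show m ≤ n + m by omega)).and (hθ.mono (show n ≤ n + m by omega))
  refine Thy.eventually_of hs ⟨n + m, ψ, hψ, hu.mono (by omega), hθ.mono (by omega), rfl⟩
    fun Δ hΔ => hJ.mono_append (Ctx.Sub.trans ?_ hΔ)
  exact stg_sub s (s.and hs) (by omega) hw
    (.andE1 (hu.in_stg s hw (by omega)) (hw.stg_holds (s.and hs)))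

theorem Tr.ent (h : w.Tr [] J) : w.Ent .top J :=
  (Thy.Ent.iff_eventually PProp.supp_top (uprop_top 0)).2 h

theorem tr_iff_ent : w.Tr [] J ↔ w.Ent .top J :=
  (Thy.Ent.iff_eventually PProp.supp_top (uprop_top 0)).symm

theorem Tr.mono (h : w.Tr Θ J) (hw : w ≤ w') : w'.Tr Θ J := by
  obtain ⟨n, ψ, hψ, h⟩ := tr_iff.1 h
  exact tr_iff.2 ⟨n, ψ, hw.2 hψ, h⟩

theorem tr_wf : w.Tr [] .wf := Thy.eventually_wf PProp.supp_top (uprop_top 0)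

theorem tr_of_mem (h : φ ∈ w.F) : w.Tr [] (.holds φ) := by
  obtain ⟨n, hn⟩ := w.uprop φ h
  exact tr_iff.2 ⟨n, φ, h, hn, hn.stg_holds (w.posSupp h)⟩

theorem mem_of_tr (hs : φ.Supp (names w.rank)) {n : ℕ} (hφ : UProp T n φ)
    (h : w.Tr [] (.holds φ)) : φ ∈ w.F := by
  obtain ⟨m, ψ, hψ, _, hJ⟩ := tr_iff.1 h
  exact w.closed m ψ hψ φ hs ⟨n, hφ⟩ hJ

theorem tr_name {c : ℕ} (hc : 1 ≤ c) : w.Tr [] (.tm (.var c) .V) := by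
  obtain ⟨j, rfl⟩ := Nat.exists_eq_add_of_le' hc
  exact tr_iff.2 ⟨j + 1, .top, w.top_mem, uprop_top _,
    .var (uprop_top _).stg_wf (stg_has_succ.2 ⟨by omega, rfl⟩)⟩

theorem not_tr_bot : ¬ w.Tr [] (.holds .bot) := fun h =>
  w.bot_notMem (mem_of_tr (n := 0) (fun _ _ _ => rfl) (.propsProp (.botF (replicate_wf 0))) h)

theorem tr_or (hs : φ.Supp (names w.rank)) (hs' : ψ.Supp (names w.rank))
    (hφ : w.Tr [] (.prop φ)) (hψ : w.Tr [] (.prop ψ)) :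
    w.Tr [] (.holds (.or φ ψ)) ↔ w.Tr [] (.holds φ) ∨ w.Tr [] (.holds ψ) := by
  constructor
  swap
  · rintro (h | h)
    · filter_upwards [hφ, hψ, h] with Δ a b c using .orI1 a b c
    · filter_upwards [hφ, hψ, h] with Δ a b c using .orI2 a b c
  intro h
  obtain ⟨n, χ, hχ, hu, hJ1, hJ2⟩ : ∃ n, ∃ χ ∈ w.F, UProp T n χ ∧ Der T (stg n χ) (.prop φ) ∧
      Der T (stg n χ) (.prop ψ) := by
    obtain ⟨Δ, h1, h2⟩ := (Thy.fil_basis PProp.supp_top (uprop_top 0)).eventually_iff.1 (hφ.and hψ)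
    have h3 := h2 ⟨h1, SubTy.id (Thy.stages_wf h1)⟩
    obtain ⟨n, ψ, hψ, hu, hu', rfl⟩ := h1
    exact ⟨n, _, w.and_mem _ hψ _ w.top_mem, hu.and hu', h3⟩
  have g1 := stg_guard hu (hs.mono (names_pos _)) hJ1
  have g2 := stg_guard hu (hs'.mono (names_pos _)) hJ2
  have h1 : w.Tr [] (.prop χ) := tr_iff.2 ⟨n, χ, hχ, hu, hu.stg_prop (w.posSupp hχ)⟩
  have h2 := tr_of_mem hχ
  have h3 : w.Tr [] (.holds (.or (guard χ φ) (guard χ ψ))) := by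
    filter_upwards [h1, h2, hφ, hψ, h] with Δ a b c d e
    have p1 := guard_prop a c
    have p2 := guard_prop a d
    have wkp : ∀ {ξ : PProp}, Der T Δ (.prop ξ) → (Der T (.ofProp ξ :: Δ) (.holds
        ((PProp.or (guard χ φ) (guard χ ψ)).inst [] 1)) ↔ Der T (.ofProp ξ :: Δ) (.holds
        (PProp.or (guard (χ.ren Nat.succ) (φ.ren Nat.succ))
          (guard (χ.ren Nat.succ) (ψ.ren Nat.succ))))) := by
      intro ξ _
      rw [PProp.wk_eq]
      simp only [guard, PProp.ren, PCol.ren, PProp.ren_ren]; rfl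
    refine .orE c d (.orF .large p1 p2) e ((wkp c).2 ?_) ((wkp d).2 ?_)
    · have a' := a.wk_prop (.propCol c)
      have b' := b.wk_holds (.propCol c)
      have c' := c.wk_prop (.propCol c)
      have d' := d.wk_prop (.propCol c)
      exact .orI1 (guard_prop a' c') (guard_prop a' d') ((guard_iff a' b' c').2 (Der.hyp' c))
    · have a' := a.wk_prop (.propCol d)
      have b' := b.wk_holds (.propCol d)
      have c' := c.wk_prop (.propCol d)
      have d' := d.wk_prop (.propCol d)
      exact .orI2 (guard_prop a' c') (guard_prop a' d') ((guard_iff a' b' d').2 (Der.hyp' d))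
  have s1 := (w.supp _ hχ).guard hs
  have s2 := (w.supp _ hχ).guard hs'
  have so : (PProp.or (guard χ φ) (guard χ ψ)).Supp (names w.rank) := fun σ τ hst => by
    rw [PProp.subst, PProp.subst, s1 σ τ hst, s2 σ τ hst]
  refine (w.prime _ _ ⟨n, g1⟩ ⟨n, g2⟩ (mem_of_tr so (.orF .large g1 g2) h3)).imp ?_ ?_ <;> intro h
  · filter_upwards [h1, h2, hφ, tr_of_mem h] with Δ a b c d using (guard_iff a b c).1 d
  · filter_upwards [h1, h2, hψ, tr_of_mem h] with Δ a b c d using (guard_iff a b c).1 d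

theorem tr_ex_V (hs : (PProp.ex .V φ).Supp (names w.rank)) (hφ : w.Tr [.V] (.prop φ))
    (h : w.Tr [] (.holds (.ex .V φ))) :
    ∃ c ∈ names w.rank, w.Tr [] (.holds (φ.inst [.var c] 0)) := by
  obtain ⟨n, χ, hχ, hu, hJ⟩ := tr_iff.1 hφ
  have g := stg_guard1 hu (w.posSupp hχ) (hs.mono (names_pos _)) hJ
  have h1 : w.Tr [] (.prop χ) := tr_iff.2 ⟨n, χ, hχ, hu, hu.stg_prop (w.posSupp hχ)⟩
  have h2 := tr_of_mem hχ
  have h3 : w.Tr [] (.holds (.ex .V (guard (χ.ren Nat.succ) φ))) := by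
    filter_upwards [h1, h2, hφ, h, tr_wf] with Δ a b c d e
    have hV : Der T Δ (.ty .col .V) := .vF e
    have c' : Der T (.V :: Δ) (.prop φ) := c
    have p := guard_prop (a.wk_prop hV) c'
    have pe : Der T Δ (.prop (.ex .V (guard (χ.ren Nat.succ) φ))) := .exF .large hV p
    refine .exE hV c' pe d ?_
    have hw : Der T (.ofProp φ :: .V :: Δ) .wf := .cons (.propCol c')
    have b2 := (b.wk_holds hV).wk_holds (.propCol c')
    have a2 := (a.wk_prop hV).wk_prop (.propCol c')
    have c2 := c'.wk_prop (.propCol c')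
    have e2 := (guard_iff a2 b2 c2).2 (Der.hyp' c')
    have hs2 : SubTy T (.V :: .ofProp φ :: .V :: Δ) (fun i => .var (upRen (· + 2) i)) (.V :: Δ) := by
      have := ((SubTy.wk hV).comp (SubTy.wk (.propCol c'))).up hV
      have e : (fun i => PTm.var (upRen (· + 2) i)) =
          PTm.up fun i => ((fun i => PTm.var (i + 1)) i).subst fun i => .var (i + 1) := by
        funext i; cases i <;> rfl
      rw [e]
      exact this
    have p2 := p.sub hs2
    rw [Jdg.subst, PCol.subst, ← PProp.ren_eq_subst] at p2
    have ei : (PProp.ex .V (guard (χ.ren Nat.succ) φ)).inst [] 2 =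
        .ex .V ((guard (χ.ren Nat.succ) φ).ren (upRen (· + 2))) := by
      rw [PProp.inst, PTm.sb_nil, ← PProp.ren_eq_subst, PProp.ren, PCol.ren]
    rw [ei]
    refine .exI (a := .var 1) (.vF hw) p2 (.var (A := .V) hw (.succ (A := .V) .zero)) ?_
    convert e2 using 3
    rw [PProp.inst, PTm.sb_cons, PProp.ren_subst]
    simp only [guard, PProp.subst, PCol.subst, PProp.ren_eq_subst]
    congr 1
    · rw [PProp.subst_subst, PProp.subst_subst]; rfl
    · rw [PProp.subst_subst, PProp.subst_subst]; congr 1; funext i; cases i <;> rfl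
  have hs' := (w.supp _ hχ).guard1 hs
  obtain ⟨c, hc, hg⟩ := w.witness _ ⟨n, g⟩
    (mem_of_tr hs' (.exF .large (.vF (replicate_wf n)) g) h3)
  refine ⟨c, hc, ?_⟩
  rw [guard_inst] at hg
  filter_upwards [h1, h2, hφ, tr_of_mem hg, tr_name hc.1] with Δ a b d e f
  have := Der.inst_one_ty d f
  exact (guard_iff a b this).1 e

/-- The semantics of implication. -/
theorem tr_imp (hs : φ.Supp (names w.rank)) (hs' : ψ.Supp (names w.rank)) 
    (hi : w.Tr [] (.prop (.imp φ ψ))) (hφ : w.Tr [] (.prop φ))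
    (hψ : w.Tr [.ofProp φ] (.prop (ψ.ren Nat.succ)))
    (h : ∀ w', w ≤ w' → w'.Tr [] (.holds φ) → w'.Tr [] (.holds ψ)) :
    w.Tr [] (.holds (.imp φ ψ)) := by
  obtain ⟨n, χ, hχ, hu, hJ⟩ := tr_iff.1 hφ
  have h1 : w.Tr [] (.prop χ) := tr_iff.2 ⟨n, χ, hχ, hu, hu.stg_prop (w.posSupp hχ)⟩
  have h2 := tr_of_mem hχ
  have g := stg_guard hu (hs.mono (names_pos _)) hJ
  have gs := (w.supp _ hχ).guard hs
  have gs' := gs.mono (names_pos _)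
  by_contra hn
  have hav : w.toThy.Avoids ψ (guard χ φ) := by
    refine ⟨gs.mono (names_mono (by omega)), ⟨n, g⟩, ?_, fun hc => hn ?_⟩
    · refine Thy.Ent.of_eventually gs' g ?_
      filter_upwards [hψ.fil gs' g, h1.fil gs' g, h2.fil gs' g, hφ.fil gs' g,
        (Thy.Ent.self (𝓕 := w.toThy) gs' g).eventually gs'] with Δ a b c d e
      have := Der.inst_one_ty a ((guard_iff b c d).1 e)
      rwa [PCol.inst, PCol.subst, ← PProp.inst, PProp.wk_inst] at this
    · have s0 : PProp.top.Supp posNames := PProp.supp_top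
      have hw := (uprop_top n).and g
      have hc' : w.Ent (.and .top (guard χ φ)) (.holds ψ) := by
        refine Thy.Ent.cut gs' (s0.and gs') ?_ hc
        refine Thy.Ent.of_eventually (s0.and gs') hw ?_
        filter_upwards [Thy.eventually_prop (s0.and gs') hw g gs',
          (Thy.Ent.self (𝓕 := w.toThy) (s0.and gs') hw).eventually (s0.and gs')] with Δ a b
        exact .andE2 a b
      filter_upwards [hc'.deduce s0 gs' (uprop_top n) g, h1, h2, hφ, hi] with Δ a b c d e
      refine .impI e ?_
      have b' := b.wk_prop (.propCol d)
      have c' := c.wk_holds (.propCol d)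
      have d' := d.wk_prop (.propCol d)
      have hg := (guard_iff b' c' d').2 (Der.hyp' d)
      have eg : (PCol.ofProp (guard χ φ)).subst (fun i => .var (i + 1)) =
          .ofProp (guard (χ.ren Nat.succ) (φ.ren Nat.succ)) := by
        simp only [guard, PCol.subst, PProp.subst, PProp.ren_eq_subst,
          PProp.subst_subst]
        rfl
      have := a.sub ((SubTy.wk (.propCol d)).cons (a := .tt) (by rw [eg]; exact hg))
      rw [Jdg.subst_subst] at this
      exact this
  obtain ⟨v, hr, hF, hg, hχ'⟩ := Thy.exists_world (hs'.mono (names_pos _)) hav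
  have hle : w ≤ v := ⟨by omega, hF⟩
  refine hχ' (Tr.ent (h v hle ?_))
  filter_upwards [h1.mono hle, h2.mono hle, hφ.mono hle, tr_of_mem hg] with Δ a b c d
  exact (guard_iff a b c).1 d

/-- The semantics of universal quantification. -/
theorem tr_all_V (hs : (PProp.ex .V φ).Supp (names w.rank)) (hφ : w.Tr [.V] (.prop φ))
    (h : ∀ w', w ≤ w' → ∀ c ∈ names w'.rank, w'.Tr [] (.holds (φ.inst [.var c] 0))) :
    w.Tr [] (.holds (.all .V φ)) := by
  by_contra hn
  obtain ⟨c, hc, hc', -⟩ := exists_fresh w.rank 0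
  have hs1 : (φ.inst [.var c] 0).Supp posNames := supp_inst (hs.mono (names_pos _)) le_rfl hc.1
  have hp : w.Tr [] (.prop (φ.inst [.var c] 0)) := by
    filter_upwards [hφ, tr_name hc.1] with Δ a b using Der.inst_one_ty a b
  have hav : w.toThy.Avoids (φ.inst [.var c] 0) .top := by
    refine ⟨PProp.supp_top, ⟨0, uprop_top 0⟩, hp.ent, fun he => hn ?_⟩
    obtain ⟨n, ψ, hψ, hu, hJ⟩ := tr_iff.1 (tr_iff_ent.2 he)
    have := fresh_all (supp_fresh (w.supp _ hψ) hc') hu le_rfl hJ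
    rw [Jdg.subst, PCol.subst, ren_name_eq, PProp.subst_scons_congr
      (hs.mono fun i hi => (⟨hi.1, fun e => hc' (e ▸ hi)⟩ : 1 ≤ i ∧ i ≠ c)) _
      (freshSub_eq 0 1)] at this
    have e : scons (freshSub c 0 1 c) (fun i => .var (i + 1)) = PTm.var := by
      have h1 : 1 ≤ c := hc.1
      funext i
      cases i with
      | zero => simp only [scons, freshSub]; rw [if_neg (by omega)]; simp
      | succ i => rfl
    rw [e, PProp.subst_var] at this
    have h3 : w.Tr [.V] (.holds φ) := tr_iff.2 ⟨n, ψ, hψ, hu, this⟩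
    filter_upwards [h3, hφ, tr_wf] with Δ a b c using .allI (.vF c) b a
  obtain ⟨v, hr, hF, -, hχ⟩ := Thy.exists_world hs1 hav
  exact hχ (h v ⟨by omega, hF⟩ c (hr ▸ hc)).ent

end World

end EmTT

namespace EmTT

variable {T : SetTheory}

theorem Der.eq_inst1_ty {Γ : Ctx} {A B : PCol} {k : Kind} {a b : PTm} (h : Der T (A :: Γ) (.ty k B))
    (ha : Der T Γ (.tm a A)) (hb : Der T Γ (.tm b A)) (hab : Der T Γ (.tmEq a b A)) :
    Der T Γ (.tyEq k (B.inst [a] 0) (B.inst [b] 0)) := by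
  have h1 := (SubTy.id ha.wf).cons (a := a) (A := A) (by rwa [PCol.subst_var])
  have h2 := (SubTy.id ha.wf).cons (a := b) (A := A) (by rwa [PCol.subst_var])
  rw [PCol.inst, PCol.inst, PTm.sb_cons, PTm.sb_cons]
  refine Der.substEqTy (σ := scons a .var) (τ := scons b .var) h ha.wf h1.2 h2.2 fun i C hC => ?_
  cases hC with
  | zero => rw [PCol.wk_eq, PCol.ren_subst]; simpa [scons, PCol.subst_var] using hab
  | succ hC =>
    rw [PCol.wk_eq, PCol.ren_subst]; simpa [scons, PCol.subst_var] using .tmRefl (.var ha.wf hC)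

theorem Der.eq_inst_one {Γ : Ctx} {A B : PCol} {t a b : PTm} (h : Der T (A :: Γ) (.tm t B))
    (ha : Der T Γ (.tm a A)) (hb : Der T Γ (.tm b A)) (hab : Der T Γ (.tmEq a b A)) :
    Der T Γ (.tmEq (t.inst [a] 0) (t.inst [b] 0) (B.inst [a] 0)) := by
  have := h.eq_inst1 ha hb hab
  rw [PTm.inst, PTm.inst, PCol.inst, PTm.sb_cons, PTm.sb_cons]; exact this

theorem PCol.wk_inst (φ : PCol) (a : PTm) : (φ.ren Nat.succ).inst [a] 0 = φ := by
  rw [PCol.inst, PTm.sb_cons, PCol.ren_subst]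
  exact PCol.subst_var φ

theorem PTm.wk_inst (φ : PTm) (a : PTm) : (φ.ren Nat.succ).inst [a] 0 = φ := by
  rw [PTm.inst, PTm.sb_cons, PTm.ren_subst]
  exact PTm.subst_var φ

theorem PCol.inst_wk_inst (φ : PCol) (a : PTm) : (φ.inst [] 1).inst [a] 0 = φ := by
  rw [PCol.wk_eq, PCol.wk_inst]
theorem PTm.inst_wk_inst (φ : PTm) (a : PTm) : (φ.inst [] 1).inst [a] 0 = φ := by
  rw [PTm.wk_eq, PTm.wk_inst]
theorem PProp.inst_wk_inst (φ : PProp) (a : PTm) : (φ.inst [] 1).inst [a] 0 = φ := by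
  rw [PProp.wk_eq, PProp.wk_inst]

theorem eqV_inst (a b : PTm) : (PProp.eq .V (.var 0) (a.inst [] 1)).inst [b] 0 = .eq .V b a := by
  change PProp.eq .V b ((a.inst [] 1).inst [b] 0) = _
  rw [PTm.inst_wk_inst]

namespace World

variable {w w' : World T}

/-- `σ` is a typed substitution for `Γ` over `w`. -/
def Sub (w : World T) (σ : ℕ → PTm) (Γ : Ctx) : Prop :=
  ∀ i A, Γ.Has i A → w.Tr [] (.tm (σ i) (A.subst σ))

theorem Sub.eventually {σ : ℕ → PTm} {Γ : Ctx} (h : w.Sub σ Γ) :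
    ∀ᶠ Δ in w.fil .top, SubTy T Δ σ Γ := by
  have : ∀ i ∈ Finset.range Γ.length, ∀ᶠ Δ in w.fil .top, ∀ A, Γ.Has i A →
      Der T Δ (.tm (σ i) (A.subst σ)) := fun i hi => by
    obtain ⟨A, hA⟩ := Ctx.exists_has (Finset.mem_range.1 hi)
    filter_upwards [h i A hA] with Δ h1 B hB
    rw [hB.unique hA]; exact h1
  filter_upwards [(Filter.eventually_all_finset _).2 this, tr_wf] with Δ h1 h2
  exact ⟨h2, fun i A hA => h1 i (Finset.mem_range.2 hA.lt) A hA⟩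

theorem Tr.sub {σ : ℕ → PTm} {Γ : Ctx} {J : Jdg} (hJ : Der T Γ J) (h : w.Sub σ Γ) :
    w.Tr [] (J.subst σ) := by
  filter_upwards [h.eventually] with Δ h1 using hJ.sub h1

theorem Sub.mono {σ : ℕ → PTm} {Γ : Ctx} (h : w.Sub σ Γ) (hw : w ≤ w') : w'.Sub σ Γ :=
  fun i A hA => (h i A hA).mono hw

/-! ### The elements of a world -/

def nameSetoid (w : World T) : Setoid {c // c ∈ names w.rank} where
  r c d := w.Tr [] (.tmEq (.var c) (.var d) .V)
  iseqv :=
    { refl := fun c => by filter_upwards [tr_name c.2.1] with Δ h using .tmRefl h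
      symm := fun h => by filter_upwards [h] with Δ h using .tmSymm h
      trans := fun h h' => by filter_upwards [h, h'] with Δ h h' using .tmTrans h h' }

/-- The elements of `V` over `w`. -/
def El₀ (w : World T) : Type := Quotient w.nameSetoid

end World

/-- The elements of `V` over `w`. -/
abbrev M (w : World T) : Type := w.El₀

namespace M

open World

variable {w w' w'' : World T}

/-- A name of the element `x`. -/
noncomputable def name (x : M w) : PTm := .var (Quotient.out x).1

theorem tr_name (x : M w) : w.Tr [] (.tm x.name .V) := World.tr_name (Quotient.out x).2.1

theorem name_supp (x : M w) : x.name.Supp (names w.rank) := PTm.supp_var (Quotient.out x).2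

theorem ext_tr {x y : M w} (h : w.Tr [] (.tmEq x.name y.name .V)) : x = y := by
  rw [← Quotient.out_eq x, ← Quotient.out_eq y]; exact Quotient.sound (s := w.nameSetoid) h

end M

namespace World

variable {w w' w'' : World T} {a b : PTm} {x y : M w} {A B : PCol} {φ ψ : PProp}

/-- The element `x` is the value of the term `a`. -/
def IsVal (w : World T) (a : PTm) (x : M w) : Prop :=
  w.Tr [] (.tm a .V) ∧ w.Tr [] (.tmEq x.name a .V)

theorem isVal_name (x : M w) : w.IsVal x.name x := ⟨x.tr_name, by
  filter_upwards [x.tr_name] with Δ h using .tmRefl h⟩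

theorem IsVal.unique (h : w.IsVal a x) (h' : w.IsVal a y) : x = y := M.ext_tr <| by
  filter_upwards [h.2, h'.2] with Δ h h' using .tmTrans h (.tmSymm h')

theorem IsVal.congr (h : w.IsVal a x) (hb : w.Tr [] (.tm b .V)) (h' : w.Tr [] (.tmEq a b .V)) :
    w.IsVal b x :=
  ⟨hb, by filter_upwards [h.2, h'] with Δ h h' using .tmTrans h h'⟩

theorem IsVal.eq (h : w.IsVal a x) (h' : w.IsVal b x) : w.Tr [] (.tmEq a b .V) := by
  filter_upwards [h.2, h'.2] with Δ h h' using .tmTrans (.tmSymm h) h'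

theorem name_of_mem {c : ℕ} (hc : c ∈ names w.rank) : ∃ x, w.IsVal (.var c) x := by
  refine ⟨(Quotient.mk w.nameSetoid ⟨c, hc⟩ : M w), ?_⟩
  exact ⟨tr_name hc.1, Quotient.mk_out (s := w.nameSetoid) ⟨c, hc⟩⟩

theorem Der_eq_wk {Δ : Ctx} (h : Der T Δ (.tm a .V)) :
    Der T (.V :: Δ) (.prop (.eq .V (.var 0) (a.inst [] 1))) := by
  have hV := Der.vF h.wf
  refine .propsProp (.eqVF (.var (A := .V) (.cons hV) .zero) ?_)
  exact h.wk hV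

theorem exists_isVal (hs : a.Supp (names w.rank)) (ha : w.Tr [] (.tm a .V)) :
    ∃ x, w.IsVal a x := by
  have h1 : w.Tr [] (.holds (.ex .V (.eq .V (.var 0) (a.inst [] 1)))) := by
    filter_upwards [ha] with Δ h
    refine .exI (.vF h.wf) (Der_eq_wk h) h ?_
    rw [eqV_inst]
    exact .eqI (.vF h.wf) h
  have h2 : w.Tr [.V] (.prop (.eq .V (.var 0) (a.inst [] 1))) := by
    filter_upwards [ha] with Δ h using Der_eq_wk h
  obtain ⟨c, hc, h3⟩ := tr_ex_V (supp_ex fun σ τ hst => by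
    rw [PTm.wk_eq, PProp.subst, PProp.subst, PTm.ren_subst, PTm.ren_subst]
    congr 1
    exact hs _ _ fun i hi => by simp [PTm.up, hst i hi]) h2 h1
  obtain ⟨x, hx⟩ := name_of_mem hc
  refine ⟨x, hx.congr ha ?_⟩
  filter_upwards [h3, ha, tr_name hc.1] with Δ h h1 h2
  rw [eqV_inst] at h
  exact .eqE (.vF h1.wf) h2 h1 h

instance : Nonempty (M w) :=
  (exists_isVal (w := w) (a := .empty) (fun _ _ _ => rfl)
    (by filter_upwards [tr_wf] with Δ h using .emptyI h)).nonempty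

/-- The value of a term. -/
noncomputable def val (w : World T) (a : PTm) : M w := Classical.epsilon (w.IsVal a)

theorem IsVal.val_eq (h : w.IsVal a x) : w.val a = x :=
  (Classical.epsilon_spec (p := w.IsVal a) ⟨x, h⟩ : w.IsVal a (w.val a)).unique h

theorem isVal_val (hs : a.Supp (names w.rank)) (ha : w.Tr [] (.tm a .V)) : w.IsVal a (w.val a) :=
  Classical.epsilon_spec (p := w.IsVal a) (exists_isVal hs ha)

/-- The element `x` seen in a larger world. -/
noncomputable def res (_ : w ≤ w') (x : M w) : M w' := w'.val x.name

theorem isVal_res (h : w ≤ w') (x : M w) : w'.IsVal x.name (res h x) :=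
  isVal_val (x.name_supp.mono (names_mono h.1)) (x.tr_name.mono h)

theorem IsVal.mono (h : w.IsVal a x) (hw : w ≤ w') : w'.IsVal a (res hw x) :=
  (isVal_res hw x).congr (h.1.mono hw) (h.2.mono hw)

@[simp] theorem res_refl (x : M w) : res (le_refl w) x = x := (isVal_name x).val_eq

theorem res_res (h : w ≤ w') (h' : w' ≤ w'') (x : M w) :
    res h' (res h x) = res (h.trans h') x :=
  ((isVal_res h x).mono h').unique (isVal_res _ x)

/-- `x` is an element of the collection `A`. -/
def El (w : World T) (A : PCol) (x : M w) : Prop := w.Tr [] (.tm x.name A)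

theorem IsVal.el (h : w.IsVal a x) (ha : w.Tr [] (.tm a A)) : w.El A x := by
  filter_upwards [h.2, ha, x.tr_name] with Δ h h1 h2 using .ofV h1 h2 (.tmSymm h)

theorem El.tr (h : w.El A x) (hx : w.IsVal a x) : w.Tr [] (.tm a A) := by
  filter_upwards [h, hx.2, hx.1] with Δ h h1 h2 using .ofV h h2 h1

theorem El.mono (h : w.El A x) (hw : w ≤ w') : w'.El A (res hw x) := (isVal_res hw x).el (Tr.mono h hw)

instance : Membership (M w) (M w) := ⟨fun y x => w.Tr [] (.holds (.mem x.name y.name))⟩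

theorem Der_mem_congr {Δ : Ctx} {a a' b b' : PTm} (h : Der T Δ (.tmEq a a' .V))
    (h' : Der T Δ (.tmEq b b' .V)) (hm : Der T Δ (.holds (.mem a b))) :
    Der T Δ (.holds (.mem a' b')) := .conv hm (.propColEq (.propsPropEq (.memFEq h h')))

theorem IsVal.mem (h : w.IsVal a x) (h' : w.IsVal b y) :
    x ∈ y ↔ w.Tr [] (.holds (.mem a b)) := by
  constructor
  · intro hm
    filter_upwards [h.2, h'.2, hm] with Δ h h' h1 using Der_mem_congr h h' h1
  · intro hm
    filter_upwards [h.2, h'.2, hm] with Δ h h' h1 using Der_mem_congr (.tmSymm h) (.tmSymm h') h1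

theorem mem_mono (hm : x ∈ y) (hw : w ≤ w') : res hw x ∈ res hw y :=
  ((isVal_res hw x).mem (isVal_res hw y)).2 (Tr.mono hm hw)

theorem tr_eq_iff (ha : w.Tr [] (.tm a .V)) (hb : w.Tr [] (.tm b .V)) :
    w.Tr [] (.holds (.eq .V a b)) ↔ w.Tr [] (.tmEq a b .V) := by
  constructor <;> intro h
  · filter_upwards [h, ha, hb] with Δ h h1 h2 using .eqE (.vF h1.wf) h1 h2 h
  · filter_upwards [h, ha, hb] with Δ h h1 h2
    exact .conv (.eqI (.vF h1.wf) h1) (.propColEq (.eqFEq .large (.tyRefl (.vF h1.wf)) (.tmRefl h1) h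
      (.propsProp (.eqVF h1 h1)) (.propsProp (.eqVF h1 h2))))

theorem IsVal.eq_iff (hx : w.IsVal a x) (hy : w.IsVal b y) :
    w.Tr [] (.tmEq a b .V) ↔ x = y :=
  ⟨fun h => (hx.congr hy.1 h).unique hy, fun h => hx.eq (h ▸ hy)⟩

/-- Propositions depending on an element of `A`, at equal arguments. -/
theorem tr_congr (hφ : w.Tr [A] (.prop φ))
    (ha : w.Tr [] (.tm a A)) (hb : w.Tr [] (.tm b A)) (hab : w.Tr [] (.tmEq a b .V))
    (h : w.Tr [] (.holds (φ.inst [a] 0))) : w.Tr [] (.holds (φ.inst [b] 0)) := by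
  filter_upwards [hφ, ha, hb, hab, h] with Δ h1 h2 h3 h4 h5
  exact .conv h5 (.propColEq (Der.eq_inst1_ty h1 h2 h3 (.ofVEq h2 h3 h4)))

/-! ### Kripke semantics of the logical connectives -/

theorem tr_and (h : w.Tr [] (.prop (.and φ ψ))) (hφ : w.Tr [] (.prop φ))
    (hψ : w.Tr [.ofProp φ] (.prop (ψ.ren Nat.succ))) :
    w.Tr [] (.holds (.and φ ψ)) ↔ w.Tr [] (.holds φ) ∧ w.Tr [] (.holds ψ) := by
  constructor
  · intro hh
    constructor
    · filter_upwards [hh, hφ] with Δ h h1 using .andE1 h1 h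
    · filter_upwards [hh, hφ, hψ] with Δ h h1 h2
      have h3 := Der.andE1 h1 h
      have h4 := Der.inst_one_ty h2 h3
      rw [PCol.inst, PCol.subst, ← PProp.inst, PProp.wk_inst] at h4
      exact .andE2 h4 h
  · rintro ⟨h1, h2⟩
    filter_upwards [h, h1, h2] with Δ h h1 h2 using .andI h h1 h2

theorem Der_memCol_eq {Δ : Ctx} (hA : Der T Δ (.ty .col A)) :
    Der T (.V :: Δ) (.prop (.memCol (.var 0) (A.inst [] 1))) := by
  have hV := Der.vF (T := T) (Γ := Δ) hA.wf
  exact .memColF (.var (A := .V) (.cons hV) .zero) (hA.wk hV)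

theorem memCol_inst (A : PCol) (a : PTm) :
    (PProp.memCol (.var 0) (A.inst [] 1)).inst [a] 0 = .memCol a A := by
  rw [PProp.inst, PProp.subst, ← PCol.inst, PCol.inst_wk_inst]; rfl

theorem supp_rel {L : Set ℕ} (hA : A.Supp L) (hφ : ∀ σ τ : ℕ → PTm, (∀ i ∈ L, σ i = τ i) →
    φ.subst (PTm.up σ) = φ.subst (PTm.up τ)) :
    (PProp.ex .V (.and (.memCol (.var 0) (A.inst [] 1)) φ)).Supp L ∧
    (PProp.ex .V (.imp (.memCol (.var 0) (A.inst [] 1)) φ)).Supp L := by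
  have : ∀ σ τ : ℕ → PTm, (∀ i ∈ L, σ i = τ i) →
      (A.inst [] 1).subst (PTm.up σ) = (A.inst [] 1).subst (PTm.up τ) := fun σ τ hst => by
    rw [PCol.wk_eq, PCol.ren_subst, PCol.ren_subst]
    exact hA _ _ fun i hi => by simp [PTm.up, hst i hi]
  constructor <;>
  exact supp_ex fun σ τ hst => by simp only [PProp.subst, this σ τ hst, hφ σ τ hst]; rfl

theorem supp_quant {L : Set ℕ} (hs : (PProp.ex A φ).Supp L) :
    A.Supp L ∧ ∀ σ τ : ℕ → PTm, (∀ i ∈ L, σ i = τ i) →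
      φ.subst (PTm.up σ) = φ.subst (PTm.up τ) := by
  constructor <;> intro σ τ hst <;> have := hs σ τ hst <;>
  simp only [PProp.subst, PProp.ex.injEq] at this
  exacts [this.1, this.2]

theorem tr_ex (hs : (PProp.ex A φ).Supp (names w.rank)) (hA : w.Tr [] (.ty .col A))
    (hφ : w.Tr [A] (.prop φ)) :
    w.Tr [] (.holds (.ex A φ)) ↔ ∃ x, w.El A x ∧ w.Tr [] (.holds (φ.inst [x.name] 0)) := by
  constructor
  · intro h
    have h1 : w.Tr [] (.holds (.ex .V (.and (.memCol (.var 0) (A.inst [] 1)) φ))) := by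
      filter_upwards [h, hA, hφ] with Δ h1 h2 h3
      have hV := Der.vF (T := T) (Γ := Δ) h1.wf
      have q : Der T Δ (.prop (.ex .V (.and (.memCol (.var 0) (A.inst [] 1)) φ))) :=
        .exF .large hV (.andRelF h2 h3)
      have p : Der T Δ (.prop (.ex A φ)) := .exF .large h2 h3
      refine .impE q (.andE1 ?_ (.exRel h2 h3)) h1
      exact .impF .large p q
    have h2 : w.Tr [.V] (.prop (.and (.memCol (.var 0) (A.inst [] 1)) φ)) := by
      filter_upwards [hA, hφ] with Δ h2 h3 using .andRelF h2 h3
    obtain ⟨sA, sφ⟩ := supp_quant hs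
    obtain ⟨c, hc, h3⟩ := tr_ex_V (supp_rel sA sφ).1 h2 h1
    obtain ⟨x, hx⟩ := name_of_mem hc
    have h3' : w.Tr [] (.holds (.and (.memCol (.var c) A) (φ.inst [.var c] 0))) := by
      have e : (PProp.and (.memCol (.var 0) (A.inst [] 1)) φ).inst [.var c] 0 =
          .and (.memCol (.var c) A) (φ.inst [.var c] 0) := by
        rw [← memCol_inst A (.var c)]; rfl
      rwa [e] at h3
    have h4 : w.Tr [] (.tm (.var c) A) := by
      filter_upwards [h3', hA, tr_name hc.1] with Δ h hA hc
      exact .memColE hA hc (.andE1 (.memColF hc hA) h)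
    have h5 : w.Tr [] (.holds (φ.inst [.var c] 0)) := by
      filter_upwards [h3', h4, hφ] with Δ h h1 h2 using .andE2 (Der.inst_one_ty h2 h1) h
    have h6 := hx.el h4
    refine ⟨x, h6, tr_congr hφ h4 h6 ?_ h5⟩
    filter_upwards [hx.2] with Δ h using .tmSymm h
  · rintro ⟨x, h1, h2⟩
    filter_upwards [hA, hφ, h1, h2] with Δ a b c d using .exI a b c d

theorem tr_all (hs : (PProp.ex A φ).Supp (names w.rank)) (hA : w.Tr [] (.ty .col A))
    (hφ : w.Tr [A] (.prop φ)) :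
    w.Tr [] (.holds (.all A φ)) ↔
      ∀ w', w ≤ w' → ∀ x : M w', w'.El A x → w'.Tr [] (.holds (φ.inst [x.name] 0)) := by
  constructor
  · intro h w' hw x hx
    filter_upwards [h.mono hw, hA.mono hw, hφ.mono hw, hx] with Δ a b c d using .allE b c a d
  · intro h
    have h2 : w.Tr [.V] (.prop (.imp (.memCol (.var 0) (A.inst [] 1)) φ)) := by
      filter_upwards [hA, hφ] with Δ h2 h3 using .impRelF h2 h3
    obtain ⟨sA, sφ⟩ := supp_quant hs
    have h1 : w.Tr [] (.holds (.all .V (.imp (.memCol (.var 0) (A.inst [] 1)) φ))) := by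
      refine tr_all_V (supp_rel sA sφ).2 h2 fun w' hw c hc => ?_
      have e : (PProp.imp (.memCol (.var 0) (A.inst [] 1)) φ).inst [.var c] 0 =
          .imp (.memCol (.var c) A) (φ.inst [.var c] 0) := by
        rw [← memCol_inst A (.var c)]; rfl
      have hL : names w.rank ⊆ names w'.rank := names_mono hw.1
      have hc1 := tr_name (w := w') hc.1
      have hφ' := hφ.mono hw
      have hA' := hA.mono hw
      have hsA := sA
      rw [e]
      refine tr_imp ?_ ?_ ?_ ?_ ?_ ?_
      · intro σ τ hst
        simp only [PProp.subst, PTm.subst, hst c hc, sA σ τ fun i hi => hst i (hL hi)]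
      · intro σ τ hst
        rw [ren_name_eq, ren_name_eq, hst c hc]
        have := sφ σ τ fun i hi => hst i (hL hi)
        have h3 := congrArg (fun φ => PProp.subst (scons (τ c) .var) φ) this
        simpa [PProp.subst_subst, up_subst_scons, PTm.subst_var] using h3
      · filter_upwards [h2.mono hw, hc1] with Δ a b
        have := Der.inst_one_ty a b
        rwa [PCol.inst, PCol.subst, ← PProp.inst, e] at this
      · filter_upwards [hA', hc1] with Δ a b using .memColF b a
      · filter_upwards [hA', hφ', hc1] with Δ a b c1
        have p := Der.memColF c1 a
        have hs := SubTy.wk (.propCol p)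
        have c2 := c1.wk (.propCol p)
        have a2 := a.wk (.propCol p)
        have h5 := Der.memColE a2 c2 (by
          have := Der.hyp p
          rw [PProp.inst, PTm.sb_nil] at this
          exact this)
        have := Der.sub (J := .prop φ) b (hs.cons h5)
        rw [Jdg.subst, PCol.subst] at this
        rw [PProp.inst, PTm.sb_cons, PProp.subst_ren, scons_ren]
        exact this
      · intro w'' hw' hm
        have hc2 := hc1.mono hw'
        have hA2 := hA'.mono hw'
        have hc3 : w''.Tr [] (.tm (.var c) A) := by
          filter_upwards [hm, hc2, hA2] with Δ a b c using .memColE c b a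
        obtain ⟨x, hx⟩ := name_of_mem (names_mono hw'.1 hc)
        have hx1 := hx.el hc3
        exact tr_congr (hφ'.mono hw') hx1 hc3 hx.2 (h _ (hw.trans hw') x hx1)
    filter_upwards [h1, hA, hφ, tr_wf] with Δ a b c d
    refine .impE (.allF .large b c) (.andE2 ?_ (.allRel b c)) a
    exact .impF .large (.allF .large (.vF d) (.impRelF b c)) (.allF .large b c)

theorem tr_imp_iff (hs : φ.Supp (names w.rank)) (hs' : ψ.Supp (names w.rank))
    (hi : w.Tr [] (.prop (.imp φ ψ))) (hφ : w.Tr [] (.prop φ))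
    (hψ : w.Tr [.ofProp φ] (.prop (ψ.ren Nat.succ))) :
    w.Tr [] (.holds (.imp φ ψ)) ↔
      ∀ w', w ≤ w' → w'.Tr [] (.holds φ) → w'.Tr [] (.holds ψ) := by
  refine ⟨fun h w' hw hp => ?_, tr_imp hs hs' hi hφ hψ⟩
  filter_upwards [h.mono hw, hp, hψ.mono hw] with Δ a b c
  have h4 := Der.inst_one_ty c b
  rw [PCol.inst, PCol.subst, ← PProp.inst, PProp.wk_inst] at h4
  exact .impE h4 a b

end World

end EmTT

namespace EmTT

variable {T : SetTheory}

/-! ## Well-formed formulas of set theory -/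

def STm.Wf (T : SetTheory) (t : STm) : Prop := ∃ n, Der T (List.replicate n .V) (.tm t.tilde .V)

/-- All terms occurring in `φ` are well formed. -/
def SFm.Wf (T : SetTheory) : SFm → Prop
  | .bot => True
  | .eq a b => a.Wf T ∧ b.Wf T
  | .mem a b => a.Wf T ∧ b.Wf T
  | .and φ ψ => φ.Wf T ∧ ψ.Wf T
  | .or φ ψ => φ.Wf T ∧ ψ.Wf T
  | .imp φ ψ => φ.Wf T ∧ ψ.Wf T
  | .all φ => φ.Wf T
  | .ex φ => φ.Wf T

/-- `φ` may be used in a separation term. -/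
def SFm.Adm (T : SetTheory) (φ : SFm) : Prop :=
  ∃ n, Der T (List.replicate n .V) (.prop φ.tilde) ∧
    (T = .CZF → Der T (List.replicate n .V) (.props φ.tilde))

theorem Der.repl {n m : ℕ} {J : Jdg} (h : Der T (List.replicate n .V) J) (hnm : n ≤ m) :
    Der T (List.replicate m .V) J := h.mono (replicate_sub hnm)

theorem STm.wf_var (i : ℕ) : (STm.var i).Wf T :=
  ⟨i + 1, .var (replicate_wf _) (replicate_has.2 ⟨by omega, rfl⟩)⟩

theorem STm.wf_empty : STm.empty.Wf T := ⟨0, .emptyI (replicate_wf 0)⟩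
theorem STm.wf_omega : STm.omega.Wf T := ⟨0, .omegaI (replicate_wf 0)⟩

namespace STm.Wf

variable {a b : STm}

theorem upair (h : a.Wf T) (h' : b.Wf T) : (STm.upair a b).Wf T := by
  obtain ⟨n, h⟩ := h; obtain ⟨m, h'⟩ := h'
  exact ⟨n + m, .upairI (h.repl (by omega)) (h'.repl (by omega))⟩

theorem union (h : a.Wf T) : (STm.union a).Wf T := by
  obtain ⟨n, h⟩ := h; exact ⟨n, .unionI h⟩

theorem sing (h : a.Wf T) : (STm.sing a).Wf T := h.upair h
theorem pair (h : a.Wf T) (h' : b.Wf T) : (STm.pair a b).Wf T := h.sing.upair (h.upair h')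
theorem cup (h : a.Wf T) (h' : b.Wf T) : (STm.cup a b).Wf T := (h.upair h').union

theorem sep {φ : SFm} (h : a.Wf T) (h' : φ.Adm T) : (STm.sep a φ).Wf T := by
  obtain ⟨n, h⟩ := h; obtain ⟨m, h1, h2⟩ := h'
  by_cases hT : T = .CZF
  · exact ⟨n + m, .sepIs hT (h.repl (by omega)) ((h2 hT).repl (m := n + m + 1) (by omega))⟩
  · exact ⟨n + m, .sepI hT (h.repl (by omega)) (h1.repl (m := n + m + 1) (by omega))⟩

theorem subst {σ : ℕ → STm} (h : a.Wf T) (hσ : ∀ i, (σ i).Wf T) : (a.subst σ).Wf T := by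
  obtain ⟨n, h⟩ := h
  choose m hm using hσ
  refine ⟨(Finset.range n).sup m, ?_⟩
  rw [STm.tilde_subst]
  have := h.sub (σ := fun i => (σ i).tilde) (Δ := List.replicate ((Finset.range n).sup m) .V)
    ⟨replicate_wf _, fun i A hA => ?_⟩
  · exact this
  obtain ⟨hi, rfl⟩ := replicate_has.1 hA
  exact (hm i).repl (Finset.le_sup (Finset.mem_range.2 hi))

theorem ren (ρ : ℕ → ℕ) (h : a.Wf T) : (a.ren ρ).Wf T := by
  rw [STm.ren_eq_subst]; exact h.subst fun _ => STm.wf_var _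

end STm.Wf

theorem STm.wf_sb {l : List STm} (h : ∀ t ∈ l, t.Wf T) (m i : ℕ) : (STm.sb l m i).Wf T := by
  induction l generalizing i with
  | nil => exact STm.wf_var _
  | cons t l ih =>
    cases i with
    | zero => exact h t (by simp)
    | succ i => exact ih (fun t ht => h t (by simp [ht])) i

theorem STm.Wf.inst {a : STm} {l : List STm} {m : ℕ} (h : a.Wf T) (hl : ∀ t ∈ l, t.Wf T) :
    (a.inst l m).Wf T := h.subst (STm.wf_sb hl m)

theorem STm.wf_up {σ : ℕ → STm} (h : ∀ i, (σ i).Wf T) (i : ℕ) : (STm.up σ i).Wf T := by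
  cases i with
  | zero => exact STm.wf_var 0
  | succ i => exact (h i).ren _

theorem SFm.Wf.subst {φ : SFm} {σ : ℕ → STm} (h : φ.Wf T) (hσ : ∀ i, (σ i).Wf T) :
    (φ.subst σ).Wf T := by
  match φ, h with
  | .bot, _ => trivial
  | .eq a b, h => exact ⟨h.1.subst hσ, h.2.subst hσ⟩
  | .mem a b, h => exact ⟨h.1.subst hσ, h.2.subst hσ⟩
  | .and φ ψ, h => exact ⟨SFm.Wf.subst (φ := φ) h.1 hσ, SFm.Wf.subst (φ := ψ) h.2 hσ⟩
  | .or φ ψ, h => exact ⟨SFm.Wf.subst (φ := φ) h.1 hσ, SFm.Wf.subst (φ := ψ) h.2 hσ⟩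
  | .imp φ ψ, h => exact ⟨SFm.Wf.subst (φ := φ) h.1 hσ, SFm.Wf.subst (φ := ψ) h.2 hσ⟩
  | .all φ, h => exact SFm.Wf.subst (φ := φ) h (STm.wf_up hσ)
  | .ex φ, h => exact SFm.Wf.subst (φ := φ) h (STm.wf_up hσ)

theorem SFm.Wf.inst {φ : SFm} {l : List STm} {m : ℕ} (h : φ.Wf T) (hl : ∀ t ∈ l, t.Wf T) :
    (φ.inst l m).Wf T := h.subst (STm.wf_sb hl m)

theorem SFm.Wf.prop {φ : SFm} (h : φ.Wf T) : ∃ n, Der T (List.replicate n .V) (.prop φ.tilde) := by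
  match φ, h with
  | .bot, _ => exact ⟨0, .propsProp (.botF (replicate_wf 0))⟩
  | .eq a b, ⟨⟨n, h⟩, ⟨m, h'⟩⟩ =>
    exact ⟨n + m, .propsProp (.eqVF (h.repl (by omega)) (h'.repl (by omega)))⟩
  | .mem a b, ⟨⟨n, h⟩, ⟨m, h'⟩⟩ =>
    exact ⟨n + m, .propsProp (.memF (h.repl (by omega)) (h'.repl (by omega)))⟩
  | .and φ ψ, h =>
    obtain ⟨n, h1⟩ := SFm.Wf.prop (φ := φ) h.1
    obtain ⟨m, h2⟩ := SFm.Wf.prop (φ := ψ) h.2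
    exact ⟨n + m, .andF .large (h1.repl (by omega)) (h2.repl (by omega))⟩
  | .or φ ψ, h =>
    obtain ⟨n, h1⟩ := SFm.Wf.prop (φ := φ) h.1
    obtain ⟨m, h2⟩ := SFm.Wf.prop (φ := ψ) h.2
    exact ⟨n + m, .orF .large (h1.repl (by omega)) (h2.repl (by omega))⟩
  | .imp φ ψ, h =>
    obtain ⟨n, h1⟩ := SFm.Wf.prop (φ := φ) h.1
    obtain ⟨m, h2⟩ := SFm.Wf.prop (φ := ψ) h.2
    exact ⟨n + m, .impF .large (h1.repl (by omega)) (h2.repl (by omega))⟩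
  | .all φ, h =>
    obtain ⟨n, h1⟩ := SFm.Wf.prop (φ := φ) h
    exact ⟨n, .allF .large (.vF (replicate_wf n)) (h1.repl (m := n + 1) (by omega))⟩
  | .ex φ, h =>
    obtain ⟨n, h1⟩ := SFm.Wf.prop (φ := φ) h
    exact ⟨n, .exF .large (.vF (replicate_wf n)) (h1.repl (m := n + 1) (by omega))⟩

/-! ### Admissible formulas -/

namespace SFm

theorem Adm.mono {φ : SFm} {n m : ℕ} (h : Der T (List.replicate n .V) (.prop φ.tilde) ∧
    (T = .CZF → Der T (List.replicate n .V) (.props φ.tilde))) (hnm : n ≤ m) :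
    Der T (List.replicate m .V) (.prop φ.tilde) ∧
    (T = .CZF → Der T (List.replicate m .V) (.props φ.tilde)) :=
  ⟨h.1.repl hnm, fun hT => (h.2 hT).repl hnm⟩

theorem adm_eq {a b : STm} (h : a.Wf T) (h' : b.Wf T) : (SFm.eq a b).Adm T := by
  obtain ⟨n, h⟩ := h; obtain ⟨m, h'⟩ := h'
  have : Der T (List.replicate (n + m) .V) (.props (SFm.eq a b).tilde) :=
    .eqVF (h.repl (by omega)) (h'.repl (by omega))
  exact ⟨_, .propsProp this, fun _ => this⟩

theorem adm_mem {a b : STm} (h : a.Wf T) (h' : b.Wf T) : (SFm.mem a b).Adm T := by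
  obtain ⟨n, h⟩ := h; obtain ⟨m, h'⟩ := h'
  have : Der T (List.replicate (n + m) .V) (.props (SFm.mem a b).tilde) :=
    .memF (h.repl (by omega)) (h'.repl (by omega))
  exact ⟨_, .propsProp this, fun _ => this⟩

theorem Adm.and {φ ψ : SFm} (h : φ.Adm T) (h' : ψ.Adm T) : (SFm.and φ ψ).Adm T := by
  obtain ⟨n, h⟩ := h; obtain ⟨m, h'⟩ := h'
  have h1 := Adm.mono h (show n ≤ n + m by omega)
  have h2 := Adm.mono h' (show m ≤ n + m by omega)
  exact ⟨_, .andF .large h1.1 h2.1, fun hT => .andF .small (h1.2 hT) (h2.2 hT)⟩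

theorem Adm.imp {φ ψ : SFm} (h : φ.Adm T) (h' : ψ.Adm T) : (SFm.imp φ ψ).Adm T := by
  obtain ⟨n, h⟩ := h; obtain ⟨m, h'⟩ := h'
  have h1 := Adm.mono h (show n ≤ n + m by omega)
  have h2 := Adm.mono h' (show m ≤ n + m by omega)
  exact ⟨_, .impF .large h1.1 h2.1, fun hT => .impF .small (h1.2 hT) (h2.2 hT)⟩

theorem wk_tilde (a : STm) : (a.inst [] 1).tilde = a.tilde.inst [] 1 := by
  rw [STm.inst, STm.tilde_subst]; rfl

theorem Adm.ball {a : STm} {φ : SFm} (h : a.Wf T) (h' : φ.Adm T) :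
    (SFm.all (.imp (.mem (.var 0) (a.inst [] 1)) φ)).Adm T := by
  have hm : (SFm.mem (.var 0) (a.inst [] 1)).Adm T := adm_mem (STm.wf_var 0) (h.inst (by simp))
  obtain ⟨k, hk⟩ := hm.imp h'
  obtain ⟨n, h⟩ := h; obtain ⟨m, h'⟩ := h'
  have h1 := Adm.mono h' (show m ≤ k + n + m + 1 by omega)
  have h2 := Adm.mono hk (show k ≤ k + n + m + 1 by omega)
  refine ⟨k + n + m, .allF .large (.vF (replicate_wf _)) h2.1, fun hT => ?_⟩
  have := Der.bddAllF hT (h.repl (show n ≤ k + n + m by omega)) (h1.2 hT)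
  rw [SFm.tilde, SFm.tilde, SFm.tilde, wk_tilde]
  exact this

theorem Adm.bex {a : STm} {φ : SFm} (h : a.Wf T) (h' : φ.Adm T) :
    (SFm.ex (.and (.mem (.var 0) (a.inst [] 1)) φ)).Adm T := by
  have hm : (SFm.mem (.var 0) (a.inst [] 1)).Adm T := adm_mem (STm.wf_var 0) (h.inst (by simp))
  obtain ⟨k, hk⟩ := hm.and h'
  obtain ⟨n, h⟩ := h; obtain ⟨m, h'⟩ := h'
  have h1 := Adm.mono h' (show m ≤ k + n + m + 1 by omega)
  have h2 := Adm.mono hk (show k ≤ k + n + m + 1 by omega)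
  refine ⟨k + n + m, .exF .large (.vF (replicate_wf _)) h2.1, fun hT => ?_⟩
  have := Der.bddExF hT (h.repl (show n ≤ k + n + m by omega)) (h1.2 hT)
  rw [SFm.tilde, SFm.tilde, SFm.tilde, wk_tilde]
  exact this

end SFm

theorem STm.inst_nil_succ (a : STm) (m : ℕ) : a.inst [] (m + 1) = (a.inst [] m).inst [] 1 := by
  rw [STm.inst, STm.inst, STm.inst, STm.subst_subst]; rfl

namespace STm

theorem adm_fst {a : STm} (h : a.Wf T) :
    (SFm.all (.imp (.mem (.var 0) (a.inst [] 2)) (.mem (.var 1) (.var 0)))).Adm T := by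
  rw [STm.inst_nil_succ]
  exact .ball (h.inst (by simp)) (SFm.adm_mem (wf_var _) (wf_var _))

theorem Wf.fst {a : STm} (h : a.Wf T) : a.fst.Wf T := (h.union.sep (adm_fst h)).union

theorem adm_snd {a : STm} (h : a.Wf T) : (SFm.imp (.eq (.var 0) (STm.fst (a.inst [] 1)))
      (.eq (a.inst [] 1) (.sing (.sing (STm.fst (a.inst [] 1)))))).Adm T := by
  have h1 : (a.inst [] 1).Wf T := h.inst (by simp)
  exact .imp (SFm.adm_eq (wf_var 0) h1.fst) (SFm.adm_eq h1 h1.fst.sing.sing)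

theorem Wf.snd {a : STm} (h : a.Wf T) : a.snd.Wf T := (h.union.sep (adm_snd h)).union

theorem adm_len {a : STm} (h : a.Wf T) :
    (SFm.ex (.and (.mem (.var 0) (.union (.union (a.inst [] 2))))
      (.mem (.pair (.var 1) (.var 0)) (a.inst [] 2)))).Adm T := by
  have h1 : (a.inst [] 1).Wf T := h.inst (by simp)
  have h2 : (a.inst [] 2).Wf T := h.inst (by simp)
  have e : STm.union (.union (a.inst [] 2)) = (STm.union (.union (a.inst [] 1))).inst [] 1 := by
    rw [STm.inst_nil_succ]; rfl
  rw [e]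
  exact .bex h1.union.union (SFm.adm_mem ((wf_var 1).pair (wf_var 0)) h2)

theorem Wf.len {a : STm} (h : a.Wf T) : a.len.Wf T := wf_omega.sep (adm_len h)

end STm

attribute [simp] STm.wf_var STm.wf_empty STm.wf_omega STm.Wf.upair STm.Wf.union STm.Wf.sing
  STm.Wf.pair STm.Wf.cup STm.Wf.fst STm.Wf.snd STm.Wf.len STm.Wf.inst SFm.Wf.inst SFm.Wf

/-! ## Environments -/

/-- Extension of an environment. -/
def econs {α : Type*} (a : α) (e : ℕ → α) : ℕ → α
  | 0 => a
  | i + 1 => e i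

infixr:67 " ▹ " => econs

@[simp] theorem econs_zero {α : Type*} (x : α) (e : ℕ → α) : (x ▹ e) 0 = x := rfl
@[simp] theorem econs_succ {α : Type*} (x : α) (e : ℕ → α) (i : ℕ) : (x ▹ e) (i + 1) = e i := rfl

def edrop {α : Type*} (m : ℕ) (e : ℕ → α) : ℕ → α := fun i => e (i + m)

@[simp] theorem edrop_zero {α : Type*} (e : ℕ → α) : edrop 0 e = e := rfl
@[simp] theorem edrop_succ {α : Type*} (x : α) (e : ℕ → α) (m : ℕ) :
    edrop (m + 1) (x ▹ e) = edrop m e := rfl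

namespace World

variable {w w' w'' : World T}

theorem Sub.equal {σ τ : ℕ → PTm} {Γ : Ctx}
    (h : ∀ i B, Γ.Has i B → w.Tr [] (.tmEq (σ i) (τ i) (B.subst σ))) :
    ∀ᶠ Δ in w.fil .top, ∀ i B, Γ.Has i B → Der T Δ (.tmEq (σ i) (τ i) (B.subst σ)) := by
  have : ∀ i ∈ Finset.range Γ.length, ∀ᶠ Δ in w.fil .top, ∀ A, Γ.Has i A →
      Der T Δ (.tmEq (σ i) (τ i) (A.subst σ)) := fun i hi => by
    obtain ⟨A, hA⟩ := Ctx.exists_has (Finset.mem_range.1 hi)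
    filter_upwards [h i A hA] with Δ h1 B hB
    rw [hB.unique hA]; exact h1
  filter_upwards [(Filter.eventually_all_finset _).2 this] with Δ h1
  exact fun i A hA => h1 i (Finset.mem_range.2 hA.lt) A hA

theorem Tr.sub_eq {σ τ : ℕ → PTm} {Γ : Ctx} {a : PTm} {A : PCol} (ha : Der T Γ (.tm a A))
    (hσ : w.Sub σ Γ) (hτ : w.Sub τ Γ)
    (h : ∀ i B, Γ.Has i B → w.Tr [] (.tmEq (σ i) (τ i) (B.subst σ))) :
    w.Tr [] (.tmEq (a.subst σ) (a.subst τ) (A.subst σ)) := by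
  filter_upwards [hσ.eventually, hτ.eventually, Sub.equal h] with Δ h1 h2 h3
  exact .substEqTm ha h1.1 h1.2 h2.2 h3

theorem Tr.sub_eq_ty {σ τ : ℕ → PTm} {Γ : Ctx} {k : Kind} {A : PCol} (ha : Der T Γ (.ty k A))
    (hσ : w.Sub σ Γ) (hτ : w.Sub τ Γ)
    (h : ∀ i B, Γ.Has i B → w.Tr [] (.tmEq (σ i) (τ i) (B.subst σ))) :
    w.Tr [] (.tyEq k (A.subst σ) (A.subst τ)) := by
  filter_upwards [hσ.eventually, hτ.eventually, Sub.equal h] with Δ h1 h2 h3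
  exact .substEqTy ha h1.1 h1.2 h2.2 h3

/-- The substitution of names for the values of an environment. -/
noncomputable def nms (e : ℕ → M w) : ℕ → PTm := fun i => (e i).name

/-- An environment seen in a larger world. -/
noncomputable def rese (h : w ≤ w') (e : ℕ → M w) : ℕ → M w' := fun i => res h (e i)

noncomputable def ev (e : ℕ → M w) (t : STm) : M w := w.val (t.tilde.subst (nms e))

@[simp] theorem rese_cons (h : w ≤ w') (x : M w) (e : ℕ → M w) :
    rese h (x ▹ e) = res h x ▹ rese h e := by
  funext i; cases i <;> rfl

@[simp] theorem rese_rese (h : w ≤ w') (h' : w' ≤ w'') (e : ℕ → M w) :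
    rese h' (rese h e) = rese (h.trans h') e := funext fun _ => res_res _ _ _

@[simp] theorem rese_refl (e : ℕ → M w) : rese (le_refl w) e = e := funext fun _ => res_refl _

@[simp] theorem rese_const (h : w ≤ w') (x : M w) :
    rese h (fun _ => x) = fun _ => res h x := rfl

@[simp] theorem edrop_const (m : ℕ) (x : M w) : edrop m (fun _ => x) = fun _ => x := rfl

theorem sub_nms (e : ℕ → M w) (n : ℕ) : w.Sub (nms e) (List.replicate n .V) := fun i A hA => by
  rw [(replicate_has.1 hA).2]; exact (e i).tr_name

end World

open World

variable {w w' : World T}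

theorem STm.Wf.tr {t : STm} (h : t.Wf T) (e : ℕ → M w) : w.Tr [] (.tm (t.tilde.subst (nms e)) .V) := by
  obtain ⟨n, h⟩ := h
  exact Tr.sub h (sub_nms e n)

theorem STm.Wf.isVal {t : STm} (h : t.Wf T) (e : ℕ → M w) :
    w.IsVal (t.tilde.subst (nms e)) (ev e t) :=
  isVal_val (PTm.supp_subst fun i => (e i).name_supp) (h.tr e)

theorem STm.Wf.congr {t : STm} (h : t.Wf T) {σ : ℕ → PTm} {e : ℕ → M w}
    (he : ∀ i, w.IsVal (σ i) (e i)) :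
    w.IsVal (t.tilde.subst σ) (ev e t) := by
  have hs : ∀ n, w.Sub σ (List.replicate n .V) := fun n i A hA => by
    rw [(replicate_has.1 hA).2]; exact (he i).1
  refine (h.isVal e).congr (Tr.sub h.choose_spec (hs _)) ?_
  obtain ⟨n, h⟩ := h
  refine Tr.sub_eq h (sub_nms e n) (hs n) fun i B hB => ?_
  rw [(replicate_has.1 hB).2]; exact (he i).2

theorem STm.Wf.ev_subst {t : STm} (h : t.Wf T) {τ : ℕ → STm} (hτ : ∀ i, (τ i).Wf T)
    (e : ℕ → M w) : ev e (t.subst τ) = ev (fun i => ev e (τ i)) t := by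
  have := h.congr (σ := fun i => ((τ i).tilde.subst (nms e))) (fun i => (hτ i).isVal e)
  rw [ev, STm.tilde_subst, PTm.subst_subst]
  exact this.val_eq

theorem STm.Wf.res_ev {t : STm} (h : t.Wf T) (hw : w ≤ w') (e : ℕ → M w) :
    res hw (ev e t) = ev (rese hw e) t :=
  ((h.isVal e).mono hw).unique
    (h.congr fun i => isVal_res hw (e i))

@[simp] theorem ev_var (e : ℕ → M w) (i : ℕ) : ev e (.var i) = e i := (isVal_name (e i)).val_eq

theorem STm.Wf.ev_ren {t : STm} (h : t.Wf T) (ρ : ℕ → ℕ) (e : ℕ → M w) :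
    ev e (t.ren ρ) = ev (fun i => e (ρ i)) t := by
  rw [STm.ren_eq_subst, h.ev_subst fun i => STm.wf_var _]
  simp only [ev_var]

/-- Kripke forcing for the language of set theory. -/
def SFm.force : SFm → (w : World T) → (ℕ → M w) → Prop
  | .bot, _, _ => False
  | .eq a b, _, e => ev e a = ev e b
  | .mem a b, _, e => ev e a ∈ ev e b
  | .and φ ψ, w, e => φ.force w e ∧ ψ.force w e
  | .or φ ψ, w, e => φ.force w e ∨ ψ.force w e
  | .imp φ ψ, w, e => ∀ w' (h : w ≤ w'), φ.force w' (rese h e) → ψ.force w' (rese h e)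
  | .all φ, w, e => ∀ w' (h : w ≤ w') (x : M w'), φ.force w' (x ▹ rese h e)
  | .ex φ, w, e => ∃ x : M w, φ.force w (x ▹ e)

section force

variable {a b : STm} {φ ψ : SFm} {e : ℕ → M w}

@[simp] theorem SFm.force_bot : SFm.bot.force w e ↔ False := Iff.rfl
@[simp] theorem SFm.force_eq : (SFm.eq a b).force w e ↔ ev e a = ev e b := Iff.rfl
@[simp] theorem SFm.force_mem : (SFm.mem a b).force w e ↔ ev e a ∈ ev e b := Iff.rfl
@[simp] theorem SFm.force_and : (SFm.and φ ψ).force w e ↔ φ.force w e ∧ ψ.force w e := Iff.rfl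
@[simp] theorem SFm.force_or : (SFm.or φ ψ).force w e ↔ φ.force w e ∨ ψ.force w e := Iff.rfl
@[simp] theorem SFm.force_imp : (SFm.imp φ ψ).force w e ↔
    ∀ w' (h : w ≤ w'), φ.force w' (rese h e) → ψ.force w' (rese h e) := Iff.rfl
@[simp 900] theorem SFm.force_all : (SFm.all φ).force w e ↔
    ∀ w' (h : w ≤ w') (x : M w'), φ.force w' (x ▹ rese h e) := Iff.rfl
@[simp] theorem SFm.force_ex : (SFm.ex φ).force w e ↔ ∃ x : M w, φ.force w (x ▹ e) := Iff.rfl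

end force

@[simp] theorem SFm.force_all_imp {φ ψ : SFm} {e : ℕ → M w} : (SFm.all (.imp φ ψ)).force w e ↔
    ∀ w' (h : w ≤ w') (x : M w'), φ.force w' (x ▹ rese h e) → ψ.force w' (x ▹ rese h e) := by
  simp only [SFm.force, rese_cons, rese_rese]
  constructor
  · intro H w' h x hφ
    have := H w' h x w' le_rfl
    rw [res_refl] at this
    exact this hφ
  · intro H w' h x w'' h'
    exact H w'' (h.trans h') _

@[simp] theorem SFm.force_all_all {φ : SFm} {e : ℕ → M w} : (SFm.all (.all φ)).force w e ↔
    ∀ w' (h : w ≤ w') (x y : M w'), φ.force w' (y ▹ x ▹ rese h e) := by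
  simp only [SFm.force, rese_cons, rese_rese]
  constructor
  · intro H w' h x y
    have := H w' h x w' le_rfl y
    rwa [res_refl] at this
  · intro H w' h x w'' h' y
    exact H w'' (h.trans h') _ _

@[simp] theorem SFm.force_iff' {φ ψ : SFm} {e : ℕ → M w} : (SFm.iff φ ψ).force w e ↔
    ∀ w' (h : w ≤ w'), φ.force w' (rese h e) ↔ ψ.force w' (rese h e) :=
  ⟨fun h w' hw => ⟨h.1 w' hw, h.2 w' hw⟩, fun h => ⟨fun w' hw => (h w' hw).1, fun w' hw => (h w' hw).2⟩⟩

@[simp] theorem SFm.force_all_iff {φ ψ : SFm} {e : ℕ → M w} : (SFm.all (SFm.iff φ ψ)).force w e ↔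
    ∀ w' (h : w ≤ w') (x : M w'), φ.force w' (x ▹ rese h e) ↔ ψ.force w' (x ▹ rese h e) := by
  simp only [SFm.force, SFm.force_iff', rese_cons, rese_rese]
  constructor
  · intro H w' h x
    have := H w' h x w' le_rfl
    rwa [res_refl] at this
  · intro H w' h x w'' h'
    exact H w'' (h.trans h') _

@[simp] theorem SFm.wf_iff {φ ψ : SFm} : (SFm.iff φ ψ).Wf T ↔ φ.Wf T ∧ ψ.Wf T := by
  simp [SFm.iff]; tauto

theorem SFm.Wf.congr {φ : SFm} (h : φ.Wf T) {σ : ℕ → PTm} {e : ℕ → M w}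
    (he : ∀ i, w.IsVal (σ i) (e i)) :
    w.Tr [] (.holds (φ.tilde.subst σ)) ↔ w.Tr [] (.holds (φ.tilde.subst (nms e))) := by
  obtain ⟨n, h⟩ := h.prop
  have := Tr.sub_eq_ty h (sub_nms e n) (τ := σ) (fun i A hA => ?_) fun i B hB => ?_
  · constructor <;> intro h'
    · filter_upwards [h', this] with Δ a b using .conv a (.propColEq (.tySymm b))
    · filter_upwards [h', this] with Δ a b using .conv a (.propColEq b)
  · rw [(replicate_has.1 hA).2]; exact (he i).1
  · rw [(replicate_has.1 hB).2]; exact (he i).2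

theorem SFm.Wf.tr_prop {φ : SFm} (h : φ.Wf T) (e : ℕ → M w) :
    w.Tr [] (.prop (φ.tilde.subst (nms e))) := by
  obtain ⟨n, h⟩ := h.prop
  exact Tr.sub h (sub_nms e n)

theorem SFm.Wf.tr_prop1 {φ : SFm} (h : φ.Wf T) (e : ℕ → M w) :
    w.Tr [.V] (.prop (φ.tilde.subst (PTm.up (nms e)))) := by
  obtain ⟨n, h⟩ := h.prop
  filter_upwards [(sub_nms e n).eventually] with Δ h1
  exact Der.sub1 (Γ := List.replicate n .V) (h.repl (Nat.le_succ n)) h1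

theorem up_inst (φ : PProp) (σ : ℕ → PTm) (a : PTm) :
    (φ.subst (PTm.up σ)).inst [a] 0 = φ.subst (scons a σ) := by
  rw [PProp.inst, PTm.sb_cons, PProp.subst_subst, up_subst_scons]
  have : (fun i => (σ i).subst (PTm.sb [] 0)) = σ := funext fun i => PTm.subst_var _
  rw [this]

/-- Forcing is truth. -/
theorem SFm.Wf.force_iff {φ : SFm} (h : φ.Wf T) (w : World T) (e : ℕ → M w) :
    φ.force w e ↔ w.Tr [] (.holds (φ.tilde.subst (nms e))) := by
  have supp : ∀ (ψ : PProp) {w : World T} (e : ℕ → M w), (ψ.subst (nms e)).Supp (names w.rank) :=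
    fun ψ w e => PProp.supp_subst fun i => (e i).name_supp
  match φ, h with
  | .bot, _ => exact ⟨False.elim, not_tr_bot⟩
  | .eq a b, h =>
    exact ((h.1.isVal e).eq_iff (h.2.isVal e)).symm.trans (tr_eq_iff (h.1.tr e) (h.2.tr e)).symm
  | .mem a b, h => exact (h.1.isVal e).mem (h.2.isVal e)
  | .and φ ψ, h =>
    have h1 : SFm.Wf T φ := h.1
    have h2 : SFm.Wf T ψ := h.2
    refine (and_congr (SFm.Wf.force_iff h1 w e) (SFm.Wf.force_iff h2 w e)).trans
      (tr_and (SFm.Wf.tr_prop (φ := .and φ ψ) h e) (h1.tr_prop e) ?_).symm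
    filter_upwards [h1.tr_prop e, h2.tr_prop e] with Δ a b using b.wk_prop (.propCol a)
  | .or φ ψ, h =>
    have h1 : SFm.Wf T φ := h.1
    have h2 : SFm.Wf T ψ := h.2
    exact (or_congr (SFm.Wf.force_iff h1 w e) (SFm.Wf.force_iff h2 w e)).trans
      (tr_or (supp _ e) (supp _ e) (h1.tr_prop e) (h2.tr_prop e)).symm
  | .imp φ ψ, h =>
    have h1 : SFm.Wf T φ := h.1
    have h2 : SFm.Wf T ψ := h.2
    refine Iff.trans ?_ (tr_imp_iff (supp _ e) (supp _ e)
      (SFm.Wf.tr_prop (φ := .imp φ ψ) h e) (h1.tr_prop e) ?_).symm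
    · refine forall_congr' fun w' => forall_congr' fun hw => ?_
      exact imp_congr ((SFm.Wf.force_iff h1 w' _).trans (h1.congr fun i => isVal_res hw (e i)).symm)
        ((SFm.Wf.force_iff h2 w' _).trans (h2.congr fun i => isVal_res hw (e i)).symm)
    · filter_upwards [h1.tr_prop e, h2.tr_prop e] with Δ a b using b.wk_prop (.propCol a)
  | .all φ, h =>
    have h1 : SFm.Wf T φ := h
    refine Iff.trans ?_ (tr_all (supp (.ex .V φ.tilde) e) ?_ (h1.tr_prop1 e)).symm
    · refine forall_congr' fun w' => forall_congr' fun hw => forall_congr' fun x => ?_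
      rw [up_inst, SFm.Wf.force_iff h1 w']
      refine (h1.congr ?_).symm.trans ⟨fun h _ => h, fun h => h x.tr_name⟩
      · intro i; cases i with
        | zero => exact isVal_name x
        | succ i => exact isVal_res hw (e i)
    · filter_upwards [tr_wf] with Δ h using .vF h
  | .ex φ, h =>
    have h1 : SFm.Wf T φ := h
    refine Iff.trans ?_ (tr_ex (supp (.ex .V φ.tilde) e) ?_ (h1.tr_prop1 e)).symm
    · refine exists_congr fun x => ?_
      rw [up_inst, SFm.Wf.force_iff h1 w]
      refine (h1.congr ?_).symm.trans (and_iff_right x.tr_name).symm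
      · intro i; cases i with
        | zero => exact isVal_name x
        | succ i => exact isVal_name (e i)
    · filter_upwards [tr_wf] with Δ h using .vF h

theorem SFm.Wf.force_mono {φ : SFm} (h : φ.Wf T) (hw : w ≤ w') {e : ℕ → M w}
    (hf : φ.force w e) : φ.force w' (rese hw e) := by
  rw [h.force_iff] at hf ⊢
  exact (h.congr fun i => isVal_res hw (e i)).1 (Tr.mono hf hw)

theorem SFm.Wf.force_subst {φ : SFm} (h : φ.Wf T) {τ : ℕ → STm} (hτ : ∀ i, (τ i).Wf T)
    (w : World T) (e : ℕ → M w) :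
    (φ.subst τ).force w e ↔ φ.force w fun i => ev e (τ i) := by
  have hr : ∀ {w' : World T} (hw : w ≤ w'), (fun i => ev (rese hw e) (τ i)) =
      rese hw fun i => ev e (τ i) := fun hw => funext fun i => ((hτ i).res_ev hw e).symm
  have hc : ∀ {w' : World T} (e : ℕ → M w') (x : M w'), (fun i => ev (x ▹ e) (STm.up τ i)) =
      x ▹ fun i => ev e (τ i) := fun e x => by
    funext i; cases i with
    | zero => exact ev_var _ _
    | succ i => exact (hτ i).ev_ren _ _
  match φ, h with
  | .bot, _ => exact Iff.rfl
  | .eq a b, h =>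
    simp only [SFm.subst, SFm.force]
    rw [h.1.ev_subst hτ, h.2.ev_subst hτ]
  | .mem a b, h =>
    simp only [SFm.subst, SFm.force]
    rw [h.1.ev_subst hτ, h.2.ev_subst hτ]
  | .and φ ψ, h =>
    exact and_congr (SFm.Wf.force_subst (φ := φ) h.1 hτ w e)
      (SFm.Wf.force_subst (φ := ψ) h.2 hτ w e)
  | .or φ ψ, h =>
    exact or_congr (SFm.Wf.force_subst (φ := φ) h.1 hτ w e)
      (SFm.Wf.force_subst (φ := ψ) h.2 hτ w e)
  | .imp φ ψ, h =>
    refine forall_congr' fun w' => forall_congr' fun hw => ?_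
    rw [SFm.Wf.force_subst (φ := φ) h.1 hτ, SFm.Wf.force_subst (φ := ψ) h.2 hτ, hr]
  | .all φ, h =>
    refine forall_congr' fun w' => forall_congr' fun hw => forall_congr' fun x => ?_
    rw [SFm.Wf.force_subst (φ := φ) h (STm.wf_up hτ), hc, hr]
  | .ex φ, h =>
    refine exists_congr fun x => ?_
    rw [SFm.Wf.force_subst (φ := φ) h (STm.wf_up hτ), hc]

theorem SFm.Wf.force_ren {φ : SFm} (h : φ.Wf T) (ρ : ℕ → ℕ) (w : World T) (e : ℕ → M w) :
    (φ.ren ρ).force w e ↔ φ.force w fun i => e (ρ i) := by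
  rw [SFm.ren_eq_subst, h.force_subst fun i => STm.wf_var _]
  simp only [ev_var]

/-- The environment in which `φ` is evaluated in `φ.inst l m`. -/
noncomputable def envs (e : ℕ → M w) : List STm → ℕ → ℕ → M w
  | [], m => edrop m e
  | t :: l, m => ev e t ▹ envs e l m

@[simp] theorem envs_nil (e : ℕ → M w) (m : ℕ) : envs e [] m = edrop m e := rfl
@[simp] theorem envs_cons (e : ℕ → M w) (t : STm) (l : List STm) (m : ℕ) :
    envs e (t :: l) m = ev e t ▹ envs e l m := rfl

theorem ev_sb (e : ℕ → M w) (l : List STm) (m : ℕ) :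
    (fun i => ev e (STm.sb l m i)) = envs e l m := by
  induction l with
  | nil => funext i; exact ev_var _ _
  | cons t l ih =>
    funext i; cases i with
    | zero => rfl
    | succ i => exact congrFun ih i

@[simp] theorem SFm.Wf.force_inst {φ : SFm} (h : φ.Wf T) {l : List STm} {m : ℕ} (hl : ∀ t ∈ l, t.Wf T)
    (w : World T) (e : ℕ → M w) : (φ.inst l m).force w e ↔ φ.force w (envs e l m) := by
  rw [SFm.inst, h.force_subst (STm.wf_sb hl m), ev_sb]

@[simp] theorem STm.Wf.ev_inst {a : STm} (h : a.Wf T) {l : List STm} {m : ℕ} (hl : ∀ t ∈ l, t.Wf T)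
    (e : ℕ → M w) : ev e (a.inst l m) = ev (envs e l m) a := by
  rw [STm.inst, h.ev_subst (STm.wf_sb hl m), ev_sb]

end EmTT

namespace EmTT

open World

variable {T : SetTheory} {w w' w'' : World T}

theorem force_of_der {ξ : SFm} {n : ℕ} (hd : Der T (List.replicate n .V) (.holds ξ.tilde))
    (h : ξ.Wf T) (e : ℕ → M w) : ξ.force w e := (h.force_iff w e).2 (Tr.sub hd (sub_nms e n))

theorem der_var {n i : ℕ} (h : i < n) : Der T (List.replicate n .V) (.tm (.var i) .V) :=
  .var (replicate_wf n) (replicate_has.2 ⟨h, rfl⟩)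

/-! ## Set theory in a world -/

namespace M

noncomputable def empty : M w := w.val .empty
noncomputable def omega : M w := w.val .omega
noncomputable def upair (x y : M w) : M w := ev (x ▹ fun _ => y) (.upair (.var 0) (.var 1))
noncomputable def union (x : M w) : M w := ev (fun _ => x) (.union (.var 0))
noncomputable def fst (x : M w) : M w := ev (fun _ => x) (.fst (.var 0))
noncomputable def snd (x : M w) : M w := ev (fun _ => x) (.snd (.var 0))
noncomputable def len (x : M w) : M w := ev (fun _ => x) (.len (.var 0))
noncomputable def sing (x : M w) : M w := upair x x
noncomputable def one : M w := sing empty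
noncomputable def pair (x y : M w) : M w := upair (sing x) (upair x y)
noncomputable def cup (x y : M w) : M w := union (upair x y)
noncomputable def succ (x : M w) : M w := cup x (sing x)

end M

section ev

variable {a b : STm} {e : ℕ → M w}

@[simp] theorem ev_empty : ev e .empty = M.empty := rfl
@[simp] theorem ev_omega : ev e .omega = M.omega := rfl

theorem ev_inst1 {t : STm} (ht : t.Wf T) (h : a.Wf T) (m : ℕ) :
    ev e (t.inst [a] m) = ev (ev e a ▹ edrop m e) t := ht.ev_inst (by simpa) e

@[simp] theorem ev_upair (h : a.Wf T) (h' : b.Wf T) :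
    ev e (.upair a b) = M.upair (ev e a) (ev e b) :=
  STm.Wf.ev_inst (a := .upair (.var 0) (.var 1)) (l := [a, b]) (m := 0) (by simp) (by simp [h, h']) e

@[simp] theorem ev_union (h : a.Wf T) : ev e (.union a) = M.union (ev e a) :=
  ev_inst1 (t := .union (.var 0)) (by simp) h 0

@[simp] theorem ev_sing (h : a.Wf T) : ev e (.sing a) = M.sing (ev e a) := ev_upair h h
@[simp] theorem ev_pair (h : a.Wf T) (h' : b.Wf T) :
    ev e (.pair a b) = M.pair (ev e a) (ev e b) := by simp [STm.pair, M.pair, h, h', STm.Wf.sing]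
@[simp] theorem ev_one : ev e .one = M.one := by simp [STm.one, M.one]
@[simp] theorem ev_cup (h : a.Wf T) (h' : b.Wf T) :
    ev e (.cup a b) = M.cup (ev e a) (ev e b) := by simp [STm.cup, M.cup, h, h']

@[simp] theorem ev_fst (h : a.Wf T) : ev e (.fst a) = M.fst (ev e a) := by
  have : STm.fst a = (STm.fst (.var 0)).inst [a] 0 := by
    simp only [STm.fst, STm.inst, STm.subst, SFm.subst, STm.sb, STm.up, STm.ren_eq_subst,
      STm.subst_subst]
  rw [this]
  exact ev_inst1 (by simp) h 0

@[simp] theorem ev_snd (h : a.Wf T) : ev e (.snd a) = M.snd (ev e a) := by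
  have : STm.snd a = (STm.snd (.var 0)).inst [a] 0 := by
    simp only [STm.snd, STm.fst, STm.inst, STm.subst, SFm.subst, STm.sb, STm.up,
      STm.ren_eq_subst, STm.subst_subst, STm.sing]
  rw [this]
  exact ev_inst1 (by simp) h 0

@[simp] theorem ev_len (h : a.Wf T) : ev e (.len a) = M.len (ev e a) := by
  have : STm.len a = (STm.len (.var 0)).inst [a] 0 := by
    simp only [STm.len, STm.inst, STm.subst, SFm.subst, STm.sb, STm.up, STm.ren_eq_subst,
      STm.subst_subst, STm.pair, STm.sing]
  rw [this]
  exact ev_inst1 (by simp) h 0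

end ev

@[simp] theorem STm.wf_one : STm.one.Wf T := by simp [STm.one]

/-! ### Elements -/

namespace M

variable {x y z u v : M w}

theorem ext (h : ∀ w' (hw : w ≤ w') (z : M w'), z ∈ res hw x ↔ z ∈ res hw y) : x = y := by
  have := force_of_der (ξ := .imp (.all (.iff (.mem (.var 0) (.var 1)) (.mem (.var 0) (.var 2))))
    (.eq (.var 0) (.var 1))) (n := 2) (Der.setExt (der_var (by omega)) (der_var (by omega)))
    (by simp) (w := w) (x ▹ y ▹ fun _ => x)
  have h1 := this w le_rfl
  simp only [SFm.force_all_iff] at h1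
  simp at h1
  exact h1 h

theorem not_mem_empty : x ∉ (empty : M w) := fun h => by
  have := force_of_der (ξ := .imp (.mem (.var 0) .empty) .bot) (n := 1)
    (Der.emptyMem (der_var (by omega))) (by simp) (w := w) (fun _ => x)
  exact this w le_rfl (by simpa using h)

@[simp] theorem mem_upair : z ∈ upair x y ↔ z = x ∨ z = y := by
  have := force_of_der (ξ := .iff (.mem (.var 0) (.upair (.var 1) (.var 2)))
    (.or (.eq (.var 0) (.var 1)) (.eq (.var 0) (.var 2)))) (n := 3)
    (Der.upairMem (der_var (by omega)) (der_var (by omega)) (der_var (by omega))) (by simp) (w := w)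
    (z ▹ x ▹ y ▹ fun _ => x)
  have := SFm.force_iff'.1 this w le_rfl
  simpa using this

@[simp] theorem mem_union : z ∈ union x ↔ ∃ y, z ∈ y ∧ y ∈ x := by
  have := force_of_der (ξ := .iff (.mem (.var 0) (.union (.var 1)))
    (.ex (.and (.mem (.var 1) (.var 0)) (.mem (.var 0) (.var 2))))) (n := 2)
    (Der.unionMem (der_var (by omega)) (der_var (by omega))) (by simp) (w := w)
    (z ▹ x ▹ fun _ => x)
  have := SFm.force_iff'.1 this w le_rfl
  simpa using this

@[simp] theorem res_empty (h : w ≤ w') : res h (empty : M w) = empty :=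
  STm.Wf.res_ev (t := .empty) (by simp) h (fun _ => empty)
@[simp] theorem res_omega (h : w ≤ w') : res h (omega : M w) = omega :=
  STm.Wf.res_ev (t := .omega) (by simp) h (fun _ => empty)
@[simp] theorem res_upair (h : w ≤ w') : res h (upair x y) = upair (res h x) (res h y) := by
  have := STm.Wf.res_ev (t := .upair (.var 0) (.var 1)) (by simp) h (x ▹ y ▹ fun _ => x)
  simpa using this
@[simp] theorem res_union (h : w ≤ w') : res h (union x) = union (res h x) := by
  have := STm.Wf.res_ev (t := .union (.var 0)) (by simp) h (fun _ => x)
  simpa [rese] using this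
@[simp] theorem res_fst (h : w ≤ w') : res h (fst x) = fst (res h x) := by
  have := STm.Wf.res_ev (t := .fst (.var 0)) (by simp) h (fun _ => x)
  simpa [rese] using this
@[simp] theorem res_snd (h : w ≤ w') : res h (snd x) = snd (res h x) := by
  have := STm.Wf.res_ev (t := .snd (.var 0)) (by simp) h (fun _ => x)
  simpa [rese] using this
@[simp] theorem res_len (h : w ≤ w') : res h (len x) = len (res h x) := by
  have := STm.Wf.res_ev (t := .len (.var 0)) (by simp) h (fun _ => x)
  simpa [rese] using this
@[simp] theorem res_sing (h : w ≤ w') : res h (sing x) = sing (res h x) := res_upair h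
@[simp] theorem res_one (h : w ≤ w') : res h (one : M w) = one := by simp [one]
@[simp] theorem res_pair (h : w ≤ w') : res h (pair x y) = pair (res h x) (res h y) := by
  simp [pair]
@[simp] theorem res_cup (h : w ≤ w') : res h (cup x y) = cup (res h x) (res h y) := by simp [cup]
@[simp] theorem res_succ (h : w ≤ w') : res h (succ x) = succ (res h x) := by simp [succ]

@[simp] theorem mem_sing : z ∈ sing x ↔ z = x := by simp [sing]
@[simp] theorem mem_cup : z ∈ cup x y ↔ z ∈ x ∨ z ∈ y := by
  simp only [cup, mem_union, mem_upair]
  constructor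
  · rintro ⟨v, h, rfl | rfl⟩
    exacts [.inl h, .inr h]
  · rintro (h | h)
    exacts [⟨x, h, .inl rfl⟩, ⟨y, h, .inr rfl⟩]
@[simp] theorem mem_succ : z ∈ succ x ↔ z ∈ x ∨ z = x := by simp [succ]
@[simp] theorem mem_one : z ∈ (one : M w) ↔ z = empty := mem_sing

theorem empty_ne_one : (empty : M w) ≠ one := fun h => by
  have : (empty : M w) ∈ (one : M w) := mem_one.2 rfl
  rw [← h] at this
  exact not_mem_empty this

theorem mem_pair : z ∈ pair x y ↔ z = sing x ∨ z = upair x y := by simp [pair]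

theorem sing_inj (h : sing x = sing y) : x = y := mem_sing.1 (h ▸ mem_sing.2 rfl)

theorem sing_eq_upair (h : sing x = upair y z) : x = y ∧ x = z := by
  constructor
  · exact (mem_sing.1 (h ▸ mem_upair.2 (.inl rfl) : y ∈ sing x)).symm
  · exact (mem_sing.1 (h ▸ mem_upair.2 (.inr rfl) : z ∈ sing x)).symm

theorem pair_inj : pair x y = pair u v ↔ x = u ∧ y = v := by
  refine ⟨fun h => ?_, fun ⟨h, h'⟩ => by rw [h, h']⟩
  have h1 : x = u := by
    rcases mem_pair.1 (h ▸ mem_pair.2 (.inl rfl) : sing x ∈ pair u v) with h | h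
    · exact sing_inj h
    · exact (sing_eq_upair h).1
  subst h1
  refine ⟨rfl, ?_⟩
  rcases mem_pair.1 (h ▸ mem_pair.2 (.inr rfl) : upair x y ∈ pair x v) with h2 | h2
  · obtain ⟨-, h3⟩ := sing_eq_upair h2.symm
    subst h3
    rcases mem_pair.1 (h.symm ▸ mem_pair.2 (.inr rfl) : upair x v ∈ pair x x) with h4 | h4
    · exact (sing_eq_upair h4.symm).2
    · exact (sing_eq_upair (x := x) h4.symm).2
  · rcases mem_upair.1 (h2 ▸ mem_upair.2 (.inr rfl) : y ∈ upair x v) with h3 | h3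
    · subst h3
      exact (sing_eq_upair h2).2
    · exact h3

/-- Separation. -/
theorem mem_sep {a : STm} {φ : SFm} (ha : a.Wf T) (hφ : φ.Wf T) (hA : φ.Adm T) (e : ℕ → M w) :
    z ∈ ev e (.sep a φ) ↔ z ∈ ev e a ∧ φ.force w (z ▹ e) := by
  have ha1 := ha
  obtain ⟨n, h1⟩ := ha1
  obtain ⟨m, h2⟩ := hA
  have h3 := SFm.Adm.mono h2 (show m ≤ n + m + 1 by omega)
  have ha' := h1.repl (show n ≤ n + m by omega)
  have hb : Der T (.V :: List.replicate (n + m) .V)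
      (.holds (.iff (.mem (.var 0) ((STm.sep a φ).tilde.inst [] 1))
        (.and (.mem (.var 0) (a.tilde.inst [] 1)) φ.tilde))) := by
    have v0 : Der T (.V :: List.replicate (n + m) .V) (.tm (.var 0) .V) :=
      der_var (n := n + m + 1) (by omega)
    have hwk := SubTy.wk (T := T) (.vF (replicate_wf (n + m)))
    have e : φ.tilde = (φ.tilde.subst (PTm.up fun i => .var (i + 1))).inst [.var 0] 0 := by
      rw [up_inst]
      conv_lhs => rw [← PProp.subst_var φ.tilde]
      congr 1; funext i; cases i <;> rfl
    by_cases hT : T = .CZF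
    · have := Der.sepMems hT (ha'.sub hwk) (Der.sub1 (h3.2 hT) hwk) v0
      rw [← e] at this
      exact this
    · have := Der.sepMem hT (ha'.sub hwk) (Der.sub1 h3.1 hwk) v0
      rw [← e] at this
      exact this
  have hs : (STm.sep a φ).Wf T := STm.Wf.sep ⟨n, h1⟩ ⟨m, h2⟩
  have hx := force_of_der (n := n + m + 1) (ξ := .iff (.mem (.var 0) ((STm.sep a φ).inst [] 1))
    (.and (.mem (.var 0) (a.inst [] 1)) φ)) (by
      simp only [SFm.iff, SFm.tilde, SFm.wk_tilde, STm.tilde]; exact hb)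
    (by simp [hs, hφ, ha]) (z ▹ e)
  have := SFm.force_iff'.1 hx w le_rfl
  simpa [hs, ha] using this

theorem fst_pair (x y : M w) : fst (pair x y) = x := by
  refine ext fun w' hw z => ?_
  simp only [res_fst, res_pair]
  generalize res hw x = x; generalize res hw y = y
  clear hw
  have key : ∀ t, t ∈ ev (w := w') (fun _ => pair x y) (.sep (.union (.var 0))
      (.all (.imp (.mem (.var 0) ((STm.var 0).inst [] 2)) (.mem (.var 1) (.var 0))))) ↔ t = x := by
    intro t
    refine (mem_sep (STm.wf_var 0).union (by simp) (STm.adm_fst (STm.wf_var 0)) _).trans ?_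
    simp
    constructor
    · rintro ⟨-, h⟩
      have := h w' le_rfl (sing x) (by simp [mem_pair])
      simpa [res_refl] using this
    · rintro rfl
      refine ⟨⟨sing t, by simp [mem_pair]⟩, fun w'' h v hv => ?_⟩
      simp [mem_pair] at hv
      rcases hv with rfl | rfl <;> simp
  have e : fst (pair x y) = union (ev (w := w') (fun _ => pair x y) (.sep (.union (.var 0))
      (.all (.imp (.mem (.var 0) ((STm.var 0).inst [] 2)) (.mem (.var 1) (.var 0)))))) :=
    ev_union (STm.Wf.sep (by simp) (STm.adm_fst (by simp)))
  rw [e]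
  simp [key]

theorem pair_eq_sing_sing : pair x y = sing (sing x) ↔ x = y := by
  have : sing (sing x) = pair x x := rfl
  rw [this, pair_inj]; simp [eq_comm]

theorem snd_pair (x y : M w) : snd (pair x y) = y := by
  refine ext fun w' hw z => ?_
  simp only [res_snd, res_pair]
  generalize res hw x = x; generalize res hw y = y
  clear hw
  have key : ∀ t, t ∈ ev (w := w') (fun _ => pair x y) (.sep (.union (.var 0))
      (.imp (.eq (.var 0) (STm.fst ((STm.var 0).inst [] 1)))
        (.eq ((STm.var 0).inst [] 1) (.sing (.sing (STm.fst ((STm.var 0).inst [] 1))))))) ↔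
      t = y := by
    intro t
    refine (mem_sep (STm.wf_var 0).union (by simp) (STm.adm_snd (STm.wf_var 0)) _).trans ?_
    simp (maxDischargeDepth := 9) [fst_pair]
    simp only [pair_eq_sing_sing]
    constructor
    · rintro ⟨⟨v, h1, h2⟩, h⟩
      rcases mem_pair.1 h2 with rfl | rfl
      · have := h w' le_rfl (by rw [mem_sing.1 h1])
        simp only [res_refl] at this
        rw [mem_sing.1 h1, this]
      · rcases mem_upair.1 h1 with rfl | rfl
        · have := h w' le_rfl rfl
          simpa only [res_refl] using this
        · rfl
    · rintro rfl
      refine ⟨⟨upair x t, by simp [mem_pair]⟩, fun w'' h e => e.symm⟩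
  have e : snd (pair x y) = union (ev (w := w') (fun _ => pair x y) (.sep (.union (.var 0))
      (.imp (.eq (.var 0) (STm.fst ((STm.var 0).inst [] 1)))
        (.eq ((STm.var 0).inst [] 1) (.sing (.sing (STm.fst ((STm.var 0).inst [] 1)))))))) :=
    ev_union (STm.Wf.sep (by simp) (STm.adm_snd (by simp)))
  rw [e]
  simp [key]

end M

end EmTT

namespace EmTT

open World

variable {T : SetTheory} {w w' w'' : World T}

theorem SFm.Adm.or {φ ψ : SFm} (h : φ.Adm T) (h' : ψ.Adm T) : (SFm.or φ ψ).Adm T := by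
  obtain ⟨n, h⟩ := h; obtain ⟨m, h'⟩ := h'
  have h1 := Adm.mono h (show n ≤ n + m by omega)
  have h2 := Adm.mono h' (show m ≤ n + m by omega)
  exact ⟨_, .orF .large h1.1 h2.1, fun hT => .orF .small (h1.2 hT) (h2.2 hT)⟩

theorem STm.sb_tilde (l : List STm) (m : ℕ) :
    (fun i => (STm.sb l m i).tilde) = PTm.sb (l.map STm.tilde) m := by
  induction l with
  | nil => rfl
  | cons t l ih =>
    funext i; cases i with
    | zero => rfl
    | succ i => exact congrFun ih i

theorem SFm.inst_tilde (φ : SFm) (l : List STm) (m : ℕ) :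
    (φ.inst l m).tilde = φ.tilde.inst (l.map STm.tilde) m := by
  rw [SFm.inst, SFm.tilde_subst, STm.sb_tilde]; rfl

/-! ### Induction -/

/-- `∈`-induction. -/
theorem SFm.Wf.mem_ind {φ : SFm} (h : φ.Wf T) (e : ℕ → M w)
    (hs : ∀ w' (hw : w ≤ w') (x : M w'), (∀ w'' (hw' : w' ≤ w'') (z : M w''), z ∈ res hw' x →
      φ.force w'' (z ▹ rese (hw.trans hw') e)) → φ.force w' (x ▹ rese hw e)) (a : M w) :
    φ.force w (a ▹ e) := by
  have hφ : (φ.inst [.var 0] 2).Wf T := h.inst (by simp)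
  obtain ⟨n, hn⟩ := hφ.prop
  have hd := Der.memInd (der_var (n := n + 1) (i := 0) (by omega))
    (Der.repl hn (show n ≤ n + 1 + 1 by omega))
  have := force_of_der (n := n + 1) (ξ := .imp (.all (.imp (.all (.imp (.mem (.var 0) (.var 1))
      ((φ.inst [.var 0] 2).inst [.var 0] 2))) (φ.inst [.var 0] 2)))
      ((φ.inst [.var 0] 2).inst [.var 0] 0)) (by
    simp only [SFm.tilde, SFm.inst_tilde, STm.tilde, List.map] at hd ⊢; exact hd) (by simp [h])
    (w := w) (a ▹ e)
  simp [h] at this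
  simpa using this w le_rfl fun w' h x hx => hs w' h x fun w'' hw' z hz => by
    simpa using hx w'' hw' z hz

namespace M

variable {x y z u v n b : M w}

theorem omega_closed : (empty : M w) ∈ (omega : M w) ∧
    ∀ w' (_ : w ≤ w') (x : M w'), x ∈ (omega : M w') → succ x ∈ (omega : M w') := by
  have := force_of_der (ξ := .and (.mem .empty .omega)
    (.all (.imp (.mem (.var 0) .omega) (.mem (.cup (.var 0) (.sing (.var 0))) .omega)))) (n := 0)
    (Der.omegaTrans (replicate_wf 0)) (by simp) (w := w) (fun _ => empty)
  simpa [M.succ] using this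

@[simp] theorem empty_mem_omega : (empty : M w) ∈ (omega : M w) := omega_closed.1
theorem succ_mem_omega (h : x ∈ (omega : M w)) : succ x ∈ (omega : M w) :=
  omega_closed.2 w le_rfl x h

theorem omega_min (hx : x ∈ (omega : M w)) (h0 : empty ∈ y)
    (hs : ∀ w' (hw : w ≤ w') (z : M w'), z ∈ res hw y → succ z ∈ res hw y) : x ∈ y := by
  have := force_of_der (ξ := .imp (.mem (.var 0) .omega) (.all (.imp
    (.and (.mem .empty (.var 0))
      (.all (.imp (.mem (.var 0) (.var 1)) (.mem (.cup (.var 0) (.sing (.var 0))) (.var 1)))))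
    (.mem (.var 1) (.var 0))))) (n := 1)
    (Der.omegaMin (der_var (by omega))) (by simp) (w := w) (fun _ => x)
  simp at this
  simpa using this w le_rfl (by simpa using hx) w le_rfl y h0 hs

theorem omega_cases (hx : x ∈ (omega : M w)) : x = empty ∨ ∃ y ∈ (omega : M w), x = succ y := by
  let φ : SFm := .or (.eq (.var 0) .empty) (.ex (.and (.mem (.var 0) (STm.inst .omega [] 1))
    (.eq (.var 1) (.cup (.var 0) (.sing (.var 0))))))
  have hφ : φ.Adm T := .or (SFm.adm_eq (by simp) (by simp))
    (.bex (by simp) (SFm.adm_eq (by simp) (by simp)))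
  have hs : (STm.sep .omega φ).Wf T := .sep (by simp) hφ
  have key : ∀ {w} (e : ℕ → M w) (t : M w), t ∈ ev e (.sep .omega φ) ↔
      t ∈ (omega : M w) ∧ (t = empty ∨ ∃ y ∈ (omega : M w), t = succ y) := fun e t => by
    rw [mem_sep (by simp) (by simp [φ]) hφ]
    simp [φ, M.succ]
  refine ((key (fun _ => x) x).1 (omega_min hx ?_ fun w' hw z hz => ?_)).2
  · rw [key]; simp
  · rw [hs.res_ev, key] at hz ⊢
    exact ⟨succ_mem_omega hz.1, .inr ⟨z, hz.1, rfl⟩⟩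

theorem omega_ind {φ : SFm} (h : φ.Wf T) (e : ℕ → M w) (h0 : φ.force w (empty ▹ e))
    (hs : ∀ w' (hw : w ≤ w') (n : M w'), n ∈ (omega : M w') → φ.force w' (n ▹ rese hw e) →
      φ.force w' (succ n ▹ rese hw e)) {n : M w} (hn : n ∈ (omega : M w)) :
    φ.force w (n ▹ e) := by
  have := SFm.Wf.mem_ind (φ := .imp (.mem (.var 0) .omega) φ) (by simp [h]) e
    (fun w' hw x ih => ?_) n
  · simp at this
    simpa using this w le_rfl (by simpa using hn)
  · simp at ih ⊢
    intro w'' hw' hx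
    rcases omega_cases hx with h1 | ⟨y, hy, h1⟩
    · rw [h1]
      simpa using h.force_mono (hw.trans hw') h0
    · rw [h1]
      refine hs _ _ _ hy ?_
      have := ih w'' hw' y (by rw [h1]; simp) w'' le_rfl (by simpa using hy)
      simpa using this

theorem not_mem_self (x : M w) : x ∉ x := fun h => by
  have := SFm.Wf.mem_ind (φ := .imp (.mem (.var 0) (.var 0)) .bot) (T := T) (by simp)
    (fun _ => x) (fun w' hw x ih => ?_) x
  · exact this w le_rfl (by simpa using h)
  · simp at ih ⊢
    intro w'' h hx
    exact ih w'' h _ hx w'' le_rfl (by simpa using hx)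

theorem omega_trans (hn : n ∈ (omega : M w)) (hx : x ∈ n) : x ∈ (omega : M w) := by
  have := omega_ind (φ := .all (.imp (.mem (.var 0) (.var 1)) (.mem (.var 0) .omega))) (T := T)
    (by simp) (fun _ => x) (by simp [not_mem_empty]) (fun w' hw n hn h => ?_) hn
  · simp at this
    exact this w le_rfl x (by simpa using hx)
  · simp at h ⊢
    rintro w'' hw' z (hz | rfl)
    · exact h w'' hw' z hz
    · simpa using mem_mono hn hw'

theorem mem_len : z ∈ len x ↔ z ∈ (omega : M w) ∧ ∃ y, pair z y ∈ x := by
  have h := mem_sep (T := T) (a := .omega) (φ := .ex (.and (.mem (.var 0) (.union (.union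
    ((STm.var 0).inst [] 2)))) (.mem (.pair (.var 1) (.var 0)) ((STm.var 0).inst [] 2))))
    (z := z) (by simp) (by simp (maxDischargeDepth := 9)) (STm.adm_len (by simp)) (fun _ => x)
  refine h.trans ?_
  simp (maxDischargeDepth := 9)
  intro hz
  constructor
  · rintro ⟨y, -, h⟩; exact ⟨y, h⟩
  · rintro ⟨y, h⟩
    exact ⟨y, ⟨upair z y, by simp, pair z y, by simp [mem_pair], h⟩, h⟩

@[simp] theorem len_empty : len (empty : M w) = empty := by
  refine ext fun w' hw z => ?_
  simp [mem_len, not_mem_empty]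

/-- `v ∪ {(ℓ(v), b)}` -/
noncomputable def snoc (v b : M w) : M w := cup v (sing (pair (len v) b))

@[simp] theorem res_snoc (h : w ≤ w') : res h (snoc v b) = snoc (res h v) (res h b) := by
  simp [snoc]

theorem mem_snoc : z ∈ snoc v b ↔ z ∈ v ∨ z = pair (len v) b := by simp [snoc]

theorem len_snoc (h : len v ∈ (omega : M w)) : len (snoc v b) = succ (len v) := by
  refine ext fun w' hw z => ?_
  have h' := mem_mono h hw
  simp at h'
  simp only [res_len, res_snoc, res_succ, mem_len, mem_succ, mem_snoc]
  constructor
  · rintro ⟨h1, y, h2 | h2⟩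
    · exact .inl ⟨h1, y, h2⟩
    · exact .inr (pair_inj.1 h2).1
  · rintro (⟨h1, y, h2⟩ | rfl)
    · exact ⟨h1, y, .inl h2⟩
    · exact ⟨h', _, .inr rfl⟩

/-- Application of a function. -/
noncomputable def app (f x : M w) : M w :=
  ev (x ▹ f ▹ fun _ => x) (.snd (.union (.sep (.var 1) (.eq (.fst (.var 0)) (.var 1)))))

theorem wf_app {i j : ℕ} :
    (STm.snd (.union (.sep (.var i) (.eq (.fst (.var 0)) (.var j))))).Wf T :=
  (STm.Wf.sep (by simp) (SFm.adm_eq (by simp) (by simp))).union.snd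

theorem app_eq {f x y : M w} (hy : pair x y ∈ f) (hf : ∀ w' (h : w ≤ w') (p : M w'), p ∈ res h f →
      fst p = res h x → p = pair (res h x) (res h y)) : app f x = y := by
  have h1 : (SFm.eq (.fst (.var 0)) (.var 1)).Adm T := SFm.adm_eq (by simp) (by simp)
  have h2 : (STm.sep (.var 1) (.eq (.fst (.var 0)) (.var 1))).Wf T := .sep (by simp) h1
  have h3 : ev (x ▹ f ▹ fun _ => x) (.sep (.var 1) (.eq (.fst (.var 0)) (.var 1))) =
      sing (pair x y) := by
    refine ext fun w' hw z => ?_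
    rw [h2.res_ev, mem_sep (by simp) (by simp) h1]
    simp
    constructor
    · rintro ⟨h1, h2⟩; exact hf w' hw z h1 h2
    · rintro rfl; exact ⟨by simpa using mem_mono hy hw, fst_pair _ _⟩
  rw [app, ev_snd (by simp [h2]), ev_union h2, h3]
  have : union (sing (pair x y)) = pair x y := by
    refine ext fun w' hw z => ?_
    simp
  rw [this, snd_pair]

end M

/-! ### Values of terms -/

namespace World.IsVal

variable {a b : PTm} {x y : M w}

theorem cons {e : ℕ → M w} {σ : ℕ → PTm} (h : w.IsVal a x) (he : ∀ i, w.IsVal (σ i) (e i)) (i : ℕ) :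
    w.IsVal (scons a σ i) ((x ▹ e) i) := by
  cases i with
  | zero => exact h
  | succ i => exact he i

theorem op {t : STm} (ht : t.Wf T) (h : w.IsVal a x) :
    w.IsVal (t.tilde.subst fun _ => a) (ev (fun _ => x) t) := ht.congr fun _ => h

theorem op₂ {t : STm} (ht : t.Wf T) (h : w.IsVal a x) (h' : w.IsVal b y) :
    w.IsVal (t.tilde.subst (scons a fun _ => b)) (ev (x ▹ fun _ => y) t) :=
  ht.congr (h.cons fun _ => h')

theorem empty : w.IsVal .empty .empty := STm.Wf.isVal STm.wf_empty (fun _ => M.empty)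
theorem upair (h : w.IsVal a x) (h' : w.IsVal b y) : w.IsVal (.upair a b) (.upair x y) := by
  have := op₂ (t := .upair (.var 0) (.var 1)) (by simp) h h'
  simp at this
  exact this
theorem union (h : w.IsVal a x) : w.IsVal (.union a) (.union x) := by
  have := op (t := .union (.var 0)) (by simp) h
  simp at this
  exact this
theorem sing (h : w.IsVal a x) : w.IsVal (.sing a) (.sing x) := h.upair h
theorem kpair (h : w.IsVal a x) (h' : w.IsVal b y) : w.IsVal (.kpair a b) (.pair x y) :=
  h.sing.upair (h.upair h')
theorem succ (h : w.IsVal a x) : w.IsVal (.succ a) (.succ x) := (h.upair h.sing).union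

end World.IsVal

/-! ### The formulas of the translation are well formed -/

theorem svl_wf {t : STm} (h : t.Wf T) : (svl t).Wf T := by
  simp (maxDischargeDepth := 9) [svl, h]

theorem etaPi_wf {α β : SFm} (h : α.Wf T) (h' : β.Wf T) : (etaPi α β).Wf T := by
  simp (maxDischargeDepth := 9) [etaPi, h, h', svl_wf]

theorem sub_wf {a b : STm} (h : a.Wf T) (h' : b.Wf T) : (STm.sub a b).Wf T := by
  simp (maxDischargeDepth := 9) [STm.sub, h, h']

theorem etaPow1_wf : etaPow1.Wf T := sub_wf (by simp) (by simp)

theorem etaList_wf {α : SFm} (h : α.Wf T) : (etaList α).Wf T := by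
  simp (maxDischargeDepth := 9) [etaList, h, svl_wf]

theorem classOf_wf {α β γ : SFm} (h : α.Wf T) (h' : β.Wf T) (h'' : γ.Wf T) :
    (classOf α β γ).Wf T := by
  simp (maxDischargeDepth := 9) [classOf, h, h', h'']

mutual
theorem PCol.eta_wf (A : PCol) : A.eta.Wf T := by
  match A with
  | .N0 | .N1 | .V => simp [PCol.eta]
  | .list A => exact etaList_wf A.eta_wf
  | .sum A B => simp (maxDischargeDepth := 9) [PCol.eta, A.eta_wf, B.eta_wf, STm.wf_one]
  | .sigma A B => simp (maxDischargeDepth := 9) [PCol.eta, A.eta_wf, B.eta_wf]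
  | .pi A B => exact etaPi_wf A.eta_wf B.eta_wf
  | .quot A φ => exact classOf_wf A.eta_wf A.eta_wf φ.hat_wf
  | .pow1 => exact etaPow1_wf
  | .funPow1 A => exact etaPi_wf A.eta_wf etaPow1_wf
  | .compr φ => exact φ.hat_wf
  | .ofProp φ => simp (maxDischargeDepth := 9) [PCol.eta, φ.hat_wf]
theorem PTm.delta_wf (a : PTm) : a.delta.Wf T := by
  match a with
  | .var i | .emp0 _ | .star | .nil | .tt | .empty | .omega => simp [PTm.delta]
  | .elN1 _ b => exact b.delta_wf
  | .cons a b => simp (maxDischargeDepth := 9) [PTm.delta, a.delta_wf, b.delta_wf]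
  | .elList A a b c =>
    simp (maxDischargeDepth := 9) [PTm.delta, a.delta_wf, b.delta_wf, c.delta_wf, A.eta_wf,
      etaList_wf, svl_wf]
  | .inl a => simp (maxDischargeDepth := 9) [PTm.delta, a.delta_wf]
  | .inr a => simp (maxDischargeDepth := 9) [PTm.delta, a.delta_wf]
  | .elSum a b c => simp (maxDischargeDepth := 9) [PTm.delta, a.delta_wf, b.delta_wf, c.delta_wf]
  | .pair a b => simp (maxDischargeDepth := 9) [PTm.delta, a.delta_wf, b.delta_wf]
  | .elSigma a b => simp (maxDischargeDepth := 9) [PTm.delta, a.delta_wf, b.delta_wf]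
  | .lam A b => simp (maxDischargeDepth := 9) [PTm.delta, A.eta_wf, b.delta_wf]
  | .app a b => simp (maxDischargeDepth := 9) [PTm.delta, a.delta_wf, b.delta_wf, M.wf_app]
  | .cls A φ a => exact classOf_wf a.delta_wf A.eta_wf φ.hat_wf
  | .elQuot _ _ a b => simp (maxDischargeDepth := 9) [PTm.delta, a.delta_wf, b.delta_wf]
  | .code φ => simp (maxDischargeDepth := 9) [PTm.delta, φ.hat_wf]
  | .name A => simp (maxDischargeDepth := 9) [PTm.delta, A.eta_wf]
  | .upair a b => simp (maxDischargeDepth := 9) [PTm.delta, a.delta_wf, b.delta_wf]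
  | .union a => simp (maxDischargeDepth := 9) [PTm.delta, a.delta_wf]
  | .power a => simp (maxDischargeDepth := 9) [PTm.delta, a.delta_wf, sub_wf]
  | .sep a φ => simp (maxDischargeDepth := 9) [PTm.delta, a.delta_wf, φ.hat_wf]
theorem PProp.hat_wf (φ : PProp) : φ.hat.Wf T := by
  match φ with
  | .bot => trivial
  | .mem a b => simp (maxDischargeDepth := 9) [PProp.hat, a.delta_wf, b.delta_wf]
  | .memCol a A => exact ⟨a.delta_wf, A.eta_wf⟩
  | .eq A a b => exact ⟨a.delta_wf, b.delta_wf, A.eta_wf⟩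
  | .imp φ ψ => exact ⟨φ.hat_wf, ψ.hat_wf⟩
  | .and φ ψ => exact ⟨φ.hat_wf, ψ.hat_wf⟩
  | .or φ ψ => exact ⟨φ.hat_wf, ψ.hat_wf⟩
  | .ex A φ => exact ⟨A.eta_wf, φ.hat_wf⟩
  | .all A φ => exact ⟨A.eta_wf, φ.hat_wf⟩
end

end EmTT

namespace EmTT

open World

variable {T : SetTheory} {w w' w'' : World T}

/-! ## Supports under binders -/

/-- The variables of `L` under a binder, together with the bound one. -/
def upL (L : Set ℕ) : Set ℕ := {i | i = 0 ∨ ∃ j ∈ L, i = j + 1}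

theorem zero_mem_upL {L : Set ℕ} : 0 ∈ upL L := .inl rfl
theorem succ_mem_upL {L : Set ℕ} {i : ℕ} (h : i ∈ L) : i + 1 ∈ upL L := .inr ⟨i, h, rfl⟩

theorem PTm.supp_up {L L' : Set ℕ} {σ : ℕ → PTm} (h : ∀ i ∈ L', (σ i).Supp L) :
    ∀ i ∈ upL L', (PTm.up σ i).Supp (upL L) := by
  rintro i (rfl | ⟨j, hj, rfl⟩)
  · exact PTm.supp_var zero_mem_upL
  · intro τ τ' ht
    simp only [PTm.up, PTm.ren_subst]
    exact h j hj _ _ fun i hi => ht _ (succ_mem_upL hi)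

theorem up_agree {L : Set ℕ} {σ τ : ℕ → PTm} (h : ∀ i ∈ L, σ i = τ i) :
    ∀ i ∈ upL L, PTm.up σ i = PTm.up τ i := by
  rintro i (rfl | ⟨j, hj, rfl⟩)
  · rfl
  · simp only [PTm.up, h j hj]

section
variable {L L' : Set ℕ} {σ : ℕ → PTm}

theorem PProp.Supp.subst {φ : PProp} (h : φ.Supp L') (hσ : ∀ i ∈ L', (σ i).Supp L) :
    (φ.subst σ).Supp L := fun τ τ' ht => by
  rw [PProp.subst_subst, PProp.subst_subst]; exact h _ _ fun i hi => hσ i hi _ _ ht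

theorem PCol.Supp.subst {φ : PCol} (h : φ.Supp L') (hσ : ∀ i ∈ L', (σ i).Supp L) :
    (φ.subst σ).Supp L := fun τ τ' ht => by
  rw [PCol.subst_subst, PCol.subst_subst]; exact h _ _ fun i hi => hσ i hi _ _ ht

theorem PTm.Supp.subst {φ : PTm} (h : φ.Supp L') (hσ : ∀ i ∈ L', (σ i).Supp L) :
    (φ.subst σ).Supp L := fun τ τ' ht => by
  rw [PTm.subst_subst, PTm.subst_subst]; exact h _ _ fun i hi => hσ i hi _ _ ht

theorem PTm.Supp.wk {a : PTm} (h : a.Supp L) : (a.ren Nat.succ).Supp (upL L) := by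
  rw [PTm.ren_eq_subst]
  exact h.subst fun i hi => PTm.supp_var (succ_mem_upL hi)

theorem PCol.Supp.wk {a : PCol} (h : a.Supp L) : (a.ren Nat.succ).Supp (upL L) := by
  rw [PCol.ren_eq_subst]
  exact h.subst fun i hi => PTm.supp_var (succ_mem_upL hi)

theorem PProp.supp_quant {A : PCol} {φ : PProp} (h : A.Supp L) (h' : φ.Supp (upL L)) :
    (PProp.ex A φ).Supp L := fun τ τ' ht => by
  simp only [PProp.subst, h _ _ ht, h' _ _ (up_agree ht)]

theorem PProp.supp_all {A : PCol} {φ : PProp} (h : A.Supp L) (h' : φ.Supp (upL L)) :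
    (PProp.all A φ).Supp L := fun τ τ' ht => by
  simp only [PProp.subst, h _ _ ht, h' _ _ (up_agree ht)]

theorem PTm.supp_scons {a : PTm} (ha : a.Supp L) (hσ : ∀ i ∈ L', (σ i).Supp L) :
    ∀ i ∈ upL L', (scons a σ i).Supp L := by
  rintro i (rfl | ⟨j, hj, rfl⟩)
  · exact ha
  · exact hσ j hj

theorem PTm.Supp.inst1 {φ : PTm} {a : PTm} (h : φ.Supp (upL L)) (ha : a.Supp L) :
    (φ.subst (scons a .var)).Supp L :=
  h.subst (PTm.supp_scons ha fun _ hi => PTm.supp_var hi)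

end

theorem PCol.inst_one (A : PCol) (a : PTm) : A.inst [a] 0 = A.subst (scons a .var) := by
  rw [PCol.inst, PTm.sb_cons]; rfl
theorem PTm.inst_one (A : PTm) (a : PTm) : A.inst [a] 0 = A.subst (scons a .var) := by
  rw [PTm.inst, PTm.sb_cons]; rfl

/-! ## Derivations -/

namespace Der

variable {Γ : Ctx} {φ ψ : PProp} {a b t : PTm} {A B : PCol}

theorem mp (h : Der T Γ (.holds (.iff φ ψ))) (hφ : Der T Γ (.prop φ)) (hψ : Der T Γ (.prop ψ))
    (h' : Der T Γ (.holds φ)) : Der T Γ (.holds ψ) :=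
  .impE hψ (.andE1 (.impF .large hφ hψ) h) h'

theorem mpr (h : Der T Γ (.holds (.iff φ ψ))) (hφ : Der T Γ (.prop φ)) (hψ : Der T Γ (.prop ψ))
    (h' : Der T Γ (.holds ψ)) : Der T Γ (.holds φ) :=
  .impE hφ (.andE2 (.impF .large hψ hφ) h) h'

theorem ofV_ctx {J : Jdg} (h : Der T (.V :: Γ) J) (hA : Der T Γ (.ty .col A)) :
    Der T (A :: Γ) J := by
  refine h.mono ⟨.cons hA, fun i B hB => ?_⟩
  rw [PCol.subst_var]
  cases hB with
  | zero => exact .toV (.var (.cons hA) .zero)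
  | succ hB => exact .var (.cons hA) (.succ hB)

theorem all_elim (hA : Der T Γ (.ty .col A)) (hφ : Der T (A :: Γ) (.prop φ))
    (h : Der T Γ (.holds (.all A φ))) : Der T (A :: Γ) (.holds φ) := by
  have h1 := h.wk hA
  have h2 := hφ.sub1 (SubTy.wk hA)
  have := Der.allE (hA.wk hA) h2 h1 (a := .var 0) (by
    rw [← PCol.ren_eq_subst, ← PCol.wk_eq]; exact .var (.cons hA) .zero)
  rw [up_inst] at this
  have e : scons (.var 0) (fun i => PTm.var (i + 1)) = .var := by funext i; cases i <;> rfl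
  rwa [e, PProp.subst_var] at this

theorem sep_iff (ha : Der T Γ (.tm a .V)) (hφ : Der T (.V :: Γ) (.prop φ))
    (hφ' : T = .CZF → Der T (.V :: Γ) (.props φ)) (hb : Der T Γ (.tm b .V)) :
    Der T Γ (.holds (.iff (.mem b (.sep a φ)) (.and (.mem b a) (φ.inst [b] 0)))) := by
  by_cases hT : T = .CZF
  · exact .sepMems hT ha (hφ' hT) hb
  · exact .sepMem hT ha hφ hb

theorem sep_V (ha : Der T Γ (.tm a .V)) (hφ : Der T (.V :: Γ) (.prop φ))
    (hφ' : T = .CZF → Der T (.V :: Γ) (.props φ)) : Der T Γ (.tm (.sep a φ) .V) := by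
  by_cases hT : T = .CZF
  · exact .sepIs hT ha (hφ' hT)
  · exact .sepI hT ha hφ

theorem mem_sep (ha : Der T Γ (.tm a .V)) (hφ : Der T (.V :: Γ) (.prop φ))
    (hφ' : T = .CZF → Der T (.V :: Γ) (.props φ)) (hb : Der T Γ (.tm b .V)) :
    Der T Γ (.holds (.mem b (.sep a φ))) ↔
      Der T Γ (.holds (.mem b a)) ∧ Der T Γ (.holds (φ.inst [b] 0)) := by
  have h1 : Der T Γ (.prop (.mem b (.sep a φ))) := .propsProp (.memF hb (sep_V ha hφ hφ'))
  have h2 : Der T Γ (.prop (.mem b a)) := .propsProp (.memF hb ha)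
  have h3 : Der T Γ (.prop (φ.inst [b] 0)) := hφ.inst_one_ty hb
  have h4 : Der T Γ (.prop (.and (.mem b a) (φ.inst [b] 0))) := .andF .large h2 h3
  have h5 := sep_iff ha hφ hφ' hb
  constructor
  · intro h
    have := h5.mp h1 h4 h
    exact ⟨.andE1 h2 this, .andE2 h3 this⟩
  · intro h
    exact h5.mpr h1 h4 (.andI h4 h.1 h.2)

theorem mem_name (hA : Der T Γ (.ty .set A)) (hb : Der T Γ (.tm b .V)) :
    Der T Γ (.holds (.mem b (.name A))) ↔ Der T Γ (.tm b A) := by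
  have hV := Der.vF (T := T) hb.wf
  have hn := Der.nameI hA
  have v0 : Der T (.V :: Γ) (.tm (.var 0) .V) := .var (A := .V) (.cons hV) .zero
  have p1 := Der_memCol_eq (.setCol hA)
  have p2 : Der T (.V :: Γ) (.prop (.mem (.var 0) (.name (A.inst [] 1)))) :=
    .propsProp (.memF v0 (hn.wk hV))
  have p : Der T (.V :: Γ) (.prop (.iff (.memCol (.var 0) (A.inst [] 1))
      (.mem (.var 0) (.name (A.inst [] 1))))) := .andF .large (.impF .large p1 p2) (.impF .large p2 p1)
  have h := Der.allE hV p (.nameMem hA) hb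
  have e : (PProp.iff (.memCol (.var 0) (A.inst [] 1)) (.mem (.var 0) (.name (A.inst [] 1)))).inst
      [b] 0 = .iff (.memCol b A) (.mem b (.name A)) := by
    have e1 : ((PTm.name A).inst [] 1).inst [b] 0 = .name A := PTm.inst_wk_inst _ _
    rw [← memCol_inst A b]
    conv_rhs => rw [← e1]
    rfl
  rw [e] at h
  have q1 := Der.memColF hb (.setCol hA)
  have q2 : Der T Γ (.prop (.mem b (.name A))) := .propsProp (.memF hb hn)
  constructor
  · intro hm; exact .memColE (.setCol hA) hb (h.mpr q1 q2 hm)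
  · intro hm; exact h.mp q1 q2 (.memColI (.setCol hA) hm)

theorem mem_compr (hφ : Der T (.V :: Γ) (.prop φ)) (hb : Der T Γ (.tm b .V)) :
    Der T Γ (.tm b (.compr φ)) ↔ Der T Γ (.holds (φ.inst [b] 0)) := by
  have p1 : Der T Γ (.prop (φ.inst [b] 0)) := hφ.inst_one_ty hb
  have p2 := Der.memColF hb (.comprF hφ)
  constructor
  · intro h; exact (Der.comprMem hφ hb).mpr p1 p2 (.memColI (.comprF hφ) h)
  · intro h; exact .memColE (.comprF hφ) hb ((Der.comprMem hφ hb).mp p1 p2 h)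

theorem mem_sing (h : Der T Γ (.tm b .V)) : Der T Γ (.holds (.mem b (.sing b))) := by
  have p : Der T Γ (.prop (.eq .V b b)) := .propsProp (.eqVF h h)
  have q : Der T Γ (.prop (.mem b (.sing b))) := .propsProp (.memF h (.upairI h h))
  exact (Der.upairMem h h h).mpr q (.orF .large p p) (.orI1 p p (.eqI (.vF h.wf) h))

end Der

/-- The collection of the elements of a set `t`. -/
def elts (t : PTm) : PCol := .compr (.mem (.var 0) (t.inst [] 1))

namespace Der

variable {Γ : Ctx} {φ ψ : PProp} {a b t : PTm} {A B : PCol}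

theorem elts_prop (h : Der T Γ (.tm t .V)) : Der T (.V :: Γ) (.prop (.mem (.var 0) (t.inst [] 1))) := by
  have hV := Der.vF (T := T) h.wf
  exact .propsProp (.memF (.var (A := .V) (.cons hV) .zero) (h.wk hV))

theorem mem_elts (h : Der T Γ (.tm t .V)) (hb : Der T Γ (.tm b .V)) :
    Der T Γ (.tm b (elts t)) ↔ Der T Γ (.holds (.mem b t)) := by
  rw [elts, mem_compr (elts_prop h) hb]
  have e : (PProp.mem (.var 0) (t.inst [] 1)).inst [b] 0 = .mem b t := by
    change PProp.mem b ((t.inst [] 1).inst [b] 0) = _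
    rw [PTm.inst_wk_inst]
  rw [e]

theorem elts_set (h : Der T Γ (.tm t .V)) : Der T Γ (.ty .set (elts t)) := by
  have hV := Der.vF (T := T) h.wf
  have c : Der T Γ (.ty .col (elts t)) := .comprF (elts_prop h)
  have v0 : Der T (.V :: Γ) (.tm (.var 0) .V) := .var (A := .V) (.cons hV) .zero
  have hV' : Der T (.V :: Γ) (.ty .col .V) := .vF v0.wf
  have v0' : Der T (.V :: .V :: Γ) (.tm (.var 0) .V) := .var (A := .V) (.cons hV') .zero
  have v1' : Der T (.V :: .V :: Γ) (.tm (.var 1) .V) := .var (A := .V) (.cons hV') (.succ .zero)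
  have q1 : Der T (.V :: .V :: Γ) (.prop (.memCol (.var 0) ((elts t).inst [] 2))) := by
    refine .memColF v0' ?_
    have := (c.wk hV).wk hV'
    rw [Jdg.subst_subst] at this
    exact this
  have q2 : Der T (.V :: .V :: Γ) (.prop (.mem (.var 0) (.var 1))) := .propsProp (.memF v0' v1')
  have q : Der T (.V :: .V :: Γ) (.prop (.iff (.memCol (.var 0) ((elts t).inst [] 2))
      (.mem (.var 0) (.var 1)))) := .andF .large (.impF .large q1 q2) (.impF .large q2 q1)
  have r1 := Der_memCol_eq c
  have r2 := elts_prop h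
  refine .setI c (.exI hV (.allF .large hV' q) h ?_)
  have e : (PProp.all .V (.iff (.memCol (.var 0) ((elts t).inst [] 2)) (.mem (.var 0) (.var 1)))).inst
      [t] 0 = .all .V (.iff (.memCol (.var 0) ((elts t).inst [] 1)) (.mem (.var 0) (t.inst [] 1))) := by
    have e1 : ((elts t).inst [] 2).subst (PTm.up (PTm.sb [t] 0)) = (elts t).inst [] 1 := by
      rw [PCol.inst, PCol.subst_subst]; rfl
    have e2 : PTm.up (PTm.sb [t] 0) 1 = t.inst [] 1 := by rw [PTm.wk_eq]; rfl
    simp only [PProp.inst, PProp.subst, PProp.iff, e1, PTm.subst, e2]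
    rfl
  rw [e]
  have h1 : Der T (.V :: Γ) (.tm (t.inst [] 1) .V) := h.wk hV
  have c1 : Der T (.V :: Γ) (.ty .col ((elts t).inst [] 1)) := c.wk hV
  have e3 : (elts t).inst [] 1 = elts (t.inst [] 1) := by
    simp only [elts, PCol.inst, PCol.subst, PProp.subst, PTm.inst, PTm.subst_subst]
    rfl
  have h2 := Der.comprMem (elts_prop h1) v0
  have e4 : (PProp.mem (.var 0) ((t.inst [] 1).inst [] 1)).inst [.var 0] 0 =
      .mem (.var 0) (t.inst [] 1) := by
    change PProp.mem (.var 0) (((t.inst [] 1).inst [] 1).inst [.var 0] 0) = _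
    rw [PTm.inst_wk_inst]
  rw [e4] at h2
  rw [e3] at r1 ⊢
  exact .allI hV (.andF .large (.impF .large r1 r2) (.impF .large r2 r1))
    (.andI (.andF .large (.impF .large r1 r2) (.impF .large r2 r1))
      (.andE2 (.impF .large r1 r2) h2) (.andE1 (.impF .large r2 r1) h2))

end Der

end EmTT

namespace EmTT

open World

variable {T : SetTheory} {w w' w'' : World T}

theorem add_mem_upL {L : Set ℕ} {i : ℕ} (h : i ∈ L) (n : ℕ) : i + n ∈ upL^[n] L := by
  induction n with
  | zero => exact h
  | succ n ih => rw [Function.iterate_succ_apply']; exact succ_mem_upL ih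

theorem upL_iterate_mono {L L' : Set ℕ} (h : L ⊆ L') (n : ℕ) : upL^[n] L ⊆ upL^[n] L' := by
  induction n with
  | zero => exact h
  | succ n ih =>
    rw [Function.iterate_succ_apply', Function.iterate_succ_apply']
    rintro i (rfl | ⟨j, hj, rfl⟩)
    exacts [zero_mem_upL, succ_mem_upL (ih hj)]

theorem SubTy.wk_append {Θ Δ : Ctx} (h : Der T (Θ ++ Δ) .wf) :
    SubTy T (Θ ++ Δ) (fun i => .var (i + Θ.length)) Δ := by
  induction Θ with
  | nil => exact SubTy.id h
  | cons B Θ ih =>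
    exact (ih h.head.wf).comp (SubTy.wk h.head)

namespace World

/-! ## Hypothetical judgements over a world -/

/-- `σ` replaces the variables of `Θ` by terms over `w`. -/
def Inst (w : World T) : Ctx → (ℕ → PTm) → Prop
  | [], σ => σ = .var
  | B :: Θ, σ => ∃ τ a, w.Inst Θ τ ∧ a.Supp (names w.rank) ∧ w.Tr [] (.tm a (B.subst τ)) ∧
      σ = scons a τ

def SuppCtx (L : Set ℕ) : Ctx → Prop
  | [] => True
  | B :: Θ => SuppCtx L Θ ∧ B.Supp (upL^[Θ.length] L)

variable {Θ : Ctx} {σ : ℕ → PTm} {φ : PProp} {J : Jdg} {A B : PCol} {t a b : PTm} {x y z : M w}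

theorem Inst.supp (h : w.Inst Θ σ) : ∀ i ∈ upL^[Θ.length] (names w.rank), (σ i).Supp (names w.rank) := by
  induction Θ generalizing σ with
  | nil => intro i hi; rw [h]; exact PTm.supp_var hi
  | cons B Θ ih =>
    obtain ⟨τ, a, h1, h2, -, rfl⟩ := h
    rw [List.length_cons, Function.iterate_succ_apply']
    exact PTm.supp_scons h2 (ih h1)

theorem Inst.subTy (h : w.Inst Θ σ) : ∀ᶠ Δ in w.fil .top, SubTy T Δ σ (Θ ++ Δ) := by
  induction Θ generalizing σ with
  | nil => filter_upwards [tr_wf] with Δ h1; rw [h]; exact SubTy.id h1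
  | cons B Θ ih =>
    obtain ⟨τ, a, h1, -, h2, rfl⟩ := h
    filter_upwards [ih h1, h2] with Δ h1 h2 using h1.cons h2

theorem Tr.inst (hJ : w.Tr Θ J) (h : w.Inst Θ σ) : w.Tr [] (J.subst σ) := by
  filter_upwards [hJ, h.subTy] with Δ h1 h2 using h1.sub h2

theorem Inst.mono (h : w.Inst Θ σ) (hw : w ≤ w') : w'.Inst Θ σ := by
  induction Θ generalizing σ with
  | nil => exact h
  | cons B Θ ih =>
    obtain ⟨τ, a, h1, h2, h3, rfl⟩ := h
    exact ⟨τ, a, ih h1, h2.mono (names_mono hw.1), h3.mono hw, rfl⟩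

theorem Inst.add (h : w.Inst Θ σ) (i : ℕ) : σ (i + Θ.length) = .var i := by
  induction Θ generalizing σ with
  | nil => rw [h]; rfl
  | cons B Θ ih =>
    obtain ⟨τ, a, h1, h2, h3, rfl⟩ := h
    exact ih h1

theorem inst_one_iff : w.Inst [A] σ ↔ ∃ a, a.Supp (names w.rank) ∧ w.Tr [] (.tm a A) ∧
    σ = scons a .var := by
  constructor
  · rintro ⟨τ, a, rfl, h1, h2, rfl⟩
    exact ⟨a, h1, by rwa [PCol.subst_var] at h2, rfl⟩
  · rintro ⟨a, h1, h2, rfl⟩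
    exact ⟨_, a, rfl, h1, by rwa [PCol.subst_var], rfl⟩

/-- A hypothetical proposition holds if all its instances in later worlds do. -/
theorem tr_gen (hΘ : SuppCtx (names w.rank) Θ) (hs : φ.Supp (upL^[Θ.length] (names w.rank)))
    (hφ : w.Tr Θ (.prop φ))
    (h : ∀ w', w ≤ w' → ∀ σ, w'.Inst Θ σ → w'.Tr [] (.holds (φ.subst σ))) :
    w.Tr Θ (.holds φ) := by
  induction Θ generalizing φ with
  | nil => have := h w le_rfl _ rfl; rwa [PProp.subst_var] at this
  | cons B Θ ih =>
    have hs' : φ.Supp (upL (upL^[Θ.length] (names w.rank))) := by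
      rw [List.length_cons, Function.iterate_succ_apply'] at hs; exact hs
    have h1 : w.Tr Θ (.ty .col B) := by filter_upwards [hφ] with Δ h using h.head
    have h2 : w.Tr Θ (.holds (.all B φ)) := by
      refine ih hΘ.1 (PProp.supp_all hΘ.2 hs') ?_ fun w' hw σ hσ => ?_
      · filter_upwards [hφ] with Δ h using .allF .large h.head h
      · have hi : ∀ i ∈ upL^[Θ.length] (names w.rank), (σ i).Supp (names w'.rank) :=
          fun i hi => hσ.supp i (upL_iterate_mono (names_mono hw.1) _ hi)
        refine (tr_all ?_ ((h1.mono hw).inst hσ) ?_).2 fun w'' hw' x hx => ?_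
        · exact PProp.supp_quant (hΘ.2.subst hi) (hs'.subst (PTm.supp_up hi))
        · filter_upwards [hφ.mono hw, hσ.subTy] with Δ h1 h2 using Der.sub1 (Γ := Θ ++ Δ) h1 h2
        · rw [up_inst]
          exact h w'' (hw.trans hw') _ ⟨σ, x.name, hσ.mono hw', x.name_supp, hx, rfl⟩
    filter_upwards [h2, hφ] with Δ h2 h3 using Der.all_elim h3.head h3 h2

theorem tr_gen_tm (hΘ : SuppCtx (names w.rank) Θ) (hs : t.Supp (upL^[Θ.length] (names w.rank)))
    (hs' : B.Supp (upL^[Θ.length] (names w.rank)))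
    (ht : w.Tr Θ (.tm t .V)) (hB : w.Tr Θ (.ty .col B))
    (h : ∀ w', w ≤ w' → ∀ σ, w'.Inst Θ σ → w'.Tr [] (.tm (t.subst σ) (B.subst σ))) :
    w.Tr Θ (.tm t B) := by
  have : w.Tr Θ (.holds (.memCol t B)) := by
    refine tr_gen hΘ (fun σ τ hst => ?_) ?_ fun w' hw σ hσ => ?_
    · simp only [PProp.subst, hs _ _ hst, hs' _ _ hst]
    · filter_upwards [ht, hB] with Δ h1 h2 using .memColF h1 h2
    · filter_upwards [h w' hw σ hσ, (hB.mono hw).inst hσ] with Δ h1 h2 using .memColI h2 h1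
  filter_upwards [this, ht, hB] with Δ h1 h2 h3 using .memColE h3 h2 h1

/-! ### Set-theoretic formulas as motives -/

theorem _root_.EmTT.SFm.Wf.force_iff_of {φ : SFm} (h : φ.Wf T) {σ : ℕ → PTm} {e : ℕ → M w}
    (he : ∀ i, w.IsVal (σ i) (e i)) : φ.force w e ↔ w.Tr [] (.holds (φ.tilde.subst σ)) :=
  (h.force_iff w e).trans (h.congr he).symm

/-- The motive given by the formula `ξ` with parameters `e`. -/
noncomputable def mot (ξ : SFm) (e : ℕ → M w) : PProp := ξ.tilde.subst (PTm.up (nms e))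

variable {ξ : SFm} {e : ℕ → M w}

theorem mot_prop (h : ξ.Wf T) (hA : w.Tr [] (.ty .col A)) : w.Tr [A] (.prop (mot ξ e)) := by
  filter_upwards [h.tr_prop1 e, hA] with Δ h1 h2 using h1.ofV_ctx h2

theorem mot_ty (h : ξ.Wf T) (hA : w.Tr [] (.ty .col A)) : w.Tr [A] (.ty .col (.ofProp (mot ξ e))) := by
  filter_upwards [mot_prop h hA] with Δ h1 using .propCol h1

theorem mot_inst (ξ : SFm) (e : ℕ → M w) (t : PTm) (m : ℕ) : (mot ξ e).inst [t] m =
    ξ.tilde.subst (scons t fun i => (nms e i).subst fun i => .var (i + m)) := by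
  rw [mot, PProp.inst, PTm.sb_cons, PProp.subst_subst, up_subst_scons]
  rfl

theorem mot_inst_subst (h : w'.Inst Θ σ) : ((mot ξ e).inst [t] Θ.length).subst σ =
    ξ.tilde.subst (scons (t.subst σ) (nms e)) := by
  rw [mot_inst, PProp.subst_subst, scons_subst]
  congr 2
  funext i
  rw [PTm.subst_subst]
  simp only [PTm.subst, h.add]
  exact PTm.subst_var _

theorem mot_inst_zero (ξ : SFm) (e : ℕ → M w) (t : PTm) : (mot ξ e).inst [t] 0 =
    ξ.tilde.subst (scons t (nms e)) := by
  rw [mot_inst]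
  simp only [Nat.add_zero]
  congr 2

theorem tr_mot (h : ξ.Wf T) (hx : w.IsVal t x) :
    w.Tr [] (.holds ((mot ξ e).inst [t] 0)) ↔ ξ.force w (x ▹ e) := by
  rw [mot_inst_zero, h.force_iff_of]
  exact hx.cons fun i => isVal_name (e i)

theorem mot_supp {n : ℕ} (hs : t.Supp (upL^[n] (names w.rank))) :
    ((mot ξ e).inst [t] n).Supp (upL^[n] (names w.rank)) := by
  rw [mot_inst]
  have : ξ.tilde.Supp (upL Set.univ) := fun σ τ hst => congrArg (fun σ => ξ.tilde.subst σ) <| by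
    funext i
    refine hst i ?_
    cases i with
    | zero => exact zero_mem_upL
    | succ i => exact succ_mem_upL trivial
  refine this.subst (PTm.supp_scons hs fun i _ => ?_)
  exact (e i).name_supp.subst fun j hj => PTm.supp_var (add_mem_upL hj _)

theorem tr_mot_gen (h : ξ.Wf T) (hΘ : SuppCtx (names w.rank) Θ)
    (hs : t.Supp (upL^[Θ.length] (names w.rank))) (ht : w.Tr Θ (.tm t .V))
    (H : ∀ w' (hw : w ≤ w') σ x, w'.Inst Θ σ → w'.IsVal (t.subst σ) x → ξ.force w' (x ▹ rese hw e)) :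
    w.Tr Θ (.holds ((mot ξ e).inst [t] Θ.length)) := by
  refine tr_gen hΘ (mot_supp hs) ?_ fun w' hw σ hσ => ?_
  · filter_upwards [h.tr_prop1 e, ht] with Δ h1 h2
    have := Der.sub (Γ := .V :: Δ) h1 ((SubTy.wk_append h2.wf).cons (A := .V) h2)
    rw [mot, PProp.inst, PTm.sb_cons]
    exact this
  · have h1 : w'.Tr [] (.tm (t.subst σ) .V) := (ht.mono hw).inst hσ
    have h2 : (t.subst σ).Supp (names w'.rank) := by
      refine PTm.Supp.subst (L' := upL^[Θ.length] (names w.rank)) hs fun i hi => hσ.supp i ?_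
      exact upL_iterate_mono (names_mono hw.1) _ hi
    obtain ⟨x, hx⟩ := exists_isVal h2 h1
    rw [mot_inst_subst hσ]
    exact (h.force_iff_of (e := x ▹ rese hw e) (hx.cons fun i => isVal_res hw (e i))).1
      (H w' hw σ x hσ hx)

end World

end EmTT

namespace EmTT

variable {T : SetTheory}

theorem Der.pair_vars {Γ : Ctx} {A B : PCol} (hB : Der T (A :: Γ) (.ty .col B)) :
    Der T (B :: A :: Γ) (.tm (.pair (.var 1) (.var 0)) .V) := by
  have hA := hB.head
  have s := (SubTy.wk hA).comp (SubTy.wk hB)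
  have hA' : Der T (B :: A :: Γ) (.ty .col (A.subst _)) := hA.sub s
  have hB' := hB.sub1 s
  refine .toV (.sigmaI hA' hB' (a := .var 1) (b := .var 0) ?_ ?_)
  · have : Der T (B :: A :: Γ) (.tm (.var 1) _) := .var (.cons hB) (.succ .zero)
    rw [PCol.inst, PCol.inst, PCol.subst_subst] at this
    exact this
  · have : Der T (B :: A :: Γ) (.tm (.var 0) _) := .var (.cons hB) .zero
    have e : (B.subst (PTm.up fun i => (PTm.var (i + 1)).subst fun i => .var (i + 1))).inst
        [.var 1] 0 = B.inst [] 1 := by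
      rw [PCol.inst_one, PCol.subst_subst, PCol.inst]
      congr 1; funext i; cases i <;> rfl
    rw [Jdg.subst] at hB'
    rw [e]; exact this

theorem Der.elN1_var {Γ : Ctx} {C : PCol} {b : PTm} (h1 : Der T (.N1 :: Γ) (.ty .col C))
    (h2 : Der T Γ (.tm b (C.inst [.star] 0))) :
    Der T (.N1 :: Γ) (.tm (.elN1 (.var 0) (b.ren Nat.succ)) C) := by
  have h3 := h1.sub1 (SubTy.wk h1.head)
  have h4 := h2.wk h1.head
  have e1 : (C.inst [.star] 0).subst (fun i => .var (i + 1)) =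
      (C.subst (PTm.up fun i => .var (i + 1))).inst [.star] 0 := by
    rw [PCol.inst_one, PCol.inst_one, PCol.subst_subst, PCol.subst_subst]
    congr 1; funext i; cases i <;> rfl
  have e2 : (C.subst (PTm.up fun i => .var (i + 1))).inst [.var 0] 0 = C := by
    rw [PCol.inst_one, PCol.subst_subst]
    conv_rhs => rw [← PCol.subst_var C]
    congr 1; funext i; cases i <;> rfl
  rw [Jdg.subst, e1, ← PTm.ren_eq_subst] at h4
  have := Der.n1E (a := .var 0) h3 (.var h1.wf .zero) h4
  rwa [e2] at this

open World

namespace World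

variable {w w' w'' : World T}

/-- The formula `α`, with parameters `e`, describes the collection `A`. -/
def Rep (e : ℕ → M w) (α : SFm) (A : PCol) : Prop :=
  ∀ w' (h : w ≤ w') z, α.force w' (z ▹ rese h e) ↔ w'.El A z

def Rep₁ (e : ℕ → M w) (β : SFm) (A B : PCol) : Prop :=
  ∀ w' (h : w ≤ w') x z, w'.El A x →
    (β.force w' (z ▹ x ▹ rese h e) ↔ w'.El (B.inst [x.name] 0) z)

/-- The formula `δ`, with parameters `e`, describes the value of `a`. -/
def RepT (e : ℕ → M w) (δ : SFm) (a : PTm) : Prop :=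
  ∀ w' (h : w ≤ w') z, δ.force w' (z ▹ rese h e) ↔ w'.IsVal a z

def RepT₁ (e : ℕ → M w) (δ : SFm) (A : PCol) (b : PTm) : Prop :=
  ∀ w' (h : w ≤ w') x z, w'.El A x →
    (δ.force w' (z ▹ x ▹ rese h e) ↔ w'.IsVal (b.inst [x.name] 0) z)

variable {e : ℕ → M w} {α β δ ξ : SFm} {A B C : PCol} {a b c d m n t : PTm} {x y z v : M w}
  {φ ψ : PProp} {k : Kind}

theorem Rep.self (h : Rep e α A) : α.force w (z ▹ e) ↔ w.El A z := by
  have := h w le_rfl z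
  rwa [rese_refl] at this

theorem Rep₁.self (h : Rep₁ e β A B) (hx : w.El A x) :
    β.force w (z ▹ x ▹ e) ↔ w.El (B.inst [x.name] 0) z := by
  have := h w le_rfl x z hx
  rwa [rese_refl] at this

theorem RepT.self (h : RepT e δ a) : δ.force w (z ▹ e) ↔ w.IsVal a z := by
  have := h w le_rfl z
  rwa [rese_refl] at this

theorem RepT₁.self (h : RepT₁ e δ A b) (hx : w.El A x) :
    δ.force w (z ▹ x ▹ e) ↔ w.IsVal (b.inst [x.name] 0) z := by
  have := h w le_rfl x z hx
  rwa [rese_refl] at this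

theorem Rep.mono (h : Rep e α A) (hw : w ≤ w') : Rep (rese hw e) α A := fun w'' hw' z => by
  rw [rese_rese]; exact h w'' _ z

/-! ### Equality of values -/

theorem IsVal.iff_of_eq (ha : w.Tr [] (.tm a .V)) (hb : w.Tr [] (.tm b .V))
    (h : w.Tr [] (.tmEq a b A)) : w.IsVal a v ↔ w.IsVal b v := by
  have h' : w.Tr [] (.tmEq a b .V) := by filter_upwards [h] with Δ h using .toVEq h
  refine ⟨fun hv => hv.congr hb h', fun hv => hv.congr ha ?_⟩
  filter_upwards [h'] with Δ h using .tmSymm h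

theorem Tr.toV (h : w.Tr [] (.tm a A)) : w.Tr [] (.tm a .V) := by
  filter_upwards [h] with Δ h using .toV h

theorem conv_inst (hB : w.Tr [A] (.ty k B)) (hx : w.El A x) (ha : w.IsVal a x) :
    w.Tr [] (.tyEq k (B.inst [a] 0) (B.inst [x.name] 0)) := by
  filter_upwards [hB, hx, hx.tr ha, ha.2] with Δ h1 h2 h3 h4
  exact Der.eq_inst1_ty h1 h3 h2 (.tmSymm (.ofVEq h2 h3 h4))

theorem isVal_inst (ht : w.Tr [A] (.tm t B)) (hx : w.El A x) (ha : w.IsVal a x) :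
    w.IsVal (t.inst [a] 0) v ↔ w.IsVal (t.inst [x.name] 0) v := by
  have h3 := hx.tr ha
  refine IsVal.iff_of_eq (A := B.inst [a] 0) ?_ ?_ ?_
  · filter_upwards [ht, h3] with Δ h1 h2 using .toV (h1.inst1 h2 |> fun h => by
      rw [PTm.inst_one]; exact h)
  · filter_upwards [ht, hx] with Δ h1 h2 using .toV (h1.inst1 h2 |> fun h => by
      rw [PTm.inst_one]; exact h)
  · filter_upwards [ht, hx, h3, ha.2] with Δ h1 h2 h3 h4
    exact Der.eq_inst_one h1 h3 h2 (.tmSymm (.ofVEq h2 h3 h4))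

theorem el_conv (h : w.Tr [] (.tyEq .col A B)) : w.El A z ↔ w.El B z := by
  constructor <;> intro hz
  · filter_upwards [h, hz] with Δ h1 h2 using .conv h2 h1
  · filter_upwards [h, hz] with Δ h1 h2 using .conv h2 (.tySymm h1)

/-! ### Propositions, comprehension -/

theorem isVal_tt : w.IsVal .tt M.empty := by
  refine IsVal.empty.congr ?_ ?_
  · filter_upwards [tr_wf] with Δ h using h.tt_V
  · filter_upwards [tr_wf] with Δ h using .tmSymm h.tt_eq

theorem El.isVal_tt (hφ : w.Tr [] (.prop φ)) (hz : w.El (.ofProp φ) z) : w.IsVal .tt z := by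
  refine (isVal_name z).congr World.isVal_tt.1 ?_
  filter_upwards [hφ, hz] with Δ h1 h2 using .toVEq (.propMono h1 h2 (.propTrue h1 h2))

theorem El.holds (hφ : w.Tr [] (.prop φ)) (hz : w.El (.ofProp φ) z) : w.Tr [] (.holds φ) := by
  filter_upwards [hφ, hz] with Δ h1 h2 using .propTrue h1 h2

theorem el_ofProp (hφ : w.Tr [] (.prop φ)) :
    w.El (.ofProp φ) z ↔ z = M.empty ∧ w.Tr [] (.holds φ) := by
  constructor
  · intro h; exact ⟨(El.isVal_tt hφ h).unique World.isVal_tt, h.holds hφ⟩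
  · rintro ⟨rfl, h⟩; exact isVal_tt.el h

theorem el_V : w.El .V z := z.tr_name

theorem el_compr (hφ : w.Tr [.V] (.prop φ)) :
    w.El (.compr φ) z ↔ w.Tr [] (.holds (φ.inst [z.name] 0)) := by
  constructor <;> intro h
  · filter_upwards [hφ, h, z.tr_name] with Δ h1 h2 h3 using (Der.mem_compr h1 h3).1 h2
  · filter_upwards [hφ, h, z.tr_name] with Δ h1 h2 h3 using (Der.mem_compr h1 h3).2 h2

/-! ### The empty set and the singleton -/

theorem not_el_N0 : ¬ w.El .N0 z := fun h => not_tr_bot (w := w) <| by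
  filter_upwards [h] with Δ h
  have hN : Der T Δ (.ty .col .N0) := .setCol (.n0F h.wf)
  have hb : Der T (.N0 :: Δ) (.prop .bot) := .propsProp (.botF (.cons hN))
  exact .propTrue (.propsProp (.botF h.wf)) (.n0E (M := .ofProp .bot) (.propCol hb) h)

theorem isVal_star : w.IsVal .star M.empty := by
  refine IsVal.empty.congr ?_ ?_
  · filter_upwards [tr_wf] with Δ h using .toV (.n1I h)
  · filter_upwards [tr_wf] with Δ h using .toVEq (.tmSymm (.starEq h))

theorem tr_N1 : w.Tr [] (.ty .set .N1) := by filter_upwards [tr_wf] with Δ h using .n1F h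

theorem n1_ind (h : ξ.Wf T) (h0 : ξ.force w (M.empty ▹ e)) (hz : w.El .N1 z) :
    ξ.force w (z ▹ e) := by
  have hN : w.Tr [] (.ty .col .N1) := by filter_upwards [tr_N1] with Δ h using .setCol h
  rw [← tr_mot h (isVal_name z)]
  filter_upwards [mot_ty (e := e) h hN, mot_prop (e := e) h hN, hz,
    (tr_mot (e := e) h isVal_star).2 h0] with Δ h1 h2 h3 h4
  exact .propTrue (h2.inst_one_ty h3) (.n1E h1 h3 h4)

theorem el_N1 : w.El .N1 z ↔ z = M.empty := by
  constructor
  · intro h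
    have := n1_ind (e := fun _ => z) (ξ := .eq (.var 0) .empty) (by simp) (by simp) h
    simpa using this
  · rintro rfl
    refine isVal_star.el ?_
    filter_upwards [tr_wf] with Δ h using .n1I h

theorem isVal_elN1 (hM : w.Tr [.N1] (.ty .col C)) (ha : w.Tr [] (.tm a .N1))
    (hx : w.IsVal a x) (hb : w.Tr [] (.tm b (C.inst [.star] 0))) : w.IsVal (.elN1 a b) v ↔ w.IsVal b v := by
  obtain rfl := el_N1.1 (hx.el ha)
  have hel : w.Tr [.N1] (.tm (.elN1 (.var 0) (b.ren Nat.succ)) C) := by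
    filter_upwards [hM, hb] with Δ h1 h2 using h1.elN1_var h2
  have hsub : ∀ t, (PTm.elN1 (.var 0) (b.ren Nat.succ)).inst [t] 0 = .elN1 t b := fun t => by
    have := PTm.wk_inst b t
    rw [PTm.inst] at this ⊢
    rw [PTm.subst, this]; rfl
  have hN : w.El .N1 M.empty := el_N1.2 rfl
  have h1 := isVal_inst (v := v) hel hN hx
  have h2 := isVal_inst (v := v) hel hN isVal_star
  rw [hsub] at h1 h2
  rw [h1, ← h2]
  refine IsVal.iff_of_eq ?_ hb.toV (A := C.inst [.star] 0) ?_
  · filter_upwards [hM, hb] with Δ h1 h2 using .toV (.n1E h1 (.n1I h2.wf) h2)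
  · filter_upwards [hM, hb] with Δ h1 h2 using .n1C h1 h2

end World

end EmTT

namespace EmTT

open World

namespace World

variable {T : SetTheory} {w w' w'' : World T}
  {e : ℕ → M w} {α β δ ξ : SFm} {A B C : PCol} {a b c d m n t : PTm} {x y z v : M w}
  {φ ψ : PProp} {k : Kind}

/-! ### Indexed sums -/

theorem isVal_pair (hA : w.Tr [] (.ty .col A)) (hB : w.Tr [A] (.ty .col B))
    (ha : w.Tr [] (.tm a A)) (hb : w.Tr [] (.tm b (B.inst [a] 0))) (hx : w.IsVal a x)
    (hy : w.IsVal b y) : w.IsVal (.pair a b) (M.pair x y) := by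
  refine (hx.kpair hy).congr ?_ ?_
  · filter_upwards [hA, hB, ha, hb] with Δ h1 h2 h3 h4 using .toV (.sigmaI h1 h2 h3 h4)
  · filter_upwards [hA, hB, ha, hb] with Δ h1 h2 h3 h4
    exact .tmSymm (.toVEq (.pairEq h1 h2 h3 h4))

theorem el_sigma_intro (hA : w.Tr [] (.ty .col A)) (hB : w.Tr [A] (.ty .col B))
    (hx : w.El A x) (hy : w.El (B.inst [x.name] 0) y) : w.El (.sigma A B) (M.pair x y) := by
  refine (isVal_pair hA hB hx hy (isVal_name x) (isVal_name y)).el ?_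
  filter_upwards [hA, hB, hx, hy] with Δ h1 h2 h3 h4 using .sigmaI h1 h2 h3 h4

theorem sigma_ind (hA : w.Tr [] (.ty .col A)) (hB : w.Tr [A] (.ty .col B))
    (sA : A.Supp (names w.rank)) (sB : B.Supp (upL (names w.rank))) (h : ξ.Wf T)
    (H : ∀ w' (hw : w ≤ w') x y, w'.El A x → w'.El (B.inst [x.name] 0) y →
      ξ.force w' (M.pair x y ▹ rese hw e)) (hz : w.El (.sigma A B) z) : ξ.force w (z ▹ e) := by
  have hS : w.Tr [] (.ty .col (.sigma A B)) := by
    filter_upwards [hA, hB] with Δ h1 h2 using .sigmaF .large h1 h2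
  have hm : w.Tr [B, A] (.holds ((mot ξ e).inst [.pair (.var 1) (.var 0)] 2)) := by
    refine tr_mot_gen (Θ := [B, A]) h ⟨⟨trivial, sA⟩, sB⟩ ?_ ?_ ?_
    · intro σ τ hst
      simp only [PTm.subst]
      rw [hst 1 (succ_mem_upL zero_mem_upL), hst 0 zero_mem_upL]
    · filter_upwards [hB] with Δ h using Der.pair_vars h
    · rintro w' hw σ p ⟨τ, b, hτ, hs, hb, rfl⟩ hp
      obtain ⟨a, hs', ha, rfl⟩ := inst_one_iff.1 hτ
      obtain ⟨x, hx⟩ := exists_isVal hs' ha.toV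
      obtain ⟨y, hy⟩ := exists_isVal hs hb.toV
      rw [← PCol.inst_one] at hb
      obtain rfl := hp.unique (isVal_pair (hA.mono hw) (hB.mono hw) ha hb hx hy)
      have hx' := hx.el ha
      exact H w' hw x y hx' ((el_conv (conv_inst (hB.mono hw) hx' hx)).1 (hy.el hb))
  rw [← tr_mot h (isVal_name z)]
  filter_upwards [hA, hB, mot_ty (e := e) h hS, mot_prop (e := e) h hS, hz, hm]
    with Δ h1 h2 h3 h4 h5 h6
  exact .propTrue (h4.inst_one_ty h5) (.sigmaE h1 h2 h3 h5 h6)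

theorem rep_sigma (hA : w.Tr [] (.ty .col A)) (hB : w.Tr [A] (.ty .col B))
    (sA : A.Supp (names w.rank)) (sB : B.Supp (upL (names w.rank))) (wα : α.Wf T) (wβ : β.Wf T)
    (hα : Rep e α A) (hβ : Rep₁ e β A B) :
    (SFm.ex (.ex (.and (α.inst [.var 1] 3) (.and (β.inst [.var 0, .var 1] 3)
        (.eq (.var 2) (.pair (.var 1) (.var 0))))))).force w (z ▹ e) ↔ w.El (.sigma A B) z := by
  constructor
  · simp [wα, wβ]
    rintro x h1 y h2 rfl
    rw [hα.self] at h1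
    rw [hβ.self h1] at h2
    exact el_sigma_intro hA hB h1 h2
  · refine sigma_ind hA hB sA sB (by simp [wα, wβ]) fun w' hw x y h1 h2 => ?_
    simp [wα, wβ]
    exact ⟨x, (hα w' hw x).2 h1, y, (hβ w' hw x y h1).2 h2, rfl⟩

theorem el_sigma (hA : w.Tr [] (.ty .col A)) (hB : w.Tr [A] (.ty .col B))
    (sA : A.Supp (names w.rank)) (sB : B.Supp (upL (names w.rank))) (wα : α.Wf T) (wβ : β.Wf T)
    (hα : Rep e α A) (hβ : Rep₁ e β A B) :
    w.El (.sigma A B) z ↔ ∃ x y, w.El A x ∧ w.El (B.inst [x.name] 0) y ∧ z = M.pair x y := by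
  constructor
  · rw [← rep_sigma hA hB sA sB wα wβ hα hβ]
    simp [wα, wβ]
    rintro x h1 y h2 rfl
    rw [hα.self] at h1
    rw [hβ.self h1] at h2
    exact ⟨x, h1, y, h2, rfl⟩
  · rintro ⟨x, y, h1, h2, rfl⟩
    exact el_sigma_intro hA hB h1 h2

theorem isVal_elSigma (hA : w.Tr [] (.ty .col A)) (hB : w.Tr [A] (.ty .col B))
    (hC : w.Tr [.sigma A B] (.ty .col C))
    (hm : w.Tr [B, A] (.tm m (C.inst [.pair (.var 1) (.var 0)] 2)))
    (hd : w.Tr [] (.tm d (.sigma A B))) (hx : w.El A x) (hy : w.El (B.inst [x.name] 0) y)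
    (hv : w.IsVal d (M.pair x y)) :
    w.IsVal (.elSigma d m) v ↔ w.IsVal (m.inst [y.name, x.name] 0) v := by
  have hp := isVal_pair hA hB hx hy (isVal_name x) (isVal_name y)
  have hdp := hv.eq hp
  refine IsVal.iff_of_eq (A := .V) ?_ ?_ ?_
  · filter_upwards [hA, hB, hC, hd, hm] with Δ h1 h2 h3 h4 h5 using .toV (.sigmaE h1 h2 h3 h4 h5)
  · filter_upwards [hm, hx, hy, tr_wf] with Δ h1 h2 h3 h4
    have := h1.sub (((SubTy.id h4).cons (A := A) (a := x.name) (by rwa [PCol.subst_var])).cons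
      (A := B) (a := y.name) (by rwa [← PCol.inst_one]))
    rw [PTm.inst, PTm.sb_cons, PTm.sb_cons]
    exact .toV this
  · filter_upwards [hA, hB, hC, hd, hm, hdp, hx, hy] with Δ h1 h2 h3 h4 h5 h6 h7 h8
    have hpt := Der.sigmaI h1 h2 h7 h8
    refine .tmTrans (.toVEq (.sigmaEEq h1 h2 h3 (.ofVEq h4 hpt h6) (.tmRefl h5)
      (.sigmaE h1 h2 h3 h4 h5) (.sigmaE h1 h2 h3 hpt h5))) (.toVEq (.sigmaC h1 h2 h3 h7 h8 h5))

/-! ### Disjoint sums -/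

theorem isVal_inl (hA : w.Tr [] (.ty .set A)) (hB : w.Tr [] (.ty .set B))
    (ha : w.Tr [] (.tm a A)) (hx : w.IsVal a x) : w.IsVal (.inl a) (M.pair M.empty x) := by
  refine (IsVal.empty.kpair hx).congr ?_ ?_
  · filter_upwards [hA, hB, ha] with Δ h1 h2 h3 using .toV (.sumI1 h1 h2 h3)
  · filter_upwards [hA, hB, ha] with Δ h1 h2 h3 using .tmSymm (.toVEq (.inlEq h1 h2 h3))

theorem isVal_inr (hA : w.Tr [] (.ty .set A)) (hB : w.Tr [] (.ty .set B))
    (ha : w.Tr [] (.tm a B)) (hx : w.IsVal a x) : w.IsVal (.inr a) (M.pair M.one x) := by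
  refine (IsVal.empty.sing.kpair hx).congr ?_ ?_
  · filter_upwards [hA, hB, ha] with Δ h1 h2 h3 using .toV (.sumI2 h1 h2 h3)
  · filter_upwards [hA, hB, ha] with Δ h1 h2 h3 using .tmSymm (.toVEq (.inrEq h1 h2 h3))

theorem el_inl (hA : w.Tr [] (.ty .set A)) (hB : w.Tr [] (.ty .set B))
    (hx : w.El A x) : w.El (.sum A B) (M.pair M.empty x) := by
  refine (isVal_inl hA hB hx (isVal_name x)).el ?_
  filter_upwards [hA, hB, hx] with Δ h1 h2 h3 using .sumI1 h1 h2 h3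

theorem el_inr (hA : w.Tr [] (.ty .set A)) (hB : w.Tr [] (.ty .set B))
    (hx : w.El B x) : w.El (.sum A B) (M.pair M.one x) := by
  refine (isVal_inr hA hB hx (isVal_name x)).el ?_
  filter_upwards [hA, hB, hx] with Δ h1 h2 h3 using .sumI2 h1 h2 h3

theorem sum_ind (hA : w.Tr [] (.ty .set A)) (hB : w.Tr [] (.ty .set B))
    (sA : A.Supp (names w.rank)) (sB : B.Supp (names w.rank)) (h : ξ.Wf T)
    (H1 : ∀ w' (hw : w ≤ w') x, w'.El A x → ξ.force w' (M.pair M.empty x ▹ rese hw e))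
    (H2 : ∀ w' (hw : w ≤ w') x, w'.El B x → ξ.force w' (M.pair M.one x ▹ rese hw e))
    (hz : w.El (.sum A B) z) : ξ.force w (z ▹ e) := by
  have hS : w.Tr [] (.ty .col (.sum A B)) := by
    filter_upwards [hA, hB] with Δ h1 h2 using .setCol (.sumF h1 h2)
  have hm : w.Tr [A] (.holds ((mot ξ e).inst [.inl (.var 0)] 1)) := by
    refine tr_mot_gen (Θ := [A]) h ⟨trivial, sA⟩ ?_ ?_ ?_
    · intro σ τ hst
      simp only [PTm.subst]
      rw [hst 0 zero_mem_upL]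
    · filter_upwards [hA, hB] with Δ h1 h2
      have := SubTy.wk (T := T) (.setCol h1)
      have h3 : Der T (A :: Δ) (.tm (.var 0) _) := .var this.1 .zero
      exact .toV (.sumI1 (h1.sub this) (h2.sub this) h3)
    · rintro w' hw σ p hσ hp
      obtain ⟨a, hs', ha, rfl⟩ := inst_one_iff.1 hσ
      obtain ⟨x, hx⟩ := exists_isVal hs' ha.toV
      obtain rfl := hp.unique (isVal_inl (hA.mono hw) (hB.mono hw) ha hx)
      exact H1 w' hw x (hx.el ha)
  have hn : w.Tr [B] (.holds ((mot ξ e).inst [.inr (.var 0)] 1)) := by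
    refine tr_mot_gen (Θ := [B]) h ⟨trivial, sB⟩ ?_ ?_ ?_
    · intro σ τ hst
      simp only [PTm.subst]
      rw [hst 0 zero_mem_upL]
    · filter_upwards [hA, hB] with Δ h1 h2
      have := SubTy.wk (T := T) (.setCol h2)
      have h3 : Der T (B :: Δ) (.tm (.var 0) _) := .var this.1 .zero
      exact .toV (.sumI2 (h1.sub this) (h2.sub this) h3)
    · rintro w' hw σ p hσ hp
      obtain ⟨a, hs', ha, rfl⟩ := inst_one_iff.1 hσ
      obtain ⟨x, hx⟩ := exists_isVal hs' ha.toV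
      obtain rfl := hp.unique (isVal_inr (hA.mono hw) (hB.mono hw) ha hx)
      exact H2 w' hw x (hx.el ha)
  rw [← tr_mot h (isVal_name z)]
  filter_upwards [hA, hB, mot_ty (e := e) h hS, mot_prop (e := e) h hS, hz, hm, hn]
    with Δ h1 h2 h3 h4 h5 h6 h7
  exact .propTrue (h4.inst_one_ty h5) (.sumE h1 h2 h3 h5 h6 h7)

theorem rep_sum (hA : w.Tr [] (.ty .set A)) (hB : w.Tr [] (.ty .set B))
    (sA : A.Supp (names w.rank)) (sB : B.Supp (names w.rank)) (wα : α.Wf T) (wβ : β.Wf T)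
    (hα : Rep e α A) (hβ : Rep e β B) :
    (SFm.or (.ex (.and (α.inst [.var 0] 2) (.eq (.var 1) (.pair .empty (.var 0)))))
        (.ex (.and (β.inst [.var 0] 2) (.eq (.var 1) (.pair .one (.var 0)))))).force w (z ▹ e) ↔
      w.El (.sum A B) z := by
  constructor
  · simp [wα, wβ]
    rintro (⟨x, h1, rfl⟩ | ⟨x, h1, rfl⟩)
    · exact el_inl hA hB (hα.self.1 h1)
    · exact el_inr hA hB (hβ.self.1 h1)
  · refine sum_ind hA hB sA sB (by simp [wα, wβ]) (fun w' hw x h1 => ?_) fun w' hw x h1 => ?_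
    · simp [wα, wβ]
      exact .inl ⟨x, (hα w' hw x).2 h1, rfl⟩
    · simp [wα, wβ]
      exact .inr ⟨x, (hβ w' hw x).2 h1, rfl⟩

theorem el_sum (hA : w.Tr [] (.ty .set A)) (hB : w.Tr [] (.ty .set B))
    (sA : A.Supp (names w.rank)) (sB : B.Supp (names w.rank)) (wα : α.Wf T) (wβ : β.Wf T)
    (hα : Rep e α A) (hβ : Rep e β B) (hz : w.El (.sum A B) z) :
    (∃ x, w.El A x ∧ z = M.pair M.empty x) ∨ ∃ x, w.El B x ∧ z = M.pair M.one x := by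
  rw [← rep_sum hA hB sA sB wα wβ hα hβ] at hz
  simp [wα, wβ] at hz
  rcases hz with ⟨x, h1, rfl⟩ | ⟨x, h1, rfl⟩
  · exact .inl ⟨x, hα.self.1 h1, rfl⟩
  · exact .inr ⟨x, hβ.self.1 h1, rfl⟩

theorem tr_inst_V (ht : w.Tr [A] (.tm t B)) (ha : w.Tr [] (.tm a A)) :
    w.Tr [] (.tm (t.inst [a] 0) .V) := by
  filter_upwards [ht, ha] with Δ h1 h2
  have := h1.inst1 h2
  rw [PTm.inst_one]
  exact .toV this

theorem isVal_elSum_inl (hA : w.Tr [] (.ty .set A)) (hB : w.Tr [] (.ty .set B))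
    (hC : w.Tr [.sum A B] (.ty .col C))
    (hm : w.Tr [A] (.tm m (C.inst [.inl (.var 0)] 1)))
    (hn : w.Tr [B] (.tm n (C.inst [.inr (.var 0)] 1)))
    (hd : w.Tr [] (.tm d (.sum A B))) (hx : w.El A x) (hv : w.IsVal d (M.pair M.empty x)) :
    w.IsVal (.elSum d m n) v ↔ w.IsVal (m.inst [x.name] 0) v := by
  have hdp := hv.eq (isVal_inl hA hB hx (isVal_name x))
  refine IsVal.iff_of_eq (A := .V) ?_ (tr_inst_V hm hx) ?_
  · filter_upwards [hA, hB, hC, hd, hm, hn] with Δ h1 h2 h3 h4 h5 h6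
    exact .toV (.sumE h1 h2 h3 h4 h5 h6)
  · filter_upwards [hA, hB, hC, hd, hm, hn, hdp, hx] with Δ h1 h2 h3 h4 h5 h5' h6 h7
    have hpt := Der.sumI1 h1 h2 h7
    exact .tmTrans (.toVEq (.sumEEq h1 h2 h3 (.ofVEq h4 hpt h6) (.tmRefl h5) (.tmRefl h5')
      (.sumE h1 h2 h3 h4 h5 h5') (.sumE h1 h2 h3 hpt h5 h5'))) (.toVEq (.sumC1 h1 h2 h3 h7 h5 h5'))

theorem isVal_elSum_inr (hA : w.Tr [] (.ty .set A)) (hB : w.Tr [] (.ty .set B))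
    (hC : w.Tr [.sum A B] (.ty .col C))
    (hm : w.Tr [A] (.tm m (C.inst [.inl (.var 0)] 1)))
    (hn : w.Tr [B] (.tm n (C.inst [.inr (.var 0)] 1)))
    (hd : w.Tr [] (.tm d (.sum A B))) (hx : w.El B x) (hv : w.IsVal d (M.pair M.one x)) :
    w.IsVal (.elSum d m n) v ↔ w.IsVal (n.inst [x.name] 0) v := by
  have hdp := hv.eq (isVal_inr hA hB hx (isVal_name x))
  refine IsVal.iff_of_eq (A := .V) ?_ (tr_inst_V hn hx) ?_
  · filter_upwards [hA, hB, hC, hd, hm, hn] with Δ h1 h2 h3 h4 h5 h6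
    exact .toV (.sumE h1 h2 h3 h4 h5 h6)
  · filter_upwards [hA, hB, hC, hd, hm, hn, hdp, hx] with Δ h1 h2 h3 h4 h5 h5' h6 h7
    have hpt := Der.sumI2 h1 h2 h7
    exact .tmTrans (.toVEq (.sumEEq h1 h2 h3 (.ofVEq h4 hpt h6) (.tmRefl h5) (.tmRefl h5')
      (.sumE h1 h2 h3 h4 h5 h5') (.sumE h1 h2 h3 hpt h5 h5'))) (.toVEq (.sumC2 h1 h2 h3 h7 h5 h5'))

/-! ### Separation and names of sets -/

theorem mem_sepTm (ha : w.Tr [] (.tm a .V)) (hx : w.IsVal a x) (hφ : w.Tr [.V] (.prop φ))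
    (hφ' : T = .CZF → w.Tr [.V] (.props φ)) (hv : w.IsVal (.sep a φ) v) :
    z ∈ v ↔ z ∈ x ∧ w.Tr [] (.holds (φ.inst [z.name] 0)) := by
  rw [(isVal_name z).mem hv, (isVal_name z).mem hx]
  have h' : ∀ᶠ Δ in w.fil .top, T = .CZF → Der T (.V :: Δ) (.props φ) := by
    by_cases hT : T = .CZF
    · filter_upwards [hφ' hT] with Δ h1 h2 using h1
    · exact .of_forall fun Δ h => absurd h hT
  constructor
  · intro h
    constructor
    · filter_upwards [ha, hφ, h', z.tr_name, h] with Δ h1 h2 h3 h4 h5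
      exact ((Der.mem_sep h1 h2 h3 h4).1 h5).1
    · filter_upwards [ha, hφ, h', z.tr_name, h] with Δ h1 h2 h3 h4 h5
      exact ((Der.mem_sep h1 h2 h3 h4).1 h5).2
  · rintro ⟨h, hh⟩
    filter_upwards [ha, hφ, h', z.tr_name, h, hh] with Δ h1 h2 h3 h4 h5 h6
    exact (Der.mem_sep h1 h2 h3 h4).2 ⟨h5, h6⟩

theorem tr_sep (ha : w.Tr [] (.tm a .V)) (hφ : w.Tr [.V] (.prop φ))
    (hφ' : T = .CZF → w.Tr [.V] (.props φ)) : w.Tr [] (.tm (.sep a φ) .V) := by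
  have h' : ∀ᶠ Δ in w.fil .top, T = .CZF → Der T (.V :: Δ) (.props φ) := by
    by_cases hT : T = .CZF
    · filter_upwards [hφ' hT] with Δ h1 h2 using h1
    · exact .of_forall fun Δ h => absurd h hT
  filter_upwards [ha, hφ, h'] with Δ h1 h2 h3 using Der.sep_V h1 h2 h3

theorem tr_name_V (hA : w.Tr [] (.ty .set A)) : w.Tr [] (.tm (.name A) .V) := by
  filter_upwards [hA] with Δ h using .nameI h

theorem mem_nameTm (hA : w.Tr [] (.ty .set A)) (hv : w.IsVal (.name A) v) : z ∈ v ↔ w.El A z := by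
  rw [(isVal_name z).mem hv]
  constructor
  · intro h
    filter_upwards [hA, z.tr_name, h] with Δ h1 h2 h3 using (Der.mem_name h1 h2).1 h3
  · intro h
    filter_upwards [hA, z.tr_name, h] with Δ h1 h2 h3 using (Der.mem_name h1 h2).2 h3

/-- A set is represented by the value of its name. -/
theorem exists_set (hA : w.Tr [] (.ty .set A)) (sA : A.Supp (names w.rank)) :
    ∃ v, w.IsVal (.name A) v ∧ ∀ w' (hw : w ≤ w') z, z ∈ res hw v ↔ w'.El A z := by
  obtain ⟨v, hv⟩ := exists_isVal (a := .name A) (fun σ τ h => by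
    simp only [PTm.subst, sA σ τ h]) (tr_name_V hA)
  exact ⟨v, hv, fun w' hw z => mem_nameTm (hA.mono hw) (hv.mono hw)⟩

end World

end EmTT

namespace EmTT

variable {T : SetTheory}

/-- A function has graph `{z ε ⌈(Σ x ∈ A) B⌉ | …}`, whatever the collection of its values. -/
theorem Der.lam_graph {Γ : Ctx} {A : PCol} {b : PTm} (hA : Der T Γ (.ty .set A))
    (hb : Der T (A :: Γ) (.tm b .V)) :
    Der T (A :: Γ) (.ty .set (elts (.sing b))) ∧ Der T (A :: Γ) (.tm b (elts (.sing b))) ∧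
    Der T Γ (.tmEq (.lam A b)
        (.sep (.name (.sigma A (elts (.sing b))))
          (.ex (A.inst [] 1) (.eq .V (.var 1) (.kpair (.var 0) (b.inst [.var 0] 2))))) .V) ∧
    Der T Γ (.tm (.lam A b) .V) := by
  have h1 : Der T (A :: Γ) (.ty .set (elts (.sing b))) := elts_set (.upairI hb hb)
  have h2 : Der T (A :: Γ) (.tm b (elts (.sing b))) := (mem_elts (.upairI hb hb) hb).2 hb.mem_sing
  exact ⟨h1, h2, .toVEq (.lamEq hA h1 h2), .toV (.piI hA h1 h2)⟩

theorem PCol.Supp.mono {A : PCol} {L L' : Set ℕ} (h : A.Supp L) (hL : L ⊆ L') : A.Supp L' :=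
  fun _ _ hst => h _ _ fun i hi => hst i (hL hi)

open World

namespace World

variable {w w' w'' : World T}
  {e : ℕ → M w} {α β δ ξ : SFm} {A B C : PCol} {a b c d m n t f : PTm} {x y z v F : M w}
  {φ ψ : PProp} {k : Kind}

/-! ### Functions -/

theorem tr_exists_kpair (hA : w.Tr [] (.ty .col A)) (sA : A.Supp (names w.rank))
    (hb : w.Tr [A] (.tm b B)) (sb : b.Supp (upL (names w.rank))) :
    w.Tr [] (.holds (.ex A (.eq .V (z.name.ren Nat.succ) (.kpair (.var 0) b)))) ↔
      ∃ x y, w.El A x ∧ w.IsVal (b.inst [x.name] 0) y ∧ z = M.pair x y := by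
  rw [tr_ex ?_ hA ?_]
  · constructor
    · rintro ⟨x, hx, h⟩
      have hbx := tr_inst_V hb hx
      obtain ⟨y, hy⟩ := exists_isVal (by rw [PTm.inst_one]; exact sb.inst1 x.name_supp) hbx
      refine ⟨x, y, hx, hy, ?_⟩
      have hk := (isVal_name x).kpair hy
      rw [show (PProp.eq .V (z.name.ren Nat.succ) (.kpair (.var 0) b)).inst [x.name] 0 =
        .eq .V ((z.name.ren Nat.succ).inst [x.name] 0) (.kpair x.name (b.inst [x.name] 0)) from rfl,
        PTm.wk_inst, tr_eq_iff z.tr_name hk.1] at h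
      exact ((isVal_name z).eq_iff hk).1 h
    · rintro ⟨x, y, hx, hy, rfl⟩
      refine ⟨x, hx, ?_⟩
      have hk := (isVal_name x).kpair hy
      rw [show (PProp.eq .V ((M.pair x y).name.ren Nat.succ) (.kpair (.var 0) b)).inst [x.name] 0 =
        .eq .V (((M.pair x y).name.ren Nat.succ).inst [x.name] 0)
          (.kpair x.name (b.inst [x.name] 0)) from rfl,
        PTm.wk_inst, tr_eq_iff (M.pair x y).tr_name hk.1]
      exact (isVal_name _).eq hk
  · refine PProp.supp_quant sA fun σ τ h => ?_
    simp only [PProp.subst, PTm.kpair, PTm.sing, PTm.subst, sb σ τ h, z.name_supp.wk σ τ h,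
      h 0 zero_mem_upL, PCol.subst]
  · filter_upwards [hA, hb, z.tr_name] with Δ h1 h2 h3
    have h4 : Der T (A :: Δ) (.tm (.var 0) _) := .var h2.wf .zero
    have h3' := h3.wk h1
    rw [Jdg.subst, ← PTm.ren_eq_subst] at h3'
    exact .propsProp (.eqVF h3' (.upairI (.upairI (.toV h4) (.toV h4)) (.upairI (.toV h4) (.toV h2))))

/-- The value of an abstraction is the graph of the function. -/
theorem exists_graph (hA : w.Tr [] (.ty .set A)) (sA : A.Supp (names w.rank))
    (hb : w.Tr [A] (.tm b B)) (sb : b.Supp (upL (names w.rank))) :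
    ∃ g, w.IsVal (.lam A b) g ∧ ∀ w' (hw : w ≤ w') z, z ∈ res hw g ↔
      ∃ x y, w'.El A x ∧ w'.IsVal (b.inst [x.name] 0) y ∧ z = M.pair x y := by
  have hA' : w.Tr [] (.ty .col A) := by filter_upwards [hA] with Δ h using .setCol h
  have hV : w.Tr [] (.tm (.lam A b) .V) := by
    filter_upwards [hA, hb] with Δ h1 h2 using (Der.lam_graph h1 (.toV h2)).2.2.2
  obtain ⟨g, hg⟩ := exists_isVal (a := .lam A b) (fun σ τ h => by
    simp only [PTm.subst, sA σ τ h, sb _ _ (up_agree h)]) hV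
  refine ⟨g, hg, fun w' hw z => ?_⟩
  have kA := hA.mono hw
  have kA' := hA'.mono hw
  have kb := hb.mono hw
  have kg := hg.mono hw
  generalize res hw g = g at kg ⊢
  have sA' := sA.mono (names_mono hw.1)
  have sb' : b.Supp (upL (names w'.rank)) := sb.mono (upL_iterate_mono (names_mono hw.1) 1)
  set B' := elts (.sing b)
  have hB' : w'.Tr [A] (.ty .set B') := by
    filter_upwards [kA, kb] with Δ h1 h2 using (Der.lam_graph h1 (.toV h2)).1
  have hB'' : w'.Tr [A] (.ty .col B') := by filter_upwards [hB'] with Δ h using .setCol h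
  have hbB : w'.Tr [A] (.tm b B') := by
    filter_upwards [kA, kb] with Δ h1 h2 using (Der.lam_graph h1 (.toV h2)).2.1
  have hS : w'.Tr [] (.ty .set (.sigma A B')) := by
    filter_upwards [kA, hB'] with Δ h1 h2 using .sigmaF .small h1 h2
  have sB' : B'.Supp (upL (names w'.rank)) := fun σ τ h => by
    have := (show (PTm.sing b).Supp (upL (names w'.rank)) from fun σ τ h => by
      simp only [PTm.sing, PTm.subst, sb' σ τ h]).wk
    simp only [B', elts, PCol.subst, PProp.subst, PTm.wk_eq, this _ _ (up_agree h), PTm.subst,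
      PTm.up]
  obtain ⟨s, hs, hs'⟩ := exists_set hS fun σ τ h => by
    simp only [PCol.subst, sA' σ τ h, sB' _ _ (up_agree h)]
  have hs'' : ∀ z, z ∈ s ↔ w'.El (.sigma A B') z := fun z => by simpa using hs' w' le_rfl z
  set θ : PProp := .ex (A.inst [] 1) (.eq .V (.var 1) (.kpair (.var 0) (b.inst [.var 0] 2)))
  have hθ : w'.Tr [.V] (.props θ) := by
    filter_upwards [kA, kb] with Δ h1 h2
    have hVc := Der.vF (T := T) h1.wf
    have k1 : Der T (.V :: Δ) (.ty .set (A.inst [] 1)) := h1.wk hVc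
    have c1 : Der T (A.inst [] 1 :: .V :: Δ) .wf := .cons (.setCol k1)
    have v0 : Der T (A.inst [] 1 :: .V :: Δ) (.tm (.var 0) .V) := .toV (.var c1 .zero)
    have v1 : Der T (A.inst [] 1 :: .V :: Δ) (.tm (.var 1) .V) :=
      .toV (.var c1 (.succ .zero))
    have s1 := h2.sub ((((SubTy.wk hVc).comp (SubTy.wk (.setCol k1))).cons (A := A) (a := .var 0)) (by
      have : Der T (A.inst [] 1 :: .V :: Δ) (.tm (.var 0) _) := .var c1 .zero
      rw [PCol.inst, PCol.inst, PCol.subst_subst] at this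
      exact this))
    refine .exF .small k1 (.eqVF v1 (.upairI (.upairI v0 v0) (.upairI v0 ?_)))
    rw [PTm.inst, PTm.sb_cons]
    exact .toV s1
  have hθ' : w'.Tr [.V] (.prop θ) := by filter_upwards [hθ] with Δ h using .propsProp h
  have hsep : w'.IsVal (.sep (.name (.sigma A B')) θ) g := by
    refine kg.congr (tr_sep (tr_name_V hS) hθ' fun _ => hθ) ?_
    filter_upwards [kA, kb] with Δ h1 h2 using (Der.lam_graph h1 (.toV h2)).2.2.1
  rw [mem_sepTm (tr_name_V hS) hs hθ' (fun _ => hθ) hsep]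
  have e1 : θ.inst [z.name] 0 = .ex A (.eq .V (z.name.ren Nat.succ) (.kpair (.var 0) b)) := by
    change PProp.ex ((A.inst [] 1).inst [z.name] 0) (.eq .V (z.name.ren Nat.succ) (.kpair (.var 0)
      ((b.inst [.var 0] 2).subst (PTm.up (PTm.sb [z.name] 0))))) = _
    rw [PCol.inst_wk_inst]
    congr 3
    rw [PTm.inst, PTm.subst_subst]
    conv_rhs => rw [← PTm.subst_var b]
    congr 1; funext i; cases i <;> rfl
  rw [e1, tr_exists_kpair kA' sA' kb sb', hs'']
  refine ⟨fun h => h.2, fun h => ⟨?_, h⟩⟩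
  obtain ⟨x, y, hx, hy, rfl⟩ := h
  refine el_sigma_intro kA' hB'' hx (hy.el ?_)
  filter_upwards [hbB, hx] with Δ h1 h2 using h1.inst_one h2

theorem isVal_lam (hA : w.Tr [] (.ty .set A)) (sA : A.Supp (names w.rank))
    (hb : w.Tr [A] (.tm b B)) (sb : b.Supp (upL (names w.rank))) (wα : α.Wf T) (wδ : δ.Wf T)
    (hα : Rep e α A) (hδ : RepT₁ e δ A b) :
    (SFm.all (SFm.iff (.mem (.var 0) (.var 1))
        (.ex (.ex (.and (α.inst [.var 1] 4) (.and (δ.inst [.var 0, .var 1] 4)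
          (.eq (.var 2) (.pair (.var 1) (.var 0))))))))).force w (z ▹ e) ↔ w.IsVal (.lam A b) z := by
  obtain ⟨g, hg, hg'⟩ := exists_graph hA sA hb sb
  have key : ∀ w' (hw : w ≤ w') v, v ∈ res hw g ↔ ∃ x, α.force w' (x ▹ rese hw e) ∧
      ∃ y, δ.force w' (y ▹ x ▹ rese hw e) ∧ v = M.pair x y := fun w' hw v => by
    rw [hg']
    constructor
    · rintro ⟨x, y, h1, h2, h3⟩
      exact ⟨x, (hα w' hw x).2 h1, y, (hδ w' hw x y h1).2 h2, h3⟩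
    · rintro ⟨x, h1, y, h2, h3⟩
      have h1' := (hα w' hw x).1 h1
      exact ⟨x, y, h1', (hδ w' hw x y h1').1 h2, h3⟩
  rw [SFm.force_all_iff]
  simp [wα, wδ]
  constructor
  · intro h
    have : z = g := M.ext fun w' hw v => by rw [key]; exact h w' hw v
    rwa [this]
  · intro h w' hw v
    rw [h.unique hg]
    exact key w' hw v

end World

end EmTT

namespace EmTT

open World

namespace World

variable {T : SetTheory} {w w' w'' : World T}
  {e : ℕ → M w} {α β δ δ' ξ ρ : SFm} {A B C : PCol} {a b c d m n t f : PTm} {x y z v F G : M w}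
  {φ ψ : PProp} {k : Kind}

/-- `F` is the graph of `x ↦ t(x)` on `A`. -/
def IsGraph (A : PCol) (t : PTm) (F : M w) : Prop := ∀ w' (hw : w ≤ w') z, z ∈ res hw F ↔
  ∃ x y, w'.El A x ∧ w'.IsVal (t.inst [x.name] 0) y ∧ z = M.pair x y

theorem IsGraph.self (h : IsGraph A t F) : z ∈ F ↔
    ∃ x y, w.El A x ∧ w.IsVal (t.inst [x.name] 0) y ∧ z = M.pair x y := by
  simpa using h w le_rfl z

theorem IsGraph.mono (h : IsGraph A t F) (hw : w ≤ w') : IsGraph A t (res hw F) := fun w'' hw' z => by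
  rw [res_res]; exact h w'' _ z

theorem IsGraph.pair_mem (h : IsGraph A t F) : M.pair x y ∈ F ↔
    w.El A x ∧ w.IsVal (t.inst [x.name] 0) y := by
  rw [h.self]
  constructor
  · rintro ⟨u, v, h1, h2, h3⟩
    obtain ⟨rfl, rfl⟩ := M.pair_inj.1 h3
    exact ⟨h1, h2⟩
  · rintro ⟨h1, h2⟩
    exact ⟨x, y, h1, h2, rfl⟩

theorem IsGraph.app (h : IsGraph A t F) (hx : w.El A x) (hy : w.IsVal (t.inst [x.name] 0) y) :
    M.app F x = y := by
  refine M.app_eq (h.pair_mem.2 ⟨hx, hy⟩) fun w' hw p hp hpx => ?_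
  obtain ⟨u, v, h1, h2, rfl⟩ := (h w' hw p).1 hp
  rw [M.fst_pair] at hpx
  subst hpx
  have h3 : w'.IsVal (t.inst [(res hw x).name] 0) (res hw y) :=
    (h.mono hw).pair_mem.1 (by simpa using mem_mono (h.pair_mem.2 ⟨hx, hy⟩) hw) |>.2
  rw [h2.unique h3]

theorem force_svl {t : STm} (ht : t.Wf T) : (svl t).force w e ↔
    ∀ w' (hw : w ≤ w') x y z, M.pair x y ∈ res hw (ev e t) → M.pair x z ∈ res hw (ev e t) → y = z := by
  rw [svl, SFm.force_all_all]
  simp only [SFm.force_all_imp]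
  simp (maxDischargeDepth := 9) [ht, ← ht.res_ev]
  constructor
  · intro H w' hw x y z
    simpa using H w' hw x y w' le_rfl z
  · intro H w' hw x y w'' hw' z
    exact H w'' _ _ _ z

/-- The content of `etaPi`. -/
theorem force_etaPi (wα : α.Wf T) (wβ : β.Wf T) (hα : Rep e α A) (hβ : Rep₁ e β A B) :
    (etaPi α β).force w (F ▹ e) ↔
      (∀ w' (hw : w ≤ w') p, p ∈ res hw F → ∃ x y, p = M.pair x y ∧ w'.El A x ∧
        w'.El (B.inst [x.name] 0) y) ∧
      (∀ w' (hw : w ≤ w') x y z, M.pair x y ∈ res hw F → M.pair x z ∈ res hw F → y = z) ∧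
      (∀ w' (hw : w ≤ w') x, w'.El A x → ∃ y, M.pair x y ∈ res hw F) := by
  rw [etaPi, SFm.force_and, SFm.force_and, force_svl (by simp)]
  simp (maxDischargeDepth := 9) [wα, wβ, hα _ _ _]
  refine fun _ _ => ⟨fun h w' hw p hp => ?_, fun h w' hw p hp => ?_⟩
  · obtain ⟨x, y, h1, h2, h3⟩ := h w' hw p hp
    exact ⟨x, y, h1, h2, (hβ w' hw x y h2).1 h3⟩
  · obtain ⟨x, y, h1, h2, h3⟩ := h w' hw p hp
    exact ⟨x, y, h1, h2, (hβ w' hw x y h2).2 h3⟩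

theorem force_etaPow1 : etaPow1.force w (F ▹ e) ↔
    ∀ w' (hw : w ≤ w') z, z ∈ res hw F → z = M.empty := by
  simp (maxDischargeDepth := 9) [etaPow1, STm.sub]

/-- The term `F(x)`, for the last variable `x`. -/
noncomputable def appTm (F : M w) : PTm :=
  (STm.snd (.union (.sep (.var 1) (.eq (.fst (.var 0)) (.var 1))))).tilde.subst
    (scons (.var 0) (scons (F.name.ren Nat.succ) fun _ => .var 0))

theorem appTm_subst (F : M w) (t : PTm) (σ : ℕ → PTm) : (appTm F).subst (scons t σ) =
    (STm.snd (.union (.sep (.var 1) (.eq (.fst (.var 0)) (.var 1))))).tilde.subst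
      (scons t (scons (F.name.subst σ) fun _ => t)) := by
  rw [appTm, PTm.subst_subst, scons_subst, scons_subst, PTm.ren_subst]
  rfl

theorem isVal_appTm (hw : w ≤ w') {x : M w'} (hx : w'.IsVal t x) :
    w'.IsVal ((appTm F).subst (scons t .var)) (M.app (res hw F) x) := by
  rw [appTm_subst, PTm.subst_var]
  exact M.wf_app.congr (e := x ▹ res hw F ▹ fun _ => x)
    (hx.cons ((isVal_res hw F).cons fun _ => hx))

theorem appTm_supp : (appTm F).Supp (upL (names w.rank)) := fun σ τ h => by
  have h0 := h 0 zero_mem_upL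
  have h1 := F.name_supp.wk σ τ h
  rw [appTm, PTm.subst_subst, PTm.subst_subst, scons_subst, scons_subst, scons_subst, scons_subst, h1]
  simp only [PTm.subst, h0]

/-- A set-theoretic function from `A` to `B` is the value of an abstraction. -/
theorem exists_lam (hA : w.Tr [] (.ty .set A)) (sA : A.Supp (names w.rank))
    (hB : w.Tr [A] (.ty .col B)) (sB : B.Supp (upL (names w.rank)))
    (h1 : ∀ w' (hw : w ≤ w') p, p ∈ res hw F → ∃ x y, p = M.pair x y ∧ w'.El A x ∧
        w'.El (B.inst [x.name] 0) y)
    (h2 : ∀ w' (hw : w ≤ w') x y z, M.pair x y ∈ res hw F → M.pair x z ∈ res hw F → y = z)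
    (h3 : ∀ w' (hw : w ≤ w') x, w'.El A x → ∃ y, M.pair x y ∈ res hw F) :
    w.Tr [A] (.tm (appTm F) B) ∧ w.IsVal (.lam A (appTm F)) F := by
  have happ : ∀ w' (hw : w ≤ w') x y, M.pair x y ∈ res hw F → M.app (res hw F) x = y :=
    fun w' hw x y hxy => M.app_eq hxy fun w'' hw' p hp hpx => by
      rw [res_res] at hp
      obtain ⟨u, v, rfl, -, -⟩ := h1 w'' _ p hp
      rw [M.fst_pair] at hpx
      subst hpx
      have := mem_mono hxy hw'
      rw [res_res, M.res_pair] at this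
      rw [h2 w'' _ _ _ _ hp this]
  have ht : w.Tr [A] (.tm (appTm F) B) := by
    refine tr_gen_tm (Θ := [A]) ⟨trivial, sA⟩ appTm_supp sB ?_ hB fun w' hw σ hσ => ?_
    · obtain ⟨n, hn⟩ := M.wf_app (T := T) (i := 1) (j := 1)
      filter_upwards [hB, F.tr_name] with Δ k1 k2
      have k3 : Der T (A :: Δ) (.tm (F.name.ren Nat.succ) .V) := by
        have := k2.wk k1.head
        rwa [Jdg.subst, ← PTm.ren_eq_subst] at this
      have k4 : Der T (A :: Δ) (.tm (.var 0) .V) := .toV (.var k1.wf .zero)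
      refine Der.sub (J := .tm _ .V) hn ⟨k1.wf, fun i C hC => ?_⟩
      obtain ⟨-, rfl⟩ := replicate_has.1 hC
      match i with
      | 0 => exact k4
      | 1 => exact k3
      | i + 2 => exact k4
    · obtain ⟨a, hs', ha, rfl⟩ := inst_one_iff.1 hσ
      obtain ⟨x, hx⟩ := exists_isVal hs' ha.toV
      have hxA := hx.el ha
      obtain ⟨y, hy⟩ := h3 w' hw x hxA
      obtain ⟨u, v, k1, k2, k3⟩ := h1 w' hw _ hy
      obtain ⟨rfl, rfl⟩ := M.pair_inj.1 k1
      have := isVal_appTm (F := F) hw hx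
      rw [happ w' hw _ _ hy] at this
      have k4 := (el_conv (conv_inst (hB.mono hw) hxA hx)).2 k3
      rw [PCol.inst_one] at k4
      exact k4.tr this
  refine ⟨ht, ?_⟩
  obtain ⟨g, hg, hg'⟩ := exists_graph hA sA ht appTm_supp
  suffices g = F by rwa [this] at hg
  refine M.ext fun w' hw z => ?_
  rw [hg']
  constructor
  · rintro ⟨x, y, hx, hy, rfl⟩
    rw [PTm.inst_one] at hy
    have := hy.unique (isVal_appTm hw (isVal_name x))
    obtain ⟨v, hv⟩ := h3 w' hw x hx
    rwa [this, happ w' hw _ _ hv]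
  · intro hz
    obtain ⟨x, y, rfl, hx, hy⟩ := h1 w' hw z hz
    refine ⟨x, y, hx, ?_, rfl⟩
    have := isVal_appTm (F := F) hw (isVal_name x)
    rwa [happ w' hw _ _ hz, ← PTm.inst_one] at this

/-- The graph of a function with values in `B`. -/
theorem etaPi_of_graph (hB : w.Tr [A] (.tm b B)) (sb : b.Supp (upL (names w.rank)))
    (hF : IsGraph A b F) (wα : α.Wf T) (wβ : β.Wf T) (hα : Rep e α A) (hβ : Rep₁ e β A B) :
    (etaPi α β).force w (F ▹ e) := by
  rw [force_etaPi wα wβ hα hβ]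
  refine ⟨fun w' hw p hp => ?_, fun w' hw x y z h1 h2 => ?_, fun w' hw x hx => ?_⟩
  · obtain ⟨x, y, h1, h2, h3⟩ := (hF w' hw p).1 hp
    refine ⟨x, y, h3, h1, h2.el ?_⟩
    filter_upwards [hB.mono hw, h1] with Δ k1 k2 using k1.inst_one k2
  · exact ((hF.mono hw).pair_mem.1 h1).2.unique ((hF.mono hw).pair_mem.1 h2).2
  · obtain ⟨y, hy⟩ := exists_isVal (w := w') (a := b.inst [x.name] 0)
      (by rw [PTm.inst_one]
          exact PTm.Supp.inst1 (sb.mono (upL_iterate_mono (names_mono hw.1) 1)) x.name_supp)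
      (tr_inst_V (hB.mono hw) hx)
    exact ⟨y, (hF.mono hw).pair_mem.2 ⟨hx, hy⟩⟩

theorem app_inst (f a : PTm) : (PTm.app (f.inst [] 1) (.var 0)).inst [a] 0 = .app f a := by
  change PTm.app ((f.inst [] 1).inst [a] 0) a = _
  rw [PTm.inst_wk_inst]

theorem app_supp {L : Set ℕ} (h : f.Supp L) : (PTm.app (f.inst [] 1) (.var 0)).Supp (upL L) :=
  fun σ τ hst => by
    have := h.wk σ τ hst
    rw [← PTm.wk_eq] at this
    simp only [PTm.subst, this, hst 0 zero_mem_upL]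

theorem _root_.EmTT.Der.app_var {Γ : Ctx} (hA : Der T Γ (.ty .set A)) (hB : Der T (A :: Γ) (.ty .set B))
    (hf : Der T Γ (.tm f (.pi A B))) : Der T (A :: Γ) (.tm (.app (f.inst [] 1) (.var 0)) B) := by
  have h0 : Der T (A :: Γ) (.tm (.var 0) _) := .var (.cons (.setCol hA)) .zero
  have := Der.piE (hA.wk (.setCol hA)) (hB.sub1 (SubTy.wk (.setCol hA))) (hf.wk (.setCol hA)) h0
  have e : (B.subst (PTm.up fun i => .var (i + 1))).inst [.var 0] 0 = B := by
    rw [PCol.inst_one, PCol.subst_subst]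
    conv_rhs => rw [← PCol.subst_var B]
    congr 1; funext i; cases i <;> rfl
  rw [e] at this
  exact this

theorem _root_.EmTT.Der.app_var_pow {Γ : Ctx} (hA : Der T Γ (.ty .set A))
    (hf : Der T Γ (.tm f (.funPow1 A))) : Der T (A :: Γ) (.tm (.app (f.inst [] 1) (.var 0)) .pow1) := by
  have h0 : Der T (A :: Γ) (.tm (.var 0) _) := .var (.cons (.setCol hA)) .zero
  exact Der.funE (hA.wk (.setCol hA)) (hf.wk (.setCol hA)) h0

/-- An element of a product is the graph of its application. -/
theorem graph_pi (hA : w.Tr [] (.ty .set A)) (sA : A.Supp (names w.rank))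
    (hB : w.Tr [A] (.ty .set B)) (hf : w.Tr [] (.tm f (.pi A B))) (sf : f.Supp (names w.rank))
    (hF : w.IsVal f F) : IsGraph A (.app (f.inst [] 1) (.var 0)) F := by
  have hb : w.Tr [A] (.tm (.app (f.inst [] 1) (.var 0)) B) := by
    filter_upwards [hA, hB, hf] with Δ h1 h2 h3 using Der.app_var h1 h2 h3
  obtain ⟨g, hg, hg'⟩ := exists_graph hA sA hb (app_supp sf)
  suffices g = F from this ▸ hg'
  refine (hg.congr hf.toV ?_).unique hF
  filter_upwards [hA, hB, hf] with Δ h1 h2 h3 using .tmSymm (.toVEq (.piEta h1 h2 h3))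

theorem graph_funPow1 (hA : w.Tr [] (.ty .set A)) (sA : A.Supp (names w.rank))
    (hf : w.Tr [] (.tm f (.funPow1 A))) (sf : f.Supp (names w.rank))
    (hF : w.IsVal f F) : IsGraph A (.app (f.inst [] 1) (.var 0)) F := by
  have hb : w.Tr [A] (.tm (.app (f.inst [] 1) (.var 0)) .pow1) := by
    filter_upwards [hA, hf] with Δ h1 h2 using Der.app_var_pow h1 h2
  obtain ⟨g, hg, hg'⟩ := exists_graph hA sA hb (app_supp sf)
  suffices g = F from this ▸ hg'
  refine (hg.congr hf.toV ?_).unique hF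
  filter_upwards [hA, hf] with Δ h1 h2 using .tmSymm (.toVEq (.funEta h1 h2))

theorem rep_pi (hA : w.Tr [] (.ty .set A)) (sA : A.Supp (names w.rank))
    (hB : w.Tr [A] (.ty .set B)) (sB : B.Supp (upL (names w.rank))) (wα : α.Wf T) (wβ : β.Wf T)
    (hα : Rep e α A) (hβ : Rep₁ e β A B) :
    (etaPi α β).force w (F ▹ e) ↔ w.El (.pi A B) F := by
  constructor
  · intro h
    obtain ⟨h1, h2, h3⟩ := (force_etaPi wα wβ hα hβ).1 h
    obtain ⟨h4, h5⟩ := exists_lam hA sA (by filter_upwards [hB] with Δ h using .setCol h) sB h1 h2 h3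
    refine h5.el ?_
    filter_upwards [hA, hB, h4] with Δ k1 k2 k3 using .piI k1 k2 k3
  · intro h
    have hb : w.Tr [A] (.tm (.app (F.name.inst [] 1) (.var 0)) B) := by
      filter_upwards [hA, hB, h] with Δ h1 h2 h3 using Der.app_var h1 h2 h3
    exact etaPi_of_graph hb (app_supp F.name_supp)
      (graph_pi hA sA hB h F.name_supp (isVal_name F)) wα wβ hα hβ

theorem rep_funPow1 (hA : w.Tr [] (.ty .set A)) (sA : A.Supp (names w.rank)) (wα : α.Wf T)
    (wβ : β.Wf T) (hα : Rep e α A) (hβ : Rep₁ e β A .pow1) :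
    (etaPi α β).force w (F ▹ e) ↔ w.El (.funPow1 A) F := by
  constructor
  · intro h
    obtain ⟨h1, h2, h3⟩ := (force_etaPi wα wβ hα hβ).1 h
    obtain ⟨h4, h5⟩ := exists_lam hA sA (B := .pow1)
      (by filter_upwards [hA] with Δ h using .powF (.cons (.setCol h))) (fun _ _ _ => rfl) h1 h2 h3
    refine h5.el ?_
    filter_upwards [hA, h4] with Δ k1 k2 using .funI k1 k2
  · intro h
    have hb : w.Tr [A] (.tm (.app (F.name.inst [] 1) (.var 0)) .pow1) := by
      filter_upwards [hA, h] with Δ h1 h2 using Der.app_var_pow h1 h2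
    exact etaPi_of_graph hb (app_supp F.name_supp)
      (graph_funPow1 hA sA h F.name_supp (isVal_name F)) wα wβ hα hβ

/-- Application, for an element of a product or of `A → 𝒫(1)`. -/
theorem isVal_app (hb : w.Tr [A] (.tm (.app (f.inst [] 1) (.var 0)) B)) (sf : f.Supp (names w.rank))
    (hF : IsGraph A (.app (f.inst [] 1) (.var 0)) F) (ha : w.Tr [] (.tm a A)) (hx : w.IsVal a x) :
    w.IsVal (.app f a) v ↔ v = M.app F x := by
  have hxA := hx.el ha
  obtain ⟨y, hy⟩ := exists_isVal
    (by rw [PTm.inst_one]; exact (app_supp sf).inst1 x.name_supp) (tr_inst_V hb hxA)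
  rw [hF.app hxA hy, ← app_inst, isVal_inst hb hxA hx]
  exact ⟨fun h => h.unique hy, fun h => h ▸ hy⟩

/-! ### The power-collection of the singleton -/

/-- The sentence `θ`, with parameters `e`, describes the proposition `φ`. -/
def RepP (e : ℕ → M w) (θ : SFm) (φ : PProp) : Prop :=
  ∀ w' (h : w ≤ w'), θ.force w' (rese h e) ↔ w'.Tr [] (.holds φ)

def RepP₁ (e : ℕ → M w) (θ : SFm) (A : PCol) (φ : PProp) : Prop :=
  ∀ w' (h : w ≤ w') x, w'.El A x →
    (θ.force w' (x ▹ rese h e) ↔ w'.Tr [] (.holds (φ.inst [x.name] 0)))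

variable {θ : SFm}

theorem isVal_code (sφ : φ.Supp (names w.rank)) (hφ : w.Tr [] (.props φ)) : w.IsVal (.code φ) v ↔
    ∀ w' (hw : w ≤ w') z, z ∈ res hw v ↔ z = M.empty ∧ w'.Tr [] (.holds φ) := by
  have hV : w.Tr [] (.tm (.code φ) .V) := by filter_upwards [hφ] with Δ h using .toV (.powI h)
  obtain ⟨g, hg⟩ := exists_isVal (a := .code φ) (fun σ τ h => by simp only [PTm.subst, sφ σ τ h]) hV
  have key : ∀ w' (hw : w ≤ w') z, z ∈ res hw g ↔ z = M.empty ∧ w'.Tr [] (.holds φ) := by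
    intro w' hw z
    have kg := hg.mono hw
    have kφ := hφ.mono hw
    generalize res hw g = g at kg ⊢
    set ψ : PProp := .and (.eq .V (.var 0) .empty) (φ.inst [] 1)
    have hs : w'.Tr [] (.tm (.sing .empty) .V) := IsVal.empty.sing.1
    have hψ : w'.Tr [.V] (.props ψ) := by
      filter_upwards [kφ] with Δ h
      have hVc := Der.vF (T := T) h.wf
      exact .andF .small (.eqVF (.var (A := .V) (.cons hVc) .zero) (.emptyI (.cons hVc))) (h.wk hVc)
    have hψ' : w'.Tr [.V] (.prop ψ) := by filter_upwards [hψ] with Δ h using .propsProp h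
    have hsep : w'.IsVal (.sep (.sing .empty) ψ) g := by
      refine kg.congr (tr_sep hs hψ' fun _ => hψ) ?_
      filter_upwards [kφ] with Δ h using .toVEq (.codeEq h)
    rw [mem_sepTm hs IsVal.empty.sing hψ' (fun _ => hψ) hsep]
    have e1 : ψ.inst [z.name] 0 = .and (.eq .V z.name .empty) φ := by
      change PProp.and (.eq .V z.name .empty) ((φ.inst [] 1).inst [z.name] 0) = _
      rw [PProp.inst_wk_inst]
    have p1 : w'.Tr [] (.prop (.eq .V z.name .empty)) := by
      filter_upwards [z.tr_name] with Δ h using .propsProp (.eqVF h (.emptyI h.wf))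
    rw [e1, tr_and ?_ p1 ?_, tr_eq_iff z.tr_name IsVal.empty.1, (isVal_name z).eq_iff IsVal.empty]
    · simp
    · filter_upwards [p1, kφ] with Δ h1 h2 using .andF .large h1 (.propsProp h2)
    · filter_upwards [p1, kφ] with Δ h1 h2 using Der.wk_prop (.propsProp h2) (.propCol h1)
  constructor
  · intro h; rw [h.unique hg]; exact key
  · intro h
    have : v = g := M.ext fun w' hw z => by rw [h, key]
    rwa [this]

theorem isVal_code_delta (sφ : φ.Supp (names w.rank)) (hφ : w.Tr [] (.props φ)) (wθ : θ.Wf T)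
    (hθ : RepP e θ φ) : (SFm.all (SFm.iff (.mem (.var 0) (.var 1))
        (.and (.eq (.var 0) .empty) (θ.inst [] 2)))).force w (v ▹ e) ↔ w.IsVal (.code φ) v := by
  rw [isVal_code sφ hφ, SFm.force_all_iff]
  simp [wθ, hθ _ _]

theorem rep_pow1 : etaPow1.force w (v ▹ e) ↔ w.El .pow1 v := by
  rw [force_etaPow1]
  constructor
  · intro h
    have hp : w.Tr [] (.props (.mem .empty v.name)) := by
      filter_upwards [v.tr_name] with Δ h using .memF (.emptyI h.wf) h
    have hv : w.IsVal (.code (.mem .empty v.name)) v := by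
      refine (isVal_code (fun σ τ h => ?_) hp).2 fun w' hw z => ?_
      · simp only [PProp.subst, PTm.subst, v.name_supp σ τ h]
      · rw [← IsVal.empty.mem (isVal_res hw v)]
        constructor
        · intro hz
          have := h w' hw z hz
          exact ⟨this, this ▸ hz⟩
        · rintro ⟨rfl, hz⟩; exact hz
    refine hv.el ?_
    filter_upwards [hp] with Δ h using .powI h
  · intro h
    have hp : w.Tr [] (.props (.eq .pow1 v.name (.code .top))) := by
      filter_upwards [h] with Δ h
      exact .powEqF h (.powI (.impF .small (.botF h.wf) (.botF h.wf)))
    have hv : w.IsVal (.code (.eq .pow1 v.name (.code .top))) v := by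
      refine (isVal_name v).congr ?_ ?_
      · filter_upwards [hp] with Δ h using .toV (.powI h)
      · filter_upwards [h] with Δ h using .toVEq (.powEta h)
    intro w' hw z hz
    refine (((isVal_code (fun σ τ h => ?_) hp).1 hv w' hw z).1 hz).1
    simp only [PProp.subst, PTm.subst, v.name_supp σ τ h]
    rfl

/-! ### Names, separation, power sets -/

theorem isVal_name_delta (hA : w.Tr [] (.ty .set A)) (sA : A.Supp (names w.rank)) (wα : α.Wf T)
    (hα : Rep e α A) : (SFm.all (SFm.iff (.mem (.var 0) (.var 1))
      (α.inst [.var 0] 2))).force w (v ▹ e) ↔ w.IsVal (.name A) v := by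
  obtain ⟨g, hg, hg'⟩ := exists_set hA sA
  rw [SFm.force_all_iff]
  simp [wα, hα _ _ _]
  constructor
  · intro h
    have : v = g := M.ext fun w' hw z => by rw [h, hg']
    rwa [this]
  · intro h w' hw z
    rw [h.unique hg, hg']

theorem isVal_sep (sa : a.Supp (names w.rank)) (sφ : φ.Supp (upL (names w.rank)))
    (hφ : w.Tr [.V] (.prop φ)) (hφ' : T = .CZF → w.Tr [.V] (.props φ))
    (hx : w.IsVal a x) : w.IsVal (.sep a φ) v ↔ ∀ w' (hw : w ≤ w') z, z ∈ res hw v ↔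
      z ∈ res hw x ∧ w'.Tr [] (.holds (φ.inst [z.name] 0)) := by
  obtain ⟨g, hg⟩ := exists_isVal (a := .sep a φ)
    (fun σ τ h => by simp only [PTm.subst, sa σ τ h, sφ _ _ (up_agree h)]) (tr_sep hx.1 hφ hφ')
  have key : ∀ w' (hw : w ≤ w') z, z ∈ res hw g ↔
      z ∈ res hw x ∧ w'.Tr [] (.holds (φ.inst [z.name] 0)) := fun w' hw z =>
    mem_sepTm (hx.1.mono hw) (hx.mono hw) (hφ.mono hw) (fun h => (hφ' h).mono hw) (hg.mono hw)
  constructor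
  · intro h; rw [h.unique hg]; exact key
  · intro h
    have : v = g := M.ext fun w' hw z => by rw [h, key]
    rwa [this]

theorem isVal_sep_delta (sa : a.Supp (names w.rank)) (sφ : φ.Supp (upL (names w.rank)))
    (hφ : w.Tr [.V] (.prop φ)) (hφ' : T = .CZF → w.Tr [.V] (.props φ))
    (ha : w.Tr [] (.tm a .V)) (wδ : δ.Wf T) (wθ : θ.Wf T) (hδ : RepT e δ a) (hθ : RepP₁ e θ .V φ) :
    (SFm.ex (.and (δ.inst [.var 0] 2) (.all (SFm.iff (.mem (.var 0) (.var 2))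
      (.and (.mem (.var 0) (.var 1)) (θ.inst [.var 0] 3)))))).force w (v ▹ e) ↔
        w.IsVal (.sep a φ) v := by
  obtain ⟨x, hx⟩ := exists_isVal sa ha
  simp (maxDischargeDepth := 9) [wδ, wθ, hδ.self, hθ _ _ _ el_V]
  rw [isVal_sep sa sφ hφ hφ' hx]
  constructor
  · rintro ⟨y, hy, h⟩
    rwa [hy.unique hx] at h
  · intro h; exact ⟨x, hx, h⟩

theorem isVal_power (hT : T ≠ .CZF) (hx : w.IsVal a x) :
    w.IsVal (.power a) v ↔ ∀ w' (hw : w ≤ w') z, z ∈ res hw v ↔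
      ∀ w'' (hw' : w' ≤ w'') u, u ∈ res hw' z → u ∈ res (hw.trans hw') x := by
  have wp : (STm.power (.var 0)).Wf T := ⟨1, .powerI hT (der_var (by omega))⟩
  have wp1 : (STm.power (.var 1)).Wf T := ⟨2, .powerI hT (der_var (by omega))⟩
  have hg : w.IsVal (.power a) (ev (fun _ => x) (.power (.var 0))) :=
    IsVal.op (t := .power (.var 0)) wp hx
  have key : ∀ w' (hw : w ≤ w') z, z ∈ res hw (ev (fun _ => x) (.power (.var 0))) ↔
      ∀ w'' (hw' : w' ≤ w'') u, u ∈ res hw' z → u ∈ res (hw.trans hw') x := by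
    intro w' hw z
    have := force_of_der (ξ := .iff (.mem (.var 0) (.power (.var 1)))
      (.all (.imp (.mem (.var 0) (.var 1)) (.mem (.var 0) (.var 2))))) (n := 2)
      (Der.powerMem hT (der_var (by omega)) (der_var (by omega)))
      (by simp (maxDischargeDepth := 9) [wp1]) (w := w') (z ▹ fun _ => res hw x)
    have := SFm.force_iff'.1 this w' le_rfl
    have e1 : ev (z ▹ fun _ => res hw x) (.power (.var 1)) =
        ev (fun _ => res hw x) (.power (.var 0)) := rfl
    rw [wp.res_ev]
    simpa [wp1, e1, res_res] using this
  constructor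
  · intro h; rw [h.unique hg]; exact key
  · intro h
    have : v = ev (fun _ => x) (.power (.var 0)) := M.ext fun w' hw z => by rw [h, key]
    rwa [this]

theorem isVal_power_delta (hT : T ≠ .CZF) (sa : a.Supp (names w.rank)) (ha : w.Tr [] (.tm a .V))
    (wδ : δ.Wf T) (hδ : RepT e δ a) :
    (SFm.ex (.and (δ.inst [.var 0] 2)
        (.all (SFm.iff (.mem (.var 0) (.var 2)) (STm.sub (.var 0) (.var 1)))))).force w (v ▹ e) ↔
      w.IsVal (.power a) v := by
  obtain ⟨x, hx⟩ := exists_isVal sa ha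
  simp (maxDischargeDepth := 9) [wδ, hδ.self, STm.sub]
  rw [isVal_power hT hx]
  constructor
  · rintro ⟨y, hy, h⟩
    rw [hy.unique hx] at h
    simpa [res_res] using h
  · intro h; exact ⟨x, hx, by simpa [res_res] using h⟩

end World

end EmTT

namespace EmTT

variable {T : SetTheory}

theorem Der.cons_vars {Γ : Ctx} {A B : PCol} (hA : Der T Γ (.ty .set A))
    (h : Der T (B :: A.inst [] 1 :: .list A :: Γ) .wf) :
    Der T (B :: A.inst [] 1 :: .list A :: Γ) (.tm (.cons (.var 2) (.var 1)) .V) := by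
  have hB := h.head
  have hA1 := hB.wf.head
  have hL := hA1.wf.head
  have k := ((hA.wk hL).wk hA1).wk hB
  refine .toV (.listI2 k ?_ ?_)
  · exact .var h (.succ (.succ .zero))
  · exact .var h (.succ .zero)

theorem Der.nil_eq {Γ : Ctx} {A : PCol} (hA : Der T Γ (.ty .set A)) :
    Der T Γ (.tmEq .nil .empty .V) := .toVEq (.nilEq hA)

theorem PCol.inst_nil_one_subst (A : PCol) (σ : ℕ → PTm) :
    (A.inst [] 1).subst (PTm.up σ) = (A.subst σ).inst [] 1 :=
  PCol.inst_subst A [] (m := 1) (n := 1) le_rfl σ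

/-- The context and the type of the step of a list recursion, under a substitution. -/
theorem list_step_subst (C : PCol) (σ : ℕ → PTm) :
    (C.inst [.var 1] 2).subst (PTm.up (PTm.up σ)) = (C.subst (PTm.up σ)).inst [.var 1] 2 ∧
    (C.inst [.cons (.var 2) (.var 1)] 3).subst (PTm.up (PTm.up (PTm.up σ))) =
      (C.subst (PTm.up σ)).inst [.cons (.var 2) (.var 1)] 3 :=
  ⟨PCol.inst_subst C [.var 1] (m := 2) (n := 2) le_rfl σ,
    PCol.inst_subst C [.cons (.var 2) (.var 1)] (m := 3) (n := 3) le_rfl σ⟩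

open World

namespace World

variable {w w' w'' : World T}
  {e : ℕ → M w} {α β δ δ' ξ ρ : SFm} {A B C : PCol} {a b c d t : PTm} {l x y z v u n F G : M w}
  {φ ψ : PProp} {k : Kind}

/-! ### Lists -/

theorem isVal_nil (hA : w.Tr [] (.ty .set A)) : w.IsVal .nil M.empty := by
  refine IsVal.empty.congr ?_ ?_
  · filter_upwards [hA] with Δ h using .toV (.listI1 h)
  · filter_upwards [hA] with Δ h using .tmSymm h.nil_eq

theorem list_ind (hA : w.Tr [] (.ty .set A)) (sA : A.Supp (names w.rank)) (h : ξ.Wf T)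
    (H0 : ξ.force w (M.empty ▹ e))
    (HS : ∀ w' (hw : w ≤ w') a b l x v, w'.Tr [] (.tm a (.list A)) → w'.Tr [] (.tm b A) →
      w'.IsVal a l → w'.IsVal b x → w'.IsVal (.cons a b) v → ξ.force w' (l ▹ rese hw e) →
        ξ.force w' (v ▹ rese hw e)) (hz : w.El (.list A) z) : ξ.force w (z ▹ e) := by
  have hL : w.Tr [] (.ty .col (.list A)) := by
    filter_upwards [hA] with Δ h using .setCol (.listF h)
  have hmt := mot_ty (e := e) h hL
  have sL : (PCol.list A).Supp (names w.rank) := fun σ τ hst => by simp only [PCol.subst, sA σ τ hst]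
  have hv1 : (PTm.var 1).Supp (upL^[2] (names w.rank)) :=
    PTm.supp_var (succ_mem_upL zero_mem_upL)
  have wf3 : w.Tr [.ofProp ((mot ξ e).inst [.var 1] 2), A.inst [] 1, .list A] .wf := by
    filter_upwards [hA, hL, hmt] with Δ h1 h2 h3
    have k1 : Der T (A.inst [] 1 :: .list A :: Δ) .wf := .cons (.setCol (h1.wk h2))
    have s := ((SubTy.wk h2).comp (SubTy.wk k1.head)).cons (A := .list A) (a := .var 1) (by
      have : Der T (A.inst [] 1 :: .list A :: Δ) (.tm (.var 1) _) := .var k1 (.succ .zero)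
      rw [show ((PCol.list A).inst [] 1).inst [] 1 = _ from PCol.subst_subst _ _ _] at this
      exact this)
    have := h3.sub s
    refine .cons ?_
    rw [PProp.inst, PTm.sb_cons]
    exact this
  have hm : w.Tr [.ofProp ((mot ξ e).inst [.var 1] 2), A.inst [] 1, .list A]
      (.holds ((mot ξ e).inst [.cons (.var 2) (.var 1)] 3)) := by
    refine tr_mot_gen (Θ := [.ofProp ((mot ξ e).inst [.var 1] 2), A.inst [] 1, .list A]) h
      ⟨⟨⟨trivial, sL⟩, ?_⟩, ?_⟩ ?_ ?_ ?_
    · rw [PCol.wk_eq]; exact sA.wk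
    · have := mot_supp (w := w) (ξ := ξ) (e := e) hv1
      intro σ τ hst
      rw [PCol.subst, PCol.subst, this σ τ hst]
    · intro σ τ hst
      simp only [PTm.subst]
      rw [hst 2 (succ_mem_upL (succ_mem_upL zero_mem_upL)), hst 1 (succ_mem_upL zero_mem_upL)]
    · filter_upwards [hA, wf3] with Δ h1 h2 using h1.cons_vars h2
    · rintro w' hw σ v ⟨τ, p, hτ', -, hp, rfl⟩ hv
      obtain ⟨τ', b, hτ, sb, hb, rfl⟩ := id hτ'
      obtain ⟨a, sa, ha, rfl⟩ := inst_one_iff.1 hτ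
      have hb' : w'.Tr [] (.tm b A) := by
        rw [PCol.wk_eq, PCol.ren_subst] at hb
        exact (PCol.subst_var A ▸ hb :)
      obtain ⟨l, hl⟩ := exists_isVal sa ha.toV
      obtain ⟨x, hx⟩ := exists_isVal sb hb.toV
      refine HS w' hw a b l x v ha hb' hl hx hv ?_
      rw [PCol.subst] at hp
      have e1 := mot_inst_subst (ξ := ξ) (e := e) (t := .var 1) hτ'
      have hpr : w'.Tr [] (.prop (ξ.tilde.subst (scons a (nms e)))) := by
        have := mot_inst_zero ξ e a
        rw [← this]
        filter_upwards [(mot_prop (e := e) h hL).mono hw, ha] with Δ h1 h2 using h1.inst_one_ty h2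
      refine (h.force_iff_of (σ := scons a (nms e)) (hl.cons fun i => isVal_res hw (e i))).2 ?_
      filter_upwards [hpr, hp] with Δ h1 h2
      refine .propTrue h1 (a := p) ?_
      exact e1 ▸ h2
  rw [← tr_mot h (isVal_name z)]
  filter_upwards [hA, hmt, mot_prop (e := e) h hL, hz, hm,
    (tr_mot (e := e) h (isVal_nil hA)).2 H0] with Δ h1 h2 h3 h4 h5 h6
  exact .propTrue (h3.inst_one_ty h4) (.listE h1 h2 h4 h6 h5)

/-- `F` is a function from `n` to `A`. -/
def IsSeq (A : PCol) (n F : M w) : Prop :=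
  (∀ w' (hw : w ≤ w') p, p ∈ res hw F → ∃ x ∈ res hw n, ∃ y, w'.El A y ∧ p = M.pair x y) ∧
  (∀ w' (hw : w ≤ w') x y z, M.pair x y ∈ res hw F → M.pair x z ∈ res hw F → y = z) ∧
  (∀ w' (hw : w ≤ w') x, x ∈ res hw n → ∃ y, M.pair x y ∈ res hw F)

/-- The formula saying that `u` is a function from `n` to the class `α`, for the variables
`n, u`. -/
def seqFm (α : SFm) : SFm :=
  .and (.all (.imp (.mem (.var 0) (.var 2))
      (.ex (.ex (.and (.mem (.var 1) (.var 3))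
        (.and (α.inst [.var 0] 5) (.eq (.var 2) (.pair (.var 1) (.var 0)))))))))
  (.and (svl (.var 1))
    (.all (.imp (.mem (.var 0) (.var 1)) (.ex (.mem (.pair (.var 1) (.var 0)) (.var 3))))))

theorem seqFm_wf (wα : α.Wf T) : (seqFm α).Wf T := by
  simp (maxDischargeDepth := 9) [seqFm, wα, svl_wf]

theorem force_seqFm (wα : α.Wf T) (hα : Rep e α A) :
    (seqFm α).force w (n ▹ F ▹ e) ↔ IsSeq A n F := by
  rw [seqFm, SFm.force_and, SFm.force_and, force_svl (by simp)]
  simp (maxDischargeDepth := 9) [wα, hα _ _ _]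
  rfl

theorem force_etaList (wα : α.Wf T) (hα : Rep e α A) :
    (etaList α).force w (F ▹ e) ↔ ∃ n ∈ (M.omega : M w), IsSeq A n F := by
  have : etaList α = .ex (.and (.mem (.var 0) .omega) (seqFm α)) := rfl
  rw [this]
  simp [force_seqFm wα hα]

theorem IsSeq.len (h : IsSeq A n F) (hn : n ∈ (M.omega : M w)) : M.len F = n := by
  refine M.ext fun w' hw z => ?_
  rw [M.res_len, M.mem_len]
  constructor
  · rintro ⟨-, y, hy⟩
    obtain ⟨x, hx, v, -, h1⟩ := h.1 w' hw _ hy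
    rwa [(M.pair_inj.1 h1).1]
  · intro hz
    have hn' := mem_mono hn hw
    rw [M.res_omega] at hn'
    exact ⟨M.omega_trans hn' hz, h.2.2 w' hw z hz⟩

theorem isSeq_empty : IsSeq A (M.empty : M w) M.empty := by
  refine ⟨fun w' hw p hp => ?_, fun w' hw x y z h => ?_, fun w' hw x hx => ?_⟩
  · simp [M.not_mem_empty] at hp
  · simp [M.not_mem_empty] at h
  · simp [M.not_mem_empty] at hx

theorem IsSeq.snoc (h : IsSeq A n F) (hn : n ∈ (M.omega : M w)) (hx : w.El A x) :
    IsSeq A (M.succ n) (M.snoc F x) := by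
  have hl := h.len hn
  refine ⟨fun w' hw p hp => ?_, fun w' hw u y z h1 h2 => ?_, fun w' hw u hu => ?_⟩
  · rw [M.res_snoc, M.mem_snoc, ← M.res_len, hl] at hp
    rw [M.res_succ]
    rcases hp with hp | rfl
    · obtain ⟨u, hu, y, hy, rfl⟩ := h.1 w' hw p hp
      exact ⟨u, by simp [hu], y, hy, rfl⟩
    · exact ⟨_, by simp, _, hx.mono hw, rfl⟩
  · rw [M.res_snoc, M.mem_snoc, ← M.res_len, hl] at h1 h2
    have key : ∀ y, M.pair (res hw n) y ∉ res hw F := fun y hy => by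
      obtain ⟨u, hu, v, -, h3⟩ := h.1 w' hw _ hy
      rw [← (M.pair_inj.1 h3).1] at hu
      exact M.not_mem_self _ hu
    rcases h1 with h1 | h1 <;> rcases h2 with h2 | h2
    · exact h.2.1 w' hw _ _ _ h1 h2
    · rw [(M.pair_inj.1 h2).1] at h1; exact absurd h1 (key _)
    · rw [(M.pair_inj.1 h1).1] at h2; exact absurd h2 (key _)
    · rw [(M.pair_inj.1 h1).2, (M.pair_inj.1 h2).2]
  · rw [M.res_succ, M.mem_succ] at hu
    simp only [M.res_snoc, M.mem_snoc, ← M.res_len, hl]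
    rcases hu with hu | rfl
    · obtain ⟨y, hy⟩ := h.2.2 w' hw u hu
      exact ⟨y, .inl hy⟩
    · exact ⟨_, .inr rfl⟩

/-- The restriction of a sequence. -/
theorem IsSeq.exists_init (h : IsSeq A (M.succ n) F) (hn : n ∈ (M.omega : M w)) :
    ∃ G x, IsSeq A n G ∧ w.El A x ∧ F = M.snoc G x := by
  have hφ : (SFm.mem (.fst (.var 0)) (.var 2)).Adm T := SFm.adm_mem (by simp) (by simp)
  have hs : (STm.sep (.var 0) (.mem (.fst (.var 0)) (.var 2))).Wf T := .sep (by simp) hφ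
  have hG : ∀ w' (hw : w ≤ w') p, p ∈ res hw (ev (F ▹ fun _ => n)
      (.sep (.var 0) (.mem (.fst (.var 0)) (.var 2)))) ↔ p ∈ res hw F ∧ M.fst p ∈ res hw n := by
    intro w' hw p
    rw [hs.res_ev, M.mem_sep (by simp) (by simp) hφ]
    simp
  generalize ev (F ▹ fun _ => n) (.sep (.var 0) (.mem (.fst (.var 0)) (.var 2))) = G at hG
  obtain ⟨x, hx⟩ := h.2.2 w le_rfl n (by simp)
  rw [res_refl] at hx
  have hxA : w.El A x := by
    obtain ⟨u, hu, v, hv, h1⟩ := h.1 w le_rfl _ (by rwa [res_refl])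
    rwa [(M.pair_inj.1 h1).2]
  have hseq : IsSeq A n G := by
    refine ⟨fun w' hw p hp => ?_, fun w' hw u y z h1 h2 => ?_, fun w' hw u hu => ?_⟩
    · obtain ⟨h1, h2⟩ := (hG w' hw p).1 hp
      obtain ⟨u, hu, v, hv, rfl⟩ := h.1 w' hw p h1
      rw [M.fst_pair] at h2
      exact ⟨u, h2, v, hv, rfl⟩
    · exact h.2.1 w' hw _ _ _ ((hG _ _ _).1 h1).1 ((hG _ _ _).1 h2).1
    · obtain ⟨y, hy⟩ := h.2.2 w' hw u (by simp [hu])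
      exact ⟨y, (hG _ _ _).2 ⟨hy, by rwa [M.fst_pair]⟩⟩
  refine ⟨G, x, hseq, hxA, M.ext fun w' hw p => ?_⟩
  have hl : M.len (res hw G) = res hw n := by rw [← M.res_len, hseq.len hn]
  rw [M.res_snoc, M.mem_snoc, hG, hl]
  have hx' := mem_mono hx hw
  rw [M.res_pair] at hx'
  constructor
  · intro hp
    obtain ⟨u, hu, v, hv, rfl⟩ := h.1 w' hw p hp
    rw [M.res_succ, M.mem_succ] at hu
    rcases hu with hu | rfl
    · exact .inl ⟨hp, by rwa [M.fst_pair]⟩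
    · right; rw [h.2.1 w' hw _ _ _ hp hx']
  · rintro (hp | rfl)
    · exact hp.1
    · exact hx'

theorem _root_.EmTT.Der.len_step {Γ : Ctx} {A : PCol} (hA : Der T Γ (.ty .set A)) :
    Der T (.V :: A.inst [] 1 :: .list A :: Γ) (.tm (.succ (.var 0)) .V) := by
  have hL : Der T Γ (.ty .col (.list A)) := .setCol (.listF hA)
  have k : Der T (.list A :: Γ) (.ty .col (A.inst [] 1)) := .setCol (hA.wk hL)
  have v : Der T (.V :: A.inst [] 1 :: .list A :: Γ) (.tm (.var 0) .V) :=
    .var (A := .V) (.cons (.vF (.cons k))) .zero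
  exact .unionI (.upairI v (.upairI v v))

theorem _root_.EmTT.Der.len_V {Γ : Ctx} {A : PCol} (hA : Der T Γ (.ty .set A))
    (ha : Der T Γ (.tm a (.list A))) : Der T Γ (.tm (.len A a) .V) :=
  .listE (M := .V) hA (.vF (.cons (.setCol (.listF hA)))) ha (.emptyI ha.wf) hA.len_step

theorem _root_.EmTT.Der.len_nil {Γ : Ctx} {A : PCol} (hA : Der T Γ (.ty .set A)) :
    Der T Γ (.tmEq (.len A .nil) .empty .V) :=
  .listC1 (M := .V) hA (.vF (.cons (.setCol (.listF hA)))) (.emptyI hA.wf) hA.len_step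

theorem _root_.EmTT.Der.len_cons {Γ : Ctx} {A : PCol} (hA : Der T Γ (.ty .set A))
    (ha : Der T Γ (.tm a (.list A))) (hb : Der T Γ (.tm b A)) :
    Der T Γ (.tmEq (.len A (.cons a b)) (.succ (.len A a)) .V) :=
  .listC2 (M := .V) hA (.vF (.cons (.setCol (.listF hA)))) ha hb (.emptyI hA.wf) hA.len_step

/-- `ℓ(x)`, for the last variable `x`. -/
theorem lenTm_inst (A : PCol) (a : PTm) :
    (PTm.len (A.inst [] 1) (.var 0)).inst [a] 0 = .len A a := by
  change PTm.elList ((A.inst [] 1).inst [a] 0) a .empty (.succ (.var 0)) = _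
  rw [PCol.inst_wk_inst]; rfl

theorem _root_.EmTT.Der.len_var {Γ : Ctx} {A : PCol} (hA : Der T Γ (.ty .set A)) :
    Der T (.list A :: Γ) (.tm (.len (A.inst [] 1) (.var 0)) .V) := by
  have hL : Der T Γ (.ty .col (.list A)) := .setCol (.listF hA)
  exact Der.len_V (hA.wk hL) (.var (.cons hL) .zero)

theorem isVal_cons_of_len (hA : w.Tr [] (.ty .set A)) (ha : w.Tr [] (.tm a (.list A)))
    (hb : w.Tr [] (.tm b A)) (hl : w.IsVal a l) (hx : w.IsVal b x)
    (hn : w.IsVal (.len A a) (M.len l)) : w.IsVal (.cons a b) (M.snoc l x) := by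
  refine (IsVal.union (hl.upair (hn.kpair hx).sing)).congr ?_ ?_
  · filter_upwards [hA, ha, hb] with Δ h1 h2 h3 using .toV (.listI2 h1 h2 h3)
  · filter_upwards [hA, ha, hb] with Δ h1 h2 h3 using .tmSymm (.toVEq (.consEq h1 h2 h3))

theorem list_spec (hA : w.Tr [] (.ty .set A)) (sA : A.Supp (names w.rank)) (wα : α.Wf T)
    (hα : Rep e α A) (hz : w.El (.list A) z) :
    w.IsVal (.len A z.name) (M.len z) ∧ M.len z ∈ (M.omega : M w) ∧ IsSeq A (M.len z) z := by
  have hL : w.Tr [] (.ty .set (.list A)) := by filter_upwards [hA] with Δ h using .listF h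
  have sL : (PCol.list A).Supp (names w.rank) := fun σ τ hst => by simp only [PCol.subst, sA σ τ hst]
  have ht : w.Tr [.list A] (.tm (.len (A.inst [] 1) (.var 0)) .V) := by
    filter_upwards [hA] with Δ h using h.len_var
  have st : (PTm.len (A.inst [] 1) (.var 0)).Supp (upL (names w.rank)) := fun σ τ h => by
    have := sA.wk σ τ h
    rw [← PCol.wk_eq] at this
    simp only [PTm.len, PTm.subst, this, h 0 zero_mem_upL]
    rfl
  obtain ⟨g, -, hg⟩ := exists_graph hL sL ht st
  replace hg : IsGraph (.list A) (.len (A.inst [] 1) (.var 0)) g := hg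
  have wf1 := seqFm_wf wα
  have key := list_ind (ξ := .and (.mem (.len (.var 0)) .omega)
    (.and (.mem (.pair (.var 0) (.len (.var 0))) (.var 1))
      ((seqFm α).inst [.len (.var 0), .var 0] 2))) (e := g ▹ e) hA sA
    (by simp (maxDischargeDepth := 9) [wf1]) ?_ ?_ hz
  · simp (maxDischargeDepth := 9) [wf1, force_seqFm wα hα, hg.pair_mem, lenTm_inst] at key
    exact ⟨key.2.1.2, key.1, key.2.2⟩
  · have k1 := isVal_nil hA
    have k2 : w.El (.list A) M.empty := k1.el (by filter_upwards [hA] with Δ h using .listI1 h)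
    simp (maxDischargeDepth := 9) [wf1, force_seqFm wα hα, hg.pair_mem, lenTm_inst, isSeq_empty, k2]
    rw [← lenTm_inst, ← isVal_inst ht k2 k1, lenTm_inst]
    refine IsVal.empty.congr ?_ ?_
    · filter_upwards [hA] with Δ h using h.len_V (.listI1 h)
    · filter_upwards [hA] with Δ h using .tmSymm h.len_nil
  · intro w' hw a b l x v ha hb hl hx hv
    have hα' := hα.mono hw
    have hA' := hA.mono hw
    have hg' := hg.mono hw
    simp (maxDischargeDepth := 9) [wf1, force_seqFm wα hα', hg'.pair_mem, lenTm_inst]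
    intro h1 h2 h3 h4
    have h5 : w'.IsVal (.len A a) (M.len l) := by
      rw [← lenTm_inst, isVal_inst (ht.mono hw) h2 hl, lenTm_inst]; exact h3
    obtain rfl := hv.unique (isVal_cons_of_len hA' ha hb hl hx h5)
    have h6 : w'.El (.list A) (M.snoc l x) := hv.el (by
      filter_upwards [hA', ha, hb] with Δ h1 h2 h3 using .listI2 h1 h2 h3)
    rw [M.len_snoc h1]
    refine ⟨M.succ_mem_omega h1, ⟨h6, ?_⟩, h4.snoc h1 (hx.el hb)⟩
    rw [← lenTm_inst, ← isVal_inst (ht.mono hw) h6 hv, lenTm_inst]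
    refine h5.succ.congr ?_ ?_
    · filter_upwards [hA', ha, hb] with Δ h1 h2 h3 using h1.len_V (.listI2 h1 h2 h3)
    · filter_upwards [hA', ha, hb] with Δ h1 h2 h3 using .tmSymm (h1.len_cons h2 h3)

theorem isVal_cons (hA : w.Tr [] (.ty .set A)) (sA : A.Supp (names w.rank)) (wα : α.Wf T)
    (hα : Rep e α A) (ha : w.Tr [] (.tm a (.list A)))
    (hb : w.Tr [] (.tm b A)) (hl : w.IsVal a l) (hx : w.IsVal b x) :
    w.IsVal (.cons a b) (M.snoc l x) := by
  refine isVal_cons_of_len hA ha hb hl hx ?_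
  have ht : w.Tr [.list A] (.tm (.len (A.inst [] 1) (.var 0)) .V) := by
    filter_upwards [hA] with Δ h using h.len_var
  have h2 := hl.el ha
  rw [← lenTm_inst, isVal_inst ht h2 hl, lenTm_inst]
  exact (list_spec hA sA wα hα h2).1

theorem el_snoc (hA : w.Tr [] (.ty .set A)) (sA : A.Supp (names w.rank)) (wα : α.Wf T)
    (hα : Rep e α A) (hl : w.El (.list A) l) (hx : w.El A x) : w.El (.list A) (M.snoc l x) := by
  refine (isVal_cons hA sA wα hα hl hx (isVal_name l) (isVal_name x)).el ?_
  filter_upwards [hA, hl, hx] with Δ h1 h2 h3 using .listI2 h1 h2 h3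

theorem rep_list (hA : w.Tr [] (.ty .set A)) (sA : A.Supp (names w.rank)) (wα : α.Wf T)
    (hα : Rep e α A) : (etaList α).force w (F ▹ e) ↔ w.El (.list A) F := by
  have hL : w.Tr [] (.ty .set (.list A)) := by filter_upwards [hA] with Δ h using .listF h
  have sL : (PCol.list A).Supp (names w.rank) := fun σ τ hst => by simp only [PCol.subst, sA σ τ hst]
  rw [force_etaList wα hα]
  constructor
  swap
  · intro h
    have := list_spec hA sA wα hα h
    exact ⟨_, this.2⟩
  rintro ⟨n, hn, hF⟩
  obtain ⟨s, -, hs⟩ := exists_set hL sL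
  have wf1 := seqFm_wf wα
  have := M.omega_ind (φ := .all (.imp ((seqFm α).inst [.var 1, .var 0] 3) (.mem (.var 0) (.var 2))))
    (by simp [wf1]) (s ▹ e) ?_ ?_ hn
  · simp [wf1, force_seqFm wα (hα.mono _), hs] at this
    simpa using this w le_rfl F (by simpa using hF)
  · simp [wf1, force_seqFm wα (hα.mono _), hs]
    intro w' hw u hu
    have : u = M.empty := M.ext fun w'' hw' p => by
      simp only [M.res_empty, M.not_mem_empty, iff_false]
      intro hp
      obtain ⟨x, hx, -⟩ := hu.1 w'' hw' p hp
      simp [M.not_mem_empty] at hx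
    rw [this]
    exact (isVal_nil (hA.mono hw)).el (by filter_upwards [hA.mono hw] with Δ h using .listI1 h)
  · intro w' hw n hn ih
    simp [wf1, force_seqFm wα (hα.mono _), res_res, hs] at ih ⊢
    intro w'' hw' u hu
    have hn' := mem_mono hn hw'
    rw [M.res_omega] at hn'
    obtain ⟨G, x, h1, h2, rfl⟩ := hu.exists_init hn'
    have := ih w'' hw' G h1
    exact el_snoc (hA.mono (hw.trans hw')) (sA.mono (names_mono (hw.trans hw').1)) wα (hα.mono (hw.trans hw')) this h2

/-- `El_List(x, b, c)`, for the last variable `x`. -/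
def elListTm (A : PCol) (b c : PTm) : PTm :=
  .elList (A.inst [] 1) (.var 0) (b.inst [] 1) (c.subst (PTm.up (PTm.up (PTm.up (PTm.sb [] 1)))))

theorem elListTm_inst : (elListTm A b c).inst [a] 0 = .elList A a b c := by
  change PTm.elList ((A.inst [] 1).inst [a] 0) a ((b.inst [] 1).inst [a] 0)
    ((c.subst _).subst (PTm.up (PTm.up (PTm.up (PTm.sb [a] 0))))) = _
  rw [PCol.inst_wk_inst, PTm.inst_wk_inst, PTm.subst_subst]
  congr 1
  conv_rhs => rw [← PTm.subst_var c]
  congr 1; funext i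
  rcases i with _ | _ | _ | i <;> rfl

theorem _root_.EmTT.Der.elListTm {Γ : Ctx} {A C : PCol} {b c : PTm} (hA : Der T Γ (.ty .set A))
    (hC : Der T (.list A :: Γ) (.ty .col C)) (hb : Der T Γ (.tm b (C.inst [.nil] 0)))
    (hc : Der T (C.inst [.var 1] 2 :: A.inst [] 1 :: .list A :: Γ)
      (.tm c (C.inst [.cons (.var 2) (.var 1)] 3))) :
    Der T (.list A :: Γ) (.tm (elListTm A b c) C) := by
  have hL : Der T Γ (.ty .col (.list A)) := .setCol (.listF hA)
  have s := SubTy.wk (T := T) hL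
  have h1 := Der.sub3 hc s
  have h2 := hb.sub s
  rw [Jdg.subst, (list_step_subst C _).1, (list_step_subst C _).2, PCol.inst_nil_one_subst] at h1
  have e1 : (C.inst [.nil] 0).subst (fun i => .var (i + 1)) =
      (C.subst (PTm.up fun i => .var (i + 1))).inst [.nil] 0 :=
    PCol.inst_subst C [.nil] (m := 0) (n := 0) le_rfl _
  have e2 : (C.subst (PTm.up fun i => .var (i + 1))).inst [.var 0] 0 = C := by
    rw [PCol.inst_one, PCol.subst_subst]
    conv_rhs => rw [← PCol.subst_var C]
    congr 1; funext i; cases i <;> rfl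
  rw [Jdg.subst, e1] at h2
  have := Der.listE (a := .var 0) (hA.sub s) (hC.sub1 s) (.var (.cons hL) .zero) h2 h1
  rw [e2] at this
  exact this

/-- Recursion on lists, as a graph. -/
def RepT₃ (e : ℕ → M w) (δ : SFm) (A C : PCol) (c : PTm) : Prop :=
  ∀ w' (h : w ≤ w') l x r z, w'.El (.list A) l → w'.El A x → w'.El (C.inst [l.name] 0) r →
    (δ.force w' (z ▹ r ▹ x ▹ l ▹ rese h e) ↔ w'.IsVal (c.inst [r.name, x.name, l.name] 0) z)

structure ListRec (w : World T) (A C : PCol) (b c : PTm) : Prop where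
  hA : w.Tr [] (.ty .set A)
  sA : A.Supp (names w.rank)
  hC : w.Tr [.list A] (.ty .col C)
  hb : w.Tr [] (.tm b (C.inst [.nil] 0))
  sb : b.Supp (names w.rank)
  hc : w.Tr [C.inst [.var 1] 2, A.inst [] 1, .list A] (.tm c (C.inst [.cons (.var 2) (.var 1)] 3))
  sc : c.Supp (upL (upL (upL (names w.rank))))

namespace ListRec

theorem mono (h : ListRec w A C b c) (hw : w ≤ w') : ListRec w' A C b c where
  hA := h.hA.mono hw
  sA := h.sA.mono (names_mono hw.1)
  hC := h.hC.mono hw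
  hb := h.hb.mono hw
  sb := h.sb.mono (names_mono hw.1)
  hc := h.hc.mono hw
  sc := h.sc.mono (upL_iterate_mono (names_mono hw.1) 3)

theorem tr (h : ListRec w A C b c) : w.Tr [.list A] (.tm (elListTm A b c) C) := by
  filter_upwards [h.hA, h.hC, h.hb, h.hc] with Δ h1 h2 h3 h4 using Der.elListTm h1 h2 h3 h4

theorem supp (h : ListRec w A C b c) : (elListTm A b c).Supp (upL (names w.rank)) := fun σ τ hst => by
  have h1 := h.sA.wk σ τ hst
  have h2 := h.sb.wk σ τ hst
  rw [← PCol.wk_eq] at h1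
  rw [← PTm.wk_eq] at h2
  have h3 : (c.subst (PTm.up (PTm.up (PTm.up (PTm.sb [] 1))))).Supp
      (upL (upL (upL (upL (names w.rank))))) :=
    h.sc.subst (PTm.supp_up (PTm.supp_up (PTm.supp_up fun i hi => PTm.supp_var (succ_mem_upL hi))))
  simp only [World.elListTm, PTm.subst, h1, h2, hst 0 zero_mem_upL,
    h3 _ _ (up_agree (up_agree (up_agree hst)))]

theorem tr_nil (h : ListRec w A C b c) (hv : w.IsVal b v) :
    w.IsVal (.elList A (M.empty : M w).name b c) v := by
  have k1 := isVal_nil h.hA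
  have k2 : w.El (.list A) M.empty := k1.el (by filter_upwards [h.hA] with Δ h using .listI1 h)
  rw [← elListTm_inst, ← isVal_inst h.tr k2 k1, elListTm_inst]
  refine hv.congr ?_ ?_
  · filter_upwards [h.hA, h.hC, h.hb, h.hc] with Δ h1 h2 h3 h4
    exact .toV (.listE h1 h2 (.listI1 h1) h3 h4)
  · filter_upwards [h.hA, h.hC, h.hb, h.hc] with Δ h1 h2 h3 h4
    exact .tmSymm (.toVEq (.listC1 h1 h2 h3 h4))

/-- The step, with the result of the recursive call as a parameter. -/
theorem tr_step (h : ListRec w A C b c) (hl : w.El (.list A) l) (hx : w.El A x) :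
    w.Tr [C.inst [l.name] 0] (.tm (c.subst (PTm.up (scons x.name (scons l.name .var))))
      ((C.inst [.cons (.var 2) (.var 1)] 3).subst (PTm.up (scons x.name (scons l.name .var))))) := by
  filter_upwards [h.hc, hl, hx, tr_wf] with Δ h1 h2 h3 h4
  have s := ((SubTy.id h4).cons (A := .list A) (a := l.name) (by rwa [PCol.subst_var])).cons
    (A := A.inst [] 1) (a := x.name) (by
      rw [PCol.wk_eq, PCol.ren_subst]
      exact (PCol.subst_var A).symm ▸ h3)
  have := Der.sub1 (Γ := A.inst [] 1 :: .list A :: Δ) h1 s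
  have e1 : (C.inst [.var 1] 2).subst (scons x.name (scons l.name .var)) = C.inst [l.name] 0 := by
    rw [PCol.inst, PCol.inst, PCol.subst_subst]
    congr 1; funext i; cases i <;> rfl
  rwa [e1] at this

theorem step_inst (l x r : PTm) : (c.subst (PTm.up (scons x (scons l .var)))).inst [r] 0 =
    c.inst [r, x, l] 0 := by
  rw [PTm.inst_one, PTm.subst_subst, up_subst_scons]
  simp only [PTm.inst, PTm.sb_cons, PTm.subst_var]
  rfl

theorem tr_cons (h : ListRec w A C b c) (wα : α.Wf T) (hα : Rep e α A) (hl : w.El (.list A) l)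
    (hx : w.El A x) (hr : w.IsVal (.elList A l.name b c) y) :
    w.IsVal (.elList A (M.snoc l x).name b c) v ↔
      w.IsVal (c.inst [y.name, x.name, l.name] 0) v := by
  have k1 := isVal_cons h.hA h.sA wα hα hl hx (isVal_name l) (isVal_name x)
  have k2 := el_snoc h.hA h.sA wα hα hl hx
  have k3 := h.tr_step hl hx
  have k4 : w.El (C.inst [l.name] 0) y := hr.el (by
    filter_upwards [h.hA, h.hC, h.hb, h.hc, hl] with Δ h1 h2 h3 h4 h5 using .listE h1 h2 h5 h3 h4)
  have k5 := isVal_inst (v := v) k3 k4 hr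
  have k6 := isVal_inst (v := v) h.tr k2 k1
  rw [step_inst, step_inst] at k5
  rw [elListTm_inst, elListTm_inst] at k6
  rw [← k6, ← k5]
  refine IsVal.iff_of_eq (A := C.inst [.cons l.name x.name] 0) ?_ ?_ ?_
  · filter_upwards [h.hA, h.hC, h.hb, h.hc, hl, hx] with Δ h1 h2 h3 h4 h5 h6
    exact .toV (.listE h1 h2 (.listI2 h1 h5 h6) h3 h4)
  · have := tr_inst_V k3 (k4.tr hr)
    rwa [step_inst] at this
  · filter_upwards [h.hA, h.hC, h.hb, h.hc, hl, hx] with Δ h1 h2 h3 h4 h5 h6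
    exact .listC2 h1 h2 h5 h6 h3 h4

theorem supp_step (h : ListRec w A C b c) (r x l : M w) :
    (c.inst [r.name, x.name, l.name] 0).Supp (names w.rank) := by
  simp only [PTm.inst, PTm.sb_cons]
  exact h.sc.subst (PTm.supp_scons r.name_supp (PTm.supp_scons x.name_supp
    (PTm.supp_scons l.name_supp fun i hi => PTm.supp_var hi)))

end ListRec

theorem isVal_elList (h : ListRec w A C b c) (wα : α.Wf T) (wδ : δ.Wf T) (wβ : β.Wf T) (wρ : ρ.Wf T)
    (hα : Rep e α A) (hδ : RepT e δ a) (hβ : RepT e β b) (hρ : RepT₃ e ρ A C c)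
    (ha : w.Tr [] (.tm a (.list A))) (sa : a.Supp (names w.rank)) :
    (SFm.ex (.and
        (.all (.imp (.mem (.var 0) (.var 1))
          (.ex (.ex (.and ((etaList α).inst [.var 1] 5)
            (.eq (.var 2) (.pair (.var 1) (.var 0))))))))
      (.and (svl (.var 0))
      (.and
        (.all (.imp ((etaList α).inst [.var 0] 3)
          (.ex (.mem (.pair (.var 1) (.var 0)) (.var 2)))))
      (.and
        (.ex (.and (β.inst [.var 0] 3) (.mem (.pair .empty (.var 0)) (.var 1))))
      (.and
        (.all (.all (.all (.all (.imp
          (.and (.mem (.pair (.var 3) (.var 1)) (.var 4))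
            (.and (α.inst [.var 2] 6)
              (ρ.inst [.var 0, .var 1, .var 2, .var 3] 6)))
          (.mem (.pair (.cup (.var 3) (.sing (.pair (.len (.var 3)) (.var 2)))) (.var 0))
            (.var 4)))))))
        (.ex (.and (δ.inst [.var 0] 3) (.mem (.pair (.var 0) (.var 2)) (.var 1)))))))))).force w
      (v ▹ e) ↔ w.IsVal (.elList A a b c) v := by
  have wl := etaList_wf wα
  have hl : ∀ w' (hw : w ≤ w') z, (etaList α).force w' (z ▹ rese hw e) ↔ w'.El (.list A) z :=
    fun w' hw z => rep_list (h.mono hw).hA (h.mono hw).sA wα (hα.mono hw)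
  rw [SFm.force_ex]
  simp only [SFm.force_and, force_svl (STm.wf_var _)]
  simp (maxDischargeDepth := 9) [wα, wδ, wβ, wρ, wl, hl, hα _ _ _, hδ.self, hβ.self]
  have hL : w.Tr [] (.ty .set (.list A)) := by filter_upwards [h.hA] with Δ h using .listF h
  have sL : (PCol.list A).Supp (names w.rank) := fun σ τ hst => by
    simp only [PCol.subst, h.sA σ τ hst]
  obtain ⟨g, -, hg⟩ := exists_graph hL sL h.tr h.supp
  replace hg : IsGraph (.list A) (World.elListTm A b c) g := hg
  have hg1 : ∀ w' (hw : w ≤ w') l y, M.pair l y ∈ res hw g ↔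
      w'.El (.list A) l ∧ w'.IsVal (.elList A l.name b c) y := fun w' hw l y => by
    rw [(hg.mono hw).pair_mem, elListTm_inst]
  have hel : ∀ w' (hw : w ≤ w') l y, w'.El (.list A) l → w'.IsVal (.elList A l.name b c) y →
      w'.El (C.inst [l.name] 0) y := fun w' hw l y hl hy => hy.el (by
    filter_upwards [h.hA.mono hw, h.hC.mono hw, h.hb.mono hw, h.hc.mono hw, hl]
      with Δ h1 h2 h3 h4 h5 using .listE h1 h2 h5 h3 h4)
  obtain ⟨y0, hy0⟩ := exists_isVal h.sb h.hb.toV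
  obtain ⟨x0, hx0⟩ := exists_isVal sa ha.toV
  have hx0L := hx0.el ha
  have hfin : w.IsVal (.elList A a b c) v ↔ M.pair x0 v ∈ g := by
    have := hg1 w le_rfl x0 v
    rw [res_refl] at this
    rw [this, ← elListTm_inst, isVal_inst h.tr hx0L hx0, elListTm_inst]
    exact ⟨fun h => ⟨hx0L, h⟩, fun h => h.2⟩
  rw [hfin]
  constructor
  · rintro ⟨f, -, h2, h3, ⟨v0, hv0, hv0f⟩, h5, x1, hx1, hx1f⟩
    obtain rfl := hv0.unique hy0
    obtain rfl := hx1.unique hx0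
    have h5' : ∀ w' (hw : w ≤ w') l x r y, M.pair l r ∈ res hw f → w'.El A x →
        ρ.force w' (y ▹ r ▹ x ▹ l ▹ rese hw e) → M.pair (M.snoc l x) y ∈ res hw f := by
      intro w' hw l x r y k1 k2 k3
      have := h5 w' hw l x w' le_rfl r y w' le_rfl
      simp only [res_refl] at this
      exact this k1 k2 k3
    have key := list_ind (ξ := .all (.imp (.mem (.pair (.var 1) (.var 0)) (.var 2))
      (.mem (.pair (.var 1) (.var 0)) (.var 3)))) (e := f ▹ g ▹ e) (z := x1) h.hA h.sA (by simp)
      ?_ ?_ hx0L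
    · simp at key
      simpa using key w le_rfl v (by simpa using hx1f)
    · simp
      intro w' hw y hy
      have k1 := mem_mono hv0f hw
      rw [M.res_pair, M.res_empty] at k1
      obtain rfl := h2 w' hw _ _ _ hy k1
      have k2 := (isVal_nil (h.hA.mono hw)).el (A := .list A) (by
        filter_upwards [h.hA.mono hw] with Δ h using .listI1 h)
      exact (hg1 _ _ _ _).2 ⟨k2, (h.mono hw).tr_nil (hv0.mono hw)⟩
    · intro w' hw a b' l x v' ha' hb' hl' hx' hv'
      have h' := h.mono hw
      obtain rfl := hv'.unique (isVal_cons h'.hA h'.sA wα (hα.mono hw) ha' hb' hl' hx')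
      have hlL := hl'.el ha'
      have hxA := hx'.el hb'
      simp [res_res]
      intro ih w'' hw' y hy
      have h'' := h'.mono hw'
      have hlL' := hlL.mono hw'
      have hxA' := hxA.mono hw'
      obtain ⟨r, hr⟩ := h3 w'' (hw.trans hw') _ hlL'
      have k1 := ((hg1 _ _ _ _).1 (ih w'' hw' r hr)).2
      have k2 := hel _ (hw.trans hw') _ _ hlL' k1
      have k3 := tr_inst_V (h''.tr_step hlL' hxA') k2
      rw [ListRec.step_inst] at k3
      obtain ⟨v1, hv1⟩ := exists_isVal (h''.supp_step _ _ _) k3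
      have k4 := h5' _ _ _ _ r v1 hr hxA' ((hρ _ (hw.trans hw') _ _ r v1 hlL' hxA' k2).2 hv1)
      obtain rfl := h2 _ _ _ _ _ hy k4
      exact (hg1 _ _ _ _).2 ⟨el_snoc h''.hA h''.sA wα (hα.mono (hw.trans hw')) hlL' hxA',
        (h''.tr_cons wα (hα.mono (hw.trans hw')) hlL' hxA' k1).2 hv1⟩
  · intro hv
    refine ⟨g, fun w' hw p hp => ?_, fun w' hw l y z k1 k2 => ?_, fun w' hw l hl => ?_,
      ⟨y0, hy0, ?_⟩, ?_, x0, hx0, hv⟩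
    · obtain ⟨l, y, h1, h2, rfl⟩ := (hg w' hw p).1 hp
      exact ⟨l, h1, y, rfl⟩
    · exact ((hg1 _ _ _ _).1 k1).2.unique ((hg1 _ _ _ _).1 k2).2
    · have h' := h.mono hw
      obtain ⟨y, hy⟩ := exists_isVal
        (by rw [PTm.inst_one]; exact h'.supp.inst1 l.name_supp) (tr_inst_V h'.tr hl)
      rw [elListTm_inst] at hy
      exact ⟨y, (hg1 _ _ _ _).2 ⟨hl, hy⟩⟩
    · have k2 := (isVal_nil h.hA).el (A := .list A) (by
        filter_upwards [h.hA] with Δ h using .listI1 h)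
      simpa using (hg1 w le_rfl _ _).2 ⟨k2, h.tr_nil hy0⟩
    · intro w1 hw1 l x w2 hw2 r y w3 hw3
      rw [res_res, res_res, res_res, res_res]
      intro k1 k2 k3
      rw [hg1] at k1
      have h' := h.mono ((hw1.trans hw2).trans hw3)
      have k4 := hel _ ((hw1.trans hw2).trans hw3) _ _ k1.1 k1.2
      rw [hρ _ _ _ _ _ _ k1.1 k2 k4] at k3
      refine (hg1 _ _ _ _).2 ⟨?_, ?_⟩
      · exact el_snoc h'.hA h'.sA wα (hα.mono ((hw1.trans hw2).trans hw3)) k1.1 k2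
      · exact (h'.tr_cons wα (hα.mono ((hw1.trans hw2).trans hw3)) k1.1 k2 k1.2).2 k3

end World

end EmTT

namespace EmTT

variable {T : SetTheory}

theorem PProp.inst_var_var (R : PProp) :
    R.inst [.var 0, .var 1] 3 = R.subst (PTm.up (PTm.up fun i => .var (i + 1))) := by
  rw [PProp.inst]; congr 1; funext i
  rcases i with _ | _ | i <;> rfl

/-- The class of the last variable. -/
abbrev clsVar (A : PCol) (R : PProp) : PTm := .cls (A.inst [] 1) (R.inst [.var 0, .var 1] 3) (.var 0)

theorem clsVar_inst (A : PCol) (R : PProp) (a : PTm) : (clsVar A R).subst (scons a .var) = .cls A R a := by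
  have h1 := PCol.inst_wk_inst A a
  rw [PCol.inst_one] at h1
  rw [clsVar, PTm.subst, h1, PProp.inst_var_var, PProp.subst_subst]
  congr 1
  conv_rhs => rw [← PProp.subst_var R]
  congr 1; funext i
  rcases i with _ | _ | i <;> rfl

theorem Der.clsVar {Γ : Ctx} {A : PCol} {R : PProp} (hA : Der T Γ (.ty .set A))
    (hR : Der T (A.inst [] 1 :: A :: Γ) (.props R)) (hQ : Der T Γ (.ty .set (.quot A R))) :
    Der T (A :: Γ) (.tm (clsVar A R) .V) := by
  have hA' := Der.setCol hA
  have s := SubTy.wk (T := T) hA'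
  have h1 := Der.sub2 hR s
  have h2 := hQ.sub s
  have h3 := hA.sub s
  rw [PCol.inst_nil_one_subst] at h1
  refine .toV (A := .quot _ _) (.quotI (A := A.inst [] 1) h3 ?_ ?_ (.var (.cons hA') .zero))
  · rw [PProp.inst_var_var]; exact h1
  · rw [PProp.inst_var_var]; exact h2

open World

namespace World

variable {w w' w'' : World T}
  {e : ℕ → M w} {α β γ δ ξ ρ : SFm} {A B C : PCol} {a b c d m t : PTm} {x y z v u q : M w}
  {φ R : PProp}

/-! ### Quotients -/

structure IsQuot (w : World T) (A : PCol) (R : PProp) : Prop where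
  hA : w.Tr [] (.ty .set A)
  sA : A.Supp (names w.rank)
  hR : w.Tr [A.inst [] 1, A] (.props R)
  sR : R.Supp (upL (upL (names w.rank)))
  hQ : w.Tr [] (.ty .set (.quot A R))

namespace IsQuot

theorem mono (h : IsQuot w A R) (hw : w ≤ w') : IsQuot w' A R where
  hA := h.hA.mono hw
  sA := h.sA.mono (names_mono hw.1)
  hR := h.hR.mono hw
  sR := h.sR.mono (upL_iterate_mono (names_mono hw.1) 2)
  hQ := h.hQ.mono hw

theorem tr_cls (h : IsQuot w A R) (ha : w.Tr [] (.tm a A)) : w.Tr [] (.tm (.cls A R a) (.quot A R)) := by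
  filter_upwards [h.hA, h.hR, h.hQ, ha] with Δ h1 h2 h3 h4 using .quotI h1 h2 h3 h4

theorem supp_cls (h : IsQuot w A R) (sa : a.Supp (names w.rank)) :
    (PTm.cls A R a).Supp (names w.rank) := fun σ τ hst => by
  simp only [PTm.subst, h.sA σ τ hst, sa σ τ hst, h.sR _ _ (up_agree (up_agree hst))]

theorem rel_iff (h : IsQuot w A R) (ha : w.Tr [] (.tm a A)) (hb : w.Tr [] (.tm b A))
    (hu : w.IsVal (.cls A R a) u) (hv : w.IsVal (.cls A R b) v) :
    w.Tr [] (.holds (R.inst [b, a] 0)) ↔ u = v := by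
  rw [← hu.eq_iff hv]
  constructor <;> intro hr
  · filter_upwards [h.hA, h.hR, h.hQ, ha, hb, hr] with Δ h1 h2 h3 h4 h5 h6
    exact .toVEq (.quotEq h1 h2 h3 h4 h5 h6)
  · filter_upwards [h.hA, h.hR, h.hQ, ha, hb, hr] with Δ h1 h2 h3 h4 h5 h6
    exact .quotEff h1 h2 h3 h4 h5 (.ofVEq (.quotI h1 h2 h3 h4) (.quotI h1 h2 h3 h5) h6)

theorem isVal_congr (h : IsQuot w A R) (hx : w.El A x) (ha : w.IsVal a x) :
    w.IsVal (.cls A R a) v ↔ w.IsVal (.cls A R x.name) v := by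
  have ha' := hx.tr ha
  refine IsVal.iff_of_eq (A := .quot A R) (h.tr_cls ha').toV (h.tr_cls hx).toV ?_
  filter_upwards [h.hA, h.hR, h.hQ, ha', hx, ha.2] with Δ h1 h2 h3 h4 h5 h6
  exact .quotIEq (.tyRefl h1) (.tyRefl h2) (.ofVEq h4 h5 (.tmSymm h6)) (.quotI h1 h2 h3 h4)
    (.quotI h1 h2 h3 h5)

theorem mem_cls (h : IsQuot w A R) (hx : w.El A x) (hv : w.IsVal (.cls A R x.name) v) :
    z ∈ v ↔ w.El A z ∧ w.IsVal (.cls A R z.name) v := by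
  obtain ⟨s, hs, -⟩ := exists_set h.hA h.sA
  set θ : PProp := .ex (A.inst [] 1)
    (.and (.eq .V (.var 0) (.var 1)) (R.inst [x.name.inst [] 2, .var 0] 2))
  have hA' : w.Tr [] (.ty .col A) := by filter_upwards [h.hA] with Δ h using .setCol h
  have hθ : w.Tr [.V] (.props θ) := by
    filter_upwards [h.hA, h.hR, hx] with Δ h1 h2 h3
    have hVc := Der.vF (T := T) h1.wf
    have k1 : Der T (.V :: Δ) (.ty .set (A.inst [] 1)) := h1.wk hVc
    have c1 : Der T (A.inst [] 1 :: .V :: Δ) .wf := .cons (.setCol k1)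
    have v0 : Der T (A.inst [] 1 :: .V :: Δ) (.tm (.var 0) .V) := .toV (.var c1 .zero)
    have v1 : Der T (A.inst [] 1 :: .V :: Δ) (.tm (.var 1) .V) :=
      .toV (.var c1 (.succ .zero))
    have s0 := (SubTy.wk hVc).comp (SubTy.wk (.setCol k1))
    have s1 := (s0.cons (A := A) (a := .var 0) (by
      have : Der T (A.inst [] 1 :: .V :: Δ) (.tm (.var 0) _) := .var c1 .zero
      rw [PCol.inst, PCol.inst, PCol.subst_subst] at this
      exact this)).cons (A := A.inst [] 1) (a := x.name.inst [] 2) (by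
        have e : (A.inst [] 1).subst (scons (.var 0) fun i => .var (i + 2)) =
            A.subst fun i => .var (i + 2) := by
          rw [PCol.wk_eq, PCol.ren_subst]; rfl
        change Der T _ (.tm _ ((A.inst [] 1).subst (scons (.var 0) fun i => .var (i + 2))))
        rw [e]
        have := h3.sub s0
        exact this)
    have := Der.sub h2 s1
    refine .exF .small k1 (.andF .small (.eqVF v0 v1) ?_)
    rw [PProp.inst, PTm.sb_cons, PTm.sb_cons]
    exact this
  have hθ' : w.Tr [.V] (.prop θ) := by filter_upwards [hθ] with Δ h using .propsProp h
  have hsep : w.IsVal (.sep (.name A) θ) v := by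
    refine hv.congr (tr_sep (tr_name_V h.hA) hθ' fun _ => hθ) ?_
    filter_upwards [h.hA, h.hR, h.hQ, hx] with Δ h1 h2 h3 h4 using .toVEq (.clsEq h1 h2 h3 h4)
  rw [mem_sepTm (tr_name_V h.hA) hs hθ' (fun _ => hθ) hsep, mem_nameTm h.hA hs]
  refine and_congr_right fun hz => ?_
  have e1 : θ.inst [z.name] 0 = .ex A (.and (.eq .V (.var 0) (z.name.ren Nat.succ))
      (R.inst [x.name.inst [] 1, .var 0] 1)) := by
    change PProp.ex ((A.inst [] 1).inst [z.name] 0) (.and (.eq .V (.var 0) (z.name.ren Nat.succ))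
      ((R.inst [x.name.inst [] 2, .var 0] 2).subst (PTm.up (PTm.sb [z.name] 0)))) = _
    rw [PCol.inst_wk_inst]
    congr 2
    rw [PProp.inst, PProp.subst_subst, PProp.inst]
    congr 1; funext i
    rcases i with _ | _ | i
    · change (x.name.inst [] 2).subst _ = x.name.inst [] 1
      rw [PTm.inst, PTm.subst_subst]; rfl
    · rfl
    · rfl
  have e2 : ∀ y : M w, (PProp.and (.eq .V (.var 0) (z.name.ren Nat.succ))
      (R.inst [x.name.inst [] 1, .var 0] 1)).inst [y.name] 0 =
        .and (.eq .V y.name z.name) (R.inst [x.name, y.name] 0) := fun y => by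
    change PProp.and (.eq .V y.name ((z.name.ren Nat.succ).inst [y.name] 0))
      ((R.inst [x.name.inst [] 1, .var 0] 1).subst (PTm.sb [y.name] 0)) = _
    rw [PTm.wk_inst]
    congr 1
    rw [PProp.inst, PProp.subst_subst, PProp.inst]
    congr 1; funext i
    rcases i with _ | _ | i
    · exact PTm.inst_wk_inst _ _
    · rfl
    · rfl
  have hrel : ∀ y, w.El A y → w.Tr [] (.prop (R.inst [x.name, y.name] 0)) := fun y hy => by
    filter_upwards [h.hR, hx, hy, tr_wf] with Δ h1 h2 h3 h4
    have s1 := ((SubTy.id h4).cons (A := A) (a := y.name) (by rwa [PCol.subst_var])).cons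
      (A := A.inst [] 1) (a := x.name) (by
        rw [PCol.wk_eq, PCol.ren_subst]; exact (PCol.subst_var A).symm ▸ h2)
    have := Der.sub (Γ := A.inst [] 1 :: A :: Δ) h1 s1
    rw [PProp.inst, PTm.sb_cons, PTm.sb_cons]
    exact .propsProp this
  have hand : ∀ y, w.El A y → (w.Tr [] (.holds (.and (.eq .V y.name z.name)
      (R.inst [x.name, y.name] 0))) ↔ y = z ∧ w.IsVal (.cls A R y.name) v) := fun y hy => by
    have p1 : w.Tr [] (.prop (.eq .V y.name z.name)) := by
      filter_upwards [y.tr_name, z.tr_name] with Δ h1 h2 using .propsProp (.eqVF h1 h2)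
    rw [tr_and ?_ p1 ?_, tr_eq_iff y.tr_name z.tr_name, (isVal_name y).eq_iff (isVal_name z)]
    · obtain ⟨u, hu⟩ := exists_isVal (h.supp_cls y.name_supp) (h.tr_cls hy).toV
      rw [h.rel_iff hy hx hu hv]
      exact and_congr_right fun _ => ⟨fun h => h ▸ hu, fun h => hu.unique h⟩
    · filter_upwards [p1, hrel y hy] with Δ h1 h2 using .andF .large h1 h2
    · filter_upwards [p1, hrel y hy] with Δ h1 h2 using Der.wk_prop h2 (.propCol h1)
  rw [e1, tr_ex ?_ hA' ?_]
  · constructor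
    · rintro ⟨y, hy, h1⟩
      rw [e2, hand y hy] at h1
      obtain ⟨rfl, h2⟩ := h1
      exact h2
    · intro h1
      refine ⟨z, hz, ?_⟩
      rw [e2, hand z hz]
      exact ⟨rfl, h1⟩
  · refine PProp.supp_quant h.sA fun σ τ hst => ?_
    have k2 := x.name_supp.wk σ τ hst
    have k3 : (R.inst [x.name.inst [] 1, .var 0] 1).Supp (upL (names w.rank)) := by
      rw [PProp.inst, PTm.sb_cons, PTm.sb_cons, PTm.wk_eq]
      exact h.sR.subst (PTm.supp_scons x.name_supp.wk (PTm.supp_scons (PTm.supp_var zero_mem_upL)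
        fun i hi => PTm.supp_var (succ_mem_upL hi)))
    simp only [PProp.subst, PTm.subst, PCol.subst, z.name_supp.wk σ τ hst, hst 0 zero_mem_upL,
      k3 σ τ hst]
  · filter_upwards [h.hA, h.hR, hx, z.tr_name] with Δ h1 h2 h3 h4
    have h1' := Der.setCol h1
    have c1 : Der T (A :: Δ) .wf := .cons h1'
    have v0 : Der T (A :: Δ) (.tm (.var 0) .V) := .toV (.var c1 .zero)
    have s0 := SubTy.wk (T := T) h1'
    have s1 := (s0.cons (A := A) (a := .var 0) (.var c1 .zero)).cons (A := A.inst [] 1)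
      (a := x.name.inst [] 1) (by
        rw [PCol.wk_eq, PCol.ren_subst]; exact h3.sub s0)
    have := Der.sub h2 s1
    have h4' := h4.sub s0
    rw [Jdg.subst, ← PTm.ren_eq_subst] at h4'
    refine .andF .large (.propsProp (.eqVF v0 h4')) (.propsProp ?_)
    rw [PProp.inst, PTm.sb_cons, PTm.sb_cons]
    exact this

theorem ind (h : IsQuot w A R) (wξ : ξ.Wf T)
    (H : ∀ w' (hw : w ≤ w') x v, w'.El A x → w'.IsVal (.cls A R x.name) v →
      ξ.force w' (v ▹ rese hw e)) (hz : w.El (.quot A R) z) : ξ.force w (z ▹ e) := by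
  have hQ' : w.Tr [] (.ty .col (.quot A R)) := by filter_upwards [h.hQ] with Δ h using .setCol h
  have hm : w.Tr [A] (.holds ((mot ξ e).inst [clsVar A R] 1)) := by
    refine tr_mot_gen (Θ := [A]) wξ ⟨trivial, h.sA⟩ ?_ ?_ ?_
    · intro σ τ hst
      have h1 := h.sA.wk σ τ hst
      rw [← PCol.wk_eq] at h1
      have h2 : (R.inst [.var 0, .var 1] 3).Supp (upL (upL (upL (names w.rank)))) := by
        rw [PProp.inst_var_var]
        exact h.sR.subst (PTm.supp_up (PTm.supp_up fun i hi => PTm.supp_var (succ_mem_upL hi)))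
      simp only [PTm.subst, h1, h2 _ _ (up_agree (up_agree hst)), hst 0 zero_mem_upL]
    · filter_upwards [h.hA, h.hR, h.hQ] with Δ h1 h2 h3 using Der.clsVar h1 h2 h3
    · rintro w' hw σ v hσ hv
      obtain ⟨a, hs', ha, rfl⟩ := inst_one_iff.1 hσ
      obtain ⟨x, hx⟩ := exists_isVal hs' ha.toV
      rw [clsVar_inst] at hv
      exact H w' hw x v (hx.el ha) (((h.mono hw).isVal_congr (hx.el ha) hx).1 hv)
  rw [← tr_mot wξ (isVal_name z)]
  filter_upwards [h.hA, h.hR, h.hQ, mot_ty (e := e) wξ hQ', mot_prop (e := e) wξ hQ', hz, hm]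
    with Δ h1 h2 h3 h4 h5 h6 h7
  refine .propTrue (h5.inst_one_ty h6) (.quotE (m := .tt) h1 h2 h3 h4 h6 h7 (.tmRefl ?_))
  have hw := h2.wf
  have hw3 : Der T (.ofProp R :: A.inst [] 1 :: A :: Δ) .wf := .cons (.propCol (.propsProp h2))
  have s := (((SubTy.wk h1.setCol).comp (SubTy.wk hw.head)).comp
    (SubTy.wk hw3.head)).cons (A := A) (a := .var 2) (by
      have : Der T (.ofProp R :: A.inst [] 1 :: A :: Δ) (.tm (.var 2) _) :=
        .var hw3 (.succ (.succ .zero))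
      rw [show ((A.inst [] 1).inst [] 1).inst [] 1 = A.subst _ by
        rw [PCol.inst, PCol.inst, PCol.inst, PCol.subst_subst, PCol.subst_subst]] at this
      exact this)
  have := Der.sub (Γ := A :: Δ) h7 s
  have e1 : (clsVar A R).subst (scons (.var 2) fun i => .var (i + 3)) =
      .cls (A.inst [] 3) (R.inst [.var 0, .var 1] 5) (.var 2) := by
    rw [clsVar, PTm.subst, PProp.inst, PProp.subst_subst, PCol.inst, PCol.subst_subst]
    congr 1
    rw [PProp.inst]; congr 1; funext i
    rcases i with _ | _ | i <;> rfl
  have e2 : ((mot ξ e).inst [clsVar A R] 1).subst (scons (.var 2) fun i => .var (i + 3)) =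
      (mot ξ e).inst [(clsVar A R).subst (scons (.var 2) fun i => .var (i + 3))] 3 := by
    rw [PProp.inst, PProp.subst_subst, PProp.inst]
    congr 1; funext i
    cases i <;> rfl
  change Der T _ (.holds ((mot ξ e).inst [.cls (A.inst [] 3) (R.inst [.var 0, .var 1] 5) (.var 2)] 3))
  rw [← e1, ← e2]
  exact this

end IsQuot

def RepP₂ (e : ℕ → M w) (ρ : SFm) (A : PCol) (R : PProp) : Prop :=
  ∀ w' (h : w ≤ w') x y, w'.El A x → w'.El A y →
    (ρ.force w' (y ▹ x ▹ rese h e) ↔ w'.Tr [] (.holds (R.inst [y.name, x.name] 0)))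

theorem RepP₂.mono (h : RepP₂ e ρ A R) (hw : w ≤ w') : RepP₂ (rese hw e) ρ A R :=
  fun w'' hw' x y => by rw [rese_rese]; exact h w'' _ x y

namespace IsQuot

theorem mem_res_iff (h : IsQuot w A R) (hx : w.El A x) (hu : w.IsVal (.cls A R x.name) u)
    (hw : w ≤ w') {v : M w'} : v ∈ res hw u ↔
      w'.El A v ∧ w'.Tr [] (.holds (R.inst [v.name, (res hw x).name] 0)) := by
  have h' := h.mono hw
  have hu' := (h'.isVal_congr (hx.mono hw) (isVal_res hw x)).1 (hu.mono hw)
  rw [h'.mem_cls (hx.mono hw) hu']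
  refine and_congr_right fun hv => ?_
  obtain ⟨q, hq⟩ := exists_isVal (h'.supp_cls v.name_supp) (h'.tr_cls hv).toV
  rw [h'.rel_iff (hx.mono hw) hv hu' hq]
  exact ⟨fun h => h.unique hq, fun h => h ▸ hq⟩

theorem isVal_iff (h : IsQuot w A R) (hα : Rep e α A)
    (hρ : RepP₂ e ρ A R) (hx : w.El A x) :
    (∀ w' (hw : w ≤ w') v, v ∈ res hw z ↔
      α.force w' (v ▹ rese hw e) ∧ ρ.force w' (v ▹ res hw x ▹ rese hw e)) ↔
      w.IsVal (.cls A R x.name) z := by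
  have key : ∀ w' (hw : w ≤ w') v, α.force w' (v ▹ rese hw e) ∧
      ρ.force w' (v ▹ res hw x ▹ rese hw e) ↔
      w'.El A v ∧ w'.Tr [] (.holds (R.inst [v.name, (res hw x).name] 0)) := fun w' hw v => by
    rw [hα w' hw v]
    exact and_congr_right fun hv => hρ w' hw _ v (hx.mono hw) hv
  simp only [key]
  obtain ⟨u, hu⟩ := exists_isVal (h.supp_cls x.name_supp) (h.tr_cls hx).toV
  constructor
  · intro hz
    have : z = u := M.ext fun w' hw v => by rw [hz, h.mem_res_iff hx hu]
    rwa [this]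
  · rintro hz w' hw v
    exact h.mem_res_iff hx hz hw

theorem el_of_isVal (h : IsQuot w A R) (hx : w.El A x) (hz : w.IsVal (.cls A R x.name) z) :
    w.El (.quot A R) z := hz.el (h.tr_cls hx)

theorem force_classOf (h : IsQuot w A R) (wγ : γ.Wf T) (wα : α.Wf T) (wρ : ρ.Wf T)
    (hα : Rep e α A) (hρ : RepP₂ e ρ A R) (hγ : ∀ x, γ.force w (x ▹ e) → w.El A x) :
    (classOf γ α ρ).force w (z ▹ e) ↔ ∃ x, γ.force w (x ▹ e) ∧ w.IsVal (.cls A R x.name) z := by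
  simp (maxDischargeDepth := 9) [classOf, wα, wρ, wγ]
  refine exists_congr fun x => and_congr_right fun hx => ?_
  exact h.isVal_iff hα hρ (hγ x hx)

theorem rep (h : IsQuot w A R) (wα : α.Wf T) (wρ : ρ.Wf T) (hα : Rep e α A)
    (hρ : RepP₂ e ρ A R) :
    (classOf α α ρ).force w (z ▹ e) ↔ w.El (.quot A R) z := by
  constructor
  · rw [h.force_classOf wα wα wρ hα hρ fun x => hα.self.1]
    rintro ⟨x, hx, hz⟩
    exact h.el_of_isVal (hα.self.1 hx) hz
  · refine h.ind (classOf_wf wα wα wρ) fun w' hw x v hx hv => ?_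
    rw [(h.mono hw).force_classOf wα wα wρ (hα.mono hw) (hρ.mono hw) fun x => (hα w' hw x).1]
    exact ⟨x, (hα w' hw x).2 hx, hv⟩

theorem isVal_cls (h : IsQuot w A R) (wδ : δ.Wf T) (wα : α.Wf T) (wρ : ρ.Wf T) (hα : Rep e α A)
    (hρ : RepP₂ e ρ A R) (hδ : RepT e δ a) (ha : w.Tr [] (.tm a A)) (sa : a.Supp (names w.rank)) :
    (classOf δ α ρ).force w (z ▹ e) ↔ w.IsVal (.cls A R a) z := by
  rw [h.force_classOf wδ wα wρ hα hρ fun x hx => (hδ.self.1 hx).el ha]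
  constructor
  · rintro ⟨x, hx, hz⟩
    have := hδ.self.1 hx
    exact (h.isVal_congr (this.el ha) this).2 hz
  · intro hz
    obtain ⟨x, hx⟩ := exists_isVal sa ha.toV
    exact ⟨x, hδ.self.2 hx, (h.isVal_congr (hx.el ha) hx).1 hz⟩

theorem exists_rep (h : IsQuot w A R) (wα : α.Wf T) (wρ : ρ.Wf T) (hα : Rep e α A)
    (hρ : RepP₂ e ρ A R) (hz : w.El (.quot A R) z) :
    ∃ x, w.El A x ∧ w.IsVal (.cls A R x.name) z := by
  rw [← h.rep wα wρ hα hρ, h.force_classOf wα wα wρ hα hρ fun x => hα.self.1] at hz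
  obtain ⟨x, hx, hz⟩ := hz
  exact ⟨x, hα.self.1 hx, hz⟩

theorem isVal_elQuot_cls (h : IsQuot w A R) (hC : w.Tr [.quot A R] (.ty .col C))
    (hm : w.Tr [A] (.tm m (C.inst [clsVar A R] 1)))
    (hmm : w.Tr [.ofProp R, A.inst [] 1, A] (.tmEq (m.inst [.var 2] 3) (m.inst [.var 1] 3)
      (C.inst [.cls (A.inst [] 3) (R.inst [.var 0, .var 1] 5) (.var 2)] 3)))
    (hd : w.Tr [] (.tm d (.quot A R))) (hx : w.El A x) (hq : w.IsVal d q)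
    (hqx : w.IsVal (.cls A R x.name) q) :
    w.IsVal (.elQuot A R d m) v ↔ w.IsVal (m.inst [x.name] 0) v := by
  have hdp := hq.eq hqx
  refine IsVal.iff_of_eq (A := .V) ?_ (tr_inst_V hm hx) ?_
  · filter_upwards [h.hA, h.hR, h.hQ, hC, hd, hm, hmm] with Δ h1 h2 h3 h4 h5 h6 h7
    exact .toV (.quotE h1 h2 h3 h4 h5 h6 h7)
  · filter_upwards [h.hA, h.hR, h.hQ, hC, hd, hm, hmm, hdp, hx] with Δ h1 h2 h3 h4 h5 h6 h7 h8 h9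
    have hpt := Der.quotI h1 h2 h3 h9
    exact .tmTrans (.toVEq (.quotEEq (.tyRefl h1) (.tyRefl h2) h4 (.ofVEq h5 hpt h8) (.tmRefl h6)
      (.quotE h1 h2 h3 h4 h5 h6 h7) (.quotE h1 h2 h3 h4 hpt h6 h7)))
      (.toVEq (.quotC h1 h2 h3 h4 h9 h6 h7))

theorem isVal_elQuot (h : IsQuot w A R) (wα : α.Wf T) (wρ : ρ.Wf T) (wδ : δ.Wf T) (wβ : β.Wf T)
    (hα : Rep e α A) (hρ : RepP₂ e ρ A R) (hδ : RepT e δ d) (hβ : RepT₁ e β A m)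
    (hC : w.Tr [.quot A R] (.ty .col C)) (hm : w.Tr [A] (.tm m (C.inst [clsVar A R] 1)))
    (hmm : w.Tr [.ofProp R, A.inst [] 1, A] (.tmEq (m.inst [.var 2] 3) (m.inst [.var 1] 3)
      (C.inst [.cls (A.inst [] 3) (R.inst [.var 0, .var 1] 5) (.var 2)] 3)))
    (hd : w.Tr [] (.tm d (.quot A R))) (sd : d.Supp (names w.rank)) :
    (SFm.ex (.and (δ.inst [.var 0] 2) (.and (.ex (.mem (.var 0) (.var 1)))
      (.all (.imp (.mem (.var 0) (.var 1)) (β.inst [.var 2, .var 0] 3)))))).force w (v ▹ e) ↔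
      w.IsVal (.elQuot A R d m) v := by
  simp (maxDischargeDepth := 9) [wδ, wβ, hδ.self]
  obtain ⟨q, hq⟩ := exists_isVal sd hd.toV
  obtain ⟨x, hx, hqx⟩ := h.exists_rep wα wρ hα hρ (hq.el hd)
  have hmem : ∀ y, y ∈ q ↔ w.El A y ∧ w.IsVal (.cls A R y.name) q := fun y => h.mem_cls hx hqx
  have hmem' : ∀ w' (hw : w ≤ w') y, y ∈ res hw q ↔
      w'.El A y ∧ w'.IsVal (.cls A R y.name) (res hw q) := fun w' hw y =>
    (h.mono hw).mem_cls (hx.mono hw)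
      (((h.mono hw).isVal_congr (hx.mono hw) (isVal_res hw x)).1 (hqx.mono hw))
  constructor
  · rintro ⟨q', hq', ⟨y, hy⟩, H⟩
    obtain rfl := hq'.unique hq
    have hy' := (hmem y).1 hy
    have := H w le_rfl y
    simp only [res_refl, rese_refl] at this
    rw [h.isVal_elQuot_cls hC hm hmm hd hy'.1 hq hy'.2]
    exact (hβ.self hy'.1).1 (this hy)
  · intro hv
    refine ⟨q, hq, ⟨x, (hmem x).2 ⟨hx, hqx⟩⟩, fun w' hw y hy => ?_⟩
    have hy' := (hmem' w' hw y).1 hy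
    rw [hβ w' hw y _ hy'.1, ← (h.mono hw).isVal_elQuot_cls (hC.mono hw) (hm.mono hw) (hmm.mono hw)
      (hd.mono hw) hy'.1 (hq.mono hw) hy'.2]
    exact hv.mono hw

end IsQuot

end World

end EmTT

namespace EmTT

variable {T : SetTheory}

/-! ## The translation describes types and terms -/

/-- The formula which describes the elements of a type or the value of a term. -/
def Jdg.desc : Jdg → SFm
  | .ty _ A => A.eta
  | .tm a _ => a.delta
  | _ => .bot

theorem Jdg.desc_wf (J : Jdg) : J.desc.Wf T := by
  cases J
  case ty => exact PCol.eta_wf _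
  case tm => exact PTm.delta_wf _
  all_goals simp [desc]

theorem Jdg.desc_ren (ρ : ℕ → ℕ) (J : Jdg) : (J.ren ρ).desc = J.desc.ren (upRen ρ) := by
  cases J
  case ty => exact PCol.eta_ren _ _
  case tm => exact PTm.delta_ren _ _
  all_goals rfl

def Jdg.Supp (L : Set ℕ) (J : Jdg) : Prop :=
  ∀ σ τ : ℕ → PTm, (∀ i ∈ L, σ i = τ i) → J.subst σ = J.subst τ

theorem Jdg.Supp.subst {L L' : Set ℕ} {J : Jdg} {σ : ℕ → PTm} (h : J.Supp L')
    (hσ : ∀ i ∈ L', (σ i).Supp L) : (J.subst σ).Supp L := fun τ τ' ht => by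
  rw [Jdg.subst_subst, Jdg.subst_subst]; exact h _ _ fun i hi => hσ i hi _ _ ht

theorem Der.supp {Γ : Ctx} {J : Jdg} (h : Der T Γ J) : J.Supp {i | i < Γ.length} := fun _ _ hs =>
  Jdg.subst_congr_of_ren h.closed.1 hs

theorem supp_ups {L L' : Set ℕ} {σ : ℕ → PTm} (h : ∀ i ∈ L', (σ i).Supp L) (n : ℕ) :
    ∀ i ∈ upL^[n] L', (ups n σ i).Supp (upL^[n] L) := by
  induction n with
  | zero => exact h
  | succ n ih =>
    rw [Function.iterate_succ_apply', Function.iterate_succ_apply']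
    exact PTm.supp_up ih

theorem mem_upL_of_lt {n m i : ℕ} (h : i < n + m) : i ∈ upL^[n] {i | i < m} := by
  induction n generalizing i with
  | zero => simpa using h
  | succ n ih =>
    rw [Function.iterate_succ_apply']
    cases i with
    | zero => exact zero_mem_upL
    | succ i => exact succ_mem_upL (ih (by omega))

def sconsL (l : List PTm) (σ : ℕ → PTm) : ℕ → PTm := l.foldr scons σ

theorem Jdg.ups_subst_sb (J : Jdg) (l : List PTm) (σ : ℕ → PTm) :
    (J.subst (ups l.length σ)).subst (PTm.sb l 0) = J.subst (sconsL l σ) := by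
  rw [Jdg.subst_subst]
  congr 1
  induction l with
  | nil => funext i; exact PTm.subst_var _
  | cons a l ih =>
    rw [PTm.sb_cons, List.length_cons, ups, up_subst_scons, ih]
    rfl

open World

namespace World

variable {w w' w'' : World T} {Γ Δ : Ctx} {σ τ : ℕ → PTm} {J : Jdg} {A B C : PCol} {k : Kind}
  {a b c d m n t : PTm} {φ ψ : PProp} {e : ℕ → M w} {x y z v : M w}

def Sem (w : World T) (z : M w) : Jdg → Prop
  | .ty _ A => w.El A z
  | .tm a _ => w.IsVal a z
  | _ => False

/-- The values of the names. -/
noncomputable def nm (w : World T) : ℕ → M w := fun i => w.val (.var i)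

theorem nm_mono (hw : w ≤ w') {i : ℕ} (hi : i ∈ names w.rank) : rese hw (nm w) i = nm w' i := by
  obtain ⟨x, hx⟩ := name_of_mem hi
  change res hw (w.val (.var i)) = w'.val (.var i)
  rw [hx.val_eq, (hx.mono hw).val_eq]

/-- The extension of an assignment by a list of elements. -/
def econsL (l : List (M w)) (e : ℕ → M w) : ℕ → M w := l.foldr econs e

theorem econsL_congr {L : Set ℕ} {e e' : ℕ → M w} (h : ∀ i ∈ L, e i = e' i) (l : List (M w)) :
    ∀ i ∈ upL^[l.length] L, econsL l e i = econsL l e' i := by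
  induction l with
  | nil => exact h
  | cons x l ih =>
    rw [List.length_cons, Function.iterate_succ_apply']
    rintro i (rfl | ⟨j, hj, rfl⟩)
    · rfl
    · exact ih j hj

theorem names_nonempty (w : World T) : (names w.rank).Nonempty :=
  ⟨_, (Quotient.out (M.empty : M w)).2⟩

theorem upL_nonempty {L : Set ℕ} (h : L.Nonempty) (n : ℕ) : (upL^[n] L).Nonempty := by
  cases n with
  | zero => exact h
  | succ n => rw [Function.iterate_succ_apply']; exact ⟨0, zero_mem_upL⟩

theorem cons_upRen (z : M w) (e : ℕ → M w) (ρ : ℕ → ℕ) :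
    (fun i => (z ▹ e) (upRen ρ i)) = z ▹ fun i => e (ρ i) := by
  funext i; cases i <;> rfl

theorem force_desc_congr {L : Set ℕ} (hL : L.Nonempty) (hJ : J.Supp L) {e e' : ℕ → M w}
    (h : ∀ i ∈ L, e i = e' i) : J.desc.force w (z ▹ e) ↔ J.desc.force w (z ▹ e') := by
  classical
  obtain ⟨c, hc⟩ := hL
  have e1 : J.ren (fun i => if i ∈ L then i else c) = J := by
    rw [Jdg.ren_eq_subst]
    conv_rhs => rw [← Jdg.subst_var J]
    exact hJ _ _ fun i hi => by simp [hi]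
  rw [← e1, Jdg.desc_ren, J.desc_wf.force_ren, J.desc_wf.force_ren, cons_upRen, cons_upRen]
  rw [show (fun i => e (if i ∈ L then i else c)) = fun i => e' (if i ∈ L then i else c) from
    funext fun i => by
      by_cases hi : i ∈ L
      · simp [hi, h]
      · simp [hi, h c hc]]

theorem exists_index (l : List (M w)) : ∃ ρ : ℕ → ℕ,
    (PTm.sb (l.map M.name) 0 = fun i => .var (ρ i)) ∧ ∀ i, nm w (ρ i) = econsL l (nm w) i := by
  induction l with
  | nil => exact ⟨fun i => i, rfl, fun _ => rfl⟩
  | cons x l ih =>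
    obtain ⟨ρ, h1, h2⟩ := ih
    refine ⟨fun i => i.casesOn (Quotient.out x).1 ρ, ?_, ?_⟩
    · rw [List.map_cons, PTm.sb_cons, h1]
      funext i; cases i <;> rfl
    · rintro (_ | i)
      · exact (isVal_name x).val_eq
      · exact h2 i

theorem force_desc_inst (J : Jdg) (l : List (M w)) :
    (J.subst (PTm.sb (l.map M.name) 0)).desc.force w (z ▹ nm w) ↔
      J.desc.force w (z ▹ econsL l (nm w)) := by
  obtain ⟨ρ, h1, h2⟩ := exists_index l
  rw [h1, ← Jdg.ren_eq_subst, Jdg.desc_ren, J.desc_wf.force_ren, cons_upRen]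
  rw [show (fun i => nm w (ρ i)) = econsL l (nm w) from funext h2]

/-- The type or term of `J`, with names for variables, is described by its translation. -/
def Ok (w : World T) (J : Jdg) : Prop :=
  ∀ w' (hw : w ≤ w') z, J.desc.force w' (z ▹ rese hw (nm w)) ↔ Sem w' z J

theorem Ok.self (h : Ok w J) : J.desc.force w (z ▹ nm w) ↔ Sem w z J := by
  have := h w le_rfl z
  rwa [rese_refl] at this

theorem Ok.of_forall (s : J.Supp (names w.rank))
    (h : ∀ w', w ≤ w' → ∀ z, J.desc.force w' (z ▹ nm w') ↔ Sem w' z J) : Ok w J :=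
  fun w' hw z => by
    rw [← h w' hw]
    exact force_desc_congr w.names_nonempty s fun i hi => nm_mono hw hi

theorem Ok.mono (h : Ok w J) (s : J.Supp (names w.rank)) (hw : w ≤ w') : Ok w' J :=
  .of_forall (fun _ _ hs => s _ _ fun i hi => hs i (names_mono hw.1 hi)) fun w'' hw' z => by
    rw [← h w'' (hw.trans hw') z]
    exact (force_desc_congr w.names_nonempty s fun i hi => nm_mono _ hi).symm

/-- Substitutions of described closed terms for the variables of a context. -/
structure Good (w : World T) (σ : ℕ → PTm) (Γ : Ctx) : Prop where
  sub : w.Sub σ Γ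
  supp : ∀ i < Γ.length, (σ i).Supp (names w.rank)
  ok : ∀ i < Γ.length, Ok w (.tm (σ i) .V)

theorem supp_tm (h : a.Supp (names w.rank)) : (Jdg.tm a .V).Supp (names w.rank) :=
  fun σ τ hs => by simp only [Jdg.subst, h σ τ hs, PCol.subst]

namespace Good

theorem mono (g : Good w σ Γ) (hw : w ≤ w') : Good w' σ Γ where
  sub := g.sub.mono hw
  supp i hi := (g.supp i hi).mono (names_mono hw.1)
  ok i hi := (g.ok i hi).mono (supp_tm (g.supp i hi)) hw

theorem supp_jdg (g : Good w σ Γ) (h : Der T Γ J) : (J.subst σ).Supp (names w.rank) :=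
  h.supp.subst g.supp

theorem supp_jdg_ups (g : Good w σ Γ) {Θ : Ctx} (h : Der T (Θ ++ Γ) J) :
    (J.subst (ups Θ.length σ)).Supp (upL^[Θ.length] (names w.rank)) :=
  h.supp.subst fun i hi => supp_ups (L' := {i | i < Γ.length}) g.supp _ i
    (mem_upL_of_lt (by simpa using hi))

theorem cons (g : Good w σ Γ) (hx : w.El (A.subst σ) x) : Good w (scons x.name σ) (A :: Γ) where
  sub i B hB := by
    cases hB with
    | zero => rw [PCol.wk_eq, PCol.ren_subst]; exact hx
    | succ hB => rw [PCol.wk_eq, PCol.ren_subst]; exact g.sub _ _ hB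
  supp i hi := by
    cases i with
    | zero => exact x.name_supp
    | succ i => exact g.supp i (by simpa using hi)
  ok i hi := by
    cases i with
    | zero =>
      refine .of_forall (supp_tm x.name_supp) fun w' hw z => ?_
      change ev (z ▹ nm w') (.var 0) = ev (z ▹ nm w') (.var ((Quotient.out x).1 + 1)) ↔ w'.IsVal x.name z
      rw [ev_var, ev_var]
      change z = w'.val x.name ↔ _
      have hv := isVal_val (x.name_supp.mono (names_mono hw.1)) ((isVal_name x).1.mono hw)
      exact ⟨fun h => h ▸ hv, fun h => h.unique hv⟩
    | succ i => exact g.ok i (by simpa using hi)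

theorem tr (g : Good w σ Γ) (h : Der T Γ J) : w.Tr [] (J.subst σ) := Tr.sub h g.sub

theorem tr1 (g : Good w σ Γ) (h : Der T (A :: Γ) J) :
    w.Tr [A.subst σ] (J.subst (PTm.up σ)) := by
  filter_upwards [g.sub.eventually] with Δ hσ using h.sub1 hσ

theorem tr2 (g : Good w σ Γ) (h : Der T (B :: A :: Γ) J) :
    w.Tr [B.subst (PTm.up σ), A.subst σ] (J.subst (PTm.up (PTm.up σ))) := by
  filter_upwards [g.sub.eventually] with Δ hσ using h.sub2 hσ

theorem tr3 (g : Good w σ Γ) (h : Der T (C :: B :: A :: Γ) J) :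
    w.Tr [C.subst (PTm.up (PTm.up σ)), B.subst (PTm.up σ), A.subst σ]
      (J.subst (PTm.up (PTm.up (PTm.up σ)))) := by
  filter_upwards [g.sub.eventually] with Δ hσ using h.sub3 hσ

end Good

/-- Every instance of `J` by described terms is described by its translation. -/
def Described (T : SetTheory) (Γ : Ctx) (J : Jdg) : Prop :=
  ∀ (w : World T) σ, Good w σ Γ → Ok w (J.subst σ)

theorem Described.intro (h : Der T Γ J)
    (H : ∀ (w : World T) σ, Good w σ Γ → ∀ z,
      (J.subst σ).desc.force w (z ▹ nm w) ↔ Sem w z (J.subst σ)) : Described T Γ J :=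
  fun _ σ g => .of_forall (g.supp_jdg h) fun w' hw z => H w' σ (g.mono hw) z

theorem Described.at_names {Θ : Ctx} (ih : Described T (Θ ++ Γ) J) (h : Der T (Θ ++ Γ) J)
    (g : Good w σ Γ) (hw : w ≤ w') (l : List (M w')) (hl : l.length = Θ.length)
    (g' : Good w' (sconsL (l.map M.name) σ) (Θ ++ Γ)) {z : M w'} :
    (J.subst (ups Θ.length σ)).desc.force w' (z ▹ econsL l (rese hw (nm w))) ↔
      Sem w' z ((J.subst (ups Θ.length σ)).subst (PTm.sb (l.map M.name) 0)) := by
  have e1 := Jdg.ups_subst_sb J (l.map M.name) σ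
  rw [List.length_map, hl] at e1
  have := (ih w' _ g').self (z := z)
  rw [← e1, force_desc_inst] at this
  rw [← this]
  refine force_desc_congr (upL_nonempty w.names_nonempty Θ.length) (g.supp_jdg_ups h) ?_
  rw [← hl]
  exact econsL_congr (fun i hi => nm_mono hw hi) l

end World

end EmTT

namespace EmTT

variable {T : SetTheory}

theorem Der.dom_col {Γ : Ctx} {A : PCol} {s : Size} (h : Der T Γ (.ty s.dom A)) :
    Der T Γ (.ty .col A) := by
  cases s
  · exact h
  · exact .setCol h

theorem Der.logic_prop {Γ : Ctx} {A : PCol} {s : Size} (h : Der T Γ (.ty s.logic A)) :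
    Der T Γ (.ty .prop A) := by
  cases s
  · exact h
  · exact .propsProp h

/-- An element of `V` that belongs to `A` is an element of `A`. -/
theorem Der.rel_guard {Γ : Ctx} {A : PCol} {J : Jdg} (hA : Der T Γ (.ty .col A))
    (h : Der T (A :: Γ) J) : Der T (.ofProp (.memCol (.var 0) (A.inst [] 1)) :: .V :: Γ)
      (J.subst fun i => .var (i + 1)) := by
  have hV : Der T Γ (.ty .col .V) := .vF hA.wf
  have hA1 : Der T (.V :: Γ) (.ty .col (A.inst [] 1)) := hA.wk hV
  have v0 : Der T (.V :: Γ) (.tm (.var 0) .V) := .var (A := .V) (.cons hV) .zero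
  have hm := Der.memColF v0 hA1
  have hm' := Der.propCol hm
  have s := (SubTy.wk hV).comp (SubTy.wk hm')
  have e1 : (A.inst [] 1).inst [] 1 = A.subst fun i => (PTm.var (i + 1)).subst fun i => .var (i + 1) := by
    rw [PCol.inst, PCol.inst, PCol.subst_subst]; rfl
  have hg : Der T (.ofProp (.memCol (.var 0) (A.inst [] 1)) :: .V :: Γ)
      (.tm (.var 0) (.ofProp (.memCol (.var 1) ((A.inst [] 1).inst [] 1)))) := .var (.cons hm') .zero
  have hm1 : Der T (.ofProp (.memCol (.var 0) (A.inst [] 1)) :: .V :: Γ)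
      (.prop (.memCol (.var 1) ((A.inst [] 1).inst [] 1))) := hm.wk hm'
  rw [e1] at hg hm1
  have s' := s.cons (A := A) (a := .var 1) (.memColE (hA.sub s) (v0.wk hm') (.propTrue hm1 hg))
  have := h.sub s'
  rwa [show scons (.var 1) (fun i => (PTm.var (i + 1)).subst fun i => .var (i + 1)) =
    fun i => .var (i + 1) from funext fun i => by cases i <;> rfl] at this

open World

namespace World

variable {w w' w'' : World T} {Γ Δ : Ctx} {σ τ : ℕ → PTm} {J : Jdg} {A B C : PCol} {k k' : Kind}
  {a b c d m n t : PTm} {φ ψ R : PProp} {e : ℕ → M w} {x y z v : M w} {L : Set ℕ}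

theorem _root_.EmTT.Jdg.Supp.ty (h : (Jdg.ty k A).Supp L) : A.Supp L := fun σ τ hs => by
  simpa [Jdg.subst] using h σ τ hs

theorem _root_.EmTT.Jdg.Supp.tm (h : (Jdg.tm a A).Supp L) : a.Supp L := fun σ τ hs => by
  have := h σ τ hs
  simp only [Jdg.subst, Jdg.tm.injEq] at this
  exact this.1

theorem _root_.EmTT.Jdg.Supp.prop (h : (Jdg.ty k (.ofProp φ)).Supp L) : φ.Supp L := fun σ τ hs => by
  simpa [Jdg.subst, PCol.subst] using h σ τ hs

theorem force_ofProp : (PCol.ofProp φ).eta.force w (z ▹ e) ↔ z = M.empty ∧ φ.hat.force w e := by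
  simp [PCol.eta, φ.hat_wf]

theorem force_hat_congr (s : φ.Supp L) (hL : L.Nonempty) {e e' : ℕ → M w}
    (h : ∀ i ∈ L, e i = e' i) : φ.hat.force w e ↔ φ.hat.force w e' := by
  have := force_desc_congr (J := .prop φ) (z := M.empty) hL
    (fun σ τ hs => by simp only [Jdg.subst, PCol.subst, s σ τ hs]) h
  simpa only [Jdg.desc, force_ofProp, true_and] using this

namespace Good

variable (g : Good w σ Γ)
include g

theorem supp_ty (h : Der T Γ (.ty k A)) : (A.subst σ).Supp (names w.rank) := (g.supp_jdg h).ty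
theorem supp_tm (h : Der T Γ (.tm a A)) : (a.subst σ).Supp (names w.rank) := (g.supp_jdg h).tm
theorem supp_prop (h : Der T Γ (.ty k (.ofProp φ))) : (φ.subst σ).Supp (names w.rank) :=
  (g.supp_jdg h).prop
theorem supp_ty1 (h : Der T (A :: Γ) (.ty k B)) : (B.subst (PTm.up σ)).Supp (upL (names w.rank)) :=
  (g.supp_jdg_ups (Θ := [A]) h).ty
theorem supp_tm1 (h : Der T (A :: Γ) (.tm b B)) : (b.subst (PTm.up σ)).Supp (upL (names w.rank)) :=
  (g.supp_jdg_ups (Θ := [A]) h).tm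
theorem supp_prop1 (h : Der T (A :: Γ) (.ty k (.ofProp φ))) :
    (φ.subst (PTm.up σ)).Supp (upL (names w.rank)) := (g.supp_jdg_ups (Θ := [A]) h).prop
theorem supp_prop2 (h : Der T (B :: A :: Γ) (.ty k (.ofProp φ))) :
    (φ.subst (PTm.up (PTm.up σ))).Supp (upL (upL (names w.rank))) :=
  (g.supp_jdg_ups (Θ := [B, A]) h).prop
theorem supp_tm3 {D : PCol} (h : Der T (C :: B :: A :: Γ) (.tm c D)) :
    (c.subst (PTm.up (PTm.up (PTm.up σ)))).Supp (upL (upL (upL (names w.rank)))) :=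
  (g.supp_jdg_ups (Θ := [C, B, A]) h).tm

end Good

namespace Described

theorem kind (h : Described T Γ (.ty k A)) : Described T Γ (.ty k' A) := h
theorem retype (h : Described T Γ (.tm a A)) : Described T Γ (.tm a B) := h

theorem rep (ih : Described T Γ (.ty k A)) (g : Good w σ Γ) :
    Rep (nm w) (A.subst σ).eta (A.subst σ) := ih w σ g

theorem repT (ih : Described T Γ (.tm a A)) (g : Good w σ Γ) :
    RepT (nm w) (a.subst σ).delta (a.subst σ) := ih w σ g

theorem rep₁ (ih : Described T (A :: Γ) (.ty k B)) (h : Der T (A :: Γ) (.ty k B))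
    (g : Good w σ Γ) : Rep₁ (nm w) (B.subst (PTm.up σ)).eta (A.subst σ) (B.subst (PTm.up σ)) :=
  fun _ hw x _ hx => ih.at_names (Θ := [A]) h g hw [x] rfl ((g.mono hw).cons hx)

theorem repT₁ (ih : Described T (A :: Γ) (.tm b B)) (h : Der T (A :: Γ) (.tm b B))
    (g : Good w σ Γ) : RepT₁ (nm w) (b.subst (PTm.up σ)).delta (A.subst σ) (b.subst (PTm.up σ)) :=
  fun _ hw x _ hx => ih.at_names (Θ := [A]) h g hw [x] rfl ((g.mono hw).cons hx)

theorem repP (ih : Described T Γ (.ty k (.ofProp φ))) (h : Der T Γ (.prop φ))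
    (g : Good w σ Γ) : RepP (nm w) (φ.subst σ).hat (φ.subst σ) := fun w' hw => by
  have := ih w σ g w' hw M.empty
  have h' := (g.mono hw).tr h
  simpa only [Jdg.desc, Jdg.subst, Sem, PCol.subst, force_ofProp, el_ofProp h', true_and] using this

theorem repP₁ (ih : Described T (A :: Γ) (.ty k (.ofProp φ))) (h : Der T (A :: Γ) (.prop φ))
    (g : Good w σ Γ) : RepP₁ (nm w) (φ.subst (PTm.up σ)).hat (A.subst σ) (φ.subst (PTm.up σ)) :=
  fun w' hw x hx => by
    have := (kind (k' := .prop) ih).at_names (Θ := [A]) h g hw [x] rfl ((g.mono hw).cons hx) (z := M.empty)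
    have h' : w'.Tr [] (.prop ((φ.subst (PTm.up σ)).inst [x.name] 0)) := by
      filter_upwards [(g.mono hw).tr1 h, hx] with Δ h1 h2 using h1.inst_one_ty h2
    change (PCol.ofProp _).eta.force _ _ ↔ w'.El (.ofProp ((φ.subst (PTm.up σ)).inst [x.name] 0)) _
      at this
    rw [force_ofProp, el_ofProp h'] at this
    simp only [true_and] at this
    exact this

theorem repP₂ (ih : Described T (A.inst [] 1 :: A :: Γ) (.ty k (.ofProp R)))
    (h : Der T (A.inst [] 1 :: A :: Γ) (.prop R)) (g : Good w σ Γ) :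
    RepP₂ (nm w) (R.subst (PTm.up (PTm.up σ))).hat (A.subst σ) (R.subst (PTm.up (PTm.up σ))) :=
  fun w' hw x y hx hy => by
    have g' := ((g.mono hw).cons hx).cons (A := A.inst [] 1) (x := y) (by
      rw [PCol.wk_eq, PCol.ren_subst]; exact hy)
    have := (kind (k' := .prop) ih).at_names (Θ := [A.inst [] 1, A]) h g hw [y, x] rfl g' (z := M.empty)
    have e1 := Jdg.ups_subst_sb (.prop R) [y.name, x.name] σ
    have h' : w'.Tr [] (.prop ((R.subst (PTm.up (PTm.up σ))).inst [y.name, x.name] 0)) := by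
      have := g'.tr h
      change w'.Tr [] (Jdg.subst (sconsL [y.name, x.name] σ) (.prop R)) at this
      rw [← e1] at this
      exact this
    change (PCol.ofProp _).eta.force _ _ ↔
      w'.El (.ofProp ((R.subst (PTm.up (PTm.up σ))).inst [y.name, x.name] 0)) _ at this
    rw [force_ofProp, el_ofProp h'] at this
    simp only [true_and] at this
    exact this

theorem repT₂ (ih : Described T (B :: A :: Γ) (.tm b C)) (h : Der T (B :: A :: Γ) (.tm b C))
    (g : Good w σ Γ) (hx : w.El (A.subst σ) x) (hy : w.El ((B.subst (PTm.up σ)).inst [x.name] 0) y) :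
    (b.subst (PTm.up (PTm.up σ))).delta.force w (z ▹ y ▹ x ▹ nm w) ↔
      w.IsVal ((b.subst (PTm.up (PTm.up σ))).inst [y.name, x.name] 0) z := by
  have e1 := Jdg.ups_subst_sb (.ty .col B) [x.name] σ
  have g' := (g.cons hx).cons (A := B) (x := y) (by
    have : w.El ((B.subst (ups 1 σ)).subst (PTm.sb [x.name] 0)) y := hy
    simp only [Jdg.subst, Jdg.ty.injEq, true_and, List.length_singleton] at e1
    rwa [e1] at this)
  have := ih.at_names (Θ := [B, A]) h g le_rfl [y, x] rfl g' (z := z)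
  rw [rese_refl] at this
  exact this

theorem repT₃ (ih : Described T (C.inst [.var 1] 2 :: A.inst [] 1 :: .list A :: Γ) (.tm c B))
    (h : Der T (C.inst [.var 1] 2 :: A.inst [] 1 :: .list A :: Γ) (.tm c B)) (g : Good w σ Γ) :
    RepT₃ (nm w) (c.subst (PTm.up (PTm.up (PTm.up σ)))).delta (A.subst σ) (C.subst (PTm.up σ))
      (c.subst (PTm.up (PTm.up (PTm.up σ)))) := fun w' hw l x r z hl hx hr => by
  have g1 := (g.mono hw).cons (A := .list A) hl
  have g2 := g1.cons (A := A.inst [] 1) (x := x) (by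
    rw [PCol.wk_eq, PCol.ren_subst]; exact hx)
  have e1 := Jdg.ups_subst_sb (.ty .col C) [l.name] σ
  simp only [Jdg.subst, Jdg.ty.injEq, true_and, List.length_singleton] at e1
  have g3 := g2.cons (A := C.inst [.var 1] 2) (x := r) (by
    rw [PCol.inst, PTm.sb_cons, PCol.subst_subst, scons_subst]
    have : w'.El ((C.subst (ups 1 σ)).subst (PTm.sb [l.name] 0)) r := hr
    rw [e1] at this
    exact this)
  exact ih.at_names (Θ := [_, _, _]) h g hw [r, x, l] rfl g3 (z := z)

/-! ### Propositions -/

theorem prop (h : Der T Γ (.prop φ))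
    (H : ∀ (w : World T) σ, Good w σ Γ →
      ((φ.subst σ).hat.force w (nm w) ↔ w.Tr [] (.holds (φ.subst σ)))) :
    Described T Γ (.ty k (.ofProp φ)) := .kind <| .intro h fun w σ g z => by
  rw [Jdg.subst, Jdg.desc, Sem, PCol.subst, force_ofProp, el_ofProp (g.tr h), H w σ g]

theorem and_guard (hp : Der T Γ (.prop (.and φ ψ))) (hφ : Der T Γ (.prop φ))
    (hψ : Der T (.ofProp φ :: Γ) (.prop (ψ.inst [] 1))) (ihφ : Described T Γ (.ty k (.ofProp φ)))
    (H : ∀ (w : World T) σ, Good w σ Γ → w.Tr [] (.holds (φ.subst σ)) →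
      ((ψ.subst σ).hat.force w (nm w) ↔ w.Tr [] (.holds (ψ.subst σ)))) :
    Described T Γ (.ty k' (.ofProp (.and φ ψ))) := prop hp fun w σ g => by
  have h1 := g.tr1 hψ
  have h2 := ihφ.repP hφ g w le_rfl
  rw [rese_refl] at h2
  rw [PProp.subst, tr_and (g.tr hp) (g.tr hφ), PProp.hat, SFm.force_and, h2]
  · exact and_congr_right fun h => H w σ g h
  · simp only [Jdg.subst, PCol.subst, PProp.wk_eq, PProp.ren_subst] at h1
    rw [PProp.subst_ren]
    exact h1

theorem imp_guard (hp : Der T Γ (.prop (.imp φ ψ))) (hφ : Der T Γ (.prop φ))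
    (hψ : Der T (.ofProp φ :: Γ) (.prop (ψ.inst [] 1))) (ihφ : Described T Γ (.ty k (.ofProp φ)))
    (H : ∀ (w : World T) σ, Good w σ Γ → w.Tr [] (.holds (φ.subst σ)) →
      ((ψ.subst σ).hat.force w (nm w) ↔ w.Tr [] (.holds (ψ.subst σ)))) :
    Described T Γ (.ty k' (.ofProp (.imp φ ψ))) := prop hp fun w σ g => by
  have h1 := g.tr1 hψ
  have s2 : (ψ.subst σ).Supp (names w.rank) := fun τ τ' ht => by
    have := g.supp_prop hp τ τ' ht
    simp only [PProp.subst, PProp.imp.injEq] at this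
    exact this.2
  rw [PProp.subst, tr_imp_iff (g.supp_prop hφ) s2 (g.tr hp) (g.tr hφ), PProp.hat, SFm.force_imp]
  · refine forall_congr' fun w' => forall_congr' fun hw => ?_
    rw [ihφ.repP hφ g w' hw]
    refine imp_congr_right fun h => ?_
    rw [← H w' σ (g.mono hw) h]
    exact force_hat_congr s2 w.names_nonempty fun i hi => nm_mono hw hi
  · simp only [Jdg.subst, PCol.subst, PProp.wk_eq, PProp.ren_subst] at h1
    rw [PProp.subst_ren]
    exact h1

theorem repP_self (ih : Described T Γ (.ty k (.ofProp φ))) (h : Der T Γ (.prop φ)) (g : Good w σ Γ) :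
    (φ.subst σ).hat.force w (nm w) ↔ w.Tr [] (.holds (φ.subst σ)) := by
  have := ih.repP h g w le_rfl
  rwa [rese_refl] at this

theorem and (hφ : Der T Γ (.prop φ)) (hψ : Der T Γ (.prop ψ))
    (ihφ : Described T Γ (.ty k (.ofProp φ))) (ihψ : Described T Γ (.ty k (.ofProp ψ))) :
    Described T Γ (.ty k' (.ofProp (.and φ ψ))) :=
  and_guard (.andF .large hφ hψ) hφ (hψ.wk (.propCol hφ)) ihφ fun _ _ g _ => ihψ.repP_self hψ g

theorem imp (hφ : Der T Γ (.prop φ)) (hψ : Der T Γ (.prop ψ))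
    (ihφ : Described T Γ (.ty k (.ofProp φ))) (ihψ : Described T Γ (.ty k (.ofProp ψ))) :
    Described T Γ (.ty k' (.ofProp (.imp φ ψ))) :=
  imp_guard (.impF .large hφ hψ) hφ (hψ.wk (.propCol hφ)) ihφ fun _ _ g _ => ihψ.repP_self hψ g

theorem or (hφ : Der T Γ (.prop φ)) (hψ : Der T Γ (.prop ψ))
    (ihφ : Described T Γ (.ty k (.ofProp φ))) (ihψ : Described T Γ (.ty k (.ofProp ψ))) :
    Described T Γ (.ty k' (.ofProp (.or φ ψ))) := prop (.orF .large hφ hψ) fun w σ g => by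
  rw [PProp.subst, tr_or (g.supp_prop hφ) (g.supp_prop hψ) (g.tr hφ) (g.tr hψ), PProp.hat,
    SFm.force_or, ihφ.repP_self hφ g, ihψ.repP_self hψ g]

theorem ex (hA : Der T Γ (.ty .col A)) (hφ : Der T (A :: Γ) (.prop φ))
    (ihA : Described T Γ (.ty k A)) (ihφ : Described T (A :: Γ) (.ty k (.ofProp φ))) :
    Described T Γ (.ty k' (.ofProp (.ex A φ))) := prop (.exF .large hA hφ) fun w σ g => by
  have h1 := ihφ.repP₁ hφ g w le_rfl
  rw [rese_refl] at h1
  rw [PProp.subst, tr_ex (PProp.supp_quant (g.supp_ty hA) (g.supp_prop1 hφ)) (g.tr hA) (g.tr1 hφ),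
    PProp.hat, SFm.force_ex]
  refine exists_congr fun x => ?_
  rw [SFm.force_and, (ihA.rep g).self]
  exact and_congr_right (h1 x)

theorem all (hA : Der T Γ (.ty .col A)) (hφ : Der T (A :: Γ) (.prop φ))
    (ihA : Described T Γ (.ty k A)) (ihφ : Described T (A :: Γ) (.ty k (.ofProp φ))) :
    Described T Γ (.ty k' (.ofProp (.all A φ))) := prop (.allF .large hA hφ) fun w σ g => by
  rw [PProp.subst, tr_all (PProp.supp_quant (g.supp_ty hA) (g.supp_prop1 hφ)) (g.tr hA) (g.tr1 hφ),
    PProp.hat]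
  simp only [SFm.force_all_imp]
  refine forall_congr' fun w' => forall_congr' fun hw => forall_congr' fun x => ?_
  rw [ihA.rep g w' hw x]
  exact imp_congr_right (ihφ.repP₁ hφ g w' hw x)

theorem mem (ha : Der T Γ (.tm a .V)) (hb : Der T Γ (.tm b .V)) (iha : Described T Γ (.tm a .V))
    (ihb : Described T Γ (.tm b .V)) : Described T Γ (.ty k (.ofProp (.mem a b))) :=
  prop (.propsProp (.memF ha hb)) fun w σ g => by
    obtain ⟨x, hx⟩ := exists_isVal (g.supp_tm ha) (g.tr ha)
    obtain ⟨y, hy⟩ := exists_isVal (g.supp_tm hb) (g.tr hb)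
    rw [PProp.subst, ← hx.mem hy]
    simp (maxDischargeDepth := 9) [PProp.hat, PTm.delta_wf, (iha.repT g).self, (ihb.repT g).self]
    constructor
    · rintro ⟨u, hu, v, hv, h⟩
      rwa [hx.unique hu, hy.unique hv]
    · exact fun h => ⟨x, hx, y, hy, h⟩

theorem memCol (ha : Der T Γ (.tm a .V)) (hA : Der T Γ (.ty .col A))
    (iha : Described T Γ (.tm a .V)) (ihA : Described T Γ (.ty k A)) :
    Described T Γ (.ty k' (.ofProp (.memCol a A))) :=
  prop (.memColF ha hA) fun w σ g => by
    obtain ⟨x, hx⟩ := exists_isVal (g.supp_tm ha) (g.tr ha)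
    simp only [PProp.subst, PProp.hat, SFm.force_ex, SFm.force_and, (iha.repT g).self,
      (ihA.rep g).self]
    constructor
    · rintro ⟨y, hy, hA'⟩
      filter_upwards [g.tr hA, hA'.tr hy] with Δ h1 h2 using .memColI h1 h2
    · intro h
      refine ⟨x, hx, hx.el ?_⟩
      filter_upwards [g.tr hA, g.tr ha, h] with Δ h1 h2 h3 using .memColE h1 h2 h3

theorem eq (hA : Der T Γ (.ty .col A)) (ha : Der T Γ (.tm a A)) (hb : Der T Γ (.tm b A))
    (ihA : Described T Γ (.ty k A)) (iha : Described T Γ (.tm a A))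
    (ihb : Described T Γ (.tm b A)) : Described T Γ (.ty k' (.ofProp (.eq A a b))) :=
  prop (.eqF .large hA ha hb) fun w σ g => by
    obtain ⟨x, hx⟩ := exists_isVal (g.supp_tm ha) (Tr.toV (g.tr ha))
    obtain ⟨y, hy⟩ := exists_isVal (g.supp_tm hb) (Tr.toV (g.tr hb))
    simp only [PProp.subst, PProp.hat, SFm.force_ex, SFm.force_and, (iha.repT g).self,
      (ihb.repT g).self, (ihA.rep g).self]
    constructor
    · rintro ⟨z, h1, h2, -⟩
      filter_upwards [g.tr hA, g.tr ha, g.tr hb, h1.eq h2] with Δ k1 k2 k3 k4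
      have k5 := Der.ofVEq k2 k3 k4
      exact .conv (.eqI k1 k2) (.propColEq (.eqFEq .large (.tyRefl k1) (.tmRefl k2) k5
        (.eqF .large k1 k2 k2) (.eqF .large k1 k2 k3)))
    · intro h
      have : x = y := (hx.eq_iff hy).1 (by
        filter_upwards [g.tr hA, g.tr ha, g.tr hb, h] with Δ k1 k2 k3 k4
        exact .toVEq (.eqE k1 k2 k3 k4))
      exact ⟨x, hx, this ▸ hy, hx.el (g.tr ha)⟩

end Described

end World

end EmTT

namespace EmTT

variable {T : SetTheory}

theorem PCol.inst_one_subst (C : PCol) (a : PTm) (σ : ℕ → PTm) :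
    (C.inst [a] 0).subst σ = (C.subst (PTm.up σ)).inst [a.subst σ] 0 :=
  PCol.inst_subst C [a] (m := 0) (n := 0) le_rfl σ

open World

namespace World

variable {w w' w'' : World T} {Γ Δ : Ctx} {σ τ : ℕ → PTm} {J : Jdg} {A B C D : PCol} {k k' : Kind}
  {a b c d f m n t : PTm} {φ ψ R : PProp} {e : ℕ → M w} {x y z v : M w} {L : Set ℕ}

theorem IsVal.ex_iff (hx : w.IsVal a x) {p : M w → Prop} : (∃ u, w.IsVal a u ∧ p u) ↔ p x :=
  ⟨fun ⟨_, hu, h⟩ => hx.unique hu ▸ h, fun h => ⟨x, hx, h⟩⟩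

theorem IsVal.eq_val_iff (hx : w.IsVal a x) : z = x ↔ w.IsVal a z :=
  ⟨fun h => h ▸ hx, fun h => h.unique hx⟩

theorem Good.exists_isVal (g : Good w σ Γ) (h : Der T Γ (.tm a A)) :
    ∃ x, w.IsVal (a.subst σ) x ∧ w.El (A.subst σ) x := by
  obtain ⟨x, hx⟩ := World.exists_isVal (g.supp_tm h) (Tr.toV (g.tr h))
  exact ⟨x, hx, hx.el (g.tr h)⟩

namespace Described

theorem type (h : Der T Γ (.ty k A)) (H : ∀ (w : World T) σ, Good w σ Γ →
      ∀ z, (A.subst σ).eta.force w (z ▹ nm w) ↔ w.El (A.subst σ) z) :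
    Described T Γ (.ty k' A) := .kind <| .intro h H

theorem term (h : Der T Γ (.tm a A)) (H : ∀ (w : World T) σ, Good w σ Γ →
      ∀ z, (a.subst σ).delta.force w (z ▹ nm w) ↔ w.IsVal (a.subst σ) z) :
    Described T Γ (.tm a B) := .retype <| .intro h H

/-! ### Set-theoretic constructions -/

theorem empty (h : Der T Γ .wf) : Described T Γ (.tm .empty A) :=
  term (.emptyI h) fun w σ g z => by
    simp only [PTm.subst, PTm.delta, SFm.force_eq, ev_empty, ev_var, econs_zero]
    exact IsVal.empty.eq_val_iff

theorem omega (h : Der T Γ .wf) : Described T Γ (.tm .omega A) :=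
  term (.omegaI h) fun w σ g z => by
    simp only [PTm.subst, PTm.delta, SFm.force_eq, ev_omega, ev_var, econs_zero]
    exact (isVal_val (fun _ _ _ => rfl) (by filter_upwards [tr_wf] with Δ h using .omegaI h)).eq_val_iff

theorem upair (ha : Der T Γ (.tm a .V)) (hb : Der T Γ (.tm b .V)) (iha : Described T Γ (.tm a .V))
    (ihb : Described T Γ (.tm b .V)) : Described T Γ (.tm (.upair a b) A) :=
  term (.upairI ha hb) fun w σ g z => by
    obtain ⟨x, hx, -⟩ := g.exists_isVal ha
    obtain ⟨y, hy, -⟩ := g.exists_isVal hb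
    simp (maxDischargeDepth := 9) only [PTm.subst, PTm.delta]
    simp (maxDischargeDepth := 9) [PTm.delta_wf, (iha.repT g).self, (ihb.repT g).self, hx.ex_iff,
      hy.ex_iff]
    exact (hx.upair hy).eq_val_iff

theorem union (ha : Der T Γ (.tm a .V)) (iha : Described T Γ (.tm a .V)) :
    Described T Γ (.tm (.union a) A) :=
  term (.unionI ha) fun w σ g z => by
    obtain ⟨x, hx, -⟩ := g.exists_isVal ha
    simp only [PTm.subst, PTm.delta]
    simp (maxDischargeDepth := 9) [PTm.delta_wf, (iha.repT g).self, hx.ex_iff]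
    exact hx.union.eq_val_iff

theorem power (hT : T ≠ .CZF) (ha : Der T Γ (.tm a .V)) (iha : Described T Γ (.tm a .V)) :
    Described T Γ (.tm (.power a) A) :=
  term (.powerI hT ha) fun _ _ g _ =>
    isVal_power_delta hT (g.supp_tm ha) (g.tr ha) (PTm.delta_wf _) (iha.repT g)

theorem sep (ha : Der T Γ (.tm a .V)) (hφ : Der T (.V :: Γ) (.prop φ))
    (hφ' : T = .CZF → Der T (.V :: Γ) (.props φ)) (iha : Described T Γ (.tm a .V))
    (ihφ : Described T (.V :: Γ) (.ty k (.ofProp φ))) : Described T Γ (.tm (.sep a φ) A) :=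
  term (Der.sep_V ha hφ hφ') fun _ _ g _ =>
    isVal_sep_delta (g.supp_tm ha) (g.supp_prop1 hφ) (g.tr1 hφ) (fun hT => g.tr1 (hφ' hT)) (g.tr ha)
      (PTm.delta_wf _) (PProp.hat_wf _) (iha.repT g) (ihφ.repP₁ hφ g)

theorem compr (hφ : Der T (.V :: Γ) (.prop φ)) (ihφ : Described T (.V :: Γ) (.ty k (.ofProp φ))) :
    Described T Γ (.ty k' (.compr φ)) := type (.comprF hφ) fun w σ g z => by
  have := ihφ.repP₁ hφ g w le_rfl z el_V
  rw [rese_refl] at this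
  rw [PCol.subst, PCol.eta, this, el_compr (g.tr1 hφ)]

theorem name (hA : Der T Γ (.ty .set A)) (ihA : Described T Γ (.ty k A)) :
    Described T Γ (.tm (.name A) B) := term (.nameI hA) fun _ _ g _ =>
  isVal_name_delta (g.tr hA) (g.supp_ty hA) (PCol.eta_wf _) (ihA.rep g)

/-! ### Dependent sums -/

theorem sigma (hA : Der T Γ (.ty .col A)) (hB : Der T (A :: Γ) (.ty .col B))
    (ihA : Described T Γ (.ty k A)) (ihB : Described T (A :: Γ) (.ty .col B)) :
    Described T Γ (.ty k' (.sigma A B)) := type (.sigmaF .large hA hB) fun _ _ g _ =>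
  rep_sigma (g.tr hA) (g.tr1 hB) (g.supp_ty hA) (g.supp_ty1 hB) (PCol.eta_wf _) (PCol.eta_wf _)
    (ihA.rep g) (ihB.rep₁ hB g)

theorem pair (hA : Der T Γ (.ty .col A)) (hB : Der T (A :: Γ) (.ty .col B)) (ha : Der T Γ (.tm a A))
    (hb : Der T Γ (.tm b (B.inst [a] 0))) (iha : Described T Γ (.tm a A))
    (ihb : Described T Γ (.tm b D)) : Described T Γ (.tm (.pair a b) C) :=
  term (.sigmaI hA hB ha hb) fun w σ g z => by
    obtain ⟨x, hx, -⟩ := g.exists_isVal ha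
    obtain ⟨y, hy, -⟩ := g.exists_isVal hb
    simp only [PTm.subst, PTm.delta]
    simp (maxDischargeDepth := 9) [PTm.delta_wf, (iha.repT g).self, (ihb.repT g).self, hx.ex_iff,
      hy.ex_iff]
    have := g.tr hb
    rw [Jdg.subst, PCol.inst_one_subst] at this
    exact (isVal_pair (g.tr hA) (g.tr1 hB) (g.tr ha) this hx hy).eq_val_iff

theorem elSigma (hA : Der T Γ (.ty .col A)) (hB : Der T (A :: Γ) (.ty .col B))
    (hC : Der T (.sigma A B :: Γ) (.ty .col C)) (hd : Der T Γ (.tm d (.sigma A B)))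
    (hm : Der T (B :: A :: Γ) (.tm m (C.inst [.pair (.var 1) (.var 0)] 2)))
    (ihA : Described T Γ (.ty k A)) (ihB : Described T (A :: Γ) (.ty .col B))
    (ihd : Described T Γ (.tm d (.sigma A B)))
    (ihm : Described T (B :: A :: Γ) (.tm m (C.inst [.pair (.var 1) (.var 0)] 2))) :
    Described T Γ (.tm (.elSigma d m) D) :=
  term (.sigmaE hA hB hC hd hm) fun w σ g z => by
    obtain ⟨p, hp, hpS⟩ := g.exists_isVal hd
    obtain ⟨x, y, hx, hy, rfl⟩ := (el_sigma (g.tr hA) (g.tr1 hB) (g.supp_ty hA) (g.supp_ty1 hB)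
      (PCol.eta_wf _) (PCol.eta_wf _) (ihA.rep g) (ihB.rep₁ hB g)).1 hpS
    have h2 := g.tr2 hm
    have e1 : (C.inst [.pair (.var 1) (.var 0)] 2).subst (PTm.up (PTm.up σ)) =
      (C.subst (PTm.up σ)).inst [.pair (.var 1) (.var 0)] 2 :=
        PCol.inst_subst C [.pair (.var 1) (.var 0)] (m := 2) (n := 2) le_rfl σ
    rw [Jdg.subst, e1] at h2
    simp only [PTm.subst, PTm.delta]
    simp (maxDischargeDepth := 9) [PTm.delta_wf, (ihd.repT g).self, hp.ex_iff, M.fst_pair,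
      M.snd_pair]
    rw [isVal_elSigma (g.tr hA) (g.tr1 hB) (g.tr1 hC) h2 (g.tr hd) hx hy hp]
    exact ihm.repT₂ hm g hx hy

/-! ### Dependent products -/

theorem pi (hA : Der T Γ (.ty .set A)) (hB : Der T (A :: Γ) (.ty .set B))
    (ihA : Described T Γ (.ty k A)) (ihB : Described T (A :: Γ) (.ty .set B)) :
    Described T Γ (.ty k' (.pi A B)) := type (.piF hA hB) fun _ _ g _ =>
  rep_pi (g.tr hA) (g.supp_ty hA) (g.tr1 hB) (g.supp_ty1 hB) (PCol.eta_wf _) (PCol.eta_wf _)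
    (ihA.rep g) (ihB.rep₁ hB g)

theorem lam (h : Der T Γ (.tm (.lam A b) C)) (hA : Der T Γ (.ty .set A))
    (hb : Der T (A :: Γ) (.tm b B)) (ihA : Described T Γ (.ty k A))
    (ihb : Described T (A :: Γ) (.tm b B)) : Described T Γ (.tm (.lam A b) D) :=
  term h fun _ _ g _ =>
    isVal_lam (g.tr hA) (g.supp_ty hA) (g.tr1 hb) (g.supp_tm1 hb) (PCol.eta_wf _) (PTm.delta_wf _)
      (ihA.rep g) (ihb.repT₁ hb g)

theorem app (h : Der T Γ (.tm (.app f a) C)) (hf : Der T Γ (.tm f B)) (ha : Der T Γ (.tm a A))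
    (H : ∀ (w : World T) σ, Good w σ Γ → ∀ F, w.IsVal (f.subst σ) F →
      (∃ B', w.Tr [A.subst σ] (.tm (.app ((f.subst σ).inst [] 1) (.var 0)) B')) ∧
      IsGraph (A.subst σ) (.app ((f.subst σ).inst [] 1) (.var 0)) F)
    (ihf : Described T Γ (.tm f B)) (iha : Described T Γ (.tm a A)) :
    Described T Γ (.tm (.app f a) D) := term h fun w σ g z => by
  obtain ⟨x, hx, -⟩ := g.exists_isVal ha
  obtain ⟨F, hF, -⟩ := g.exists_isVal hf
  obtain ⟨⟨B', h1⟩, h2⟩ := H w σ g F hF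
  simp only [PTm.subst, PTm.delta, SFm.force_ex, SFm.force_and, SFm.force_eq]
  simp (maxDischargeDepth := 9) [PTm.delta_wf, (ihf.repT g).self, (iha.repT g).self, hx.ex_iff,
    hF.ex_iff]
  exact (isVal_app h1 (g.supp_tm hf) h2 (g.tr ha) hx).symm

theorem app_pi (hA : Der T Γ (.ty .set A)) (hB : Der T (A :: Γ) (.ty .set B))
    (hf : Der T Γ (.tm f (.pi A B))) (ha : Der T Γ (.tm a A))
    (ihf : Described T Γ (.tm f (.pi A B))) (iha : Described T Γ (.tm a A)) :
    Described T Γ (.tm (.app f a) D) :=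
  app (.piE hA hB hf ha) hf ha (fun w σ g F hF =>
    ⟨⟨B.subst (PTm.up σ), by
      filter_upwards [g.tr hA, g.tr1 hB, g.tr hf] with Δ h1 h2 h3 using Der.app_var h1 h2 h3⟩,
    graph_pi (g.tr hA) (g.supp_ty hA) (g.tr1 hB) (g.tr hf) (g.supp_tm hf) hF⟩) ihf iha

theorem app_fun (hA : Der T Γ (.ty .set A)) (hf : Der T Γ (.tm f (.funPow1 A)))
    (ha : Der T Γ (.tm a A)) (ihf : Described T Γ (.tm f (.funPow1 A)))
    (iha : Described T Γ (.tm a A)) : Described T Γ (.tm (.app f a) D) :=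
  app (.funE hA hf ha) hf ha (fun w σ g F hF =>
    ⟨⟨.pow1, by
      filter_upwards [g.tr hA, g.tr hf] with Δ h1 h3 using Der.app_var_pow h1 h3⟩,
    graph_funPow1 (g.tr hA) (g.supp_ty hA) (g.tr hf) (g.supp_tm hf) hF⟩) ihf iha

theorem funPow1 (hA : Der T Γ (.ty .set A)) (ihA : Described T Γ (.ty k A)) :
    Described T Γ (.ty k' (.funPow1 A)) := type (.funF hA) fun _ _ g _ =>
  rep_funPow1 (g.tr hA) (g.supp_ty hA) (PCol.eta_wf _) etaPow1_wf (ihA.rep g)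
    fun _ _ _ _ _ => rep_pow1

/-! ### Disjoint sums -/

theorem sum (hA : Der T Γ (.ty .set A)) (hB : Der T Γ (.ty .set B)) (ihA : Described T Γ (.ty k A))
    (ihB : Described T Γ (.ty k B)) : Described T Γ (.ty k' (.sum A B)) :=
  type (.sumF hA hB) fun _ _ g _ =>
    rep_sum (g.tr hA) (g.tr hB) (g.supp_ty hA) (g.supp_ty hB) (PCol.eta_wf _) (PCol.eta_wf _)
      (ihA.rep g) (ihB.rep g)

theorem inl (hA : Der T Γ (.ty .set A)) (hB : Der T Γ (.ty .set B)) (ha : Der T Γ (.tm a A))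
    (iha : Described T Γ (.tm a A)) : Described T Γ (.tm (.inl a) D) :=
  term (.sumI1 hA hB ha) fun w σ g z => by
    obtain ⟨x, hx, -⟩ := g.exists_isVal ha
    simp only [PTm.subst, PTm.delta]
    simp (maxDischargeDepth := 9) [PTm.delta_wf, (iha.repT g).self, hx.ex_iff]
    exact (isVal_inl (g.tr hA) (g.tr hB) (g.tr ha) hx).eq_val_iff

theorem inr (hA : Der T Γ (.ty .set A)) (hB : Der T Γ (.ty .set B)) (ha : Der T Γ (.tm a B))
    (iha : Described T Γ (.tm a B)) : Described T Γ (.tm (.inr a) D) :=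
  term (.sumI2 hA hB ha) fun w σ g z => by
    obtain ⟨x, hx, -⟩ := g.exists_isVal ha
    simp only [PTm.subst, PTm.delta]
    simp (maxDischargeDepth := 9) [PTm.delta_wf, (iha.repT g).self, hx.ex_iff]
    exact (isVal_inr (g.tr hA) (g.tr hB) (g.tr ha) hx).eq_val_iff

theorem elSum (hA : Der T Γ (.ty .set A)) (hB : Der T Γ (.ty .set B))
    (hC : Der T (.sum A B :: Γ) (.ty .col C)) (hd : Der T Γ (.tm d (.sum A B)))
    (hm : Der T (A :: Γ) (.tm m (C.inst [.inl (.var 0)] 1)))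
    (hn : Der T (B :: Γ) (.tm n (C.inst [.inr (.var 0)] 1))) (ihA : Described T Γ (.ty k A))
    (ihB : Described T Γ (.ty k B)) (ihd : Described T Γ (.tm d (.sum A B)))
    (ihm : Described T (A :: Γ) (.tm m (C.inst [.inl (.var 0)] 1)))
    (ihn : Described T (B :: Γ) (.tm n (C.inst [.inr (.var 0)] 1))) :
    Described T Γ (.tm (.elSum d m n) D) :=
  term (.sumE hA hB hC hd hm hn) fun w σ g z => by
    obtain ⟨p, hp, hpS⟩ := g.exists_isVal hd
    have h1 := g.tr1 hm
    have h2 := g.tr1 hn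
    have e1 : ∀ a, (C.inst [a] 1).subst (PTm.up σ) = (C.subst (PTm.up σ)).inst [a.subst (PTm.up σ)] 1 :=
      fun a => PCol.inst_subst C [a] (m := 1) (n := 1) le_rfl σ
    rw [Jdg.subst, e1] at h1 h2
    simp only [PTm.subst, PTm.delta]
    simp (maxDischargeDepth := 9) [PTm.delta_wf, (ihd.repT g).self, hp.ex_iff]
    rcases el_sum (g.tr hA) (g.tr hB) (g.supp_ty hA) (g.supp_ty hB) (PCol.eta_wf _) (PCol.eta_wf _)
      (ihA.rep g) (ihB.rep g) hpS with ⟨x, hx, rfl⟩ | ⟨x, hx, rfl⟩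
    · simp only [M.fst_pair, M.snd_pair, M.empty_ne_one, true_and, false_and, or_false]
      rw [isVal_elSum_inl (g.tr hA) (g.tr hB) (g.tr1 hC) h1 h2 (g.tr hd) hx hp]
      exact (ihm.repT₁ hm g).self hx
    · simp only [M.fst_pair, M.snd_pair, M.empty_ne_one.symm, true_and, false_and, false_or]
      rw [isVal_elSum_inr (g.tr hA) (g.tr hB) (g.tr1 hC) h1 h2 (g.tr hd) hx hp]
      exact (ihn.repT₁ hn g).self hx

/-! ### Lists -/

theorem list (hA : Der T Γ (.ty .set A)) (ihA : Described T Γ (.ty k A)) :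
    Described T Γ (.ty k' (.list A)) := type (.listF hA) fun _ _ g _ =>
  rep_list (g.tr hA) (g.supp_ty hA) (PCol.eta_wf _) (ihA.rep g)

theorem nil (hA : Der T Γ (.ty .set A)) : Described T Γ (.tm .nil D) :=
  term (.listI1 hA) fun w σ g z => by
    simp only [PTm.subst, PTm.delta, SFm.force_eq, ev_empty, ev_var, econs_zero]
    exact (isVal_nil (g.tr hA)).eq_val_iff

theorem cons (hA : Der T Γ (.ty .set A)) (ha : Der T Γ (.tm a (.list A))) (hb : Der T Γ (.tm b A))
    (ihA : Described T Γ (.ty k A)) (iha : Described T Γ (.tm a (.list A)))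
    (ihb : Described T Γ (.tm b A)) : Described T Γ (.tm (.cons a b) D) :=
  term (.listI2 hA ha hb) fun w σ g z => by
    obtain ⟨x, hx, -⟩ := g.exists_isVal ha
    obtain ⟨y, hy, -⟩ := g.exists_isVal hb
    simp only [PTm.subst, PTm.delta]
    simp (maxDischargeDepth := 9) [PTm.delta_wf, (iha.repT g).self, (ihb.repT g).self, hx.ex_iff,
      hy.ex_iff]
    exact (isVal_cons (g.tr hA) (g.supp_ty hA) (PCol.eta_wf _) (ihA.rep g) (g.tr ha) (g.tr hb)
      hx hy).eq_val_iff

theorem elList (hA : Der T Γ (.ty .set A)) (hC : Der T (.list A :: Γ) (.ty .col C))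
    (ha : Der T Γ (.tm a (.list A))) (hb : Der T Γ (.tm b (C.inst [.nil] 0)))
    (hc : Der T (C.inst [.var 1] 2 :: A.inst [] 1 :: .list A :: Γ)
      (.tm c (C.inst [.cons (.var 2) (.var 1)] 3)))
    (ihA : Described T Γ (.ty k A)) (iha : Described T Γ (.tm a (.list A)))
    (ihb : Described T Γ (.tm b B)) (ihc : Described T (C.inst [.var 1] 2 :: A.inst [] 1 :: .list A :: Γ)
      (.tm c (C.inst [.cons (.var 2) (.var 1)] 3))) : Described T Γ (.tm (.elList A a b c) D) :=
  term (.listE hA hC ha hb hc) fun w σ g z => by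
    have h3 := g.tr3 hc
    have h2 := g.tr hb
    rw [Jdg.subst, (list_step_subst C σ).1, (list_step_subst C σ).2, PCol.inst_nil_one_subst] at h3
    rw [Jdg.subst, PCol.inst_one_subst] at h2
    exact isVal_elList ⟨g.tr hA, g.supp_ty hA, g.tr1 hC, h2, g.supp_tm hb, h3, g.supp_tm3 hc⟩
      (PCol.eta_wf _) (PTm.delta_wf _) (PTm.delta_wf _) (PTm.delta_wf _) (ihA.rep g) (iha.repT g)
      (ihb.repT g) (ihc.repT₃ hc g) (g.tr ha) (g.supp_tm ha)

/-! ### Quotients -/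

theorem _root_.EmTT.World.Good.isQuot (g : Good w σ Γ) (hA : Der T Γ (.ty .set A))
    (hR : Der T (A.inst [] 1 :: A :: Γ) (.props R)) (hQ : Der T Γ (.ty .set (.quot A R))) :
    IsQuot w (A.subst σ) (R.subst (PTm.up (PTm.up σ))) where
  hA := g.tr hA
  sA := g.supp_ty hA
  hR := by
    have := g.tr2 hR
    rwa [PCol.inst_nil_one_subst] at this
  sR := g.supp_prop2 hR
  hQ := g.tr hQ

theorem quot (hA : Der T Γ (.ty .set A)) (hR : Der T (A.inst [] 1 :: A :: Γ) (.props R))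
    (hQ : Der T Γ (.ty .set (.quot A R))) (ihA : Described T Γ (.ty k A))
    (ihR : Described T (A.inst [] 1 :: A :: Γ) (.props R)) : Described T Γ (.ty k' (.quot A R)) :=
  type hQ fun _ _ g _ => (g.isQuot hA hR hQ).rep (PCol.eta_wf _) (PProp.hat_wf _) (ihA.rep g)
    (ihR.repP₂ (.propsProp hR) g)

theorem cls (hA : Der T Γ (.ty .set A)) (hR : Der T (A.inst [] 1 :: A :: Γ) (.props R))
    (hQ : Der T Γ (.ty .set (.quot A R))) (ha : Der T Γ (.tm a A)) (ihA : Described T Γ (.ty k A))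
    (ihR : Described T (A.inst [] 1 :: A :: Γ) (.props R)) (iha : Described T Γ (.tm a A)) :
    Described T Γ (.tm (.cls A R a) D) :=
  term (.quotI hA hR hQ ha) fun _ _ g _ =>
    (g.isQuot hA hR hQ).isVal_cls (PTm.delta_wf _) (PCol.eta_wf _) (PProp.hat_wf _) (ihA.rep g)
      (ihR.repP₂ (.propsProp hR) g) (iha.repT g) (g.tr ha) (g.supp_tm ha)

theorem elQuot (hA : Der T Γ (.ty .set A)) (hR : Der T (A.inst [] 1 :: A :: Γ) (.props R))
    (hQ : Der T Γ (.ty .set (.quot A R))) (hC : Der T (.quot A R :: Γ) (.ty .col C))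
    (hd : Der T Γ (.tm d (.quot A R)))
    (hm : Der T (A :: Γ) (.tm m (C.inst [clsVar A R] 1)))
    (hmm : Der T (.ofProp R :: A.inst [] 1 :: A :: Γ) (.tmEq (m.inst [.var 2] 3) (m.inst [.var 1] 3)
      (C.inst [.cls (A.inst [] 3) (R.inst [.var 0, .var 1] 5) (.var 2)] 3)))
    (ihA : Described T Γ (.ty k A)) (ihR : Described T (A.inst [] 1 :: A :: Γ) (.props R))
    (ihd : Described T Γ (.tm d (.quot A R)))
    (ihm : Described T (A :: Γ) (.tm m (C.inst [clsVar A R] 1))) :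
    Described T Γ (.tm (.elQuot A R d m) D) :=
  term (.quotE hA hR hQ hC hd hm hmm) fun w σ g z => by
    have h1 := g.tr1 hm
    have h3 := g.tr3 hmm
    have e1 : ∀ l, (C.inst l 1).subst (PTm.up σ) =
        (C.subst (ups l.length σ)).inst (l.map (·.subst (PTm.up σ))) 1 :=
      fun l => PCol.inst_subst C l (m := 1) (n := 1) le_rfl σ
    have e2 : (R.inst [.var 0, .var 1] 3).subst (PTm.up (PTm.up (PTm.up σ))) =
      (R.subst (PTm.up (PTm.up σ))).inst [.var 0, .var 1] 3 :=
        PProp.inst_subst R [.var 0, .var 1] (m := 3) (n := 3) le_rfl σ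
    have e3 : ∀ i : ℕ, (m.inst [.var i] 3).subst (PTm.up (PTm.up (PTm.up σ))) =
        (m.subst (PTm.up σ)).inst [(PTm.var i).subst (PTm.up (PTm.up (PTm.up σ)))] 3 := fun i =>
      PTm.inst_subst m [.var i] (m := 3) (n := 3) le_rfl σ
    have e4 : ∀ a, (C.inst [a] 3).subst (PTm.up (PTm.up (PTm.up σ))) =
        (C.subst (PTm.up σ)).inst [a.subst (PTm.up (PTm.up (PTm.up σ)))] 3 := fun a =>
      PCol.inst_subst C [a] (m := 3) (n := 3) le_rfl σ
    have e5 : (A.inst [] 3).subst (PTm.up (PTm.up (PTm.up σ))) = (A.subst σ).inst [] 3 :=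
      PCol.inst_subst A [] (m := 3) (n := 3) le_rfl σ
    have e6 : (R.inst [.var 0, .var 1] 5).subst (PTm.up (PTm.up (PTm.up (PTm.up (PTm.up σ))))) =
      (R.subst (PTm.up (PTm.up σ))).inst [.var 0, .var 1] 5 :=
        PProp.inst_subst R [.var 0, .var 1] (m := 5) (n := 5) le_rfl σ
    have h1' : w.Tr [A.subst σ] (.tm (m.subst (PTm.up σ))
        ((C.subst (PTm.up σ)).inst [clsVar (A.subst σ) (R.subst (PTm.up (PTm.up σ)))] 1)) := by
      rw [Jdg.subst, e1] at h1
      simp only [List.map, PTm.subst, PCol.inst_nil_one_subst, e2] at h1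
      exact h1
    have h3' : w.Tr [.ofProp (R.subst (PTm.up (PTm.up σ))), (A.subst σ).inst [] 1, A.subst σ]
        (.tmEq ((m.subst (PTm.up σ)).inst [.var 2] 3) ((m.subst (PTm.up σ)).inst [.var 1] 3)
        ((C.subst (PTm.up σ)).inst [.cls ((A.subst σ).inst [] 3)
          ((R.subst (PTm.up (PTm.up σ))).inst [.var 0, .var 1] 5) (.var 2)] 3)) := by
      rw [Jdg.subst, e3, e3, e4] at h3
      simp only [PTm.subst, e5, e6, PCol.inst_nil_one_subst] at h3
      exact h3
    exact (g.isQuot hA hR hQ).isVal_elQuot (PCol.eta_wf _) (PProp.hat_wf _) (PTm.delta_wf _)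
      (PTm.delta_wf _) (ihA.rep g) (ihR.repP₂ (.propsProp hR) g) (ihd.repT g) (ihm.repT₁ hm g)
      (g.tr1 hC) h1' h3' (g.tr hd) (g.supp_tm hd)

/-! ### The remaining types -/

theorem N0 (h : Der T Γ .wf) : Described T Γ (.ty k .N0) := type (.n0F h) fun w σ g z => by
  simp only [PCol.subst, PCol.eta, SFm.force_bot, not_el_N0]

theorem emp0 (h : Der T Γ (.tm (.emp0 a) C)) (ha : Der T Γ (.tm a .N0)) :
    Described T Γ (.tm (.emp0 a) D) := term h fun w σ g z => by
  obtain ⟨x, -, hx⟩ := g.exists_isVal ha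
  exact (not_el_N0 hx).elim

theorem N1 (h : Der T Γ .wf) : Described T Γ (.ty k .N1) := type (.n1F h) fun w σ g z => by
  simp only [PCol.subst, PCol.eta, SFm.force_eq, ev_var, ev_empty, econs_zero, el_N1]

theorem star (h : Der T Γ .wf) : Described T Γ (.tm .star A) := term (.n1I h) fun w σ g z => by
  simp only [PTm.subst, PTm.delta, SFm.force_eq, ev_empty, ev_var, econs_zero]
  exact isVal_star.eq_val_iff

theorem elN1 (hC : Der T (.N1 :: Γ) (.ty .col C)) (ha : Der T Γ (.tm a .N1))
    (hb : Der T Γ (.tm b (C.inst [.star] 0))) (ihb : Described T Γ (.tm b B)) :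
    Described T Γ (.tm (.elN1 a b) D) := term (.n1E hC ha hb) fun w σ g z => by
  obtain ⟨x, hx, -⟩ := g.exists_isVal ha
  have h2 := g.tr hb
  rw [Jdg.subst, PCol.inst_one_subst] at h2
  rw [PTm.subst, PTm.delta, isVal_elN1 (g.tr1 hC) (g.tr ha) hx h2]
  exact (ihb.repT g).self

theorem tt (h : Der T Γ (.tm .tt A)) : Described T Γ (.tm .tt B) := term h fun w σ g z => by
  simp only [PTm.subst, PTm.delta, SFm.force_eq, ev_empty, ev_var, econs_zero]
  exact isVal_tt.eq_val_iff

theorem pow1 (h : Der T Γ .wf) : Described T Γ (.ty k .pow1) := type (.powF h) fun _ _ _ _ =>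
  rep_pow1

theorem code (hφ : Der T Γ (.props φ)) (ihφ : Described T Γ (.props φ)) :
    Described T Γ (.tm (.code φ) A) := term (.powI hφ) fun _ _ g _ =>
  isVal_code_delta (g.supp_prop hφ) (g.tr hφ) (PProp.hat_wf _) (ihφ.repP (.propsProp hφ) g)

theorem V (h : Der T Γ .wf) : Described T Γ (.ty k .V) := type (.vF h) fun w σ g z => by
  simp only [PCol.subst, PCol.eta, SFm.force_eq, el_V]

theorem bot (h : Der T Γ .wf) : Described T Γ (.ty k (.ofProp .bot)) :=
  prop (.propsProp (.botF h)) fun w σ g => by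
    simp only [PProp.subst, PProp.hat, SFm.force_bot, not_tr_bot]

end Described

end World

end EmTT

namespace EmTT

variable {T : SetTheory}

open World

namespace World

variable {w : World T} {Γ Δ : Ctx} {σ : ℕ → PTm} {J : Jdg} {A : PCol} {a : PTm} {φ : PProp}
  {k : Kind}

theorem Good.comp {τ : ℕ → PTm} (g : Good w τ Δ)
    (hσ : ∀ i A, Γ.Has i A → Der T Δ (.tm (σ i) (A.subst σ)))
    (ihσ : ∀ i A, Γ.Has i A → Described T Δ (.tm (σ i) (A.subst σ))) :
    Good w (fun i => (σ i).subst τ) Γ where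
  sub i A hA := by
    have := g.tr (hσ i A hA)
    rwa [Jdg.subst, PCol.subst_subst] at this
  supp i hi := by
    obtain ⟨A, hA⟩ := Ctx.exists_has hi
    exact g.supp_tm (hσ i A hA)
  ok i hi := by
    obtain ⟨A, hA⟩ := Ctx.exists_has hi
    exact ihσ i A hA w τ g

theorem Good.retype_head (g : Good w σ (.V :: Γ)) (h : w.Tr [] (.tm (σ 0) ((A.inst [] 1).subst σ))) :
    Good w σ (A :: Γ) where
  sub i B hB := by
    cases hB with
    | zero => exact h
    | succ hB => exact g.sub _ _ (.succ hB)
  supp := g.supp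
  ok := g.ok

namespace Described

theorem subst (h : Described T Γ J) (hσ : ∀ i A, Γ.Has i A → Der T Δ (.tm (σ i) (A.subst σ)))
    (ihσ : ∀ i A, Γ.Has i A → Described T Δ (.tm (σ i) (A.subst σ))) : Described T Δ (J.subst σ) :=
  fun w τ g => by
    rw [Jdg.subst_subst]
    exact h w _ (g.comp hσ ihσ)

theorem var {i : ℕ} (hA : Γ.Has i A) : Described T Γ (.tm (.var i) A) := fun _ _ g =>
  g.ok i hA.lt

theorem wk (h : Described T Γ J) (hA : Der T Γ (.ty .col A)) :
    Described T (A :: Γ) (J.subst fun i => .var (i + 1)) :=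
  h.subst (fun _ _ hB => .var (.cons hA) (.succ hB)) fun _ _ hB => .var (.succ hB)

theorem mem_wk (hV : Der T Γ (.ty .col .V)) (ha : Der T Γ (.tm a .V)) (iha : Described T Γ (.tm a .V)) :
    Der T (.V :: Γ) (.prop (.mem (.var 0) (a.inst [] 1))) ∧
      Described T (.V :: Γ) (.ty k (.ofProp (.mem (.var 0) (a.inst [] 1)))) := by
  have h0 : Der T (.V :: Γ) (.tm (.var 0) .V) := .var (A := .V) (.cons hV) .zero
  exact ⟨.propsProp (.memF h0 (ha.wk hV)), .mem h0 (ha.wk hV) (var (A := .V) .zero) (iha.wk hV)⟩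

theorem memCol_wk (hA : Der T Γ (.ty .col A)) (ihA : Described T Γ (.ty .col A)) :
    Der T (.V :: Γ) (.prop (.memCol (.var 0) (A.inst [] 1))) ∧
      Described T (.V :: Γ) (.ty k (.ofProp (.memCol (.var 0) (A.inst [] 1)))) := by
  have hV : Der T Γ (.ty .col .V) := .vF hA.wf
  have h0 : Der T (.V :: Γ) (.tm (.var 0) .V) := .var (A := .V) (.cons hV) .zero
  exact ⟨.memColF h0 (hA.wk hV), .memCol (k := .col) h0 (hA.wk hV) (var (A := .V) .zero) (ihA.wk hV)⟩

theorem repP_guard (hA : Der T Γ (.ty .col A)) (hφ : Der T (A :: Γ) (.prop φ))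
    (ihφ : Described T (A :: Γ) (.ty k (.ofProp φ))) (g : Good w σ (.V :: Γ))
    (h : w.Tr [] (.holds ((PProp.memCol (.var 0) (A.inst [] 1)).subst σ))) :
    (φ.subst σ).hat.force w (nm w) ↔ w.Tr [] (.holds (φ.subst σ)) := by
  have hV : Der T Γ (.ty .col .V) := .vF hA.wf
  have h0 : Der T (.V :: Γ) (.tm (.var 0) .V) := .var (A := .V) (.cons hV) .zero
  refine ihφ.repP_self hφ (g.retype_head ?_)
  filter_upwards [g.tr (hA.wk hV), g.tr h0, h] with Δ h1 h2 h3
  exact .memColE h1 h2 h3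

end Described

end World

open Described in
theorem Der.described {Γ : Ctx} {J : Jdg} (h : Der T Γ J) : Described T Γ J := by
  have wk_prop : ∀ {Γ : Ctx} {A φ}, Der T Γ (.ty .col A) → Der T (A :: Γ) (.prop φ) →
      Der T (.ofProp (.memCol (.var 0) (A.inst [] 1)) :: .V :: Γ) (.prop (φ.inst [] 1)) :=
    fun h h' => h.rel_guard h'
  have triv : ∀ {Γ : Ctx} {A B k}, Described T Γ (.tyEq k A B) :=
    fun _ _ _ _ _ _ => Iff.rfl
  have triv' : ∀ {Γ : Ctx} {A a b}, Described T Γ (.tmEq a b A) :=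
    fun _ _ _ _ _ _ => Iff.rfl
  have triv'' : ∀ {Γ : Ctx}, Described T Γ .wf := fun _ _ _ _ _ _ => Iff.rfl
  induction h
  case nil => exact triv''
  case cons => exact triv''
  case var hA _ => exact .var hA
  case subst hJ hΔ hσ ih _ ihσ => exact ih.subst hσ ihσ
  case setCol ih => exact ih
  case propCol ih => exact ih
  case propsSet ih => exact ih
  case propsProp ih => exact ih
  case conv ih _ => exact ih
  case n0F h _ => exact .N0 h
  case n0E hM ha _ _ => exact .emp0 (.n0E hM ha) ha
  case n1F h _ => exact .N1 h
  case n1I h _ => exact .star h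
  case n1E hM ha hb _ _ ihb => exact .elN1 hM ha hb ihb
  case sigmaF s hA hB ihA ihB => exact .sigma hA.dom_col hB.dom_col ihA (.kind ihB)
  case sigmaI hA hB ha hb ihA ihB iha ihb => exact .pair hA hB ha hb iha ihb
  case sigmaE hA hB hM hd hm ihA ihB ihM ihd ihm => exact .elSigma hA hB hM hd hm ihA ihB ihd ihm
  case piF hA hB ihA ihB => exact .pi hA hB ihA ihB
  case piI hA hB hb ihA ihB ihb => exact .lam (.piI hA hB hb) hA hb ihA ihb
  case piE hA hB hf ha ihA ihB ihf iha => exact .app_pi hA hB hf ha ihf iha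
  case sumF hA hB ihA ihB => exact .sum hA hB ihA ihB
  case sumI1 hA hB ha _ _ ih => exact .inl hA hB ha ih
  case sumI2 hA hB ha _ _ ih => exact .inr hA hB ha ih
  case sumE hA hB hM hd hm hn ihA ihB ihM ihd ihm ihn =>
    exact .elSum hA hB hM hd hm hn ihA ihB ihd ihm ihn
  case listF hA ih => exact .list hA ih
  case listI1 hA _ => exact .nil hA
  case listI2 hA ha hb ihA iha ihb => exact .cons hA ha hb ihA iha ihb
  case listE hA hM ha hb hc ihA ihM iha ihb ihc => exact .elList hA hM ha hb hc ihA iha ihb ihc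
  case quotF hA hR h1 h2 h3 ihA ihR _ _ _ => exact .quot hA hR (.quotF hA hR h1 h2 h3) ihA ihR
  case quotI hA hR hQ ha ihA ihR ihQ iha => exact .cls hA hR hQ ha ihA ihR iha
  case quotE hA hR hQ hM hd hm hmm ihA ihR ihQ ihM ihd ihm _ =>
    exact .elQuot hA hR hQ hM hd hm hmm ihA ihR ihd ihm
  case powF h _ => exact .pow1 h
  case powI h ih => exact .code h ih
  case powEqF ha hb iha ihb => exact .eq (k := .col) (.powF ha.wf) ha hb (.pow1 ha.wf) iha ihb
  case funF hA ih => exact .funPow1 hA ih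
  case funI hA hb ihA ihb => exact .lam (.funI hA hb) hA hb ihA ihb
  case funE hA hf ha ihA ihf iha => exact .app_fun hA hf ha ihf iha
  case propTrue h ha _ _ => exact .tt (.propTrue h ha)
  case botF h _ => exact .bot h
  case botE h h' _ _ => exact .tt (.botE h h')
  case eqF s hA ha hb ihA iha ihb => exact .eq hA.dom_col ha hb ihA iha ihb
  case eqI h h' _ _ => exact .tt (.eqI h h')
  case andF s h h' ih ih' => exact .and h.logic_prop h'.logic_prop ih ih'
  case andI h h' h'' _ _ _ => exact .tt (.andI h h' h'')
  case andE1 h h' _ _ => exact .tt (.andE1 h h')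
  case andE2 h h' _ _ => exact .tt (.andE2 h h')
  case orF s h h' ih ih' => exact .or h.logic_prop h'.logic_prop ih ih'
  case orI1 h h' h'' _ _ _ => exact .tt (.orI1 h h' h'')
  case orI2 h h' h'' _ _ _ => exact .tt (.orI2 h h' h'')
  case orE h1 h2 h3 h4 h5 h6 _ _ _ _ _ _ => exact .tt (.orE h1 h2 h3 h4 h5 h6)
  case impF s h h' ih ih' => exact .imp h.logic_prop h'.logic_prop ih ih'
  case impI h h' _ _ => exact .tt (.impI h h')
  case impE h h' h'' _ _ _ => exact .tt (.impE h h' h'')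
  case exF s h h' ih ih' => exact .ex (k := .col) h.dom_col h'.logic_prop ih (.kind ih')
  case exI h1 h2 h3 h4 _ _ _ _ => exact .tt (.exI h1 h2 h3 h4)
  case exE h1 h2 h3 h4 h5 _ _ _ _ _ => exact .tt (.exE h1 h2 h3 h4 h5)
  case allF s h h' ih ih' => exact .all (k := .col) h.dom_col h'.logic_prop ih (.kind ih')
  case allI h1 h2 h3 _ _ _ => exact .tt (.allI h1 h2 h3)
  case allE h1 h2 h3 h4 _ _ _ _ => exact .tt (.allE h1 h2 h3 h4)
  case vF h _ => exact .V h
  case toV ih => exact ih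
  case ofV ih _ => exact ih
  case eqVF ha hb iha ihb => exact .eq (k := .col) (.vF ha.wf) ha hb (.V ha.wf) iha ihb
  case memF ha hb iha ihb => exact .mem ha hb iha ihb
  case memColF ha hA iha ihA => exact .memCol ha hA iha ihA
  case memColI h h' _ _ => exact .tt (.memColI h h')
  case memColE ih _ => exact ih
  case comprF h ih => exact .compr h ih
  case comprMem h h' _ _ => exact .tt (.comprMem h h')
  case andRelF hA hφ ihA ihφ =>
    have hm := memCol_wk (k := .col) hA ihA
    exact .and_guard (.andRelF hA hφ) hm.1 (wk_prop hA hφ) hm.2 fun _ _ g h => repP_guard hA hφ ihφ g h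
  case exRel h h' _ _ => exact .tt (.exRel h h')
  case impRelF hA hφ ihA ihφ =>
    have hm := memCol_wk (k := .col) hA ihA
    exact .imp_guard (.impRelF hA hφ) hm.1 (wk_prop hA hφ) hm.2 fun _ _ g h => repP_guard hA hφ ihφ g h
  case allRel h h' _ _ => exact .tt (.allRel h h')
  case setI ih _ => exact ih
  case nameI h ih => exact .name h ih
  case nameMem h _ => exact .tt (.nameMem h)
  case setExt h h' _ _ => exact .tt (.setExt h h')
  case emptyI h _ => exact .empty h
  case emptyMem h _ => exact .tt (.emptyMem h)
  case upairI h h' ih ih' => exact .upair h h' ih ih'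
  case upairMem h h' h'' _ _ _ => exact .tt (.upairMem h h' h'')
  case unionI h ih => exact .union h ih
  case unionMem h h' _ _ => exact .tt (.unionMem h h')
  case omegaI h _ => exact .omega h
  case omegaTrans h _ => exact .tt (.omegaTrans h)
  case omegaMin h _ => exact .tt (.omegaMin h)
  case memInd h h' _ _ => exact .tt (.memInd h h')
  case powerI hT h ih => exact .power hT h ih
  case powerMem hT h h' _ _ => exact .tt (.powerMem hT h h')
  case sepI hT h h' ih ih' => exact .sep h h' (fun h => absurd h hT) ih ih'
  case sepMem hT h h' h'' _ _ _ => exact .tt (.sepMem hT h h' h'')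
  case collection hT h h' h'' _ _ _ => exact .tt (.collection hT h h' h'')
  case lem hT h _ => exact .tt (.lem hT h)
  case bddAllF hT h h' ih ih' =>
    have hV := Der.vF h.wf
    have hm := mem_wk (k := .prop) hV h ih
    exact .all (k := .prop) hV (.impF .large hm.1 (.propsProp h')) (.V h.wf) (.imp hm.1 (.propsProp h') hm.2 ih')
  case bddExF hT h h' ih ih' =>
    have hV := Der.vF h.wf
    have hm := mem_wk (k := .prop) hV h ih
    exact .ex (k := .prop) hV (.andF .large hm.1 (.propsProp h')) (.V h.wf) (.and hm.1 (.propsProp h') hm.2 ih')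
  case sepIs hT h h' ih ih' => exact .sep h (.propsProp h') (fun _ => h') ih ih'
  case sepMems hT h h' h'' _ _ _ => exact .tt (.sepMems hT h h' h'')
  case strongColl hT h _ => exact .tt (.strongColl hT h)
  case subsetColl hT h _ => exact .tt (.subsetColl hT h)
  case powEff h h' h'' _ _ _ => exact .tt (.powEff h h' h'')
  case quotEff h1 h2 h3 h4 h5 h6 _ _ _ _ _ _ => exact .tt (.quotEff h1 h2 h3 h4 h5 h6)
  all_goals first | exact triv | exact triv'

end EmTT

namespace EmTT

variable {T : SetTheory}

/-! ## Completeness -/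

/-- The universal closure of `χ`. -/
def close : Ctx → PProp → PProp
  | [], χ => χ
  | A :: Γ, χ => close Γ (.all A χ)

theorem Der.close_prop {Γ : Ctx} {χ : PProp} (h : Der T Γ (.prop χ)) :
    Der T [] (.prop (close Γ χ)) := by
  induction Γ generalizing χ with
  | nil => exact h
  | cons A Γ ih => exact ih (.allF .large h.head h)

theorem Der.of_close {Γ : Ctx} {χ : PProp} (h : Der T Γ (.prop χ))
    (h' : Der T [] (.holds (close Γ χ))) : Der T Γ (.holds χ) := by
  induction Γ generalizing χ with
  | nil => exact h'
  | cons A Γ ih =>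
    have h1 := (ih (.allF .large h.head h) h').wk h.head
    have h2 := Der.allE (h.head.wk h.head) (h.sub1 (SubTy.wk h.head)) h1
      (.var (.cons h.head) .zero)
    rwa [PProp.inst, PTm.sb_cons, PProp.subst_subst, up_subst_scons,
      show scons (.var 0) (fun i => (PTm.var (i + 1)).subst (PTm.sb [] 0)) = PTm.var from
        funext fun i => by cases i <;> rfl, PProp.subst_var] at h2

/-- The hypothesis of a stage is discharged, and its names are replaced by the empty set. -/
theorem Der.of_stg {n : ℕ} {ψ : PProp} {J : Jdg} (hs : ψ.Supp (names 0))
    (hψ : Der T [] (.holds ψ)) (hJ : J.Supp ∅) (h : Der T (stg n ψ) J) : Der T [] J := by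
  have e : ψ.subst (scons .tt fun _ => .empty) = ψ := by
    conv_rhs => rw [← PProp.subst_var ψ]
    exact hs _ _ fun i hi => absurd hi.2 (by simp)
  have := h.sub (stg_subTy (τ := scons .tt fun _ => .empty) (hs.mono (names_pos 0))
    (by rw [e]; exact hψ) fun i hi _ => by
      obtain ⟨j, rfl⟩ := Nat.exists_eq_add_of_le' hi
      exact .emptyI .nil)
  rwa [hJ _ .var fun i hi => hi.elim, Jdg.subst_var] at this

theorem supp_zero_iff {φ : PProp} : φ.Supp (names 0) ↔ φ.Supp ∅ := by
  rw [show names 0 = ∅ from Set.eq_empty_of_forall_notMem fun i hi => absurd hi.2 (by simp)]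

theorem PProp.Supp.jdg_prop {L : Set ℕ} {φ : PProp} {k : Kind} (h : φ.Supp L) :
    (Jdg.ty k (.ofProp φ)).Supp L := fun σ τ hs => by
  simp only [Jdg.subst, PCol.subst, h σ τ hs]

theorem PProp.Supp.jdg_holds {L : Set ℕ} {φ : PProp} (h : φ.Supp L) :
    (Jdg.holds φ).Supp L := fun σ τ hs => by
  simp only [Jdg.subst, PTm.subst, PCol.subst, h σ τ hs]

theorem Der.uprop {φ : PProp} (h : Der T [] (.prop φ)) : UProp T 0 φ := by
  have e : φ.ren Nat.pred = φ := by
    conv_rhs => rw [← PProp.subst_var φ]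
    rw [PProp.ren_eq_subst]
    exact h.supp_prop _ _ fun i hi => absurd hi (Nat.not_lt_zero i)
  rwa [UProp, e]

/-- The provable closed propositions. -/
def Thy.init (T : SetTheory) : Thy T where
  rank := 0
  F := {φ | φ.Supp (names 0) ∧ Der T [] (.prop φ) ∧ Der T [] (.holds φ)}
  supp _ h := h.1
  uprop _ h := ⟨0, h.2.1.uprop⟩
  top_mem := ⟨PProp.supp_top, Der.top_prop .nil, Der.top_holds .nil⟩
  and_mem φ h ψ h' := ⟨h.1.and h'.1, .andF .large h.2.1 h'.2.1,
    .andI (.andF .large h.2.1 h'.2.1) h.2.2 h'.2.2⟩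
  closed n ψ h φ hφ hu h' := by
    have hs := supp_zero_iff.1 hφ
    obtain ⟨m, hu⟩ := hu
    exact ⟨hφ, .of_stg PProp.supp_top (Der.top_holds .nil) hs.jdg_prop
      (hu.in_stg (hφ.mono (names_pos 0)) (uprop_top m) le_rfl), .of_stg h.1 h.2.2 hs.jdg_holds h'⟩

open World

/-- Closed propositions which are true in all worlds are provable. -/
theorem Der.complete {χ : PProp} (h : Der T [] (.prop χ))
    (H : ∀ w : World T, w.Tr [] (.holds χ)) : Der T [] (.holds χ) := by
  by_contra hc
  have hs : χ.Supp ∅ := fun σ τ hst => h.supp_prop σ τ fun i hi => absurd hi (Nat.not_lt_zero i)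
  have hp : χ.Supp posNames := fun σ τ _ => hs σ τ fun i hi => hi.elim
  have ht : (PProp.top).Supp posNames := PProp.supp_top
  obtain ⟨w, -, -, -, hw⟩ := Thy.exists_world (𝓕 := .init T) (θ := .top) hp
    { supp := PProp.supp_top
      uprop := ⟨0, uprop_top 0⟩
      prop := ⟨stg 0 (.and .top .top), ⟨0, .top, (Thy.init T).top_mem, uprop_top 0, uprop_top 0, rfl⟩,
        h.uprop.in_stg hp ((uprop_top 0).and (uprop_top 0)) le_rfl⟩
      avoids := by
        rintro ⟨Δ, ⟨n, ψ, hψ, -, -, rfl⟩, hJ⟩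
        refine hc (.of_stg (hψ.1.and PProp.supp_top) ?_ hs.jdg_holds hJ)
        exact .andI (.andF .large hψ.2.1 (Der.top_prop .nil)) hψ.2.2 (Der.top_holds .nil) }
  exact hw (H w).ent

namespace World

variable {w : World T} {Γ : Ctx} {J : Jdg} {A : PCol} {a : PTm} {φ ψ χ : PProp} {x : M w}
  {ρ : ℕ → ℕ}

theorem tr_biimp (hs : φ.Supp (names w.rank)) (hs' : ψ.Supp (names w.rank))
    (hφ : w.Tr [] (.prop φ)) (hψ : w.Tr [] (.prop ψ)) : w.Tr [] (.holds (.iff φ ψ)) ↔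
      ∀ w', w ≤ w' → (w'.Tr [] (.holds φ) ↔ w'.Tr [] (.holds ψ)) := by
  have h1 : w.Tr [] (.prop (.imp φ ψ)) := by
    filter_upwards [hφ, hψ] with Δ a b using .impF .large a b
  have h2 : w.Tr [] (.prop (.imp ψ φ)) := by
    filter_upwards [hφ, hψ] with Δ a b using .impF .large b a
  have wk {φ ψ : PProp} (hφ : w.Tr [] (.prop φ)) (hψ : w.Tr [] (.prop ψ)) :
      w.Tr [.ofProp φ] (.prop (ψ.ren Nat.succ)) := by
    filter_upwards [hφ, hψ] with Δ a b using b.wk_prop (.propCol a)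
  rw [PProp.iff, tr_and (by filter_upwards [h1, h2] with Δ a b using .andF .large a b) h1 (wk h1 h2),
    tr_imp_iff hs hs' h1 hφ (wk hφ hψ), tr_imp_iff hs' hs h2 hψ (wk hψ hφ)]
  exact ⟨fun h w' hw => ⟨h.1 w' hw, h.2 w' hw⟩,
    fun h => ⟨fun w' hw => (h w' hw).1, fun w' hw => (h w' hw).2⟩⟩

theorem tr_close (h : Der T Γ (.prop χ)) (H : ∀ (w : World T) (ρ : ℕ → ℕ),
      (∀ i, ρ i ∈ names w.rank) → Good w (fun i => .var (ρ i)) Γ →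
      w.Tr [] (.holds (χ.subst fun i => .var (ρ i)))) (w : World T) :
    w.Tr [] (.holds (close Γ χ)) := by
  induction Γ generalizing χ w with
  | nil =>
    obtain ⟨c, hc⟩ := w.names_nonempty
    have := H w (fun _ => c) (fun _ => hc) ⟨fun _ _ hA => (by cases hA),
      fun i hi => absurd hi (Nat.not_lt_zero i), fun i hi => absurd hi (Nat.not_lt_zero i)⟩
    rwa [h.supp_prop _ .var fun i hi => absurd hi (Nat.not_lt_zero i), PProp.subst_var] at this
  | cons A Γ ih =>
    refine ih (.allF .large h.head h) (fun w ρ hρ g => ?_) w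
    rw [PProp.subst, tr_all (PProp.supp_quant (g.supp_ty h.head) (g.supp_prop1 h)) (g.tr h.head)
      (g.tr1 h)]
    intro w' hw x hx
    have := H w' (fun i => i.casesOn (Quotient.out x).1 ρ)
      (fun i => by cases i with
        | zero => exact (Quotient.out x).2
        | succ i => exact names_mono hw.1 (hρ i))
      (by
        convert (g.mono hw).cons hx using 1
        funext i; cases i <;> rfl)
    rw [PProp.inst, PTm.sb_cons, PProp.subst_subst, up_subst_scons]
    convert this using 4
    rename_i i
    cases i <;> rfl

end World

/-- Propositions which are true in all worlds, for all names of described elements, are provable. -/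
theorem Der.of_forall_world {Γ : Ctx} {χ : PProp} (h : Der T Γ (.prop χ))
    (H : ∀ (w : World T) (ρ : ℕ → ℕ), (∀ i, ρ i ∈ names w.rank) →
      Good w (fun i => .var (ρ i)) Γ → w.Tr [] (.holds (χ.subst fun i => .var (ρ i)))) :
    Der T Γ (.holds χ) := .of_close h (.complete h.close_prop (tr_close h H))

/-! ## The translations are inverse to each other -/

theorem SFm.Wf.der {φ : SFm} (h : φ.Wf T) {Δ : Ctx} (hΔ : Der T Δ .wf)
    (hφ : ∀ ρ, Fixes Δ.length ρ → (∀ i, Δ.length ≤ i → Δ.length ≤ ρ i) → φ.ren ρ = φ) :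
    Der T Δ (.prop φ.tilde) := by
  obtain ⟨m, hm⟩ := h.prop
  have h1 := hm.sub (Δ := Δ) (σ := fun i => if i < Δ.length then .var i else .empty)
    ⟨hΔ, fun i A hA => by
      rw [(replicate_has.1 hA).2]
      by_cases hi : i < Δ.length
      · obtain ⟨B, hB⟩ := Ctx.exists_has hi
        simpa [hi] using .toV (.var hΔ hB)
      · simpa [hi] using .emptyI hΔ⟩
  rwa [Jdg.subst_congr_of_ren_le (n := Δ.length) (τ := .var) (fun ρ h1 h2 => by
    rw [Jdg.ren, PCol.ren, ← SFm.tilde_ren, hφ ρ h1 h2]) (fun i hi => by simp [hi]),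
    Jdg.subst_var] at h1

theorem Der.desc_tilde {Γ : Ctx} {J : Jdg} (h : Der T Γ J) :
    Der T (.V :: Γ) (.prop J.desc.tilde) := by
  refine J.desc_wf.der (.cons (.vF h.wf)) fun ρ h1 h2 => ?_
  have e : upRen (fun i => ρ (i + 1) - 1) = ρ := funext fun i => by
    cases i with
    | zero => exact (h1 0 (by simp)).symm
    | succ i =>
      refine Nat.sub_add_cancel ?_
      by_cases hi : i < Γ.length
      · rw [h1 _ (by simpa using hi)]; omega
      · have := h2 (i + 1) (by simpa using hi)
        simp at this; omega
  rw [← e, ← Jdg.desc_ren, h.closed.1 _ fun i hi => by rw [h1 _ (by simpa using hi)]; rfl]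

theorem Der.hat_tilde {Γ : Ctx} {φ : PProp} (h : Der T Γ (.prop φ)) :
    Der T Γ (.prop φ.hat.tilde) := by
  refine φ.hat_wf.der h.wf fun ρ h1 _ => ?_
  have := h.closed.1 ρ h1
  simp only [Jdg.ren, PCol.ren, Jdg.ty.injEq, PCol.ofProp.injEq, true_and] at this
  rw [← PProp.hat_ren, this]

namespace World

variable {w w' : World T} {Γ : Ctx} {J : Jdg} {A : PCol} {a : PTm} {φ ψ χ : PProp} {x : M w}
  {ρ : ℕ → ℕ} {σ : ℕ → PTm}

theorem Good.tail (g : Good w σ (A :: Γ)) : Good w (fun i => σ (i + 1)) Γ where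
  sub i B hB := by
    have := g.sub _ _ (.succ hB)
    rwa [PCol.wk_eq, PCol.ren_subst] at this
  supp i hi := g.supp (i + 1) (by simpa using hi)
  ok i hi := g.ok (i + 1) (by simpa using hi)

theorem isVal_nm {i : ℕ} (h : i ∈ names w.rank) : w.IsVal (.var i) (nm w i) :=
  isVal_val (PTm.supp_var h) (tr_name h.1)

theorem force_desc (h : Der T Γ J) (g : Good w (fun i => .var (ρ i)) Γ) :
    J.desc.force w (x ▹ fun i => nm w (ρ i)) ↔ Sem w x (J.subst fun i => .var (ρ i)) := by
  rw [← (h.described w _ g).self, ← Jdg.ren_eq_subst, Jdg.desc_ren, J.desc_wf.force_ren,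
    cons_upRen]

theorem tr_desc (h : Der T Γ J) (hρ : ∀ i, ρ i ∈ names w.rank)
    (g : Good w (fun i => .var (ρ i)) Γ) (hx : w.IsVal a x) :
    w.Tr [] (.holds (J.desc.tilde.subst (scons a fun i => .var (ρ i)))) ↔
      Sem w x (J.subst fun i => .var (ρ i)) := by
  rw [← force_desc h g]
  refine (J.desc_wf.force_iff_of fun i => ?_).symm
  cases i with
  | zero => exact hx
  | succ i => exact isVal_nm (hρ i)

theorem tr_hat (h : Der T Γ (.prop φ)) (hρ : ∀ i, ρ i ∈ names w.rank)
    (g : Good w (fun i => .var (ρ i)) Γ) :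
    w.Tr [] (.holds (φ.hat.tilde.subst fun i => .var (ρ i))) ↔
      w.Tr [] (.holds (φ.subst fun i => .var (ρ i))) := by
  rw [← φ.hat_wf.force_iff_of fun i => isVal_nm (hρ i), ← Described.repP_self h.described h g,
    ← PProp.ren_eq_subst, PProp.hat_ren, φ.hat_wf.force_ren]

theorem tr_memCol (hA : w.Tr [] (.ty .col A)) (hx : w.IsVal a x) :
    w.Tr [] (.holds (.memCol a A)) ↔ w.El A x := by
  constructor <;> intro h
  · refine hx.el ?_
    filter_upwards [hA, hx.1, h] with Δ a b c using .memColE a b c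
  · filter_upwards [hA, h.tr hx] with Δ a b using .memColI a b

end World

theorem Der.iff_of_forall_world {Γ : Ctx} {φ ψ : PProp} (h : Der T Γ (.prop φ))
    (h' : Der T Γ (.prop ψ))
    (H : ∀ (w : World T) (ρ : ℕ → ℕ), (∀ i, ρ i ∈ names w.rank) → Good w (fun i => .var (ρ i)) Γ →
      (w.Tr [] (.holds (φ.subst fun i => .var (ρ i))) ↔
        w.Tr [] (.holds (ψ.subst fun i => .var (ρ i))))) :
    Der T Γ (.holds (.iff φ ψ)) := by
  refine .of_forall_world (.andF .large (.impF .large h h') (.impF .large h' h))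
    fun w ρ hρ g => ?_
  exact (tr_biimp (g.supp_prop h) (g.supp_prop h') (g.tr h) (g.tr h')).2 fun w' hw =>
    H w' ρ (fun i => names_mono hw.1 (hρ i)) (g.mono hw)

/-- Collections are definable classes. -/
theorem Der.eq_compr_eta {Γ : Ctx} {A : PCol} (h : Der T Γ (.ty .col A)) :
    Der T Γ (.tyEq .col A (.compr A.eta.tilde)) := by
  have hV := Der.vF h.wf
  have hp : Der T (.V :: Γ) (.prop A.eta.tilde) := h.desc_tilde
  have hc : Der T Γ (.ty .col (.compr A.eta.tilde)) := .comprF hp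
  have h0 : Der T (.V :: Γ) (.tm (.var 0) .V) := .var (A := .V) (.cons hV) .zero
  have h1 := Der.memColF h0 (h.wk hV)
  have h2 := Der.memColF h0 (hc.wk hV)
  refine .colExt h hc (.allI hV (.andF .large (.impF .large h1 h2) (.impF .large h2 h1))
    (.iff_of_forall_world h1 h2 fun w ρ hρ g => ?_))
  have hv := isVal_nm (hρ 0)
  have e (B : PCol) : (PProp.memCol (.var 0) (B.inst [] 1)).subst (fun i => .var (ρ i)) =
      .memCol (.var (ρ 0)) (B.subst fun i => .var (ρ (i + 1))) := by
    rw [PProp.subst, PCol.wk_eq, PCol.ren_subst]; rfl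
  rw [e, e, tr_memCol (g.tail.tr h) hv, tr_memCol (g.tail.tr hc) hv, PCol.subst,
    el_compr (g.tail.tr1 hp), up_inst]
  exact (tr_desc h (fun i => hρ (i + 1)) g.tail (isVal_name _)).symm

/-- Terms are definable. -/
theorem Der.delta_iff_eq {Γ : Ctx} {A : PCol} {a : PTm} (h : Der T Γ (.tm a A)) :
    Der T Γ (.holds (.all .V (.iff a.delta.tilde (.eq .V (.var 0) (a.inst [] 1))))) := by
  have hV := Der.vF h.wf
  have h1 := h.desc_tilde
  have h2 := Der_eq_wk (.toV h)
  refine .allI hV (.andF .large (.impF .large h1 h2) (.impF .large h2 h1))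
    (.iff_of_forall_world h1 h2 fun w ρ hρ g => ?_)
  have hv := isVal_nm (hρ 0)
  have e : (fun i => PTm.var (ρ i)) = scons (.var (ρ 0)) fun i => .var (ρ (i + 1)) :=
    funext fun i => by cases i <;> rfl
  have hd := tr_desc h (fun i => hρ (i + 1)) g.tail hv
  rw [← e] at hd
  refine hd.trans ?_
  have ha : w.Tr [] (.tm (a.subst fun i => .var (ρ (i + 1))) .V) := (g.tail.tr (.toV h))
  obtain ⟨x, hx⟩ := exists_isVal (g.tail.supp_tm h) ha
  rw [PProp.subst, PTm.wk_eq, PTm.ren_subst]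
  refine Iff.trans ?_ (tr_eq_iff hv.1 ha).symm
  rw [hv.eq_iff hx]
  exact ⟨fun h => hx.unique h |>.symm, fun h => h ▸ hx⟩

/-- Propositions are equivalent to formulas of set theory. -/
theorem Der.iff_hat {Γ : Ctx} {φ : PProp} (h : Der T Γ (.prop φ)) :
    Der T Γ (.holds (.iff φ φ.hat.tilde)) :=
  .iff_of_forall_world h h.hat_tilde fun _ _ hρ g => (tr_hat h hρ g).symm

end EmTT

theorem mainTheorem4 (T : EmTT.SetTheory) (Γ : EmTT.Ctx) :
    (∀ A : EmTT.PCol, EmTT.Der T Γ (.ty .col A) →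
      EmTT.Der T Γ (.tyEq .col A (.compr A.eta.tilde))) ∧
    (∀ (a : EmTT.PTm) (A : EmTT.PCol), EmTT.Der T Γ (.tm a A) →
      EmTT.Der T Γ (.holds (.all .V (.iff a.delta.tilde (.eq .V (.var 0) (a.inst [] 1)))))) ∧
    (∀ φ : EmTT.PProp, EmTT.Der T Γ (.prop φ) →
      EmTT.Der T Γ (.holds (.iff φ φ.hat.tilde))) :=
  ⟨fun _ h => h.eq_compr_eta, fun _ _ h => h.delta_iff_eq, fun _ h => h.iff_hat⟩
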